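/- There is a combinatorial algorithm that multiplies two $n\times n$ Boolean matrices in $\hat O(n^3/\log^4 n)$ time on a word RAM with word size $w\ge\Omega(\log n)$. Precisely: there are a constant $C$, one deterministic word-RAM program $P$ (a finite list of unit-cost instructions on $w$-bit words, independent of $n$ and $w$) and a function $T:\mathbb N\to\mathbb N$ such that 1. for all $n\ge 1$, all $w\ge C(\lfloor\log_2 n\rfloor+1)$ and all $A,B\in\{0,1\}^{n\times n}$, the program $P$ on input $(n,A,B)$ stops after at most $T(n)$ steps, and writes on its output tape a combinatorial certificate (below) for $A$ and $B$, followed by the Boolean product $(AB)_{ik}=\bigvee_j (A_{ij}\wedge B_{jk})$; 2. $T(n)=\hat O(n^3/\log^4 n)$, i.e. with $f(n)=n^3/\log^4 n$ there is a constant $c$ with $T(n)=O\big(f(n)\,(\log\log f(n))^{c}\big)$ as $n\to\infty$. "Combinatorial", an informal word in the literature, is taken here in the following sense: the algorithm derives its answer from entries of the matrices that it has inspected, by combining areas of triples, and prints this derivation. A certificate for $A,B$ is a finite list of lines. Each line yields a box $X\times Y\times Z$ with $X,Y,Z\subseteq\{1,\dots,n\}$, and is of one of these forms, written with four words each: (a)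 $A_{ij}=0$, with box $\{i\}\times\{j\}\times\{1,\dots,n\}$; (b) $B_{jk}=0$, with box $\{1,\dots,n\}\times\{j\}\times\{k\}$; (c) $A_{ij}=B_{jk}=1$ (a witness for $(AB)_{ik}=1$), with box $\{i\}\times\{1,\dots,n\}\times\{k\}$; (d) the merging of the boxes of two earlier lines along one of the three axes, with the union of their sides on that axis and the intersection of their sides on the two other axes. One of the lines has to yield the box of all triples $\{1,\dots,n\}^3$; the entries of $AB$ that are $1$ are then exactly the pairs $(i,k)$ with a line of form (c). -/

import Mathlib

open Filter Asymptotics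

/-! ## Word RAM -/

namespace WordRAM

/-- The binary word operations; arithmetic is modulo `2 ^ w`. -/
inductive BinOp
  | add | sub | mul | and | or | xor | shl | shr

/-- The result of a binary operation on two `w`-bit words. -/
def BinOp.eval {w : ℕ} : BinOp → BitVec w → BitVec w → BitVec w
  | .add, x, y => x + y
  | .sub, x, y => x - y
  | .mul, x, y => x * y
  | .and, x, y => x &&& y
  | .or, x, y => x ||| y
  | .xor, x, y => x ^^^ y
  | .shl, x, y => x <<< y.toNat
  | .shr, x, y => x >>> y.toNat

/-- Instructions. `d`, `s`, `t`, `a` are names of registers, `c` is a numeral, `l` is a line number. -/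
inductive Instr
  /-- `reg d := c` -/
  | const (d c : ℕ)
  /-- `reg d := o (reg s) (reg t)` -/
  | op (o : BinOp) (d s t : ℕ)
  /-- `reg d := mem (reg a)` -/
  | load (d a : ℕ)
  /-- `mem (reg a) := reg s` -/
  | store (a s : ℕ)
  /-- go to line `l` if `reg s = reg t` -/
  | jumpEq (s t l : ℕ)
  /-- go to line `l` if `reg s < reg t` (as unsigned numbers) -/
  | jumpLt (s t l : ℕ)
  /-- append `reg s` to the write-only output tape -/
  | emit (s : ℕ)
  /-- stop -/
  | halt

/-- A program is a finite list of instructions; it does not depend on the word size, nor on the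
size of the input. -/
abbrev Program := List Instr

/-- A configuration of the machine with `w`-bit words. Memory cells are addressed by words, so that
there are `2 ^ w` of them; a program can name only finitely many of the registers. -/
structure Config (w : ℕ) where
  pc : ℕ
  reg : ℕ → BitVec w
  mem : BitVec w → BitVec w
  out : List (BitVec w)

/-- One unit-cost step; `none` if the machine has stopped. -/
def step {w : ℕ} (P : Program) (c : Config w) : Option (Config w) :=
  match P[c.pc]? with
  | none => none
  | some .halt => none
  | some (.const d v) =>
      some { c with pc := c.pc + 1, reg := Function.update c.reg d (BitVec.ofNat w v) }
  | some (.op o d s t) =>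
      some { c with pc := c.pc + 1, reg := Function.update c.reg d (o.eval (c.reg s) (c.reg t)) }
  | some (.load d a) =>
      some { c with pc := c.pc + 1, reg := Function.update c.reg d (c.mem (c.reg a)) }
  | some (.store a s) =>
      some { c with pc := c.pc + 1, mem := Function.update c.mem (c.reg a) (c.reg s) }
  | some (.jumpEq s t l) =>
      some { c with pc := if c.reg s = c.reg t then l else c.pc + 1 }
  | some (.jumpLt s t l) =>
      some { c with pc := if (c.reg s).toNat < (c.reg t).toNat then l else c.pc + 1 }
  | some (.emit s) =>
      some { c with pc := c.pc + 1, out := c.out ++ [c.reg s] }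

/-- Exactly `t` steps; `none` if the machine stops earlier. -/
def stepN {w : ℕ} (P : Program) : ℕ → Config w → Option (Config w)
  | 0, c => some c
  | t + 1, c => (step P c).bind (stepN P t)

/-- The initial configuration: the input stands in the memory cells `0, 1, 2, …`, everything else
is zero, and the output tape is empty. -/
def init {w : ℕ} (input : List (BitVec w)) : Config w where
  pc := 0
  reg := fun _ => 0
  mem := fun a => input.getD a.toNat 0
  out := []

/-- On the given input, `P` stops after at most `T` steps, with exactly `output` on the output
tape. -/
def OutputsWithin {w : ℕ} (P : Program) (input : List (BitVec w)) (T : ℕ)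
    (output : List (BitVec w)) : Prop :=
  ∃ t ≤ T, ∃ c : Config w, stepN P t (init input) = some c ∧ step P c = none ∧ c.out = output

end WordRAM

/-! ## Boolean matrix multiplication -/

namespace BMM

/-- The Boolean product (OR of ANDs) of two square Boolean matrices. -/
def boolMul {n : ℕ} (A B : Matrix (Fin n) (Fin n) Bool) : Matrix (Fin n) (Fin n) Bool :=
  Matrix.of fun i k => decide (∃ j, A i j = true ∧ B j k = true)

/-- The entries of a matrix in row-major order, one 0/1 word for each entry. -/
def matrixWords (w : ℕ) {n : ℕ} (M : Matrix (Fin n) (Fin n) Bool) : List (BitVec w) :=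
  List.ofFn fun t : Fin (n * n) => if M t.divNat t.modNat then 1 else 0

/-- The input: `n`, then the two matrices. -/
def inputWords (w : ℕ) {n : ℕ} (A B : Matrix (Fin n) (Fin n) Bool) : List (BitVec w) :=
  BitVec.ofNat w n :: (matrixWords w A ++ matrixWords w B)

/-! ### Combinatorial certificates

A combinatorial algorithm works with edges, non-edges and rectangles of non-edges, and never with
cancellation in a ring. So each entry `1` that it reports comes from a witness that it has seen, and
each entry `0` comes from inspected zeros of the two matrices, which it has put together into larger
and larger areas without a new witness. A run is made to exhibit this by writing down
these inferences, at the cost of a bounded number of words for each. -/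

/-- An (axis-parallel, not necessarily contiguous) box `X 0 × X 1 × X 2` of triples `(i, j, k)`. -/
abbrev Box (n : ℕ) := Fin 3 → Set (Fin n)

/-- Two boxes are merged along an axis: the union of their sides on this axis, and the intersection
of their sides on the two others. The result is covered by the two boxes. -/
def Box.merge {n : ℕ} (X Y : Box n) (axis : Fin 3) : Box n :=
  fun a => if a = axis then X a ∪ Y a else X a ∩ Y a

/-- One line of a certificate. -/
inductive Line (n : ℕ)
  /-- `A i j` is zero -/
  | zeroLeft (i j : Fin n)
  /-- `B j k` is zero -/
  | zeroRight (j k : Fin n)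
  /-- `A i j` and `B j k` are one, so that entry `(i, k)` of the product is one -/
  | witness (i j k : Fin n)
  /-- merge the boxes of lines number `p` and `q` (counted from `0`) along an axis -/
  | merge (axis : Fin 3) (p q : ℕ)

/-- A line is written with four words. -/
def Line.words (w : ℕ) {n : ℕ} : Line n → List (BitVec w)
  | .zeroLeft i j => [0, BitVec.ofNat w i, BitVec.ofNat w j, 0]
  | .zeroRight j k => [1, BitVec.ofNat w j, BitVec.ofNat w k, 0]
  | .witness i j k => [2, BitVec.ofNat w i, BitVec.ofNat w j, BitVec.ofNat w k]
  | .merge axis p q => [3, BitVec.ofNat w axis, BitVec.ofNat w p, BitVec.ofNat w q]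

/-- `Derivation A B L X`: each line of the list `L` is correct for the matrices `A` and `B`, and `X`
lists the boxes of these lines. For each triple `(i, j, k)` in one of the boxes, `A i j = 0`, or
`B j k = 0`, or a line of `L` has a witness for the entry `(i, k)` of the product. -/
inductive Derivation {n : ℕ} (A B : Matrix (Fin n) (Fin n) Bool) :
    List (Line n) → List (Box n) → Prop
  | nil : Derivation A B [] []
  | zeroLeft {L : List (Line n)} {X : List (Box n)} {i j : Fin n} :
      Derivation A B L X → A i j = false →
      Derivation A B (L ++ [.zeroLeft i j]) (X ++ [![{i}, {j}, Set.univ]])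
  | zeroRight {L : List (Line n)} {X : List (Box n)} {j k : Fin n} :
      Derivation A B L X → B j k = false →
      Derivation A B (L ++ [.zeroRight j k]) (X ++ [![Set.univ, {j}, {k}]])
  | witness {L : List (Line n)} {X : List (Box n)} {i j k : Fin n} :
      Derivation A B L X → A i j = true → B j k = true →
      Derivation A B (L ++ [.witness i j k]) (X ++ [![{i}, Set.univ, {k}]])
  | merge {L : List (Line n)} {X : List (Box n)} {axis : Fin 3} {p q : ℕ} {Y Z : Box n} :
      Derivation A B L X → X[p]? = some Y → X[q]? = some Z →
      Derivation A B (L ++ [.merge axis p q]) (X ++ [Y.merge Z axis])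

/-- A certificate for the Boolean product of `A` and `B`: a derivation of the box of all triples.
The entries of the product that are one are then exactly those with a witness line. -/
def IsCertificate {n : ℕ} (A B : Matrix (Fin n) (Fin n) Bool) (L : List (Line n)) : Prop :=
  ∃ X : List (Box n), Derivation A B L X ∧ (fun _ => Set.univ) ∈ X

open WordRAM in
/-- `P` is a combinatorial algorithm for the multiplication of `n × n` Boolean matrices, in time
`T n`, on a word RAM with any word size `w ≥ C (⌊log₂ n⌋ + 1)`: it prints a certificate and then the
product. -/
def IsCombinatorialAlgorithm (P : Program) (C : ℕ) (T : ℕ → ℕ) : Prop :=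
  ∀ n w : ℕ, 0 < n → C * (Nat.log 2 n + 1) ≤ w →
    ∀ A B : Matrix (Fin n) (Fin n) Bool, ∃ L : List (Line n), IsCertificate A B L ∧
      OutputsWithin P (inputWords w A B) (T n)
        (L.flatMap (Line.words w) ++ matrixWords w (boolMul A B))

end BMM

/-- `T = Ô(f)`: `T = O(f · (log log f) ^ c)` for some constant `c`. -/
def IsOHat (T f : ℕ → ℝ) : Prop :=
  ∃ c : ℕ, T =O[atTop] fun n => f n * (Real.log (Real.log (f n))) ^ c

set_option linter.constructorNameAsVariable false

/-! ## A structured language over natural numbers, and its compilation to the word RAM -/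

namespace RamLang

/-! The search. Let `ℓ` be about a quarter of `log₂ n` and `m = 2 ^ ℓ`, so that `m ^ 4 ≤ n`. The
index range is cut into intervals of length `m`, and each triple of intervals is treated as a block
with rows `I`. Inside a block the work is organised by nodes, pairs of lists `J`, `K`: all pairs
`(i, k)` with `i ∈ I`, `k ∈ K` and a one-one path through some `j ∈ J` have to receive a witness.
For a row `i` let `J_i` be the `j ∈ J` with `A i j = 1` and `K_i` the `k ∈ K` for which `(i, k)` has
no witness yet. Only the rectangle `J_i × K_i` of `B` matters for this row. If it contains a one, a
new witness is found; this happens at most `n ^ 2` times, so each time may cost `O(m ^ 2)`. If it is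
empty, it can be removed from the node once and for all rows, and the rest is the union of two
smaller nodes.

The node is divided only along a row where `J_i` and `K_i` are at least a `1 / g ^ 2` part of `J`
and `K`, and one of them is even a `1 / b` part. If no such row exists, the node is a leaf
(`run_leaf`). Then a row either has a side below `1 / g ^ 2`, and direct inspection costs `|J| |K| /
g ^ 2`; or both sides are below `1 / b`. In the second case `J_i` and `K_i` are cut into pieces of
at most `s` entries inside chunks of `g` consecutive list positions, and a precomputed table answers
each pair of pieces in one lookup, which costs about `(|J| / g + |J| / (b s)) (|K| / g + |K| / (b
s))`. With `g` about `ℓ ^ 2` and `b`, `s` about `ℓ` up to powers of `log ℓ`, both costs are `|J| |K|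
/ ℓ ^ 4` up to such powers. The areas of the leaves of a block add up to at most `m ^ 2`, so all
rows of all leaves cost `m ^ 3 / ℓ ^ 4` for a block and `n ^ 3 / ℓ ^ 4` in total, up to the same
powers.

The number of nodes. Nodes of area at most `m ^ 2 / e`, where `e` is about `m ^ (1 / 4)`, are
inspected directly. A division removes a positive share of the area, and concavity shows that the
sum of the `(1 - η)`-th powers of the areas decreases, where `η` is about `1 / (b log g)`
(`rpow_add_rpow_le`). Hence there are about `e ^ (1 - η)` nodes up to powers of `ℓ`, and `b` is so
small that `e ^ η ≥ ℓ ^ 16`; this beats the overhead of about `m ^ 3 / e` for each node. `Potential`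
collects what the program needs of such an estimate, `Params.potential_spec` provides it, and
`run_node` shows that time plus potential never increases, with new witnesses paying for the
repeated scans.

The certificate. It needs only the final table of witnesses. For each `j` one chain of merges yields
the zeros of row `j` of `B`. In row `i`, let `U` be the columns without a witness. For each `j`,
either `A i j = 0`, or row `j` of `B` vanishes on `U`; merging over `j` yields `{i} × univ × U`, the
witness lines supply the other columns, and the rows are merged at the end. This takes `O(n ^ 2)`
lines (`run_certificate`).

The machine. The algorithm is written in a small imperative language over natural numbers with a
clock that counts the machine steps exactly. `Cmd.code_correct` shows that the compiled code
simulates it as long as all numbers stay below the common array length `Q`, a fixed power of `n` up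
to a constant; `Params.fits_ofSize` checks the size conditions. A Hoare logic of total correctness
(`Run`) carries both values and time bounds. -/

/-- Variables of the structured language. -/
inductive Var
  | n | m | l | g | h | hd | s | b | gg | e | dd | xx
  | i0 | i1 | j0 | j1 | k0 | k1 | sp | f | a | c | bs | nb
  | i | r | mode | hit | nj | nk | np | nq | t | te | x | y | z | cnt | u | v
  | p | q | cu | cv | ch | d | ln | cur | tot | j | k | o
  deriving DecidableEq

/-- Arrays of the structured language. -/
inductive Arr
  | inp | wit | lj | lk | sj | sk | bj | bk | pj | pk | tab | zr
  deriving DecidableEq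

theorem Var.ctorIdx_inj {a b : Var} (h : a.ctorIdx = b.ctorIdx) : a = b := by
  rw [← Var.ofNat_ctorIdx a, ← Var.ofNat_ctorIdx b, h]

theorem Arr.ctorIdx_inj {a b : Arr} (h : a.ctorIdx = b.ctorIdx) : a = b := by
  rw [← Arr.ofNat_ctorIdx a, ← Arr.ofNat_ctorIdx b, h]

theorem Arr.ctorIdx_lt (a : Arr) : a.ctorIdx < 12 := by cases a <;> decide

/-- A state: variables, arrays, output tape and the number of steps made so far. -/
structure State where
  reg : Var → ℕ
  arr : Arr → ℕ → ℕ
  out : List ℕ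
  clock : ℕ

namespace State

def tick (σ : State) (t : ℕ) : State := { σ with clock := σ.clock + t }

def set (σ : State) (d : Var) (x : ℕ) : State := { σ with reg := Function.update σ.reg d x }

def put (σ : State) (a : Arr) (x y : ℕ) : State :=
  { σ with arr := Function.update σ.arr a (Function.update (σ.arr a) x y) }

def print (σ : State) (x : ℕ) : State := { σ with out := σ.out ++ [x] }

variable (σ : State) (d r : Var) (a b : Arr) (x y t : ℕ)

@[simp] theorem tick_reg : (σ.tick t).reg = σ.reg := rfl
@[simp] theorem tick_arr : (σ.tick t).arr = σ.arr := rfl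
@[simp] theorem tick_out : (σ.tick t).out = σ.out := rfl
@[simp] theorem tick_clock : (σ.tick t).clock = σ.clock + t := rfl
@[simp] theorem set_reg : (σ.set d x).reg r = if r = d then x else σ.reg r := by
  simp [set, Function.update_apply]
@[simp] theorem set_arr : (σ.set d x).arr = σ.arr := rfl
@[simp] theorem set_out : (σ.set d x).out = σ.out := rfl
@[simp] theorem set_clock : (σ.set d x).clock = σ.clock := rfl
@[simp] theorem put_reg : (σ.put a x y).reg = σ.reg := rfl
@[simp] theorem put_arr : (σ.put a x y).arr b =
    if b = a then Function.update (σ.arr a) x y else σ.arr b := by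
  simp only [put, Function.update_apply]
@[simp] theorem put_out : (σ.put a x y).out = σ.out := rfl
@[simp] theorem put_clock : (σ.put a x y).clock = σ.clock := rfl
@[simp] theorem print_reg : (σ.print x).reg = σ.reg := rfl
@[simp] theorem print_arr : (σ.print x).arr = σ.arr := rfl
@[simp] theorem print_out : (σ.print x).out = σ.out ++ [x] := rfl
@[simp] theorem print_clock : (σ.print x).clock = σ.clock := rfl

end State

/-- Binary operations. -/
inductive Bop
  | add | sub | mul | shl | shr

/-- Subtraction truncates and nothing is reduced modulo the word size; `Bop.Ok` admits only cases in
which this agrees with arithmetic on words. -/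
def Bop.eval : Bop → ℕ → ℕ → ℕ
  | .add, x, y => x + y
  | .sub, x, y => x - y
  | .mul, x, y => x * y
  | .shl, x, y => x * 2 ^ y
  | .shr, x, y => x / 2 ^ y

/-- The operation does not leave the numbers below `Q`. -/
def Bop.Ok (Q : ℕ) : Bop → ℕ → ℕ → Prop
  | .add, x, y => x + y < Q
  | .sub, x, y => y ≤ x
  | .mul, x, y => x * y < Q
  | .shl, x, y => x * 2 ^ y < Q
  | .shr, _, _ => True

def Bop.code : Bop → WordRAM.BinOp
  | .add => .add
  | .sub => .sub
  | .mul => .mul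
  | .shl => .shl
  | .shr => .shr

/-- Expressions. -/
inductive Expr
  | var (v : Var)
  | lit (c : ℕ)
  | bin (o : Bop) (a b : Expr)
  | get (a : Arr) (e : Expr)

namespace Expr

instance : Coe Var Expr := ⟨.var⟩
instance (k : ℕ) : OfNat Expr k := ⟨.lit k⟩
instance : Add Expr := ⟨.bin .add⟩
instance : Sub Expr := ⟨.bin .sub⟩
instance : Mul Expr := ⟨.bin .mul⟩

def shl (a b : Expr) : Expr := .bin .shl a b
def shr (a b : Expr) : Expr := .bin .shr a b

def eval (σ : State) : Expr → ℕ
  | var v => σ.reg v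
  | lit c => c
  | bin o a b => o.eval (a.eval σ) (b.eval σ)
  | get a e => σ.arr a (e.eval σ)

/-- The evaluation stays below `Q`. -/
def Ok (Q : ℕ) (σ : State) : Expr → Prop
  | var _ => True
  | lit c => c < Q
  | bin o a b => a.Ok Q σ ∧ b.Ok Q σ ∧ o.Ok Q (a.eval σ) (b.eval σ)
  | get _ e => e.Ok Q σ

/-- Code for an expression contains no jump, so this is at once its length and its number of steps.
A read takes two: the base address is added, then the cell is loaded. -/
def cost : Expr → ℕ
  | var _ => 1
  | lit _ => 1
  | bin _ a b => a.cost + b.cost + 1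
  | get _ e => e.cost + 2

variable (σ : State) (Q : ℕ) (v : Var) (a b : Expr) (r : Arr) (k : ℕ)

@[simp] theorem eval_var : (var v).eval σ = σ.reg v := rfl
@[simp] theorem eval_lit : eval σ (no_index (OfNat.ofNat k)) = k := rfl
@[simp] theorem eval_add : (a + b).eval σ = a.eval σ + b.eval σ := rfl
@[simp] theorem eval_sub : (a - b).eval σ = a.eval σ - b.eval σ := rfl
@[simp] theorem eval_mul : (a * b).eval σ = a.eval σ * b.eval σ := rfl
@[simp] theorem eval_shl : (a.shl b).eval σ = a.eval σ * 2 ^ b.eval σ := rfl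
@[simp] theorem eval_shr : (a.shr b).eval σ = a.eval σ / 2 ^ b.eval σ := rfl
@[simp] theorem eval_get : (get r a).eval σ = σ.arr r (a.eval σ) := rfl
@[simp] theorem ok_var : (var v).Ok Q σ ↔ True := Iff.rfl
@[simp] theorem ok_lit : Ok Q σ (no_index (OfNat.ofNat k)) ↔ k < Q := Iff.rfl
@[simp] theorem ok_add :
    (a + b).Ok Q σ ↔ a.Ok Q σ ∧ b.Ok Q σ ∧ a.eval σ + b.eval σ < Q := Iff.rfl
@[simp] theorem ok_sub :
    (a - b).Ok Q σ ↔ a.Ok Q σ ∧ b.Ok Q σ ∧ b.eval σ ≤ a.eval σ := Iff.rfl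
@[simp] theorem ok_mul :
    (a * b).Ok Q σ ↔ a.Ok Q σ ∧ b.Ok Q σ ∧ a.eval σ * b.eval σ < Q := Iff.rfl
@[simp] theorem ok_shl :
    (a.shl b).Ok Q σ ↔ a.Ok Q σ ∧ b.Ok Q σ ∧ a.eval σ * 2 ^ b.eval σ < Q := Iff.rfl
@[simp] theorem ok_shr : (a.shr b).Ok Q σ ↔ a.Ok Q σ ∧ b.Ok Q σ := by
  simp [shr, Ok, Bop.Ok]
@[simp] theorem ok_get : (get r a).Ok Q σ ↔ a.Ok Q σ := Iff.rfl
@[simp] theorem cost_var : (var v).cost = 1 := rfl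
@[simp] theorem cost_lit : cost (no_index (OfNat.ofNat k)) = 1 := rfl
@[simp] theorem cost_add : (a + b).cost = a.cost + b.cost + 1 := rfl
@[simp] theorem cost_sub : (a - b).cost = a.cost + b.cost + 1 := rfl
@[simp] theorem cost_mul : (a * b).cost = a.cost + b.cost + 1 := rfl
@[simp] theorem cost_shl : (a.shl b).cost = a.cost + b.cost + 1 := rfl
@[simp] theorem cost_shr : (a.shr b).cost = a.cost + b.cost + 1 := rfl
@[simp] theorem cost_get : (get r a).cost = a.cost + 2 := rfl

end Expr

/-- Conditions. -/
inductive Cond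
  | lt (a b : Expr)
  | eq (a b : Expr)

namespace Cond

def Holds (σ : State) : Cond → Prop
  | lt a b => a.eval σ < b.eval σ
  | eq a b => a.eval σ = b.eval σ

def Ok (Q : ℕ) (σ : State) : Cond → Prop
  | lt a b => a.Ok Q σ ∧ b.Ok Q σ
  | eq a b => a.Ok Q σ ∧ b.Ok Q σ

def cost : Cond → ℕ
  | lt a b => a.cost + b.cost + 1
  | eq a b => a.cost + b.cost + 1

variable (σ : State) (Q : ℕ) (a b : Expr)

@[simp] theorem holds_lt : (lt a b).Holds σ ↔ a.eval σ < b.eval σ := Iff.rfl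
@[simp] theorem holds_eq : (eq a b).Holds σ ↔ a.eval σ = b.eval σ := Iff.rfl
@[simp] theorem ok_lt : (lt a b).Ok Q σ ↔ a.Ok Q σ ∧ b.Ok Q σ := Iff.rfl
@[simp] theorem ok_eq : (eq a b).Ok Q σ ↔ a.Ok Q σ ∧ b.Ok Q σ := Iff.rfl
@[simp] theorem cost_lt : (lt a b).cost = a.cost + b.cost + 1 := rfl
@[simp] theorem cost_eq : (eq a b).cost = a.cost + b.cost + 1 := rfl

end Cond

/-- Commands. -/
inductive Cmd
  | skip
  | assign (d : Var) (e : Expr)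
  | store (a : Arr) (x e : Expr)
  | emit (e : Expr)
  | seq (p q : Cmd)
  | ite (c : Cond) (p q : Cmd)
  | loop (c : Cond) (p : Cmd)

infixr:60 ";;" => Cmd.seq
infix:62 "::=" => Cmd.assign

/-- Big-step semantics, as long as all numbers stay below `Q`. -/
inductive Exec (Q : ℕ) : Cmd → State → State → Prop
  | skip {σ} : Exec Q .skip σ σ
  | assign {σ d e} : e.Ok Q σ →
      Exec Q (.assign d e) σ ((σ.tick (e.cost + 1)).set d (e.eval σ))
  | store {σ a x e} : x.Ok Q σ → e.Ok Q σ →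
      Exec Q (.store a x e) σ ((σ.tick (x.cost + e.cost + 2)).put a (x.eval σ) (e.eval σ))
  | emit {σ e} : e.Ok Q σ → Exec Q (.emit e) σ ((σ.tick (e.cost + 1)).print (e.eval σ))
  | seq {σ τ υ p q} : Exec Q p σ τ → Exec Q q τ υ → Exec Q (.seq p q) σ υ
  -- The branch for a true condition stands last in the code, so only the other branch ends with a
  -- jump and pays the extra step.
  | ite_true {σ τ c p q} : c.Ok Q σ → c.Holds σ → Exec Q p (σ.tick c.cost) τ →
      Exec Q (.ite c p q) σ τ
  | ite_false {σ τ c p q} : c.Ok Q σ → ¬ c.Holds σ → Exec Q q (σ.tick (c.cost + 1)) τ →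
      Exec Q (.ite c p q) σ τ
  | loop_true {σ τ υ c p} : c.Ok Q σ → c.Holds σ → Exec Q p (σ.tick (c.cost + 1)) τ →
      Exec Q (.loop c p) τ υ → Exec Q (.loop c p) σ υ
  | loop_false {σ c p} : c.Ok Q σ → ¬ c.Holds σ →
      Exec Q (.loop c p) σ (σ.tick (c.cost + 1))

/-! ### Compilation -/

open WordRAM (Instr Program Config step stepN)

/-- The residue modulo three keeps variables, temporaries and base addresses in different registers.
-/
def varReg (v : Var) : ℕ := 3 * v.ctorIdx
def tmpReg (t : ℕ) : ℕ := 3 * t + 1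
def baseReg (a : Arr) : ℕ := 3 * a.ctorIdx + 2

/-- Code that leaves the value of the expression in temporary register `t`. -/
def Expr.code : Expr → ℕ → List Instr
  | .var v, t => [.op .or (tmpReg t) (varReg v) (varReg v)]
  | .lit c, t => [.const (tmpReg t) c]
  | .bin o a b, t =>
      a.code t ++ b.code (t + 1) ++ [.op o.code (tmpReg t) (tmpReg t) (tmpReg (t + 1))]
  | .get a e, t =>
      e.code t ++ [.op .add (tmpReg t) (tmpReg t) (baseReg a), .load (tmpReg t) (tmpReg t)]

/-- Code that jumps to line `l` if the condition holds. -/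
def Cond.code : Cond → ℕ → List Instr
  | .lt a b, l => a.code 0 ++ b.code 1 ++ [.jumpLt (tmpReg 0) (tmpReg 1) l]
  | .eq a b, l => a.code 0 ++ b.code 1 ++ [.jumpEq (tmpReg 0) (tmpReg 1) l]

def Cmd.size : Cmd → ℕ
  | .skip => 0
  | .assign _ e => e.cost + 1
  | .store _ x e => x.cost + e.cost + 2
  | .emit e => e.cost + 1
  | .seq p q => p.size + q.size
  | .ite c p q => c.cost + (q.size + (1 + p.size))
  | .loop c p => c.cost + (1 + (p.size + 1))

/-- Code for a command, to be placed at line `l`. The loop is entered by its condition, which jumps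
over the exit jump. -/
def Cmd.code : Cmd → ℕ → List Instr
  | .skip, _ => []
  | .assign d e, _ => e.code 0 ++ [.op .or (varReg d) (tmpReg 0) (tmpReg 0)]
  | .store a x e, _ => x.code 0 ++ (e.code 1 ++
      [.op .add (tmpReg 0) (tmpReg 0) (baseReg a), .store (tmpReg 0) (tmpReg 1)])
  | .emit e, _ => e.code 0 ++ [.emit (tmpReg 0)]
  | .seq p q, l => p.code l ++ q.code (l + p.size)
  | .ite c p q, l =>
      c.code (l + c.cost + q.size + 1) ++ (q.code (l + c.cost) ++
        (.jumpEq 0 0 (l + c.cost + q.size + 1 + p.size) :: p.code (l + c.cost + q.size + 1)))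
  | .loop c p, l =>
      c.code (l + c.cost + 1) ++ (.jumpEq 0 0 (l + c.cost + 1 + p.size + 1) ::
        (p.code (l + c.cost + 1) ++ [.jumpEq 0 0 l]))

theorem Expr.length_code (e : Expr) : ∀ t, (e.code t).length = e.cost := by
  induction e with
  | var v => intro t; rfl
  | lit c => intro t; rfl
  | bin o a b iha ihb => intro t; simp [Expr.code, Expr.cost, iha, ihb]; omega
  | get a e ih => intro t; simp [Expr.code, Expr.cost, ih]

theorem Cond.length_code (c : Cond) (l : ℕ) : (c.code l).length = c.cost := by
  cases c <;> simp [Cond.code, Cond.cost, Expr.length_code] <;> omega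

theorem Cmd.length_code (p : Cmd) : ∀ l, (p.code l).length = p.size := by
  induction p with
  | skip => intro l; rfl
  | assign d e => intro l; simp [Cmd.code, Cmd.size, Expr.length_code]
  | store a x e => intro l; simp [Cmd.code, Cmd.size, Expr.length_code]; omega
  | emit e => intro l; simp [Cmd.code, Cmd.size, Expr.length_code]
  | seq p q ihp ihq => intro l; simp [Cmd.code, Cmd.size, ihp, ihq]
  | ite c p q ihp ihq =>
      intro l; simp [Cmd.code, Cmd.size, ihp, ihq, Cond.length_code]; omega
  | loop c p ih => intro l; simp [Cmd.code, Cmd.size, ih, Cond.length_code]; omega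

/-- The code stands in the program at line `l`. -/
def CodeAt (P : Program) (l : ℕ) (code : List Instr) : Prop :=
  ∃ pre post, P = pre ++ (code ++ post) ∧ pre.length = l

theorem CodeAt.left {P l x y} (h : CodeAt P l (x ++ y)) : CodeAt P l x := by
  obtain ⟨pre, post, rfl, hl⟩ := h
  exact ⟨pre, y ++ post, by simp, hl⟩

theorem CodeAt.right {P l x y} (h : CodeAt P l (x ++ y)) : CodeAt P (l + x.length) y := by
  obtain ⟨pre, post, rfl, hl⟩ := h
  exact ⟨pre ++ x, post, by simp, by simp [hl]⟩

theorem CodeAt.head {P l i y} (h : CodeAt P l (i :: y)) : P[l]? = some i := by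
  obtain ⟨pre, post, rfl, hl⟩ := h
  simp [← hl]

theorem CodeAt.tail {P l i y} (h : CodeAt P l (i :: y)) : CodeAt P (l + 1) y :=
  CodeAt.right (x := [i]) h

theorem stepN_add {w : ℕ} (P : Program) (s t : ℕ) (c : Config w) :
    stepN P (s + t) c = (stepN P s c).bind (stepN P t) := by
  induction s generalizing c with
  | zero => simp [stepN]
  | succ s ih =>
      rw [Nat.succ_add]
      simp only [stepN]
      cases step P c with
      | none => rfl
      | some c' => simp [ih]

theorem stepN_trans {w : ℕ} {P : Program} {s t : ℕ} {c c₁ c₂ : Config w}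
    (h₁ : stepN P s c = some c₁) (h₂ : stepN P t c₁ = some c₂) : stepN P (s + t) c = some c₂ := by
  rw [stepN_add, h₁]; exact h₂

theorem stepN_one {w : ℕ} {P : Program} {c c₁ : Config w} (h : step P c = some c₁) :
    stepN P 1 c = some c₁ := by
  simp [stepN, h]

section Steps

variable {w : ℕ} {P : Program} {l : ℕ} {y : List Instr} {c : Config w}

theorem step_const {d v} (hP : CodeAt P l (.const d v :: y)) (hpc : c.pc = l) :
    stepN P 1 c = some { c with
      pc := c.pc + 1, reg := Function.update c.reg d (BitVec.ofNat w v) } :=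
  stepN_one (by subst hpc; simp only [step, hP.head])

theorem step_op {o d s t} (hP : CodeAt P l (.op o d s t :: y)) (hpc : c.pc = l) :
    stepN P 1 c = some { c with
      pc := c.pc + 1, reg := Function.update c.reg d (o.eval (c.reg s) (c.reg t)) } :=
  stepN_one (by subst hpc; simp only [step, hP.head])

theorem step_load {d a} (hP : CodeAt P l (.load d a :: y)) (hpc : c.pc = l) :
    stepN P 1 c = some { c with
      pc := c.pc + 1, reg := Function.update c.reg d (c.mem (c.reg a)) } :=
  stepN_one (by subst hpc; simp only [step, hP.head])

theorem step_store {a s} (hP : CodeAt P l (.store a s :: y)) (hpc : c.pc = l) :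
    stepN P 1 c = some { c with
      pc := c.pc + 1, mem := Function.update c.mem (c.reg a) (c.reg s) } :=
  stepN_one (by subst hpc; simp only [step, hP.head])

theorem step_emit {s} (hP : CodeAt P l (.emit s :: y)) (hpc : c.pc = l) :
    stepN P 1 c = some { c with pc := c.pc + 1, out := c.out ++ [c.reg s] } :=
  stepN_one (by subst hpc; simp only [step, hP.head])

theorem step_jumpLt {s t l'} (hP : CodeAt P l (.jumpLt s t l' :: y)) (hpc : c.pc = l) :
    stepN P 1 c = some { c with
      pc := if (c.reg s).toNat < (c.reg t).toNat then l' else c.pc + 1 } :=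
  stepN_one (by subst hpc; simp only [step, hP.head])

theorem step_jumpEq {s t l'} (hP : CodeAt P l (.jumpEq s t l' :: y)) (hpc : c.pc = l) :
    stepN P 1 c = some { c with pc := if c.reg s = c.reg t then l' else c.pc + 1 } :=
  stepN_one (by subst hpc; simp only [step, hP.head])

theorem step_goto {s l'} (hP : CodeAt P l (.jumpEq s s l' :: y)) (hpc : c.pc = l) :
    stepN P 1 c = some { c with pc := l' } := by
  rw [step_jumpEq hP hpc, if_pos rfl]

end Steps

/-- The configuration `c` represents the state `σ`: array number `k` begins at address `k * Q`. -/
structure Sim (Q : ℕ) {w : ℕ} (σ : State) (c : Config w) : Prop where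
  reg_lt : ∀ v, σ.reg v < Q
  arr_lt : ∀ a x, σ.arr a x < Q
  reg : ∀ v, c.reg (varReg v) = BitVec.ofNat w (σ.reg v)
  base : ∀ a, c.reg (baseReg a) = BitVec.ofNat w (a.ctorIdx * Q)
  mem : ∀ (a : Arr) (x : ℕ), x < Q →
    c.mem (BitVec.ofNat w (a.ctorIdx * Q + x)) = BitVec.ofNat w (σ.arr a x)
  out : c.out = σ.out.map (BitVec.ofNat w)

theorem ofNat_toNat {w Q x : ℕ} (hQ : 12 * Q ≤ 2 ^ w) (hx : x < Q) :
    (BitVec.ofNat w x).toNat = x := by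
  rw [BitVec.toNat_ofNat, Nat.mod_eq_of_lt (by omega)]

theorem ofNat_inj {w Q x y : ℕ} (hQ : 12 * Q ≤ 2 ^ w) (hx : x < Q) (hy : y < Q)
    (h : BitVec.ofNat w x = BitVec.ofNat w y) : x = y := by
  rw [← ofNat_toNat hQ hx, ← ofNat_toNat hQ hy, h]

/-- The exact result is below `Q`, hence below `2 ^ w`, so the reduction modulo `2 ^ w` has no
effect. -/
theorem Bop.code_eval {Q w x y : ℕ} (hQ : 12 * Q ≤ 2 ^ w) (hx : x < Q) (hy : y < Q) (o : Bop)
    (ho : o.Ok Q x y) :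
    o.eval x y < Q ∧ o.code.eval (BitVec.ofNat w x) (BitVec.ofNat w y) =
      BitVec.ofNat w (o.eval x y) := by
  have hx' := ofNat_toNat hQ hx
  have hy' := ofNat_toNat hQ hy
  cases o with
  | add => exact ⟨ho, by simp [Bop.code, WordRAM.BinOp.eval, Bop.eval, BitVec.ofNat_add]⟩
  | mul => exact ⟨ho, by simp [Bop.code, WordRAM.BinOp.eval, Bop.eval, BitVec.ofNat_mul]⟩
  | sub =>
      have ho : y ≤ x := ho
      refine ⟨by simp only [Bop.eval]; omega, ?_⟩
      apply BitVec.eq_of_toNat_eq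
      have h3 : x - y < Q := by omega
      rw [show Bop.sub.eval x y = x - y from rfl, ofNat_toNat hQ h3]
      simp only [Bop.code, WordRAM.BinOp.eval, BitVec.toNat_sub, hx', hy']
      rw [show 2 ^ w - y + x = (x - y) + 2 ^ w by omega, Nat.add_mod_right,
        Nat.mod_eq_of_lt (by omega)]
  | shl =>
      have ho : x * 2 ^ y < Q := ho
      refine ⟨ho, ?_⟩
      apply BitVec.eq_of_toNat_eq
      rw [show Bop.shl.eval x y = x * 2 ^ y from rfl, ofNat_toNat hQ ho]
      simp only [Bop.code, WordRAM.BinOp.eval, BitVec.toNat_shiftLeft, hx', hy',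
        Nat.shiftLeft_eq]
      rw [Nat.mod_eq_of_lt (by omega)]
  | shr =>
      have h3 : x / 2 ^ y < Q := lt_of_le_of_lt (Nat.div_le_self _ _) hx
      refine ⟨h3, ?_⟩
      apply BitVec.eq_of_toNat_eq
      rw [show Bop.shr.eval x y = x / 2 ^ y from rfl, ofNat_toNat hQ h3]
      simp only [Bop.code, WordRAM.BinOp.eval, BitVec.toNat_ushiftRight, hx', hy',
        Nat.shiftRight_eq_div_pow]

theorem Sim.tmp {Q w : ℕ} {σ : State} {c : Config w} (h : Sim Q σ c) (t : ℕ) (x : BitVec w)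
    (l : ℕ) : Sim Q σ { c with pc := l, reg := Function.update c.reg (tmpReg t) x } where
  reg_lt := h.reg_lt
  arr_lt := h.arr_lt
  reg v := by
    rw [← h.reg]; exact Function.update_of_ne (by simp [varReg, tmpReg]; omega) _ _
  base a := by
    rw [← h.base]; exact Function.update_of_ne (by simp [baseReg, tmpReg]; omega) _ _
  mem := h.mem
  out := h.out

theorem Sim.pc {Q w : ℕ} {σ : State} {c : Config w} (h : Sim Q σ c) (l : ℕ) :
    Sim Q σ { c with pc := l } where
  reg_lt := h.reg_lt
  arr_lt := h.arr_lt
  reg := h.reg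
  base := h.base
  mem := h.mem
  out := h.out

theorem Sim.tick {Q w : ℕ} {σ : State} {c : Config w} (h : Sim Q σ c) (t : ℕ) :
    Sim Q (σ.tick t) c where
  reg_lt := h.reg_lt
  arr_lt := h.arr_lt
  reg := h.reg
  base := h.base
  mem := h.mem
  out := h.out

theorem Sim.set {Q w : ℕ} {σ : State} {c : Config w} (h : Sim Q σ c) (d : Var) {x : ℕ}
    (hx : x < Q) (l : ℕ) : Sim Q (σ.set d x)
      { c with pc := l, reg := Function.update c.reg (varReg d) (BitVec.ofNat w x) } where
  reg_lt v := by
    rw [State.set_reg]; split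
    · exact hx
    · exact h.reg_lt v
  arr_lt := h.arr_lt
  reg v := by
    simp only [State.set_reg, Function.update_apply]
    by_cases hv : v = d
    · simp [hv]
    · have : varReg v ≠ varReg d := fun h => hv (Var.ctorIdx_inj (by simpa [varReg] using h))
      simp [hv, this, h.reg]
  base a := by
    rw [← h.base]; exact Function.update_of_ne (by simp [baseReg, varReg]; omega) _ _
  mem := h.mem
  out := h.out

/-- Array number and offset are quotient and remainder of the address by `Q`, and all twelve arrays
lie below `2 ^ w`; so different cells have different addresses and a store disturbs only one of
them. -/
theorem Sim.put {Q w : ℕ} {σ : State} {c : Config w} (hQ : 12 * Q ≤ 2 ^ w) (h : Sim Q σ c)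
    (a : Arr) {x y : ℕ} (hx : x < Q) (hy : y < Q) (l : ℕ) : Sim Q (σ.put a x y)
      { c with
        pc := l
        mem := Function.update c.mem (BitVec.ofNat w (a.ctorIdx * Q + x)) (BitVec.ofNat w y) }
    where
  reg_lt := h.reg_lt
  arr_lt b z := by
    simp only [State.put_arr]
    split
    · rw [Function.update_apply]; split
      · exact hy
      · exact h.arr_lt _ _
    · exact h.arr_lt _ _
  reg := h.reg
  base := h.base
  mem b z hz := by
    have key : BitVec.ofNat w (b.ctorIdx * Q + z) = BitVec.ofNat w (a.ctorIdx * Q + x) ↔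
        b = a ∧ z = x := by
      constructor
      · intro he
        have hb := b.ctorIdx_lt
        have ha := a.ctorIdx_lt
        have hb' : b.ctorIdx * Q + z < 2 ^ w := by nlinarith
        have ha' : a.ctorIdx * Q + x < 2 ^ w := by nlinarith
        have he' := congrArg BitVec.toNat he
        rw [BitVec.toNat_ofNat, BitVec.toNat_ofNat, Nat.mod_eq_of_lt hb',
          Nat.mod_eq_of_lt ha'] at he'
        have h1 : b.ctorIdx = a.ctorIdx := by
          have e1 : (b.ctorIdx * Q + z) / Q = b.ctorIdx := by
            rw [mul_comm, Nat.mul_add_div (by omega), Nat.div_eq_of_lt hz, add_zero]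
          have e2 : (a.ctorIdx * Q + x) / Q = a.ctorIdx := by
            rw [mul_comm, Nat.mul_add_div (by omega), Nat.div_eq_of_lt hx, add_zero]
          rw [← e1, ← e2, he']
        refine ⟨Arr.ctorIdx_inj h1, ?_⟩
        rw [h1] at he'; omega
      · rintro ⟨rfl, rfl⟩; rfl
    simp only [State.put_arr, Function.update_apply, key]
    by_cases hb : b = a
    · subst hb
      by_cases hzx : z = x
      · simp [hzx]
      · simp [hzx, h.mem b z hz]
    · simp [hb, h.mem b z hz]
  out := h.out

theorem Sim.print {Q w : ℕ} {σ : State} {c : Config w} (h : Sim Q σ c) (x l : ℕ) :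
    Sim Q (σ.print x) { c with pc := l, out := c.out ++ [BitVec.ofNat w x] } where
  reg_lt := h.reg_lt
  arr_lt := h.arr_lt
  reg := h.reg
  base := h.base
  mem := h.mem
  out := by simp [h.out]

/-- The last clause is what makes the induction work: the left operand waits in temporary `t` while
the right one is computed with the temporaries from `t + 1` on. -/
theorem Expr.code_correct {Q w : ℕ} (hQ : 12 * Q ≤ 2 ^ w) {P : Program} {σ : State} (e : Expr) :
    ∀ (t l : ℕ) (c : Config w), CodeAt P l (e.code t) → c.pc = l → Sim Q σ c → e.Ok Q σ →
    e.eval σ < Q ∧ ∃ c', stepN P e.cost c = some c' ∧ c'.pc = l + e.cost ∧ Sim Q σ c' ∧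
      c'.reg (tmpReg t) = BitVec.ofNat w (e.eval σ) ∧
      ∀ t' < t, c'.reg (tmpReg t') = c.reg (tmpReg t') := by
  have tmp_ne : ∀ {t t' : ℕ}, t' ≠ t → tmpReg t' ≠ tmpReg t := by
    intro t t' h; simp only [tmpReg]; omega
  induction e with
  | var v =>
      intro t l c hP hpc hS _
      refine ⟨hS.reg_lt v, _, step_op hP hpc, ?_,
        hS.tmp t _ _, ?_, ?_⟩
      · simp [Expr.cost, hpc]
      · simp [WordRAM.BinOp.eval, hS.reg]
      · intro t' ht'
        exact Function.update_of_ne (tmp_ne (by omega)) _ _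
  | lit k =>
      intro t l c hP hpc hS hk
      refine ⟨hk, _, step_const hP hpc, ?_, hS.tmp t _ _, ?_, ?_⟩
      · simp [Expr.cost, hpc]
      · simp [Expr.eval]
      · intro t' ht'
        exact Function.update_of_ne (tmp_ne (by omega)) _ _
  | bin o a b iha ihb =>
      intro t l c hP hpc hS ⟨ha, hb, ho⟩
      have hP' : CodeAt P l (a.code t ++ (b.code (t + 1) ++
        [.op o.code (tmpReg t) (tmpReg t) (tmpReg (t + 1))])) := by
        simpa [Expr.code] using hP
      obtain ⟨hva, c₁, e₁, p₁, S₁, r₁, f₁⟩ := iha t l c hP'.left hpc hS ha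
      have hP₂ := hP'.right
      rw [Expr.length_code] at hP₂
      obtain ⟨hvb, c₂, e₂, p₂, S₂, r₂, f₂⟩ := ihb (t + 1) _ c₁ hP₂.left p₁ S₁ hb
      have hP₃ := hP₂.right
      rw [Expr.length_code] at hP₃
      obtain ⟨hv, hev⟩ := Bop.code_eval hQ hva hvb o ho
      refine ⟨hv, _, stepN_trans (stepN_trans e₁ e₂) (step_op hP₃ p₂), ?_, S₂.tmp t _ _, ?_, ?_⟩
      · simp [Expr.cost]; omega
      · simp [f₂ t (by omega), r₁, r₂, hev, Expr.eval]
      · intro t' ht'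
        rw [← f₁ t' ht', ← f₂ t' (by omega)]
        exact Function.update_of_ne (tmp_ne (by omega)) _ _
  | get a e ih =>
      intro t l c hP hpc hS he
      obtain ⟨hv, c₁, e₁, p₁, S₁, r₁, f₁⟩ := ih t l c hP.left hpc hS he
      have hP₂ := hP.right
      rw [Expr.length_code] at hP₂
      refine ⟨hS.arr_lt _ _, _, stepN_trans (s := e.cost) (t := 1 + 1) e₁
        (stepN_trans (step_op hP₂ p₁) (step_load hP₂.tail (by simp [p₁]))), ?_,
        (S₁.tmp t _ _).tmp t _ _, ?_, ?_⟩
      · simp [Expr.cost]; omega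
      · simp only [WordRAM.BinOp.eval, r₁, S₁.base, Function.update_self]
        rw [← BitVec.ofNat_add, add_comm, S₁.mem a _ hv]
        rfl
      · intro t' ht'
        rw [← f₁ t' ht']
        simp only [Function.update_of_ne (tmp_ne (show t' ≠ t by omega))]

theorem Cond.code_correct {Q w : ℕ} (hQ : 12 * Q ≤ 2 ^ w) {P : Program} {σ : State} (b : Cond)
    (l l' : ℕ) (c : Config w) (hP : CodeAt P l (b.code l')) (hpc : c.pc = l) (hS : Sim Q σ c)
    (hb : b.Ok Q σ) : ∃ c', stepN P b.cost c = some c' ∧ Sim Q σ c' ∧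
      (b.Holds σ → c'.pc = l') ∧ (¬ b.Holds σ → c'.pc = l + b.cost) := by
  cases b with
  | lt x y =>
      have hP' : CodeAt P l (x.code 0 ++ (y.code 1 ++ [.jumpLt (tmpReg 0) (tmpReg 1) l'])) := by
        simpa [Cond.code] using hP
      obtain ⟨hvx, c₁, e₁, p₁, S₁, r₁, f₁⟩ := x.code_correct hQ 0 l c hP'.left hpc hS hb.1
      have hP₂ := hP'.right
      rw [Expr.length_code] at hP₂
      obtain ⟨hvy, c₂, e₂, p₂, S₂, r₂, f₂⟩ := y.code_correct hQ 1 _ c₁ hP₂.left p₁ S₁ hb.2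
      have hP₃ := hP₂.right
      rw [Expr.length_code] at hP₃
      refine ⟨_, stepN_trans (stepN_trans e₁ e₂)
        (step_jumpLt hP₃ p₂), S₂.pc _, ?_, ?_⟩
      · intro h
        simp only [f₂ 0 (by omega), r₁, r₂, ofNat_toNat hQ hvx, ofNat_toNat hQ hvy]
        exact if_pos h
      · intro h
        have h : ¬ x.eval σ < y.eval σ := h
        simp only [f₂ 0 (by omega), r₁, r₂, ofNat_toNat hQ hvx, ofNat_toNat hQ hvy]
        rw [if_neg h]; simp only [Cond.cost]; omega
  | eq x y =>
      have hP' : CodeAt P l (x.code 0 ++ (y.code 1 ++ [.jumpEq (tmpReg 0) (tmpReg 1) l'])) := by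
        simpa [Cond.code] using hP
      obtain ⟨hvx, c₁, e₁, p₁, S₁, r₁, f₁⟩ := x.code_correct hQ 0 l c hP'.left hpc hS hb.1
      have hP₂ := hP'.right
      rw [Expr.length_code] at hP₂
      obtain ⟨hvy, c₂, e₂, p₂, S₂, r₂, f₂⟩ := y.code_correct hQ 1 _ c₁ hP₂.left p₁ S₁ hb.2
      have hP₃ := hP₂.right
      rw [Expr.length_code] at hP₃
      refine ⟨_, stepN_trans (stepN_trans e₁ e₂)
        (step_jumpEq hP₃ p₂), S₂.pc _, ?_, ?_⟩
      · intro h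
        have h : x.eval σ = y.eval σ := h
        simp only [f₂ 0 (by omega), r₁, r₂, h, if_true]
      · intro h
        simp only [f₂ 0 (by omega), r₁, r₂]
        rw [if_neg (fun h' => h (ofNat_inj hQ hvx hvy h'))]; simp only [Cond.cost]; omega

/-- Induction on the execution, not on the command, so that the case of a loop may use the rest of
its own run. The clock advances by exactly the number of machine steps. -/
theorem Cmd.code_correct {Q w : ℕ} (hQ : 12 * Q ≤ 2 ^ w) {P : Program} {p : Cmd} {σ τ : State}
    (hE : Exec Q p σ τ) : ∀ (l : ℕ) (c : Config w), CodeAt P l (p.code l) → c.pc = l →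
    Sim Q σ c → ∃ t c', τ.clock = σ.clock + t ∧ stepN P t c = some c' ∧ c'.pc = l + p.size ∧
      Sim Q τ c' := by
  induction hE with
  | skip =>
      intro l c _ hpc hS
      exact ⟨0, c, rfl, rfl, by simp [hpc, Cmd.size], hS⟩
  | @assign σ d e he =>
      intro l c hP hpc hS
      obtain ⟨hv, c₁, e₁, p₁, S₁, r₁, f₁⟩ := e.code_correct hQ 0 l c hP.left hpc hS he
      have hP₂ := hP.right
      rw [Expr.length_code] at hP₂
      refine ⟨e.cost + 1, _, rfl, stepN_trans e₁
        (step_op hP₂ p₁), ?_, ?_⟩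
      · simp [Cmd.size]; omega
      · simp only [WordRAM.BinOp.eval, r₁, BitVec.or_self]
        exact (S₁.tick _).set d hv _
  | @store σ a x e hx he =>
      intro l c hP hpc hS
      obtain ⟨hvx, c₁, e₁, p₁, S₁, r₁, f₁⟩ := x.code_correct hQ 0 l c hP.left hpc hS hx
      have hP₂ := hP.right
      rw [Expr.length_code] at hP₂
      obtain ⟨hve, c₂, e₂, p₂, S₂, r₂, f₂⟩ := e.code_correct hQ 1 _ c₁ hP₂.left p₁ S₁ he
      have hP₃ := hP₂.right
      rw [Expr.length_code] at hP₃
      refine ⟨x.cost + e.cost + 1 + 1, _, rfl, stepN_trans (stepN_trans (stepN_trans e₁ e₂)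
        (step_op hP₃ p₂)) (step_store hP₃.tail (by simp [p₂])), ?_, ?_⟩
      · simp [Cmd.size]; omega
      · have := (Sim.put hQ ((S₂.tmp 0 (BitVec.ofNat w (x.eval σ + a.ctorIdx * Q))
          (c₂.pc + 1)).tick (x.cost + e.cost + 2)) a hvx hve (l + x.cost + e.cost + 1 + 1))
        have hne : tmpReg 1 ≠ tmpReg 0 := by decide
        simp only [Function.update_self, WordRAM.BinOp.eval, f₂ 0 (by omega), r₁, S₂.base, r₂,
          Function.update_of_ne hne, ← BitVec.ofNat_add]
        rw [add_comm (x.eval σ)] at this ⊢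
        rw [p₂] at this ⊢
        exact this
  | @emit σ e he =>
      intro l c hP hpc hS
      obtain ⟨hv, c₁, e₁, p₁, S₁, r₁, f₁⟩ := e.code_correct hQ 0 l c hP.left hpc hS he
      have hP₂ := hP.right
      rw [Expr.length_code] at hP₂
      refine ⟨e.cost + 1, _, rfl, stepN_trans e₁
        (step_emit hP₂ p₁), ?_, ?_⟩
      · simp [Cmd.size]; omega
      · simp only [r₁]
        exact (S₁.tick _).print _ _
  | @seq σ τ υ p q _ _ ihp ihq =>
      intro l c hP hpc hS
      obtain ⟨t₁, c₁, k₁, e₁, p₁, S₁⟩ := ihp l c hP.left hpc hS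
      have hP₂ := hP.right
      rw [Cmd.length_code] at hP₂
      obtain ⟨t₂, c₂, k₂, e₂, p₂, S₂⟩ := ihq _ c₁ hP₂ p₁ S₁
      exact ⟨t₁ + t₂, c₂, by omega, stepN_trans e₁ e₂, by simp [Cmd.size]; omega, S₂⟩
  | @ite_true σ τ b p q hb hh _ ih =>
      intro l c hP hpc hS
      obtain ⟨c₁, e₁, S₁, q₁, -⟩ := b.code_correct hQ l _ c hP.left hpc hS hb
      have hP₂ := hP.right
      rw [Cond.length_code] at hP₂
      have hP₃ := hP₂.right
      rw [Cmd.length_code] at hP₃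
      obtain ⟨t₂, c₂, k₂, e₂, p₂, S₂⟩ := ih _ c₁ hP₃.tail (q₁ hh) (S₁.tick _)
      refine ⟨b.cost + t₂, c₂, ?_, stepN_trans e₁ e₂, ?_, S₂⟩
      · simp at k₂; omega
      · simp [Cmd.size]; omega
  | @ite_false σ τ b p q hb hh _ ih =>
      intro l c hP hpc hS
      obtain ⟨c₁, e₁, S₁, -, q₁⟩ := b.code_correct hQ l _ c hP.left hpc hS hb
      have hP₂ := hP.right
      rw [Cond.length_code] at hP₂
      obtain ⟨t₂, c₂, k₂, e₂, p₂, S₂⟩ := ih _ c₁ hP₂.left (q₁ hh) (S₁.tick _)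
      have hP₃ := hP₂.right
      rw [Cmd.length_code] at hP₃
      refine ⟨b.cost + t₂ + 1, _, ?_, stepN_trans (stepN_trans e₁ e₂)
        (step_goto hP₃ p₂), ?_, S₂.pc _⟩
      · simp at k₂; omega
      · simp [Cmd.size]; omega
  | @loop_true σ τ υ b p hb hh _ _ ih ihl =>
      intro l c hP hpc hS
      obtain ⟨c₁, e₁, S₁, q₁, -⟩ := b.code_correct hQ l _ c hP.left hpc hS hb
      have hP₂ := hP.right
      rw [Cond.length_code] at hP₂
      obtain ⟨t₂, c₂, k₂, e₂, p₂, S₂⟩ := ih _ c₁ hP₂.tail.left (q₁ hh) (S₁.tick _)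
      have hP₃ := hP₂.tail.right
      rw [Cmd.length_code] at hP₃
      obtain ⟨t₃, c₃, k₃, e₃, p₃, S₃⟩ := ihl l
        { c₂ with pc := l } hP rfl (S₂.pc _)
      refine ⟨b.cost + t₂ + 1 + t₃, c₃, ?_, stepN_trans (stepN_trans (stepN_trans e₁ e₂)
        (step_goto hP₃ p₂)) e₃, p₃, S₃⟩
      simp at k₂; omega
  | @loop_false σ b p hb hh =>
      intro l c hP hpc hS
      obtain ⟨c₁, e₁, S₁, -, q₁⟩ := b.code_correct hQ l _ c hP.left hpc hS hb
      have hP₂ := hP.right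
      rw [Cond.length_code] at hP₂
      refine ⟨b.cost + 1, _, ?_, stepN_trans e₁
        (step_goto hP₂ (q₁ hh)), ?_, (S₁.pc _).tick _⟩
      · simp
      · simp [Cmd.size]; omega


open WordRAM (Instr Program Config step stepN)

/-! ### The prologue -/

/-- Code that computes the size `Q` of the arrays from the input size, and the addresses of the
arrays. -/
def prologue : List Instr :=
  [.const (tmpReg 0) 0, .load (tmpReg 1) (tmpReg 0), .const (tmpReg 2) 1, .const (tmpReg 3) 1,
    .const (tmpReg 4) 1, .const (tmpReg 5) 10,
    .jumpLt (tmpReg 1) (tmpReg 2) 10, .op .shl (tmpReg 2) (tmpReg 2) (tmpReg 4),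
    .op .shl (tmpReg 3) (tmpReg 3) (tmpReg 5), .jumpEq (tmpReg 0) (tmpReg 0) 6,
    .const 2 0] ++
  (List.range 11).map fun k => .op .add (3 * (k + 1) + 2) (3 * k + 2) (tmpReg 3)

theorem length_prologue : prologue.length = 22 := rfl

/-- The whole program. -/
def program (p : Cmd) : Program := prologue ++ p.code prologue.length

/-- The size of the arrays on an input of size `n`. -/
def arraySize (n : ℕ) : ℕ := 2 ^ (10 * (Nat.log 2 n + 1))

def initState (input : List ℕ) : State where
  reg _ := 0
  arr a x := if a = .inp then input.getD x 0 else 0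
  out := []
  clock := 0

theorem codeAt_prologue (p : Cmd) : CodeAt (program p) 0 prologue :=
  ⟨[], p.code prologue.length, rfl, rfl⟩

/-- Six steps of set-up and four for each pass. A pass is made only while `2 ^ k ≤ n`, where the
comparison of words is exact; the power with factor `10` in the exponent is only asserted as a
residue modulo `2 ^ w`. -/
theorem prologue_loop {w n : ℕ} (p : Cmd) (input : List (BitVec w))
    (hnpos : 0 < n) (hw : 12 * arraySize n ≤ 2 ^ w) (h0 : input.getD 0 0 = BitVec.ofNat w n) :
    ∀ k ≤ Nat.log 2 n + 1, ∃ c : Config w,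
      stepN (program p) (6 + 4 * k) (WordRAM.init input) = some c ∧ c.pc = 6 ∧
      c.mem = (WordRAM.init input).mem ∧ c.out = [] ∧ (∀ v, c.reg (varReg v) = 0) ∧
      c.reg (tmpReg 1) = BitVec.ofNat w n ∧ c.reg (tmpReg 2) = BitVec.ofNat w (2 ^ k) ∧
      c.reg (tmpReg 3) = BitVec.ofNat w (2 ^ (10 * k)) ∧ c.reg (tmpReg 4) = BitVec.ofNat w 1 ∧
      c.reg (tmpReg 5) = BitVec.ofNat w 10 := by
  have hP := codeAt_prologue p
  have hP1 := hP.left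
  have hP6 : CodeAt (program p) 6 _ := hP1.tail.tail.tail.tail.tail.tail
  have tv : ∀ v t, varReg v ≠ tmpReg t := by intro v t; simp only [varReg, tmpReg]; omega
  have hn : n < 2 ^ w := by
    have : n < 2 ^ (Nat.log 2 n + 1) := Nat.lt_pow_succ_log_self (by norm_num) n
    have h2 : 2 ^ (Nat.log 2 n + 1) ≤ arraySize n := Nat.pow_le_pow_right (by norm_num) (by omega)
    omega
  -- Words of at least five bits represent the shift amount `10` exactly.
  have hwpos : 4 < w := by
    by_contra h
    have h1 : 2 ^ w ≤ 2 ^ 4 := Nat.pow_le_pow_right (by norm_num) (by omega)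
    have h2 : 2 ^ 10 ≤ arraySize n := Nat.pow_le_pow_right (by norm_num) (by omega)
    omega
  obtain ⟨c, hc, hpc, hmem, hout, hreg, h1, h2, h3, h4, h5⟩ : ∃ c : Config w,
      stepN (program p) 6 (WordRAM.init input) = some c ∧ c.pc = 6 ∧
      c.mem = (WordRAM.init input).mem ∧ c.out = [] ∧ (∀ v, c.reg (varReg v) = 0) ∧
      c.reg (tmpReg 1) = BitVec.ofNat w n ∧ c.reg (tmpReg 2) = BitVec.ofNat w (2 ^ 0) ∧
      c.reg (tmpReg 3) = BitVec.ofNat w (2 ^ (10 * 0)) ∧ c.reg (tmpReg 4) = BitVec.ofNat w 1 ∧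
      c.reg (tmpReg 5) = BitVec.ofNat w 10 := by
    refine ⟨_, stepN_trans (s := 5) (stepN_trans (s := 4) (stepN_trans (s := 3)
      (stepN_trans (s := 2) (stepN_trans (s := 1)
      (step_const hP1 rfl) (step_load hP1.tail rfl)) (step_const hP1.tail.tail rfl))
      (step_const hP1.tail.tail.tail rfl)) (step_const hP1.tail.tail.tail.tail rfl))
      (step_const hP1.tail.tail.tail.tail.tail rfl), rfl, rfl, rfl, ?_, ?_, ?_, ?_, ?_, ?_⟩
    · intro v
      simp only [Function.update_of_ne (tv v _)]
      rfl
    · simp only [tmpReg, Function.update_apply]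
      simp [WordRAM.init, ← h0]
    · simp [tmpReg]
    · simp [tmpReg]
    · simp [tmpReg]
    · simp [tmpReg]
  intro k
  induction k with
  | zero => intro _; exact ⟨c, hc, hpc, hmem, hout, hreg, h1, h2, h3, h4, h5⟩
  | succ k ih =>
    intro hk
    obtain ⟨c, hc, hpc, hmem, hout, hreg, h1, h2, h3, h4, h5⟩ := ih (by omega)
    have hkn : 2 ^ k ≤ n := Nat.pow_le_of_le_log (by omega) (by omega)
    have tN : ∀ x, x < 2 ^ w → (BitVec.ofNat w x).toNat = x := fun x hx => by
      rw [BitVec.toNat_ofNat, Nat.mod_eq_of_lt hx]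
    have hlt : ¬ (c.reg (tmpReg 1)).toNat < (c.reg (tmpReg 2)).toNat := by
      rw [h1, h2, tN n hn, tN _ (by omega)]; omega
    refine ⟨_, stepN_trans (s := 6 + 4 * k) hc (stepN_trans (s := 3) (stepN_trans (s := 2)
      (stepN_trans (s := 1) (step_jumpLt hP6 hpc) (step_op hP6.tail ?_))
      (step_op hP6.tail.tail ?_)) (step_goto hP6.tail.tail.tail ?_)), rfl, hmem, hout, ?_,
      ?_, ?_, ?_, ?_, ?_⟩
    · simp only [if_neg hlt, hpc]
    · simp only [if_neg hlt, hpc]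
    · simp only [if_neg hlt, hpc]
    · intro v
      simp only [Function.update_of_ne (tv v _), hreg]
    · simp [tmpReg] at h1 ⊢
      exact h1
    · simp [tmpReg] at h2 h4 ⊢
      rw [h2, h4]
      apply BitVec.eq_of_toNat_eq
      simp [WordRAM.BinOp.eval, Nat.shiftLeft_eq, pow_succ, Nat.mod_eq_of_lt (show 1 < 2 ^ w from Nat.one_lt_two_pow (by omega))]
    · have h10 : 10 < 2 ^ w := by
        calc 10 < 2 ^ 5 := by norm_num
          _ ≤ 2 ^ w := Nat.pow_le_pow_right (by norm_num) (by omega)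
      have hne3 : tmpReg 3 ≠ tmpReg 2 := by decide
      have hne5 : tmpReg 5 ≠ tmpReg 2 := by decide
      simp only [Function.update_self, Function.update_of_ne hne3, Function.update_of_ne hne5,
        h3, h5, WordRAM.BinOp.eval, tN 10 h10]
      apply BitVec.eq_of_toNat_eq
      simp only [BitVec.toNat_shiftLeft, BitVec.toNat_ofNat, Nat.shiftLeft_eq]
      rw [mul_add, pow_add]
      exact (Nat.mod_modEq _ _).mul_right _
    · simp [tmpReg] at h4 ⊢
      exact h4
    · simp [tmpReg] at h5 ⊢
      exact h5

/-- `2 ^ k` exceeds `n` for the first time at `k = Nat.log 2 n + 1`, when the second register holds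
`arraySize n`. Eleven additions then produce the multiples of it that serve as base addresses. -/
theorem prologue_correct {w n : ℕ} (p : Cmd) (input : List (BitVec w))
    (hnpos : 0 < n) (hw : 12 * arraySize n ≤ 2 ^ w) (h0 : input.getD 0 0 = BitVec.ofNat w n) :
    ∃ t c, t ≤ 4 * Nat.log 2 n + 30 ∧ stepN (program p) t (WordRAM.init input) = some c ∧
      c.pc = 22 ∧ c.mem = (WordRAM.init input).mem ∧ c.out = [] ∧
      (∀ v, c.reg (varReg v) = 0) ∧
      ∀ k < 12, c.reg (3 * k + 2) = BitVec.ofNat w (k * arraySize n) := by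
  have hP := codeAt_prologue p
  have hP6 : CodeAt (program p) 6 _ := hP.left.tail.tail.tail.tail.tail.tail
  have hn : n < 2 ^ w := by
    have : n < 2 ^ (Nat.log 2 n + 1) := Nat.lt_pow_succ_log_self (by norm_num) n
    have h2 : 2 ^ (Nat.log 2 n + 1) ≤ arraySize n := Nat.pow_le_pow_right (by norm_num) (by omega)
    omega
  obtain ⟨c, hc, hpc, hmem, hout, hreg, h1, h2, h3, h4, h5⟩ := prologue_loop p input hnpos hw h0 _ le_rfl
  have hlt : (c.reg (tmpReg 1)).toNat < (c.reg (tmpReg 2)).toNat := by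
    have hl : n < 2 ^ (Nat.log 2 n + 1) := Nat.lt_pow_succ_log_self (by norm_num) n
    have hl2 : 2 ^ (Nat.log 2 n + 1) ≤ arraySize n :=
      Nat.pow_le_pow_right (by norm_num) (by omega)
    rw [h1, h2, BitVec.toNat_ofNat, BitVec.toNat_ofNat, Nat.mod_eq_of_lt hn,
      Nat.mod_eq_of_lt (by omega)]
    exact hl
  have hP10 : CodeAt (program p) 10 _ := hP6.tail.tail.tail.tail
  have e₁ := stepN_trans (stepN_trans hc (step_jumpLt hP6 hpc))
    (step_const hP10 (by simp only [if_pos hlt]))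
  simp only [if_pos hlt] at e₁
  have hP11 := hP.right
  have bases : ∀ k ≤ 11, ∃ c : Config w,
      stepN (program p) (6 + 4 * (Nat.log 2 n + 1) + 1 + 1 + k) (WordRAM.init input) = some c ∧
      c.pc = 11 + k ∧ c.mem = (WordRAM.init input).mem ∧ c.out = [] ∧
      (∀ v, c.reg (varReg v) = 0) ∧ c.reg (tmpReg 3) = BitVec.ofNat w (arraySize n) ∧
      ∀ k' ≤ k, c.reg (3 * k' + 2) = BitVec.ofNat w (k' * arraySize n) := by
    intro k
    induction k with
    | zero =>
      intro _
      refine ⟨_, e₁, rfl, hmem, hout, ?_, ?_, ?_⟩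
      · intro v
        rw [← hreg v]
        exact Function.update_of_ne (by simp only [varReg]; omega) _ _
      · exact h3
      · intro k' hk'
        obtain rfl : k' = 0 := by omega
        simp
    | succ k ih =>
      intro hk
      obtain ⟨c, hc, hpc, hmem, hout, hreg, h3, hb⟩ := ih (by omega)
      have hcode : CodeAt (program p) (11 + k) (.op .add (3 * (k + 1) + 2) (3 * k + 2) (tmpReg 3) ::
          ((List.range 11).map fun k =>
            (Instr.op .add (3 * (k + 1) + 2) (3 * k + 2) (tmpReg 3))).drop (k + 1)) := by
        have h := hP11
        rw [← List.take_append_drop k (List.map _ (List.range 11))] at h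
        have h := h.right
        rw [List.drop_eq_getElem_cons (by simp; omega)] at h
        simpa [show min k 11 = k by omega] using h
      refine ⟨_, stepN_trans (s := 6 + 4 * (Nat.log 2 n + 1) + 1 + 1 + k) hc
        (step_op hcode hpc), by simp [hpc]; omega, hmem, hout, ?_, ?_, ?_⟩
      · intro v
        rw [← hreg v]
        exact Function.update_of_ne (by simp only [varReg]; omega) _ _
      · rw [← h3]
        exact Function.update_of_ne (by simp only [tmpReg]; omega) _ _
      · intro k' hk'
        rcases Nat.lt_or_ge k k' with h | h
        · obtain rfl : k' = k + 1 := by omega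
          simp only [Function.update_self, WordRAM.BinOp.eval, hb k le_rfl, h3,
            ← BitVec.ofNat_add]
          congr 1; ring
        · rw [← hb k' h]
          exact Function.update_of_ne (by omega) _ _
  obtain ⟨c, hc, hpc, hmem, hout, hreg, -, hb⟩ := bases 11 le_rfl
  exact ⟨6 + 4 * (Nat.log 2 n + 1) + 1 + 1 + 11, c, by omega, hc, hpc, hmem, hout, hreg, fun k hk => hb k (by omega)⟩

/-- Total correctness: from the state `σ` the command reaches a state in which `Post` holds. -/
def Run (Q : ℕ) (p : Cmd) (σ : State) (Post : State → Prop) : Prop :=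
  ∃ τ, Exec Q p σ τ ∧ Post τ

/-- The constant is `14 = 4 + 10`: twelve arrays need four more bits than the ten times `Nat.log 2 n
+ 1` bits of an offset. The input fits into the first array, so that the other arrays begin with
zeros. -/
theorem outputsWithin_of_run {w n T : ℕ} {p : Cmd} {input out : List ℕ} (hn : 0 < n)
    (hw : 14 * (Nat.log 2 n + 1) ≤ w) (h0 : input.getD 0 0 = n)
    (hlen : input.length ≤ arraySize n) (hin : ∀ x ∈ input, x < arraySize n)
    (hrun : Run (arraySize n) p (initState input) fun τ => τ.clock ≤ T ∧ τ.out = out) :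
    WordRAM.OutputsWithin (program p) (input.map (BitVec.ofNat w)) (T + 4 * Nat.log 2 n + 30)
      (out.map (BitVec.ofNat w)) := by
  have hQ : 12 * arraySize n ≤ 2 ^ w := by
    calc 12 * arraySize n ≤ 2 ^ (4 * (Nat.log 2 n + 1)) * arraySize n := by
          refine Nat.mul_le_mul_right _ ?_
          calc 12 ≤ 2 ^ 4 := by norm_num
            _ ≤ _ := Nat.pow_le_pow_right (by norm_num) (by omega)
      _ = 2 ^ (14 * (Nat.log 2 n + 1)) := by rw [arraySize, ← pow_add]; congr 1; ring
      _ ≤ 2 ^ w := Nat.pow_le_pow_right (by norm_num) hw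
  have hQpos : 0 < arraySize n := by unfold arraySize; positivity
  obtain ⟨τ, hE, hT, rfl⟩ := hrun
  have hgetD : ∀ x, (input.map (BitVec.ofNat w)).getD x 0 = BitVec.ofNat w (input.getD x 0) := by
    intro x
    simp only [List.getD_eq_getElem?_getD, List.getElem?_map]
    cases input[x]? <;> rfl
  obtain ⟨t, c, ht, hc, hpc, hmem, hout, hreg, hb⟩ :=
    prologue_correct p (input.map (BitVec.ofNat w)) hn hQ (by rw [hgetD, h0])
  have hS : Sim (arraySize n) (initState input) c := by
    refine ⟨fun v => hQpos, ?_, fun v => hreg v, ?_, ?_, by rw [hout]; rfl⟩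
    · intro a x
      simp only [initState]
      split
      · rw [List.getD_eq_getElem?_getD]
        cases h : input[x]? with
        | none => exact hQpos
        | some y => exact hin y (List.mem_of_getElem? h)
      · exact hQpos
    · intro a; exact hb _ a.ctorIdx_lt
    · intro a x hx
      have ha := a.ctorIdx_lt
      have hlt : a.ctorIdx * arraySize n + x < 2 ^ w := by nlinarith
      rw [hmem]
      simp only [WordRAM.init, BitVec.toNat_ofNat, Nat.mod_eq_of_lt hlt, hgetD, initState]
      split
      · next h => subst h; simp [show Arr.inp.ctorIdx = 0 from rfl]
      · next h =>
        have : 1 ≤ a.ctorIdx := by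
          by_contra h'
          exact h (Arr.ctorIdx_inj (show _ = 0 by omega))
        have : input.length ≤ a.ctorIdx * arraySize n + x := by nlinarith
        rw [List.getD_eq_getElem?_getD, List.getElem?_eq_none this]
        rfl
  obtain ⟨t', c', hk, e', p', S'⟩ := Cmd.code_correct hQ hE 22 c
    (P := program p) ⟨prologue, [], by simp [program, length_prologue], rfl⟩ hpc hS
  refine ⟨t + t', ?_, c', stepN_trans hc e', ?_, S'.out⟩
  · have : τ.clock = t' := by simpa [initState] using hk
    omega
  · have : (program p)[c'.pc]? = none := by
      rw [List.getElem?_eq_none]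
      simp [program, length_prologue, Cmd.length_code, p']
    simp only [step, this]

/-! ### Rules of the program logic -/

section Rules

variable {Q : ℕ} {σ : State} {Post : State → Prop}

theorem Run.mono {p : Cmd} {Post' : State → Prop} (h : Run Q p σ Post)
    (hP : ∀ τ, Post τ → Post' τ) : Run Q p σ Post' :=
  let ⟨τ, hE, hτ⟩ := h
  ⟨τ, hE, hP τ hτ⟩

theorem run_skip (h : Post σ) : Run Q .skip σ Post := ⟨σ, .skip, h⟩

theorem run_assign {d : Var} {e : Expr} (he : e.Ok Q σ)
    (h : Post ((σ.tick (e.cost + 1)).set d (e.eval σ))) : Run Q (d ::= e) σ Post :=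
  ⟨_, .assign he, h⟩

theorem run_store {a : Arr} {x e : Expr} (hx : x.Ok Q σ) (he : e.Ok Q σ)
    (h : Post ((σ.tick (x.cost + e.cost + 2)).put a (x.eval σ) (e.eval σ))) :
    Run Q (.store a x e) σ Post :=
  ⟨_, .store hx he, h⟩

theorem run_emit {e : Expr} (he : e.Ok Q σ)
    (h : Post ((σ.tick (e.cost + 1)).print (e.eval σ))) : Run Q (.emit e) σ Post :=
  ⟨_, .emit he, h⟩

theorem run_seq {p q : Cmd} (h : Run Q p σ fun τ => Run Q q τ Post) : Run Q (p ;; q) σ Post :=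
  let ⟨_, hp, _, hq, hυ⟩ := h
  ⟨_, .seq hp hq, hυ⟩

theorem run_ite {c : Cond} {p q : Cmd} (hc : c.Ok Q σ)
    (hp : c.Holds σ → Run Q p (σ.tick c.cost) Post)
    (hq : ¬ c.Holds σ → Run Q q (σ.tick (c.cost + 1)) Post) : Run Q (.ite c p q) σ Post := by
  by_cases h : c.Holds σ
  · obtain ⟨τ, hE, hτ⟩ := hp h
    exact ⟨τ, .ite_true hc h hE, hτ⟩
  · obtain ⟨τ, hE, hτ⟩ := hq h
    exact ⟨τ, .ite_false hc h hE, hτ⟩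

/-- The rule for loops, with an invariant and a measure that decreases. -/
theorem run_loop {c : Cond} {p : Cmd} (Inv : State → Prop) (μ : State → ℕ) (h0 : Inv σ)
    (hok : ∀ τ, Inv τ → c.Ok Q τ)
    (hbody : ∀ τ, Inv τ → c.Holds τ →
      Run Q p (τ.tick (c.cost + 1)) fun υ => Inv υ ∧ μ υ < μ τ)
    (hexit : ∀ τ, Inv τ → ¬ c.Holds τ → Post (τ.tick (c.cost + 1))) :
    Run Q (.loop c p) σ Post := by
  induction hm : μ σ using Nat.strong_induction_on generalizing σ with
  | _ m ih =>
    by_cases h : c.Holds σ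
    · obtain ⟨τ, hE, hI, hlt⟩ := hbody σ h0 h
      obtain ⟨υ, hE', hυ⟩ := ih (μ τ) (by omega) hI rfl
      exact ⟨υ, .loop_true (hok σ h0) h hE hE', hυ⟩
    · exact ⟨_, .loop_false (hok σ h0) h, hexit σ h0 h⟩

/-- `for x from (the present value of x) to y - 1`. -/
def forLoop (x y : Var) (p : Cmd) : Cmd := .loop (.lt x y) (p ;; x ::= x + 1)

/-- The rule for counting loops. -/
theorem run_for {x y : Var} {p : Cmd} (I : ℕ → State → Prop) (a N : ℕ) (haN : a ≤ N) (hN : N < Q)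
    (hI : I a σ)
    (hv : ∀ k τ, a ≤ k → k ≤ N → I k τ → τ.reg x = k ∧ τ.reg y = N)
    -- The test of the loop takes four steps, and so does the increment of the counter.
    (hbody : ∀ k τ, a ≤ k → k < N → I k τ →
      Run Q p (τ.tick 4) fun υ => υ.reg x = k ∧ I (k + 1) ((υ.tick 4).set x (k + 1)))
    (hexit : ∀ τ, I N τ → Post (τ.tick 4)) : Run Q (forLoop x y p) σ Post := by
  refine run_loop (fun τ => ∃ k, a ≤ k ∧ k ≤ N ∧ I k τ) (fun τ => N - τ.reg x)
    ⟨a, le_rfl, haN, hI⟩ (fun _ _ => by simp) ?_ ?_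
  · rintro τ ⟨k, hk, hkN, hIk⟩ hlt
    obtain ⟨hx, hy⟩ := hv k τ hk hkN hIk
    have hlt : τ.reg x < τ.reg y := hlt
    refine run_seq ((hbody k τ hk (by omega) hIk).mono ?_)
    rintro υ ⟨hx', hI'⟩
    refine run_assign (by simp [hx']; omega) ⟨⟨k + 1, by omega, by omega, ?_⟩, ?_⟩
    · simpa [hx'] using hI'
    · simp [hx', hx]; omega
  · rintro τ ⟨k, hk, hkN, hIk⟩ hge
    obtain ⟨hx, hy⟩ := hv k τ hk hkN hIk
    have hge : ¬ τ.reg x < τ.reg y := hge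
    obtain rfl : k = N := by omega
    exact hexit τ hIk

end Rules


/-! ### Segments of arrays, frame conditions, and filtering a segment -/

/-- The part of an array that begins at `base` and has length `len`. -/
def seg (M : ℕ → ℕ) (base len : ℕ) : List ℕ := (List.range len).map fun t => M (base + t)

@[simp] theorem length_seg (M : ℕ → ℕ) (base len : ℕ) : (seg M base len).length = len := by
  simp [seg]

@[simp] theorem seg_zero (M : ℕ → ℕ) (base : ℕ) : seg M base 0 = [] := rfl

theorem seg_succ (M : ℕ → ℕ) (base len : ℕ) :
    seg M base (len + 1) = seg M base len ++ [M (base + len)] := by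
  simp [seg, List.range_succ]

theorem mem_seg {M : ℕ → ℕ} {base len y : ℕ} :
    y ∈ seg M base len ↔ ∃ t < len, M (base + t) = y := by
  simp [seg]

theorem seg_congr {M M' : ℕ → ℕ} {base len : ℕ}
    (h : ∀ y, base ≤ y → y < base + len → M y = M' y) : seg M base len = seg M' base len := by
  refine List.map_congr_left fun t ht => h _ (by omega) ?_
  have := List.mem_range.1 ht
  omega

/-- From `σ` to `τ`, only the variables in `S` and the arrays in `R` change. -/
structure Frame (S : List Var) (R : List Arr) (σ τ : State) : Prop where
  reg : ∀ r, r ∉ S → τ.reg r = σ.reg r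
  arr : ∀ b, b ∉ R → τ.arr b = σ.arr b
  out : τ.out = σ.out

namespace Frame

variable {S S' : List Var} {R R' : List Arr} {σ τ υ : State}

theorem refl (S : List Var) (R : List Arr) (σ : State) : Frame S R σ σ :=
  ⟨fun _ _ => rfl, fun _ _ => rfl, rfl⟩

theorem trans (h : Frame S R σ τ) (h' : Frame S R τ υ) : Frame S R σ υ :=
  ⟨fun r hr => (h'.reg r hr).trans (h.reg r hr), fun b hb => (h'.arr b hb).trans (h.arr b hb),
    h'.out.trans h.out⟩

theorem mono (h : Frame S R σ τ) (hS : S ⊆ S') (hR : R ⊆ R') : Frame S' R' σ τ :=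
  ⟨fun r hr => h.reg r fun h' => hr (hS h'), fun b hb => h.arr b fun h' => hb (hR h'), h.out⟩

@[simp] theorem tick_iff {t : ℕ} : Frame S R σ (τ.tick t) ↔ Frame S R σ τ :=
  ⟨fun h => ⟨h.reg, h.arr, h.out⟩, fun h => ⟨h.reg, h.arr, h.out⟩⟩

@[simp] theorem tick_left_iff {t : ℕ} : Frame S R (σ.tick t) τ ↔ Frame S R σ τ :=
  ⟨fun h => ⟨h.reg, h.arr, h.out⟩, fun h => ⟨h.reg, h.arr, h.out⟩⟩

@[simp] theorem set_iff {d : Var} {x : ℕ} (hd : d ∈ S) :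
    Frame S R σ (τ.set d x) ↔ Frame S R σ τ := by
  have key : ∀ r, r ∉ S → (τ.set d x).reg r = τ.reg r := by
    intro r hr
    have : r ≠ d := fun h => hr (h ▸ hd)
    simp [this]
  exact ⟨fun h => ⟨fun r hr => (key r hr).symm.trans (h.reg r hr), h.arr, h.out⟩,
    fun h => ⟨fun r hr => (key r hr).trans (h.reg r hr), h.arr, h.out⟩⟩

@[simp] theorem put_iff {a : Arr} {x y : ℕ} (ha : a ∈ R) :
    Frame S R σ (τ.put a x y) ↔ Frame S R σ τ := by
  have key : ∀ b, b ∉ R → (τ.put a x y).arr b = τ.arr b := by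
    intro b hb
    have : b ≠ a := fun h => hb (h ▸ ha)
    simp [this]
  exact ⟨fun h => ⟨h.reg, fun b hb => (key b hb).symm.trans (h.arr b hb), h.out⟩,
    fun h => ⟨h.reg, fun b hb => (key b hb).trans (h.arr b hb), h.out⟩⟩

end Frame

open Var Arr

/-- Copies those entries `x` of a list for which `keep` holds. -/
def filterCmd (src : Arr) (base len : Var) (keep : Cond) (dst : Arr) (dbase : Var) : Cmd :=
  cnt ::= 0 ;; t ::= 0 ;;
  forLoop t len (
    x ::= .get src (base + t) ;;
    .ite keep (.store dst (dbase + cnt) x ;; cnt ::= cnt + 1) .skip)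

/-- By `hsafe`, source and target may share an array if the target has the same base (filtering in
place) or begins after the end of the source. Both occur when a node is divided. -/
theorem run_filterCmd {Q : ℕ} {σ : State} {Post : State → Prop} {src dst : Arr}
    {base len dbase : Var} {keep : Cond} (L : List ℕ) (P : ℕ → Bool)
    (hL : L = seg (σ.arr src) (σ.reg base) (σ.reg len))
    (hbase : base ∉ [cnt, t, x]) (hlen : len ∉ [cnt, t, x]) (hdbase : dbase ∉ [cnt, t, x])
    (hkeep : ∀ τ, Frame [cnt, t, x] [dst] σ τ → τ.reg x ∈ L →
      keep.Ok Q τ ∧ (keep.Holds τ ↔ P (τ.reg x) = true))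
    (hcost : keep.cost ≤ 20) (hQ : σ.reg base + σ.reg len < Q)
    (hQ' : σ.reg dbase + σ.reg len < Q)
    (hsafe : src ≠ dst ∨ σ.reg dbase = σ.reg base ∨ σ.reg base + σ.reg len ≤ σ.reg dbase)
    (hPost : ∀ τ, Frame [cnt, t, x] [dst] σ τ →
      (∀ y, y < σ.reg dbase ∨ σ.reg dbase + σ.reg len ≤ y → τ.arr dst y = σ.arr dst y) →
      τ.clock ≤ σ.clock + 60 * σ.reg len + 20 → τ.reg cnt = (L.filter P).length →
      seg (τ.arr dst) (σ.reg dbase) (L.filter P).length = L.filter P → Post τ) :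
    Run Q (filterCmd src base len keep dst dbase) σ Post := by
  subst hL
  simp only [List.mem_cons, List.not_mem_nil, or_false, not_or] at hbase hlen hdbase
  refine run_seq (run_assign (by simp; omega) ?_)
  refine run_seq (run_assign (by simp; omega) ?_)
  refine run_for (fun k τ => Frame [cnt, t, x] [dst] σ τ ∧ τ.reg t = k ∧
    (∀ y, y < σ.reg dbase ∨ σ.reg dbase + k ≤ y → τ.arr dst y = σ.arr dst y) ∧
    τ.clock ≤ σ.clock + 60 * k + 8 ∧
    τ.reg cnt = ((seg (σ.arr src) (σ.reg base) k).filter P).length ∧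
    seg (τ.arr dst) (σ.reg dbase) (τ.reg cnt) = (seg (σ.arr src) (σ.reg base) k).filter P)
    0 (σ.reg len) (Nat.zero_le _) (by omega) ?_ ?_ ?_ ?_
  · simp [Frame.refl]
  · rintro k τ - - ⟨hF, ht, -⟩
    exact ⟨ht, hF.reg len (by simp [hlen])⟩
  · rintro k τ - hk ⟨hF, ht, hy, hc, hcnt, hs⟩
    have hb : τ.reg base = σ.reg base := hF.reg base (by simp [hbase])
    have hd : τ.reg dbase = σ.reg dbase := hF.reg dbase (by simp [hdbase])
    have hle : τ.reg cnt ≤ k := by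
      rw [hcnt]; exact (List.length_filter_le _ _).trans (by simp)
    -- At most `k` entries have been written, so writing in place has not reached the entry that is
    -- read now.
    have hread : τ.arr src (σ.reg base + k) = σ.arr src (σ.reg base + k) := by
      by_cases h : src = dst
      · subst h
        exact hy _ (by rcases hsafe with h | h | h <;> [exact absurd rfl h; omega; omega])
      · exact congrFun (hF.arr src (by simp [h])) _
    have hmem : σ.arr src (σ.reg base + k) ∈ seg (σ.arr src) (σ.reg base) (σ.reg len) :=
      mem_seg.2 ⟨k, hk, rfl⟩
    refine run_seq (run_assign (by simp [hb, ht]; omega) ?_)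
    simp only [Expr.eval_get, Expr.eval_add, Expr.eval_var, State.tick_reg, State.tick_arr, hb,
      ht, hread, Expr.cost_get, Expr.cost_add, Expr.cost_var]
    obtain ⟨hok, hiff⟩ := hkeep (((τ.tick 4).tick (1 + 1 + 1 + 2 + 1)).set x
      (σ.arr src (σ.reg base + k))) (by simp [hF]) (by simpa using hmem)
    simp only [State.set_reg, if_true] at hiff
    refine run_ite hok ?_ ?_
    · intro h
      have hP : P (σ.arr src (σ.reg base + k)) = true := hiff.1 h
      refine run_seq (run_store (by simp [hd, hdbase]; omega) (by simp) ?_)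
      refine run_assign (by simp; omega) ?_
      simp only [Expr.eval_add, Expr.eval_var, Expr.eval_lit, State.tick_reg, State.set_reg,
        State.put_reg, hd, reduceCtorEq, if_false, if_true, hdbase]
      refine ⟨by simp [ht], by simp [hF], by simp, ?_, ?_, ?_, ?_⟩
      · intro y hy'
        have hne : y ≠ σ.reg dbase + τ.reg cnt := by omega
        simp [Function.update_of_ne hne]
        exact hy y (by omega)
      · simp; omega
      · simp [seg_succ, hP, hcnt]
      · simp only [State.set_reg, State.tick_reg, State.put_arr, State.tick_arr,
          State.set_arr, if_true, reduceCtorEq, if_false, seg_succ, List.filter_append, hcnt,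
          Function.update_self]
        rw [← hs]
        simp only [length_seg]
        congr 1
        · exact seg_congr fun y h1 h2 => Function.update_of_ne (by omega) _ _
        · simp [hP]
    · intro h
      have hP : ¬ P (σ.arr src (σ.reg base + k)) = true := fun h' => h (hiff.2 h')
      refine run_skip ?_
      refine ⟨by simp [ht], by simp [hF], by simp, ?_, ?_, ?_, ?_⟩
      · intro y hy'
        simpa using hy y (by omega)
      · simp; omega
      · simp [seg_succ, hP, hcnt]
      · simpa [seg_succ, hP] using hs
  · rintro τ ⟨hF, ht, hy, hc, hcnt, hs⟩
    exact hPost _ (by simp [hF]) (by simpa using hy) (by simp; omega) (by simpa using hcnt)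
      (by rw [← hcnt]; simpa using hs)


open Var Arr

/-! ### The program -/

/-- The entries `A i x`, `B x y`, and the witness that is known for entry `(i, y)` of the product,
increased by one, or zero. -/
abbrev entA (e : Expr) : Expr := .get inp (1 + i * n + e)
abbrev entB (d e : Expr) : Expr := .get inp (1 + n * n + d * n + e)
abbrev entW (e : Expr) : Expr := .get wit (i * n + e)

abbrev adjacent : Cond := .lt 0 (entA x)
abbrev nonadjacent : Cond := .eq (entA x) 0
abbrev unknown : Cond := .eq (entW x) 0
abbrev known : Cond := .lt 0 (entW x)

/-- The lists `bj` and `bk` of the `j` in the node with `A i j = 1`, and of the `k` in the node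
without a witness for `(i, k)`. -/
def loadRow : Cmd :=
  filterCmd sj bs a adjacent bj o ;; nj ::= cnt ;;
  filterCmd sk bs c unknown bk o ;; nk ::= cnt

/-- Inspects `B` on the rectangle `bj × bk`. -/
def scan : Cmd :=
  hit ::= 0 ;; u ::= 0 ;;
  forLoop u nj (
    x ::= .get bj u ;; v ::= 0 ;;
    forLoop v nk (
      y ::= .get bk v ;;
      .ite (.lt 0 (entB x y)) (.store wit (i * n + y) (x + 1) ;; hit ::= 1) .skip))

/-- Solves the node by inspection. -/
def tiny : Cmd := i ::= i0 ;; forLoop i i1 (loadRow ;; scan) ;; sp ::= f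

/-- Looks for a row along which the node can be divided. -/
def findRow : Cmd :=
  mode ::= 0 ;; q ::= i0 ;;
  .loop (.lt q i1) (
    i ::= q ;; loadRow ;; q ::= q + 1 ;;
    .ite (.lt a (nj * gg + 1))
      (.ite (.lt c (nk * gg + 1))
        (.ite (.lt c (nk * b + 1)) (mode ::= 1 ;; q ::= i1)
          (.ite (.lt a (nj * b + 1)) (mode ::= 2 ;; q ::= i1) .skip))
        .skip)
      .skip)

/-- Cuts a part of the node into chunks of size `g`, and the entries that are kept in each chunk
into pieces of at most `s` entries, and writes the codes of the pieces. -/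
def piecesCmd (src : Arr) (len : Var) (keep : Cond) (dst : Arr) : Cmd :=
  cnt ::= 0 ;; ch ::= 0 ;; t ::= 0 ;;
  .loop (.lt t len) (
    cur ::= 0 ;; d ::= 0 ;; te ::= t + g ;; .ite (.lt len te) (te ::= len) .skip ;;
    forLoop t te (
      x ::= .get src (bs + t) ;;
      .ite keep (
        .ite (.eq d s) (.store dst cnt (ch * dd + cur) ;; cnt ::= cnt + 1 ;; cur ::= 0 ;; d ::= 0)
          .skip ;;
        cur ::= .shl cur hd + (t + 1 - ch * g) ;; d ::= d + 1) .skip) ;;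
    .store dst cnt (ch * dd + cur) ;; cnt ::= cnt + 1 ;; ch ::= ch + 1)

/-- Whether there is a one of `B` between the pieces with codes `p` and `q`. -/
def tableEntry : Cmd :=
  z ::= 0 ;; cu ::= p - .shr p (hd * s) * dd ;;
  .loop (.lt 0 cu) (
    x ::= cu - .shl (.shr cu hd) hd + .shr p (hd * s) * g ;; cu ::= .shr cu hd ;;
    .ite (.lt 0 x)
      (.ite (.lt x (a + 1)) (
        x ::= .get sj (bs + x - 1) ;; cv ::= q - .shr q (hd * s) * dd ;;
        .loop (.lt 0 cv) (
          y ::= cv - .shl (.shr cv hd) hd + .shr q (hd * s) * g ;; cv ::= .shr cv hd ;;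
          .ite (.lt 0 y)
            (.ite (.lt y (c + 1))
              (y ::= .get sk (bs + y - 1) ;; .ite (.lt 0 (entB x y)) (z ::= 1) .skip)
              .skip)
            .skip))
        .skip)
      .skip)

def table : Cmd :=
  p ::= 0 ;; forLoop p xx (
    q ::= 0 ;; forLoop q xx (tableEntry ;; .store tab (p * xx + q) z))

/-- Looks up all pairs of pieces, until there is a hit. -/
def lookup : Cmd :=
  z ::= 0 ;; u ::= 0 ;;
  .loop (.lt u np) (
    p ::= .get pj u ;; v ::= 0 ;;
    .loop (.lt v nq) (
      q ::= .get pk v ;; v ::= v + 1 ;;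
      .ite (.lt 0 (.get tab (p * xx + q))) (z ::= 1 ;; v ::= nq ;; u ::= np) .skip) ;;
    u ::= u + 1)

/-- A positive lookup only tells that the rectangle contains a one. The scan of the whole rectangle
that follows is paid for by the new witness. -/
def lookupRow : Cmd :=
  piecesCmd sj a adjacent pj ;; np ::= cnt ;; piecesCmd sk c unknown pk ;; nq ::= cnt ;;
  lookup ;; .ite (.lt 0 z) scan .skip

/-- Solves a node along no row of which it can be divided. -/
def leaf : Cmd :=
  table ;; i ::= i0 ;;
  forLoop i i1 (
    loadRow ;;
    .ite (.lt a (nj * gg + 1)) (.ite (.lt c (nk * gg + 1)) lookupRow scan) scan) ;;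
  sp ::= f

/-- Divides the node, after the rectangle of row `i` has been found to be empty. -/
def split (s₁ l₁ : Arr) (len₁ : Var) (in₁ out₁ : Cond) (s₂ l₂ : Arr) (len₂ : Var) (out₂ : Cond) :
    Cmd :=
  filterCmd s₂ bs len₂ out₂ s₂ nb ;; .store l₂ sp cnt ;;
  filterCmd s₁ bs len₁ in₁ s₁ nb ;; .store l₁ sp cnt ;;
  filterCmd s₁ bs len₁ out₁ s₁ bs ;; .store l₁ f cnt ;;
  sp ::= sp + 1

/-- Treats the node on top of the stack. -/
def node : Cmd :=
  f ::= sp - 1 ;; a ::= .get lj f ;; c ::= .get lk f ;; bs ::= f * m ;; nb ::= bs + m ;;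
  .ite (.lt (a * c * e) (m * m + 1)) tiny
    (findRow ;;
      .ite (.eq mode 0) leaf
        (scan ;;
          .ite (.eq hit 0)
            (.ite (.eq mode 1)
              (split sj lj a adjacent nonadjacent sk lk c known)
              (split sk lk c unknown known sj lj a nonadjacent))
            .skip))

/-- Makes `[x, y)` a side of the first node. -/
def fillRange (src l : Arr) (len x y : Var) : Cmd :=
  len ::= y - x ;; t ::= 0 ;; forLoop t len (.store src t (x + t)) ;; .store l 0 len

/-- Finds all the witnesses in a block. -/
def block : Cmd :=
  fillRange sj lj a j0 j1 ;; fillRange sk lk c k0 k1 ;; sp ::= 1 ;; .loop (.lt 0 sp) node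

/-- `[x, y)` runs through intervals of length `m` that cover `[0, n)`. -/
def intervals (x y : Var) (body : Cmd) : Cmd :=
  x ::= 0 ;;
  .loop (.lt x n) (
    y ::= x + m ;; .ite (.lt n y) (y ::= n) .skip ;; body ;; x ::= y)

def search : Cmd := intervals i0 i1 (intervals j0 j1 (intervals k0 k1 block))

/-- Computes the parameters from `n`. -/
def params : Cmd :=
  n ::= .get inp 0 ;;
  m ::= 1 ;; .loop (.lt ((m + m) * (m + m) * ((m + m) * (m + m))) (n + 1)) (m ::= m + m ;; l ::= l + 1) ;;
  g ::= 1 ;; .loop (.lt g (l * l)) (g ::= g + g ;; h ::= h + 1) ;;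
  hd ::= h + 1 ;;
  s ::= 1 ;; .loop (.lt (8 * hd * s) l) (s ::= s + 1) ;;
  b ::= 1 ;; .loop (.lt (hd * hd * b) (.shr l 11)) (b ::= b + 1) ;;
  gg ::= g * g ;; e ::= .shl 1 (.shr l 2) ;; dd ::= .shl 1 (hd * s) ;;
  xx ::= (.shr m h + 1) * dd

/-- Appends line number `line` to the chain whose last line has number `top - 1`, where `top = 0`
for the empty chain. -/
def chain (axis : Expr) (top line : Var) : Cmd :=
  .ite (.eq top 0) (top ::= line + 1)
    (.emit 3 ;; .emit axis ;; .emit (top - 1) ;; .emit line ;; ln ::= ln + 1 ;; top ::= ln)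

/-- Prints a line. Its number is left in `p`. -/
def emitLine (e₀ e₁ e₂ e₃ : Expr) : Cmd :=
  .emit e₀ ;; .emit e₁ ;; .emit e₂ ;; .emit e₃ ;; p ::= ln ;; ln ::= ln + 1

/-- For each `j`, a line with the zeros of row `j` of `B`. -/
def zeroRows : Cmd :=
  j ::= 0 ;;
  forLoop j n (
    cur ::= 0 ;; k ::= 0 ;;
    forLoop k n (
      .ite (.eq (entB j k) 0)
        (emitLine 1 j k 0 ;; chain 2 cur p)
        .skip) ;;
    .store zr j cur)

/-- A line with the triples of row `i`. -/
def rowChain : Cmd :=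
  z ::= 0 ;; k ::= 0 ;; forLoop k n (.ite (.eq (entW k) 0) (z ::= 1) .skip) ;;
  cur ::= 0 ;;
  .ite (.eq z 0) .skip (
    j ::= 0 ;;
    forLoop j n (
      .ite (.eq (entA j) 0)
        (emitLine 0 i j 0)
        (p ::= .get zr j - 1) ;;
      chain 1 cur p)) ;;
  k ::= 0 ;;
  forLoop k n (
    .ite (.eq (entW k) 0) .skip
      (emitLine 2 i (entW k - 1) k ;; chain 2 cur p))

def certificate : Cmd :=
  ln ::= 0 ;; zeroRows ;; tot ::= 0 ;; i ::= 0 ;;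
  forLoop i n (rowChain ;; p ::= cur - 1 ;; chain 0 tot p)

def printProduct : Cmd :=
  i ::= 0 ;;
  forLoop i n (
    k ::= 0 ;;
    forLoop k n (.ite (.eq (entW k) 0) (.emit 0) (.emit 1)))

def multiply : Cmd := params ;; search ;; certificate ;; printProduct


open Var Arr

/-! ### Rows and rectangles -/

theorem pair_lt {n i k : ℕ} (hi : i < n) (hk : k < n) : i * n + k < n * n := by
  have : (i + 1) * n ≤ n * n := Nat.mul_le_mul_right n hi
  rw [Nat.succ_mul] at this
  omega

theorem pair_inj {n i k i' k' : ℕ} (hk : k < n) (hk' : k' < n)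
    (h : i * n + k = i' * n + k') : i = i' ∧ k = k' := by
  have hi : i = i' := by
    have := congrArg (· / n) h
    simpa [Nat.mul_comm _ n, Nat.mul_add_div (show 0 < n by omega), Nat.div_eq_of_lt hk,
      Nat.div_eq_of_lt hk'] using this
  subst hi
  exact ⟨rfl, by omega⟩

/-- The input array and the parameters of the algorithm. -/
structure Params where
  inp : ℕ → ℕ
  n : ℕ
  m : ℕ
  h : ℕ
  s : ℕ
  b : ℕ
  e : ℕ

namespace Params

variable (c : Params)

def g : ℕ := 2 ^ c.h
def gg : ℕ := c.g * c.g
-- A piece is coded by the number of its chunk and at most `s` digits in base `2 ^ (h + 1)`. So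
-- there are `dd` codes for a chunk and `xx` in all.
def dd : ℕ := 2 ^ ((c.h + 1) * c.s)
def xx : ℕ := (c.m / c.g + 1) * c.dd
def A (i j : ℕ) : ℕ := c.inp (1 + i * c.n + j)
def B (j k : ℕ) : ℕ := c.inp (1 + c.n * c.n + j * c.n + k)
def adj (i j : ℕ) : Bool := decide (0 < c.A i j)
def free (W : ℕ → ℕ) (i k : ℕ) : Bool := decide (W (i * c.n + k) = 0)

/-- All numbers that occur are below `Q`. -/
structure Fits (Q : ℕ) : Prop where
  n_pos : 0 < c.n
  m_pos : 0 < c.m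
  s_pos : 0 < c.s
  b_pos : 0 < c.b
  m_le : c.m ≤ c.n
  n_lt : 16 * (c.n * c.n) + 16 < Q
  m_lt : (c.m * c.m + 3) * c.m < Q
  e_lt : c.m * c.m * c.e < Q
  gg_lt : c.m * c.gg + 1 < Q
  b_lt : c.m * c.b + 1 < Q
  xx_lt : c.xx * c.xx < Q

/-- The entries of `W` are correct: a nonzero entry is a witness, increased by one. -/
def Sound (W : ℕ → ℕ) : Prop := ∀ i < c.n, ∀ k < c.n, W (i * c.n + k) ≠ 0 →
  W (i * c.n + k) - 1 < c.n ∧ 0 < c.A i (W (i * c.n + k) - 1) ∧ 0 < c.B (W (i * c.n + k) - 1) k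

/-- The number of entries without a witness. -/
def unknowns (W : ℕ → ℕ) : ℕ := ((Finset.range (c.n * c.n)).filter fun t => W t = 0).card

/-- All entries of the product that have a witness in the box are known. -/
def Covers (W : ℕ → ℕ) (i : ℕ) (J K : List ℕ) : Prop :=
  ∀ j ∈ J, ∀ k ∈ K, 0 < c.A i j → 0 < c.B j k → W (i * c.n + k) ≠ 0

/-- `W'` knows at least as much as `W`. -/
structure Better (W W' : ℕ → ℕ) : Prop where
  mono : ∀ t, W t ≠ 0 → W' t ≠ 0
  sound : c.Sound W → c.Sound W'

variable {c}

theorem Better.refl (W : ℕ → ℕ) : c.Better W W := ⟨fun _ h => h, fun h => h⟩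

theorem Better.trans {W W' W'' : ℕ → ℕ} (h : c.Better W W') (h' : c.Better W' W'') :
    c.Better W W'' :=
  ⟨fun t ht => h'.mono t (h.mono t ht), fun hW => h'.sound (h.sound hW)⟩

theorem Better.covers {W W' : ℕ → ℕ} (h : c.Better W W') {i : ℕ} {J K : List ℕ}
    (hW : c.Covers W i J K) : c.Covers W' i J K :=
  fun j hj k hk hA hB => h.mono _ (hW j hj k hk hA hB)

theorem Better.unknowns_le {W W' : ℕ → ℕ} (h : c.Better W W') :
    c.unknowns W' ≤ c.unknowns W := by
  refine Finset.card_le_card fun t => ?_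
  simp only [Finset.mem_filter]
  exact fun ⟨h1, h2⟩ => ⟨h1, by by_contra h3; exact h.mono t h3 h2⟩

theorem Better.unknowns_lt {W W' : ℕ → ℕ} (h : c.Better W W') {t : ℕ} (ht : t < c.n * c.n)
    (h0 : W t = 0) (h1 : W' t ≠ 0) : c.unknowns W' < c.unknowns W := by
  refine Finset.card_lt_card ⟨fun t => ?_, fun hsub => ?_⟩
  · simp only [Finset.mem_filter]
    exact fun ⟨h1, h2⟩ => ⟨h1, by by_contra h3; exact h.mono t h3 h2⟩
  · have := hsub (x := t) (by simp [ht, h0])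
    simp [h1] at this

end Params

/-- The variables that hold the parameters. -/
def paramVars : List Var := [n, m, g, h, hd, s, b, gg, e, dd, xx, o]

/-- The variables hold the parameters, and the input is there. -/
structure Consts (P : Params) (σ : State) : Prop where
  inp : σ.arr inp = P.inp
  n : σ.reg n = P.n
  m : σ.reg m = P.m
  g : σ.reg g = P.g
  h : σ.reg h = P.h
  hd : σ.reg hd = P.h + 1
  s : σ.reg s = P.s
  b : σ.reg b = P.b
  gg : σ.reg gg = P.gg
  e : σ.reg e = P.e
  dd : σ.reg dd = P.dd
  xx : σ.reg xx = P.xx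
  -- The program never assigns this variable; it serves as the base of lists that begin at offset
  -- zero.
  o : σ.reg o = 0

theorem Consts.frame {P : Params} {σ τ : State} {S : List Var} {R : List Arr}
    (hσ : Consts P σ) (hF : Frame S R σ τ) (hS : ∀ r ∈ paramVars, r ∉ S)
    (hR : Arr.inp ∉ R) : Consts P τ where
  inp := (hF.arr _ hR).trans hσ.inp
  n := (hF.reg _ (hS _ (by decide))).trans hσ.n
  m := (hF.reg _ (hS _ (by decide))).trans hσ.m
  g := (hF.reg _ (hS _ (by decide))).trans hσ.g
  h := (hF.reg _ (hS _ (by decide))).trans hσ.h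
  hd := (hF.reg _ (hS _ (by decide))).trans hσ.hd
  s := (hF.reg _ (hS _ (by decide))).trans hσ.s
  b := (hF.reg _ (hS _ (by decide))).trans hσ.b
  gg := (hF.reg _ (hS _ (by decide))).trans hσ.gg
  e := (hF.reg _ (hS _ (by decide))).trans hσ.e
  dd := (hF.reg _ (hS _ (by decide))).trans hσ.dd
  xx := (hF.reg _ (hS _ (by decide))).trans hσ.xx
  o := (hF.reg _ (hS _ (by decide))).trans hσ.o

/-- The node with sides `J` and `K` is on top of the stack. -/
structure AtNode (Q : ℕ) (P : Params) (J K : List ℕ) (σ : State) : Prop extends Consts P σ where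
  a : σ.reg a = J.length
  c : σ.reg c = K.length
  segJ : seg (σ.arr sj) (σ.reg bs) J.length = J
  segK : seg (σ.arr sk) (σ.reg bs) K.length = K
  J_lt : ∀ y ∈ J, y < P.n
  K_lt : ∀ y ∈ K, y < P.n
  J_le : J.length ≤ P.m
  K_le : K.length ≤ P.m
  bs : σ.reg bs + P.m + P.m < Q

theorem AtNode.frame {Q : ℕ} {P : Params} {J K : List ℕ} {σ τ : State} {S : List Var}
    {R : List Arr} (hσ : AtNode Q P J K σ) (hF : Frame S R σ τ)
    (hS : ∀ r ∈ Var.a :: Var.c :: Var.bs :: paramVars, r ∉ S)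
    (hR : ∀ r ∈ [Arr.inp, Arr.sj, Arr.sk], r ∉ R) : AtNode Q P J K τ where
  toConsts := hσ.toConsts.frame hF (fun r hr => hS r (by simp [hr])) (hR _ (by decide))
  a := (hF.reg _ (hS _ (by decide))).trans hσ.a
  c := (hF.reg _ (hS _ (by decide))).trans hσ.c
  segJ := by rw [hF.arr _ (hR _ (by decide)), hF.reg _ (hS _ (by decide))]; exact hσ.segJ
  segK := by rw [hF.arr _ (hR _ (by decide)), hF.reg _ (hS _ (by decide))]; exact hσ.segK
  J_lt := hσ.J_lt
  K_lt := hσ.K_lt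
  J_le := hσ.J_le
  K_le := hσ.K_le
  bs := by rw [hF.reg _ (hS _ (by decide))]; exact hσ.bs

/-- The lists of row `r` have been loaded. -/
structure AtRow (Q : ℕ) (P : Params) (J K : List ℕ) (r : ℕ) (σ : State) : Prop
    extends AtNode Q P J K σ where
  i : σ.reg i = r
  r_lt : r < P.n
  nj : σ.reg nj = (J.filter (P.adj r)).length
  nk : σ.reg nk = (K.filter (P.free (σ.arr wit) r)).length
  segNJ : seg (σ.arr bj) 0 (J.filter (P.adj r)).length = J.filter (P.adj r)
  segNK : seg (σ.arr bk) 0 (K.filter (P.free (σ.arr wit) r)).length =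
    K.filter (P.free (σ.arr wit) r)

theorem AtRow.frame {Q : ℕ} {P : Params} {J K : List ℕ} {r : ℕ} {σ τ : State} {S : List Var}
    {R : List Arr} (hσ : AtRow Q P J K r σ) (hF : Frame S R σ τ)
    (hS : ∀ r ∈ Var.i :: Var.nj :: Var.nk :: Var.a :: Var.c :: Var.bs :: paramVars, r ∉ S)
    (hR : ∀ r ∈ [Arr.inp, Arr.sj, Arr.sk, Arr.bj, Arr.bk, Arr.wit], r ∉ R) :
    AtRow Q P J K r τ where
  toAtNode := hσ.toAtNode.frame hF
    (fun r hr => hS r (by simp only [List.mem_cons] at hr ⊢; tauto))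
    (fun r hr => hR r (by simp only [List.mem_cons] at hr ⊢; tauto))
  i := (hF.reg _ (hS _ (by decide))).trans hσ.i
  r_lt := hσ.r_lt
  nj := (hF.reg _ (hS _ (by decide))).trans hσ.nj
  nk := by
    rw [hF.arr _ (hR .wit (by decide)), hF.reg _ (hS _ (by decide))]; exact hσ.nk
  segNJ := by rw [hF.arr _ (hR _ (by decide))]; exact hσ.segNJ
  segNK := by
    rw [hF.arr _ (hR .wit (by decide)), hF.arr _ (hR _ (by decide))]; exact hσ.segNK

section

variable {Q : ℕ} {P : Params} {J K : List ℕ} {σ : State} {Post : State → Prop}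

theorem entA_ok (hfit : P.Fits Q) {τ : State} (hτ : Consts P τ) {r y : ℕ} (hi : τ.reg i = r)
    (hr : r < P.n) (hx : τ.reg x = y) (hy : y < P.n) :
    (entA x).Ok Q τ ∧ (entA x).eval τ = P.A r y := by
  have h1 := pair_lt hr hy
  have h2 := hfit.n_lt
  constructor
  · simp [hτ.n, hi, hx]; omega
  · simp [hτ.n, hi, hx, hτ.inp, Params.A]

theorem entW_ok (hfit : P.Fits Q) {τ : State} (hτ : Consts P τ) {r y : ℕ} (hi : τ.reg i = r)
    (hr : r < P.n) (hx : τ.reg x = y) (hy : y < P.n) :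
    (entW x).Ok Q τ ∧ (entW x).eval τ = τ.arr wit (r * P.n + y) := by
  have h1 := pair_lt hr hy
  have h2 := hfit.n_lt
  constructor
  · simp [hτ.n, hi, hx]; omega
  · simp [hτ.n, hi, hx]

theorem entB_ok (hfit : P.Fits Q) {τ : State} (hτ : Consts P τ) {r y : ℕ} (hi : τ.reg x = r)
    (hr : r < P.n) (hx : τ.reg Var.y = y) (hy : y < P.n) :
    (entB x Var.y).Ok Q τ ∧ (entB x Var.y).eval τ = P.B r y := by
  have h1 := pair_lt hr hy
  have h2 := hfit.n_lt
  constructor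
  · simp [hτ.n, hi, hx]; omega
  · simp [hτ.n, hi, hx, hτ.inp, Params.B]

theorem run_loadRow (hfit : P.Fits Q) (hσ : AtNode Q P J K σ) {r : ℕ} (hi : σ.reg i = r)
    (hr : r < P.n)
    (hPost : ∀ τ, Frame [cnt, t, x, nj, nk] [bj, bk] σ τ → AtRow Q P J K r τ →
      τ.clock ≤ σ.clock + 60 * (J.length + K.length) + 60 → Post τ) :
    Run Q loadRow σ Post := by
  have hbs := hσ.bs
  have hJ := hσ.J_le
  have hK := hσ.K_le
  refine run_seq (run_filterCmd J (P.adj r) (by rw [hσ.a, hσ.segJ]) (by decide) (by decide)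
    (by decide) ?_ (by simp) (by rw [hσ.a]; omega) (by rw [hσ.a, hσ.o]; omega)
    (Or.inl (by decide)) ?_)
  · intro τ hF hx
    have hτ := hσ.toConsts.frame hF (by decide) (by decide)
    obtain ⟨h1, h2⟩ := entA_ok hfit hτ ((hF.reg i (by decide)).trans hi) hr rfl (hσ.J_lt _ hx)
    refine ⟨⟨by simp; have := hfit.n_lt; omega, h1⟩, ?_⟩
    rw [Cond.holds_lt, h2]
    simp [Params.adj]
  rintro τ hF - hc hcnt hs
  refine run_seq (run_assign (by simp) ?_)
  have hF' : Frame [cnt, t, x, nj, nk] [bj, bk] σ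
      ((τ.tick ((Expr.var cnt).cost + 1)).set nj (Expr.eval τ (Expr.var cnt))) := by
    simpa using hF.mono (by simp) (by simp)
  have hτ := hσ.frame hF' (by decide) (by decide)
  set τ' := ((τ.tick ((Expr.var cnt).cost + 1)).set nj (Expr.eval τ (Expr.var cnt))) with hτ'
  have hnj : τ'.reg nj = (J.filter (P.adj r)).length := by simp [hτ', hcnt]
  have hbj : seg (τ'.arr bj) 0 (J.filter (P.adj r)).length = J.filter (P.adj r) := by
    rw [hσ.o] at hs; simpa [hτ'] using hs
  have hc' : τ'.clock ≤ σ.clock + 60 * J.length + 22 := by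
    rw [hσ.a] at hc; simp [hτ']; omega
  have hi' : τ'.reg i = r := (hF'.reg i (by decide)).trans hi
  have hbs' := hτ.bs
  refine run_seq (run_filterCmd K (P.free (τ'.arr wit) r) (by rw [hτ.c, hτ.segK]) (by decide)
    (by decide) (by decide) ?_ (by simp) (by rw [hτ.c]; omega) (by rw [hτ.c, hτ.o]; omega)
    (Or.inl (by decide)) ?_)
  · intro υ hG hx
    have hυ := hτ.toConsts.frame hG (by decide) (by decide)
    obtain ⟨h1, h2⟩ := entW_ok hfit hυ ((hG.reg i (by decide)).trans hi') hr rfl (hσ.K_lt _ hx)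
    refine ⟨⟨h1, by simp; have := hfit.n_lt; omega⟩, ?_⟩
    rw [Cond.holds_eq, h2, hG.arr wit (by decide)]
    simp [Params.free]
  rintro υ hG - hd hcnt' hs'
  refine run_assign (by simp) ?_
  have hG' : Frame [cnt, t, x, nk] [bk] τ'
      ((υ.tick ((Expr.var cnt).cost + 1)).set nk (Expr.eval υ (Expr.var cnt))) := by
    simpa using hG.mono (by simp) (by simp)
  have hυ := hτ.frame hG' (by decide) (by decide)
  refine hPost _ (hF'.trans (hG'.mono (by simp) (by simp))) ?_ ?_
  · refine ⟨hυ, (hG'.reg i (by decide)).trans hi', hr, (hG'.reg nj (by decide)).trans hnj,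
      ?_, ?_, ?_⟩
    · rw [hG'.arr wit (by decide)]; simpa using hcnt'
    · rw [hG'.arr bj (by decide)]; exact hbj
    · rw [hG'.arr wit (by decide)]
      rw [hτ.o] at hs'; simpa using hs'
  · rw [hτ.c] at hd; simp; omega

end


/-! ### Inspecting the rectangle of a row -/

open Var Arr

theorem update_succ_ne_zero {W : ℕ → ℕ} {t t' j : ℕ} (h : t' ≠ t → W t' ≠ 0) :
    Function.update W t (j + 1) t' ≠ 0 := by
  rw [Function.update_apply]; split
  · omega
  · next hne => exact h hne

/-- Nothing is assumed about the previous entry: replacing one witness by another keeps the table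
correct. -/
theorem Params.Better.put {P : Params} {W W' : ℕ → ℕ} (h : P.Better W W') {r j k : ℕ}
    (hk : k < P.n) (hj : j < P.n) (hA : 0 < P.A r j) (hB : 0 < P.B j k) :
    P.Better W (Function.update W' (r * P.n + k) (j + 1)) := by
  refine h.trans ⟨fun t ht => ?_, fun hW i' hi' k' hk' h0 => ?_⟩
  · rw [Function.update_apply]; split
    · omega
    · exact ht
  · rw [Function.update_apply] at h0 ⊢
    by_cases heq : i' * P.n + k' = r * P.n + k
    · obtain ⟨rfl, rfl⟩ := pair_inj hk' hk heq
      simp [hj, hA, hB]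
    · rw [if_neg heq] at h0 ⊢
      exact hW i' hi' k' hk' h0

section

variable {Q : ℕ} {P : Params} {J K : List ℕ} {σ : State} {Post : State → Prop}

/-- Pairs outside the loaded rectangle need no inspection: there `A` is zero or the entry is already
known. Since the columns were loaded because they had no witness, every hit makes an unknown entry
known. -/
theorem run_scan (hfit : P.Fits Q) {r : ℕ} (hσ : AtRow Q P J K r σ)
    (hPost : ∀ τ, Frame [hit, u, v, x, y] [wit] σ τ → P.Better (σ.arr wit) (τ.arr wit) →
      P.Covers (τ.arr wit) r J K → (τ.reg hit = 0 → τ.arr wit = σ.arr wit) →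
      (τ.reg hit ≠ 0 → P.unknowns (τ.arr wit) < P.unknowns (σ.arr wit)) →
      τ.clock ≤ σ.clock + 50 * (σ.reg nj * σ.reg nk) + 50 * σ.reg nj + 20 → Post τ) :
    Run Q scan σ Post := by
  have hn := hfit.n_lt
  have hm := hfit.m_le
  have hnn : P.n ≤ P.n * P.n := Nat.le_mul_self _
  have hrn := hσ.r_lt
  have hlJ : σ.reg nj ≤ P.m := by
    rw [hσ.nj]; exact (List.length_filter_le _ _).trans hσ.J_le
  have hlK : σ.reg nk ≤ P.m := by
    rw [hσ.nk]; exact (List.length_filter_le _ _).trans hσ.K_le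
  have hbj : ∀ u' < σ.reg nj, σ.arr bj u' ∈ J.filter (P.adj r) := fun u' hu' => by
    rw [← hσ.segNJ, ← hσ.nj, mem_seg]; exact ⟨u', hu', by simp⟩
  have hbk : ∀ v' < σ.reg nk, σ.arr bk v' ∈ K.filter (P.free (σ.arr wit) r) := fun v' hv' => by
    rw [← hσ.segNK, ← hσ.nk, mem_seg]; exact ⟨v', hv', by simp⟩
  let Inv : State → Prop := fun τ =>
    Frame [hit, u, v, x, y] [wit] σ τ ∧ P.Better (σ.arr wit) (τ.arr wit) ∧
    (τ.reg hit = 0 → τ.arr wit = σ.arr wit) ∧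
    (τ.reg hit ≠ 0 → P.unknowns (τ.arr wit) < P.unknowns (σ.arr wit))
  refine run_seq (run_assign (by simp; omega) ?_)
  refine run_seq (run_assign (by simp; omega) ?_)
  refine run_for (fun k τ => Inv τ ∧ τ.reg u = k ∧
    (∀ u' < k, ∀ v' < σ.reg nk, 0 < P.B (σ.arr bj u') (σ.arr bk v') →
      τ.arr wit (r * P.n + σ.arr bk v') ≠ 0) ∧
    τ.clock ≤ σ.clock + 10 + k * (50 * σ.reg nk + 40)) 0 (σ.reg nj) (Nat.zero_le _) (by omega)
    ?_ ?_ ?_ ?_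
  · simp [Inv, Frame.refl, Params.Better.refl]
  · rintro k τ - - ⟨⟨hF, -⟩, hu, -⟩
    exact ⟨hu, hF.reg nj (by decide)⟩
  · rintro k τ - hk ⟨⟨hF, hB, h0, h1⟩, hu, hcov, hc⟩
    have hjmem := List.mem_filter.1 (hbj k hk)
    have hjn := hσ.J_lt _ hjmem.1
    refine run_seq (run_assign (by simp) ?_)
    refine run_seq (run_assign (by simp; omega) ?_)
    refine run_for (fun l τ' => Inv τ' ∧ τ'.reg u = k ∧ τ'.reg v = l ∧
      τ'.reg x = σ.arr bj k ∧
      (∀ u' < k, ∀ v' < σ.reg nk, 0 < P.B (σ.arr bj u') (σ.arr bk v') →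
        τ'.arr wit (r * P.n + σ.arr bk v') ≠ 0) ∧
      (∀ v' < l, 0 < P.B (σ.arr bj k) (σ.arr bk v') →
        τ'.arr wit (r * P.n + σ.arr bk v') ≠ 0) ∧
      τ'.clock ≤ σ.clock + 10 + k * (50 * σ.reg nk + 40) + 20 + l * 50)
      0 (σ.reg nk) (Nat.zero_le _) (by omega) ?_ ?_ ?_ ?_
    · refine ⟨⟨by simp [hF], by simpa using hB, by simpa using h0, by simpa using h1⟩,
        by simp [hu], by simp, by simp [hu, hF.arr bj], ?_, by simp, ?_⟩
      · simpa using hcov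
      · simp; omega
    · rintro l τ' - - ⟨⟨hF', -⟩, -, hv, -⟩
      exact ⟨hv, hF'.reg nk (by decide)⟩
    · rintro l τ' - hl ⟨⟨hF', hB', h0', h1'⟩, hu', hv', hx', hcov1, hcov2, hc'⟩
      have hkmem := List.mem_filter.1 (hbk l hl)
      have hkn := hσ.K_lt _ hkmem.1
      have hpair := pair_lt hrn hkn
      refine run_seq (run_assign (by simp) ?_)
      have hG : Frame [hit, u, v, x, y] [wit] σ (((τ'.tick 4).tick
          ((Expr.get bk (Expr.var v)).cost + 1)).set y
          ((Expr.get bk (Expr.var v)).eval (τ'.tick 4))) := by simp [hF']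
      have hτ := hσ.toConsts.frame hG (by decide) (by decide)
      have hy' : (Expr.get bk (Expr.var v)).eval (τ'.tick 4) = σ.arr bk l := by
        simp [hv', hF'.arr bk]
      rw [hy'] at hG hτ ⊢
      obtain ⟨hok, heval⟩ := entB_ok hfit hτ (by simp [hx']) hjn (by simp) hkn
      have hi' : τ'.reg i = r := (hF'.reg i (by decide)).trans hσ.i
      have hnv : τ'.reg n = P.n := (hF'.reg n (by decide)).trans hσ.n
      refine run_ite ⟨by simp; omega, hok⟩ ?_ ?_
      · intro hpos
        rw [Cond.holds_lt, heval] at hpos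
        have hpos : 0 < P.B (σ.arr bj k) (σ.arr bk l) := hpos
        refine run_seq (run_store (by simp [hi', hnv]; omega) (by simp [hx']; omega) ?_)
        refine run_assign (by simp; omega) ?_
        have hBp : P.Better (σ.arr wit) (Function.update (τ'.arr wit)
            (r * P.n + σ.arr bk l) (σ.arr bj k + 1)) :=
          hB'.put hkn hjn (by simpa [Params.adj] using hjmem.2) hpos
        refine ⟨by simp [hv'], ⟨by simp [hF'], ?_, by simp, ?_⟩, by simp [hu'], by simp,
          by simp [hx'], ?_, ?_, ?_⟩
        · simpa [hi', hnv, hx'] using hBp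
        · intro _
          have := hBp.unknowns_lt hpair (by simpa [Params.free] using hkmem.2) (by simp)
          simpa [hi', hnv, hx'] using this
        · intro u₁ hu₁ v₁ hv₁ hb
          have := hcov1 u₁ hu₁ v₁ hv₁ hb
          simp only [State.set_arr, State.tick_arr, State.put_arr, if_true]
          exact update_succ_ne_zero fun _ => by simpa using this
        · intro v₁ hv₁ hb
          simp only [State.set_arr, State.tick_arr, State.put_arr, if_true]
          refine update_succ_ne_zero fun hne => ?_
          have hlt : v₁ < l := by
            by_contra hge
            exact hne (by simp [hi', hnv, show v₁ = l by omega])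
          simpa using hcov2 v₁ hlt hb
        · simp; omega
      · intro hpos
        rw [Cond.holds_lt, heval] at hpos
        have hpos : ¬ 0 < P.B (σ.arr bj k) (σ.arr bk l) := hpos
        refine run_skip ⟨by simp [hv'], ⟨by simp [hF'], by simpa using hB', by simpa using h0',
          by simpa using h1'⟩, by simp [hu'], by simp, by simp [hx'], by simpa using hcov1,
          ?_, ?_⟩
        · intro v₁ hv₁ hb
          rcases Nat.lt_or_ge v₁ l with h | h
          · simpa using hcov2 v₁ h hb
          · obtain rfl : v₁ = l := by omega
            exact absurd hb hpos
        · simp; omega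
    · rintro τ' ⟨⟨hF', hB', h0', h1'⟩, hu', hv', hx', hcov1, hcov2, hc'⟩
      refine ⟨by simp [hu'], ⟨by simp [hF'], by simpa using hB', by simpa using h0',
          by simpa using h1'⟩, by simp, ?_, ?_⟩
      · intro u₁ hu₁ v₁ hv₁ hb
        rcases Nat.lt_or_ge u₁ k with h | h
        · simpa using hcov1 u₁ h v₁ hv₁ hb
        · obtain rfl : u₁ = k := by omega
          simpa using hcov2 v₁ hv₁ hb
      · simp only [State.set_clock, State.tick_clock]
        rw [Nat.succ_mul]; omega
  · rintro τ ⟨⟨hF, hB, h0, h1⟩, hu, hcov, hc⟩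
    refine hPost _ (by simp [hF]) (by simpa using hB) ?_ (by simpa using h0) (by simpa using h1)
      ?_
    · intro j hj k hk hA hBjk
      by_cases hW : σ.arr wit (r * P.n + k) = 0
      · have hj' : j ∈ J.filter (P.adj r) := List.mem_filter.2 ⟨hj, by simpa [Params.adj] using hA⟩
        have hk' : k ∈ K.filter (P.free (σ.arr wit) r) :=
          List.mem_filter.2 ⟨hk, by simpa [Params.free] using hW⟩
        rw [← hσ.segNJ, ← hσ.nj, mem_seg] at hj'
        rw [← hσ.segNK, ← hσ.nk, mem_seg] at hk'
        obtain ⟨u', hu', rfl⟩ := hj'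
        obtain ⟨v', hv', rfl⟩ := hk'
        have := hcov u' hu' v' hv' (by simpa using hBjk)
        simpa using this
      · simpa using hB.mono _ hW
    · have : σ.reg nj * (50 * σ.reg nk + 40) = 50 * (σ.reg nj * σ.reg nk) + 40 * σ.reg nj := by
        ring
      simp; omega

end


/-! ### Tiny nodes, and the search for a row that divides a node -/

open Var Arr

/-- The rows of the present block. -/
structure Rows (P : Params) (r₀ r₁ : ℕ) (σ : State) : Prop where
  i0 : σ.reg i0 = r₀
  i1 : σ.reg i1 = r₁
  le : r₀ ≤ r₁
  le_n : r₁ ≤ P.n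
  le_m : r₁ ≤ r₀ + P.m

theorem Rows.frame {P : Params} {r₀ r₁ : ℕ} {σ τ : State} {S : List Var} {R : List Arr}
    (hσ : Rows P r₀ r₁ σ) (hF : Frame S R σ τ) (hS : ∀ r ∈ [Var.i0, Var.i1], r ∉ S) :
    Rows P r₀ r₁ τ :=
  ⟨(hF.reg _ (hS _ (by decide))).trans hσ.i0, (hF.reg _ (hS _ (by decide))).trans hσ.i1,
    hσ.le, hσ.le_n, hσ.le_m⟩

/-- The variables and arrays that change when a node is solved. -/
abbrev nodeVars : List Var :=
  [cnt, t, x, nj, nk, hit, u, v, y, i, sp, mode, q, p, z, cu, cv, ch, cur, d, te, np, nq]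
abbrev nodeArrs : List Arr := [bj, bk, wit, tab, pj, pk]

namespace Params

/-- The numbers of entries of the lists of row `r`. -/
def cntJ (P : Params) (J : List ℕ) (r : ℕ) : ℕ := (J.filter (P.adj r)).length
def cntK (P : Params) (K : List ℕ) (W : ℕ → ℕ) (r : ℕ) : ℕ := (K.filter (P.free W r)).length

/-- Neither of the lists of row `r` is very short. -/
def Medium (P : Params) (J K : List ℕ) (W : ℕ → ℕ) (r : ℕ) : Prop :=
  J.length ≤ P.cntJ J r * P.gg ∧ K.length ≤ P.cntK K W r * P.gg

end Params

section

variable {Q : ℕ} {P : Params} {J K : List ℕ} {σ : State} {Post : State → Prop} {r₀ r₁ : ℕ}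

/-- There are at most `m` rows, each with a rectangle of at most the area of the node and `O(m)` for
loading its lists. -/
theorem run_tiny (hfit : P.Fits Q) (hσ : AtNode Q P J K σ) (hR : Rows P r₀ r₁ σ)
    (hPost : ∀ τ, Frame nodeVars nodeArrs σ τ → τ.reg sp = σ.reg f →
      P.Better (σ.arr wit) (τ.arr wit) →
      (∀ r, r₀ ≤ r → r < r₁ → P.Covers (τ.arr wit) r J K) →
      τ.clock ≤ σ.clock + 50 * (P.m * (J.length * K.length)) + 400 * (P.m * P.m) → Post τ) :
    Run Q tiny σ Post := by
  have hn := hfit.n_lt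
  have hmn := hfit.m_le
  have hmp := hfit.m_pos
  have hnn : P.n ≤ P.n * P.n := Nat.le_mul_self _
  have hJ := hσ.J_le
  have hK := hσ.K_le
  have hrn := hR.le_n
  have hrm := hR.le_m
  have hr₀ := hR.i0
  refine run_seq (run_assign (by simp) ?_)
  set T := 50 * (J.length * K.length) + 170 * P.m + 110 with hT
  refine run_seq (run_for (fun k τ => Frame nodeVars nodeArrs σ τ ∧ τ.reg i = k ∧
    P.Better (σ.arr wit) (τ.arr wit) ∧
    (∀ r, r₀ ≤ r → r < k → P.Covers (τ.arr wit) r J K) ∧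
    τ.clock ≤ σ.clock + 10 + (k - r₀) * T) r₀ r₁ hR.le (by omega) ?_ ?_ ?_ ?_)
  · refine ⟨by simp [Frame.refl], by simp [hR.i0], by simpa using Params.Better.refl _,
      fun r h1 h2 => by omega, by simp⟩
  · rintro k τ - - ⟨hF, hi, -⟩
    exact ⟨hi, (hF.reg _ (by decide)).trans hR.i1⟩
  · rintro k τ hk hk1 ⟨hF, hi, hB, hcov, hc⟩
    have hτ : AtNode Q P J K (τ.tick 4) := hσ.frame (by simpa using hF) (by decide) (by decide)
    refine run_seq (run_loadRow hfit hτ hi (by omega) ?_)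
    intro υ hG hυ hcυ
    refine run_scan hfit hυ ?_
    rintro ξ hH hB' hcov' - - hcξ
    have hw : υ.arr wit = τ.arr wit := hG.arr wit (by decide)
    have hFξ : Frame nodeVars nodeArrs σ ξ := by
      refine hF.trans (Frame.trans ?_ (hH.mono (by decide) (by decide)))
      simpa using hG.mono (S' := nodeVars) (R' := nodeArrs) (by decide) (by decide)
    rw [hw] at hB'
    have hiξ : ξ.reg i = k := (hH.reg i (by decide)).trans hυ.i
    refine ⟨hiξ, by simp [hFξ], by simp, by simpa using hB.trans hB', ?_, ?_⟩
    · intro r h1 h2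
      rcases Nat.lt_or_ge r k with h | h
      · simpa using hB'.covers (hcov r h1 h)
      · obtain rfl : r = k := by omega
        simpa using hcov'
    · have h1 : υ.reg nj ≤ J.length := by rw [hυ.nj]; exact List.length_filter_le _ _
      have h2 : υ.reg nk ≤ K.length := by rw [hυ.nk]; exact List.length_filter_le _ _
      have h3 : υ.reg nj * υ.reg nk ≤ J.length * K.length := Nat.mul_le_mul h1 h2
      have h4 : (k + 1 - r₀) * T = (k - r₀) * T + T := by
        rw [show k + 1 - r₀ = k - r₀ + 1 by omega, Nat.succ_mul]
      simp at hcυ ⊢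
      omega
  · rintro τ ⟨hF, hi, hB, hcov, hc⟩
    refine run_assign (by simp) (hPost _ (by simp [hF]) ?_ ?_ ?_ ?_)
    · simp [hF.reg f]
    · simpa using hB
    · simpa using hcov
    · have h1 : (r₁ - r₀) * T ≤ P.m * T := Nat.mul_le_mul_right _ (by omega)
      have h2 : P.m * T ≤ 50 * (P.m * (J.length * K.length)) + 280 * (P.m * P.m) := by
        rw [hT]; nlinarith
      have h3 : 1 ≤ P.m * P.m := Nat.one_le_iff_ne_zero.2 (by positivity)
      simp; omega

/-- Value `0` of `mode` means that every medium row is sparse on both sides, which is what a leaf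
needs. Otherwise `mode` tells which side has a `1 / b` part, and the search stops at once, so that
the lists of the row found are still loaded. -/
theorem run_findRow (hfit : P.Fits Q) (hσ : AtNode Q P J K σ) (hR : Rows P r₀ r₁ σ)
    (hPost : ∀ τ, Frame [cnt, t, x, nj, nk, i, mode, q] [bj, bk] σ τ →
      (τ.reg mode = 0 → ∀ r, r₀ ≤ r → r < r₁ → P.Medium J K (σ.arr wit) r →
        P.cntJ J r * P.b < J.length ∧ P.cntK K (σ.arr wit) r * P.b < K.length) →
      (τ.reg mode ≠ 0 → ∃ r, r₀ ≤ r ∧ r < r₁ ∧ AtRow Q P J K r τ ∧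
        P.Medium J K (σ.arr wit) r ∧
        (τ.reg mode = 1 → K.length ≤ P.cntK K (σ.arr wit) r * P.b) ∧
        (τ.reg mode ≠ 1 → J.length ≤ P.cntJ J r * P.b)) →
      τ.clock ≤ σ.clock + 400 * (P.m * P.m) → Post τ) :
    Run Q findRow σ Post := by
  have hn := hfit.n_lt
  have hmn := hfit.m_le
  have hmp := hfit.m_pos
  have hnn : P.n ≤ P.n * P.n := Nat.le_mul_self _
  have hJ := hσ.J_le
  have hK := hσ.K_le
  have hrn := hR.le_n
  have hrm := hR.le_m
  refine run_seq (run_assign (by simp; omega) ?_)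
  refine run_seq (run_assign (by simp) ?_)
  set T := 120 * P.m + 150 with hT
  refine run_loop (fun τ => Frame [cnt, t, x, nj, nk, i, mode, q] [bj, bk] σ τ ∧
    r₀ ≤ τ.reg q ∧ τ.reg q ≤ r₁ ∧ τ.clock ≤ σ.clock + 10 + (τ.reg q - r₀) * T ∧
    (τ.reg mode = 0 → ∀ r, r₀ ≤ r → r < τ.reg q → P.Medium J K (σ.arr wit) r →
        P.cntJ J r * P.b < J.length ∧ P.cntK K (σ.arr wit) r * P.b < K.length) ∧
    (τ.reg mode ≠ 0 → τ.reg q = r₁ ∧ ∃ r, r₀ ≤ r ∧ r < r₁ ∧ AtRow Q P J K r τ ∧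
        P.Medium J K (σ.arr wit) r ∧
        (τ.reg mode = 1 → K.length ≤ P.cntK K (σ.arr wit) r * P.b) ∧
        (τ.reg mode ≠ 1 → J.length ≤ P.cntJ J r * P.b)))
    (fun τ => r₁ - τ.reg q) ?_ ?_ ?_ ?_
  · refine ⟨by simp [Frame.refl], ?_, ?_, ?_, ?_, ?_⟩
    · simp [hR.i0]
    · simp [hR.i0, hR.le]
    · simp; omega
    · intro _ r h1 h2; simp [hR.i0] at h2; omega
    · simp
  · intro τ _; simp
  · rintro τ ⟨hF, hq0, hq1, hc, hm0, hm1⟩ hlt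
    have hi1 : τ.reg i1 = r₁ := (hF.reg i1 (by decide)).trans hR.i1
    simp only [Cond.holds_lt, Expr.eval_var, hi1] at hlt
    have hmode : τ.reg mode = 0 := by
      by_contra h; have := (hm1 h).1; omega
    have hm0 := hm0 hmode
    refine run_seq (run_assign (by simp) ?_)
    set τ' := ((τ.tick ((Cond.lt (Expr.var q) (Expr.var i1)).cost + 1)).tick
      ((Expr.var q).cost + 1)).set i (Expr.eval (τ.tick ((Cond.lt (Expr.var q)
        (Expr.var i1)).cost + 1)) (Expr.var q)) with hτ'
    have hF' : Frame [cnt, t, x, nj, nk, i, mode, q] [bj, bk] σ τ' := by simp [hτ', hF]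
    have hτ : AtNode Q P J K τ' := hσ.frame hF' (by decide) (by decide)
    have hi' : τ'.reg i = τ.reg q := by simp [hτ']
    have hq' : τ'.reg q = τ.reg q := by simp [hτ']
    have hmode' : τ'.reg mode = 0 := by simpa [hτ'] using hmode
    have hc' : τ'.clock ≤ τ.clock + 6 := by simp [hτ']
    have hw' : τ'.arr wit = σ.arr wit := hF'.arr wit (by decide)
    refine run_seq (run_loadRow hfit hτ hi' (by omega) ?_)
    intro υ hG hυ hcυ
    have hqυ : υ.reg q = τ.reg q := (hG.reg q (by decide)).trans hq'
    have hmυ : υ.reg mode = 0 := (hG.reg mode (by decide)).trans hmode'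
    have hwυ : υ.arr wit = σ.arr wit := (hG.arr wit (by decide)).trans hw'
    have hFυ : Frame [cnt, t, x, nj, nk, i, mode, q] [bj, bk] σ υ :=
      hF'.trans (hG.mono (by decide) (by decide))
    have hnj : υ.reg nj = P.cntJ J (τ.reg q) := hυ.nj
    have hnk : υ.reg nk = P.cntK K (σ.arr wit) (τ.reg q) := by rw [hυ.nk, hwυ]; rfl
    have hnjm : υ.reg nj ≤ P.m := by
      rw [hυ.nj]; exact (List.length_filter_le _ _).trans hJ
    have hnkm : υ.reg nk ≤ P.m := by
      rw [hυ.nk]; exact (List.length_filter_le _ _).trans hK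
    have b1 := hfit.gg_lt
    have b2 := hfit.b_lt
    have b3 : υ.reg nj * P.gg ≤ P.m * P.gg := Nat.mul_le_mul_right _ hnjm
    have b4 : υ.reg nk * P.gg ≤ P.m * P.gg := Nat.mul_le_mul_right _ hnkm
    have b5 : υ.reg nj * P.b ≤ P.m * P.b := Nat.mul_le_mul_right _ hnjm
    have b6 : υ.reg nk * P.b ≤ P.m * P.b := Nat.mul_le_mul_right _ hnkm
    have hTs : (τ.reg q + 1 - r₀) * T = (τ.reg q - r₀) * T + T := by
      rw [show τ.reg q + 1 - r₀ = τ.reg q - r₀ + 1 by omega, Nat.succ_mul]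
    have hTm : (τ.reg q + 1 - r₀) * T ≤ (r₁ - r₀) * T := Nat.mul_le_mul_right _ (by omega)
    have hi1υ : υ.reg i1 = r₁ := (hFυ.reg i1 (by decide)).trans hR.i1
    refine run_seq (run_assign (by simp [hqυ]; omega) ?_)
    -- The invariant after a row that does not divide the node. The three branches that reject a row
    -- differ only in the clock, so the claim is made for every state with the right contents.
    have skipCase : ¬ (P.Medium J K (σ.arr wit) (τ.reg q) ∧
        (K.length ≤ P.cntK K (σ.arr wit) (τ.reg q) * P.b ∨
          J.length ≤ P.cntJ J (τ.reg q) * P.b)) →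
        ∀ ξ : State, ξ.reg = (υ.set q (τ.reg q + 1)).reg → ξ.arr = υ.arr → ξ.out = υ.out →
        ξ.clock ≤ υ.clock + 70 →
        (Frame [cnt, t, x, nj, nk, i, mode, q] [bj, bk] σ ξ ∧
    r₀ ≤ ξ.reg q ∧ ξ.reg q ≤ r₁ ∧ ξ.clock ≤ σ.clock + 10 + (ξ.reg q - r₀) * T ∧
    (ξ.reg mode = 0 → ∀ r, r₀ ≤ r → r < ξ.reg q → P.Medium J K (σ.arr wit) r →
        P.cntJ J r * P.b < J.length ∧ P.cntK K (σ.arr wit) r * P.b < K.length) ∧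
    (ξ.reg mode ≠ 0 → ξ.reg q = r₁ ∧ ∃ r, r₀ ≤ r ∧ r < r₁ ∧ AtRow Q P J K r ξ ∧
        P.Medium J K (σ.arr wit) r ∧
        (ξ.reg mode = 1 → K.length ≤ P.cntK K (σ.arr wit) r * P.b) ∧
        (ξ.reg mode ≠ 1 → J.length ≤ P.cntJ J r * P.b))) ∧ r₁ - ξ.reg q < r₁ - τ.reg q := by
      intro hnot ξ h1 h2 h3 h4
      have hFξ : Frame [cnt, t, x, nj, nk, i, mode, q] [bj, bk] σ ξ := by
        have : Frame [cnt, t, x, nj, nk, i, mode, q] [bj, bk] σ (υ.set q (τ.reg q + 1)) := by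
          simp [hFυ]
        exact ⟨fun r hr => (congrFun h1 r).trans (this.reg r hr),
          fun r hr => (congrFun h2 r).trans (this.arr r hr), h3.trans this.out⟩
      have hqξ : ξ.reg q = τ.reg q + 1 := by rw [h1]; simp
      have hmξ : ξ.reg mode = 0 := by rw [h1]; simp [hmυ]
      refine ⟨⟨hFξ, by omega, by omega, ?_, ?_, ?_⟩, by omega⟩
      · rw [hqξ, hTs]; omega
      · rintro - r hr1 hr2 hmed
        rcases Nat.lt_or_ge r (τ.reg q) with h | h
        · exact hm0 r hr1 h hmed
        · obtain rfl : r = τ.reg q := by omega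
          constructor
          · by_contra h'; exact hnot ⟨hmed, Or.inr (by omega)⟩
          · by_contra h'; exact hnot ⟨hmed, Or.inl (by omega)⟩
      · intro h; exact absurd hmξ h
    have eA : Expr.eval υ (Expr.var q + 1) = τ.reg q + 1 := by simp [hqυ]
    have hQ1 : 2 < Q := by omega
    rw [eA]
    refine run_ite (by simp [hυ.gg]; omega) ?_ ?_
    · intro hA
      simp [hυ.gg, hυ.a, hnj] at hA
      refine run_ite (by simp [hυ.gg]; omega) ?_ ?_
      · intro hB
        simp [hυ.gg, hυ.c, hnk] at hB
        have hmed : P.Medium J K (σ.arr wit) (τ.reg q) := ⟨by omega, by omega⟩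
        refine run_ite (by simp [hυ.b]; omega) ?_ ?_
        · intro hC
          simp [hυ.b, hυ.c, hnk] at hC
          refine run_seq (run_assign (by simp; omega) (run_assign (by simp) ?_))
          refine ⟨⟨by simp [hFυ], ?_, ?_, ?_, ?_, ?_⟩, ?_⟩
          · simp [hi1υ, hR.le]
          · simp [hi1υ]
          · simp [hi1υ]; omega
          · simp
          · rintro -
            refine ⟨by simp [hi1υ], τ.reg q, hq0, hlt, ?_, hmed, ?_, ?_⟩
            · refine hυ.frame (S := [mode, q]) (R := []) ?_ (by decide) (by decide)
              simp [Frame.refl]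
            · intro _; omega
            · simp
          · simp [hi1υ]; omega
        · intro hC
          simp [hυ.b, hυ.c, hnk] at hC
          refine run_ite (by simp [hυ.b]; omega) ?_ ?_
          · intro hD
            simp [hυ.b, hυ.a, hnj] at hD
            refine run_seq (run_assign (by simp; omega) (run_assign (by simp) ?_))
            refine ⟨⟨by simp [hFυ], ?_, ?_, ?_, ?_, ?_⟩, ?_⟩
            · simp [hi1υ, hR.le]
            · simp [hi1υ]
            · simp [hi1υ]; omega
            · simp
            · rintro -
              refine ⟨by simp [hi1υ], τ.reg q, hq0, hlt, ?_, hmed, ?_, ?_⟩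
              · refine hυ.frame (S := [mode, q]) (R := []) ?_ (by decide) (by decide)
                simp [Frame.refl]
              · simp
              · intro _; omega
            · simp [hi1υ]; omega
          · intro hD
            simp [hυ.b, hυ.a, hnj] at hD
            refine run_skip (skipCase ?_ _ rfl rfl rfl ?_)
            · rintro ⟨-, h | h⟩ <;> omega
            · simp
      · intro hB
        simp [hυ.gg, hυ.c, hnk] at hB
        refine run_skip (skipCase ?_ _ rfl rfl rfl ?_)
        · rintro ⟨⟨-, h⟩, -⟩; omega
        · simp
    · intro hA
      simp [hυ.gg, hυ.a, hnj] at hA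
      refine run_skip (skipCase ?_ _ rfl rfl rfl ?_)
      · rintro ⟨⟨h, -⟩, -⟩; omega
      · simp
  · rintro τ ⟨hF, hq0, hq1, hc, hm0, hm1⟩ hge
    have hi1 : τ.reg i1 = r₁ := (hF.reg i1 (by decide)).trans hR.i1
    simp only [Cond.holds_lt, Expr.eval_var, hi1] at hge
    obtain hq : τ.reg q = r₁ := by omega
    refine hPost _ (by simp [hF]) ?_ ?_ ?_
    · intro h; rw [hq] at hm0; simpa using hm0 h
    · intro h
      obtain ⟨r, h1, h2, h3, h4⟩ := (hm1 h).2
      exact ⟨r, h1, h2, h3.frame (S := []) (R := []) (by simp [Frame.refl]) (by decide)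
        (by decide), h4⟩
    · have h1 : (r₁ - r₀) * T ≤ P.m * T := Nat.mul_le_mul_right _ (by omega)
      have h2 : P.m * T ≤ 270 * (P.m * P.m) := by rw [hT]; nlinarith
      have h3 : 1 ≤ P.m * P.m := Nat.one_le_iff_ne_zero.2 (by positivity)
      rw [hq] at hc
      simp; omega

end


/-! ### Codes of pieces, and one entry of the table -/

open Var Arr

namespace Params

variable (P : Params)

/-- The positions, counted from one, in the piece with code `p`. -/
def pos (p : ℕ) : List ℕ :=
  (Nat.digits (2 ^ (P.h + 1)) (p % P.dd)).map fun d => p / P.dd * P.g + d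

/-- There is a one of `B` at the positions `x` and `y` of the lists `J` and `K`. -/
def Hit (J K : List ℕ) (x y : ℕ) : Prop :=
  0 < x ∧ 0 < y ∧ ∃ j k, J[x - 1]? = some j ∧ K[y - 1]? = some k ∧ 0 < P.B j k

theorem g_pos : 0 < P.g := by unfold g; positivity
theorem dd_pos : 0 < P.dd := by unfold dd; positivity

theorem pow_succ_h : 2 ^ (P.h + 1) = 2 * P.g := by rw [g, pow_succ]; ring

theorem one_lt_base : 1 < 2 ^ (P.h + 1) := Nat.one_lt_two_pow (by omega)

theorem dd_eq : P.dd = (2 ^ (P.h + 1)) ^ P.s := by rw [dd, pow_mul]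

variable {P}

theorem Fits.base_le {Q : ℕ} (hfit : P.Fits Q) : 2 * P.g ≤ P.dd := by
  rw [← pow_succ_h, dd_eq]
  calc 2 ^ (P.h + 1) = (2 ^ (P.h + 1)) ^ 1 := (pow_one _).symm
    _ ≤ _ := Nat.pow_le_pow_right (by positivity) hfit.s_pos

theorem xx_pos : 0 < P.xx := Nat.mul_pos (Nat.succ_pos _) P.dd_pos

theorem dd_le_xx : P.dd ≤ P.xx := Nat.le_mul_of_pos_left _ (Nat.succ_pos _)

theorem Fits.xx_lt' {Q : ℕ} (hfit : P.Fits Q) : P.xx < Q :=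
  lt_of_le_of_lt (Nat.le_mul_self _) hfit.xx_lt

theorem code_lt {ch cu : ℕ} (h1 : ch * P.g ≤ P.m) (h2 : cu < P.dd) : ch * P.dd + cu < P.xx := by
  have h3 : ch ≤ P.m / P.g := (Nat.le_div_iff_mul_le P.g_pos).2 h1
  have h4 : ch * P.dd ≤ P.m / P.g * P.dd := Nat.mul_le_mul_right _ h3
  rw [xx, Nat.succ_mul]; omega

theorem pos_code {ch cu : ℕ} (h : cu < P.dd) :
    P.pos (ch * P.dd + cu) = (Nat.digits (2 ^ (P.h + 1)) cu).map fun d => ch * P.g + d := by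
  have h1 : (ch * P.dd + cu) % P.dd = cu := by
    rw [Nat.add_comm, Nat.add_mul_mod_self_right, Nat.mod_eq_of_lt h]
  have h2 : (ch * P.dd + cu) / P.dd = ch := by
    rw [Nat.mul_comm, Nat.mul_add_div P.dd_pos, Nat.div_eq_of_lt h, Nat.add_zero]
  rw [pos, h1, h2]

theorem chunk_le {p : ℕ} (hp : p < P.xx) : p / P.dd * P.g ≤ P.m := by
  have : p / P.dd < P.m / P.g + 1 := by
    rw [Nat.div_lt_iff_lt_mul P.dd_pos]; exact hp
  calc p / P.dd * P.g ≤ P.m / P.g * P.g := Nat.mul_le_mul_right _ (by omega)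
    _ ≤ P.m := Nat.div_mul_le_self _ _

end Params

theorem sub_div_mul (a b : ℕ) : a - a / b * b = a % b := by
  have := Nat.div_add_mod a b
  rw [Nat.mul_comm] at this
  omega

section

variable {Q : ℕ} {P : Params} {J K : List ℕ} {σ : State} {Post : State → Prop}

/-- The digits of both codes are read from the lowest one on. The table is filled for all codes,
also for those that no row produces; this is why positions outside the lists have to be rejected by
tests. Each code has at most `s` digits, hence the square. -/
theorem run_tableEntry (hfit : P.Fits Q) (hσ : AtNode Q P J K σ) {p' q' : ℕ}
    (hp : σ.reg p = p') (hq : σ.reg q = q') (hp' : p' < P.xx) (hq' : q' < P.xx)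
    (hPost : ∀ τ, Frame [z, cu, cv, x, y] [] σ τ →
      (τ.reg z ≠ 0 ↔ ∃ x ∈ P.pos p', ∃ y ∈ P.pos q', P.Hit J K x y) →
      τ.clock ≤ σ.clock + 200 * ((P.s + 1) * (P.s + 1)) → Post τ) :
    Run Q tableEntry σ Post := by
  have hxx := hfit.xx_lt'
  have hdx := P.dd_le_xx
  have hbd := hfit.base_le
  have hg := P.g_pos
  have hn := hfit.n_lt
  have hbs := hσ.bs
  have hJm := hσ.J_le
  have hKm := hσ.K_le
  have hhs : (P.h + 1) * P.s < P.dd := Nat.lt_two_pow_self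
  have hcp := Params.chunk_le hp'
  have hcq := Params.chunk_le hq'
  -- A position is at most `m` plus a digit below `2 g`; this estimate keeps it below `Q`.
  have hmx : P.m + 2 * P.g ≤ P.xx + P.g := by
    have h1 : P.m < (P.m / P.g + 1) * P.g := by
      rw [Nat.succ_mul, Nat.mul_comm]
      have := Nat.div_add_mod P.m P.g; have := Nat.mod_lt P.m hg
      omega
    have h2 : (P.m / P.g + 1) * (2 * P.g) ≤ P.xx := Nat.mul_le_mul_left _ hbd
    have h3 : (P.m / P.g + 1) * (2 * P.g) = (P.m / P.g + 1) * P.g + (P.m / P.g + 1) * P.g := by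
      ring
    have h4 : P.g ≤ (P.m / P.g + 1) * P.g := Nat.le_mul_of_pos_left _ (Nat.succ_pos _)
    omega
  have hxq : P.m + 2 * P.g < Q := by
    have h1 : 2 * P.xx ≤ P.xx * P.xx := Nat.mul_le_mul_right _ (by omega)
    have h2 := hfit.xx_lt
    omega
  -- A shift by `(h + 1) s` bits separates the chunk number from the digits.
  have hpq : ∀ p, p / 2 ^ ((P.h + 1) * P.s) = p / P.dd := fun p => rfl
  have hcode : ∀ p < P.xx, p / P.dd * P.dd < Q := fun p hp =>
    lt_of_le_of_lt (Nat.div_mul_le_self _ _) (by omega)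
  have hlen : ∀ p, (Nat.digits (2 ^ (P.h + 1)) (p % P.dd)).length ≤ P.s := fun p => by
    rw [Nat.digits_length_le_iff P.one_lt_base, ← Params.dd_eq]
    exact Nat.mod_lt _ P.dd_pos
  have hdigit : ∀ c, c % 2 ^ (P.h + 1) < 2 * P.g := fun c => by
    rw [← Params.pow_succ_h]; exact Nat.mod_lt _ (by positivity)
  refine run_seq (run_assign (by simp; omega) ?_)
  refine run_seq (run_assign ?_ ?_)
  · have := hcode p' hp'
    have := Nat.div_mul_le_self p' P.dd
    simp [hp, hσ.hd, hσ.s, hσ.dd, hpq]; omega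
  have e0 : Expr.eval ((σ.tick ((0 : Expr).cost + 1)).set z (Expr.eval σ 0))
      (Expr.var p - (Expr.var p).shr (Expr.var hd * Expr.var s) * Expr.var dd) = p' % P.dd := by
    simp [hp, hσ.hd, hσ.s, hσ.dd, hpq, sub_div_mul]
  rw [e0]
  set T := (P.s + 1) * 120 with hT
  -- A hit exists if and only if it has been recorded in `z` or involves a digit that is still in
  -- `cu`; the number of remaining digits bounds the remaining time. The inner loop has the same
  -- invariant for `cv`.
  refine run_loop (fun τ => Frame [z, cu, cv, x, y] [] σ τ ∧
    ((∃ x ∈ P.pos p', ∃ y ∈ P.pos q', P.Hit J K x y) ↔ τ.reg z ≠ 0 ∨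
      ∃ d ∈ Nat.digits (2 ^ (P.h + 1)) (τ.reg cu), ∃ y ∈ P.pos q',
        P.Hit J K (p' / P.dd * P.g + d) y) ∧ τ.reg cu < P.dd ∧
    τ.clock + (Nat.digits (2 ^ (P.h + 1)) (τ.reg cu)).length * T ≤ σ.clock + P.s * T + 20)
    (fun τ => τ.reg cu) ?_ ?_ ?_ ?_
  · refine ⟨by simp [Frame.refl], by simp [Params.pos], by simp [Nat.mod_lt _ P.dd_pos], ?_⟩
    have := Nat.mul_le_mul_right T (hlen p')
    simp; omega
  · intro τ _; simp; omega
  · rintro τ ⟨hF, hiff, hcu, hc⟩ hpos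
    simp only [Cond.holds_lt, Expr.eval_var, Expr.eval_lit] at hpos
    have hdig := Nat.digits_def' P.one_lt_base hpos
    rw [hdig, List.length_cons, Nat.succ_mul] at hc
    simp only [hdig, List.mem_cons, exists_eq_or_imp] at hiff
    set c0 := τ.reg cu with hc0
    have hτ := hσ.frame hF (by decide) (by decide)
    have hpτ : τ.reg p = p' := (hF.reg p (by decide)).trans hp
    have hqτ : τ.reg q = q' := (hF.reg q (by decide)).trans hq
    have hlt : c0 / 2 ^ (P.h + 1) < c0 := Nat.div_lt_self hpos P.one_lt_base
    have hle := Nat.div_mul_le_self c0 (2 ^ (P.h + 1))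
    have hd0 := hdigit c0
    have e1 : Expr.eval (τ.tick ((Cond.lt 0 (Expr.var cu)).cost + 1)) (Expr.var cu -
        ((Expr.var cu).shr (Expr.var hd)).shl (Expr.var hd) +
        (Expr.var p).shr (Expr.var hd * Expr.var s) * Expr.var g) =
        c0 % 2 ^ (P.h + 1) + p' / P.dd * P.g := by
      simp [hpτ, hτ.hd, hτ.s, hτ.g, hpq, sub_div_mul, ← hc0]
    refine run_seq (run_assign ?_ ?_)
    · have e2 := sub_div_mul c0 (2 ^ (P.h + 1))
      have hdx := Nat.div_mul_le_self p' P.dd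
      simp only [Expr.ok_add, Expr.ok_sub, Expr.ok_shl, Expr.ok_shr, Expr.ok_mul, Expr.ok_var,
        Expr.eval_sub, Expr.eval_mul, Expr.eval_shr, Expr.eval_shl, Expr.eval_var,
        State.tick_reg, hpτ, hτ.hd, hτ.s, hτ.g, hpq, ← hc0, e2, true_and]
      omega
    rw [e1]
    set x0 := c0 % 2 ^ (P.h + 1) + p' / P.dd * P.g with hx0
    refine run_seq (run_assign (by simp) ?_)
    -- what remains to be shown when this digit has been treated
    have key : ∀ υ : State, Frame [z, cu, cv, x, y] [] σ υ → υ.reg cu = c0 / 2 ^ (P.h + 1) →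
        (υ.reg z ≠ 0 ↔ τ.reg z ≠ 0 ∨ ∃ y ∈ P.pos q', P.Hit J K x0 y) →
        υ.clock ≤ τ.clock + T →
        (Frame [z, cu, cv, x, y] [] σ υ ∧
        ((∃ x ∈ P.pos p', ∃ y ∈ P.pos q', P.Hit J K x y) ↔ υ.reg z ≠ 0 ∨
          ∃ d ∈ Nat.digits (2 ^ (P.h + 1)) (υ.reg cu), ∃ y ∈ P.pos q',
            P.Hit J K (p' / P.dd * P.g + d) y) ∧ υ.reg cu < P.dd ∧
        υ.clock + (Nat.digits (2 ^ (P.h + 1)) (υ.reg cu)).length * T ≤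
          σ.clock + P.s * T + 20) ∧ υ.reg cu < c0 := by
      intro υ h1 h2 h3 h4
      refine ⟨⟨h1, ?_, by omega, by rw [h2]; omega⟩, by omega⟩
      rw [hiff, h3, h2, Nat.add_comm (p' / P.dd * P.g) (c0 % 2 ^ (P.h + 1)), ← hx0, or_assoc]
    have hT120 : 120 * P.s + 120 = T := by rw [hT]; ring
    refine run_ite (by simp; omega) ?_ ?_
    · intro hxpos
      simp at hxpos
      refine run_ite (by simp [hτ.a]; omega) ?_ ?_
      · intro hxa
        simp [hτ.a] at hxa
        obtain ⟨j0, hj0⟩ : ∃ j0, J[x0 - 1]? = some j0 :=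
          ⟨_, List.getElem?_eq_getElem (by omega)⟩
        have hj0' : τ.arr sj (τ.reg bs + (x0 - 1)) = j0 := by
          have h1 := hτ.segJ
          have h2 : J[x0 - 1]? = some (τ.arr sj (τ.reg bs + (x0 - 1))) := by
            conv_lhs => rw [← h1]
            simp [seg, List.getElem?_range (show x0 - 1 < J.length by omega)]
          rw [hj0] at h2
          exact (Option.some.inj h2).symm
        have hj0n : j0 < P.n := hσ.J_lt _ (List.mem_of_getElem? hj0)
        have hbs' := hτ.bs
        refine run_seq (run_assign (by simp; omega) ?_)
        have e2 : τ.reg bs + x0 - 1 = τ.reg bs + (x0 - 1) := by omega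
        simp only [Expr.eval_get, Expr.eval_sub, Expr.eval_add, Expr.eval_var, Expr.eval_lit,
          State.tick_reg, State.set_reg, State.tick_arr, State.set_arr, if_true, reduceCtorEq,
          if_false, e2, hj0', hτ.hd]
        refine run_seq (run_assign ?_ ?_)
        · have := hcode q' hq'
          have := Nat.div_mul_le_self q' P.dd
          simp [hqτ, hτ.hd, hτ.s, hτ.dd, hpq]; omega
        simp only [Expr.eval_sub, Expr.eval_mul, Expr.eval_shr, Expr.eval_var, Expr.eval_lit,
          State.tick_reg, State.set_reg, if_true, reduceCtorEq,
          if_false, hqτ, hτ.hd, hτ.s, hτ.dd, hpq, sub_div_mul]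
        refine run_loop (fun υ => Frame [z, cu, cv, x, y] [] σ υ ∧
          υ.reg cu = c0 / 2 ^ (P.h + 1) ∧ υ.reg x = j0 ∧ υ.reg cv < P.dd ∧
          (τ.reg z ≠ 0 ∨ (∃ y ∈ P.pos q', P.Hit J K x0 y) ↔ υ.reg z ≠ 0 ∨
            ∃ d ∈ Nat.digits (2 ^ (P.h + 1)) (υ.reg cv),
              P.Hit J K x0 (q' / P.dd * P.g + d)) ∧
          υ.clock + (Nat.digits (2 ^ (P.h + 1)) (υ.reg cv)).length * 100 ≤
            τ.clock + P.s * 100 + 100) (fun υ => υ.reg cv) ?_ ?_ ?_ ?_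
        · refine ⟨by simp [hF], by simp [← hc0], by simp, by simp [Nat.mod_lt _ P.dd_pos],
            by simp [Params.pos], ?_⟩
          have := hlen q'
          simp; omega
        · intro υ _; simp; omega
        · rintro υ ⟨hG, hcuυ, hxυ, hcv, hiff', hc'⟩ hpos'
          simp only [Cond.holds_lt, Expr.eval_var, Expr.eval_lit] at hpos'
          have hdig' := Nat.digits_def' P.one_lt_base hpos'
          rw [hdig', List.length_cons, Nat.succ_mul] at hc'
          simp only [hdig', List.mem_cons, exists_eq_or_imp] at hiff'
          set c1 := υ.reg cv with hc1
          have hυ := hσ.frame hG (by decide) (by decide)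
          have hqυ : υ.reg q = q' := (hG.reg q (by decide)).trans hq
          have hlt' : c1 / 2 ^ (P.h + 1) < c1 := Nat.div_lt_self hpos' P.one_lt_base
          have hle' := Nat.div_mul_le_self c1 (2 ^ (P.h + 1))
          have hd1 := hdigit c1
          refine run_seq (run_assign ?_ ?_)
          · have e2 := sub_div_mul c1 (2 ^ (P.h + 1))
            simp only [Expr.ok_add, Expr.ok_sub, Expr.ok_shl, Expr.ok_shr, Expr.ok_mul,
              Expr.ok_var, Expr.eval_sub, Expr.eval_mul, Expr.eval_shr, Expr.eval_shl,
              Expr.eval_var, State.tick_reg, hqυ, hυ.hd, hυ.s, hυ.g, hpq, ← hc1, e2, true_and]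
            omega
          simp only [Expr.eval_sub, Expr.eval_mul, Expr.eval_shr, Expr.eval_shl, Expr.eval_add,
            Expr.eval_var, Expr.eval_lit, State.tick_reg, State.set_reg, if_true, reduceCtorEq,
            if_false, hqυ, hυ.hd, hυ.s, hυ.g, hpq, sub_div_mul, ← hc1]
          set y0 := c1 % 2 ^ (P.h + 1) + q' / P.dd * P.g with hy0
          refine run_seq (run_assign (by simp) ?_)
          have key' : ∀ ξ : State, Frame [z, cu, cv, x, y] [] σ ξ →
              ξ.reg cu = c0 / 2 ^ (P.h + 1) → ξ.reg x = j0 →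
              ξ.reg cv = c1 / 2 ^ (P.h + 1) →
              (ξ.reg z ≠ 0 ↔ υ.reg z ≠ 0 ∨ P.Hit J K x0 y0) → ξ.clock ≤ υ.clock + 100 →
              (Frame [z, cu, cv, x, y] [] σ ξ ∧
              ξ.reg cu = c0 / 2 ^ (P.h + 1) ∧ ξ.reg x = j0 ∧ ξ.reg cv < P.dd ∧
              (τ.reg z ≠ 0 ∨ (∃ y ∈ P.pos q', P.Hit J K x0 y) ↔ ξ.reg z ≠ 0 ∨
                ∃ d ∈ Nat.digits (2 ^ (P.h + 1)) (ξ.reg cv),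
                  P.Hit J K x0 (q' / P.dd * P.g + d)) ∧
              ξ.clock + (Nat.digits (2 ^ (P.h + 1)) (ξ.reg cv)).length * 100 ≤
                τ.clock + P.s * 100 + 100) ∧ ξ.reg cv < c1 := by
            intro ξ h1 h2 h3 h4 h5 h6
            refine ⟨⟨h1, h2, h3, by omega, ?_, by rw [h4]; omega⟩, by omega⟩
            rw [hiff', h5, h4, Nat.add_comm (q' / P.dd * P.g) (c1 % 2 ^ (P.h + 1)), ← hy0,
              or_assoc]
          refine run_ite (by simp; omega) ?_ ?_
          · intro hypos
            simp at hypos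
            refine run_ite (by simp [hυ.c]; omega) ?_ ?_
            · intro hyc
              simp [hυ.c] at hyc
              obtain ⟨k0, hk0⟩ : ∃ k0, K[y0 - 1]? = some k0 :=
                ⟨_, List.getElem?_eq_getElem (by omega)⟩
              have hk0' : υ.arr sk (υ.reg bs + (y0 - 1)) = k0 := by
                have h1 := hυ.segK
                have h2 : K[y0 - 1]? = some (υ.arr sk (υ.reg bs + (y0 - 1))) := by
                  conv_lhs => rw [← h1]
                  simp [seg, List.getElem?_range (show y0 - 1 < K.length by omega)]
                rw [hk0] at h2
                exact (Option.some.inj h2).symm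
              have hk0n : k0 < P.n := hσ.K_lt _ (List.mem_of_getElem? hk0)
              have hbs'' := hυ.bs
              refine run_seq (run_assign (by simp; omega) ?_)
              have e3 : υ.reg bs + y0 - 1 = υ.reg bs + (y0 - 1) := by omega
              simp only [Expr.eval_get, Expr.eval_sub, Expr.eval_add, Expr.eval_var,
                Expr.eval_lit, State.tick_reg, State.set_reg, State.tick_arr, State.set_arr,
                if_true, reduceCtorEq, if_false, e3, hk0', hυ.hd]
              have hHit : P.Hit J K x0 y0 ↔ 0 < P.B j0 k0 := by
                simp [Params.Hit, hj0, hk0, hxpos, hypos]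
              have hpair := pair_lt hj0n hk0n
              refine run_ite ?_ ?_ ?_
              · simp [hυ.n, hxυ]; omega
              · intro hB
                have hB : 0 < P.B j0 k0 := by
                  simpa [hυ.n, hxυ, hυ.inp, Params.B] using hB
                refine run_assign (by simp; omega) (key' _ (by simp [hG]) (by simp [hcuυ])
                  (by simp [hxυ]) (by simp [hυ.hd, ← hc1]) ?_ ?_)
                · simp [hHit, hB]
                · simp
              · intro hB
                have hB : ¬ 0 < P.B j0 k0 := by
                  simpa [hυ.n, hxυ, hυ.inp, Params.B] using hB
                refine run_skip (key' _ (by simp [hG]) (by simp [hcuυ])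
                  (by simp [hxυ]) (by simp [hυ.hd, ← hc1]) ?_ ?_)
                · simp [hHit, hB]
                · simp
            · intro hyc
              simp [hυ.c] at hyc
              have hHit : ¬ P.Hit J K x0 y0 := by
                rintro ⟨-, -, j, k, -, hk, -⟩
                have := (List.getElem?_eq_some_iff.1 hk).1
                omega
              refine run_skip (key' _ (by simp [hG]) (by simp [hcuυ])
                  (by simp [hxυ]) (by simp [hυ.hd, ← hc1]) ?_ ?_)
              · simp [hHit]
              · simp
          · intro hypos
            simp at hypos
            have hHit : ¬ P.Hit J K x0 y0 := by
              rintro ⟨-, h, -⟩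
              omega
            refine run_skip (key' _ (by simp [hG]) (by simp [hcuυ])
                (by simp [hxυ]) (by simp [hυ.hd, ← hc1]) ?_ ?_)
            · simp [hHit]
            · simp
        · rintro υ ⟨hG, hcuυ, hxυ, hcv, hiff', hc'⟩ hneg
          have hcv0 : υ.reg cv = 0 := by simpa using hneg
          rw [hcv0] at hiff' hc'
          refine key _ (by simp [hG]) (by simp [hcuυ]) ?_ ?_
          · rw [hiff']; simp
          · simp at hc' ⊢; omega
      · intro hxa
        simp [hτ.a] at hxa
        have hHit : ∀ y, ¬ P.Hit J K x0 y := by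
          rintro y ⟨-, -, j, k, hj, -⟩
          have := (List.getElem?_eq_some_iff.1 hj).1
          omega
        refine run_skip (key _ (by simp [hF]) (by simp [hτ.hd, ← hc0]) ?_ ?_)
        · simp [hHit]
        · simp; omega
    · intro hxpos
      simp at hxpos
      have hHit : ∀ y, ¬ P.Hit J K x0 y := by
        rintro y ⟨h, -⟩
        omega
      refine run_skip (key _ (by simp [hF]) (by simp [hτ.hd, ← hc0]) ?_ ?_)
      · simp [hHit]
      · simp; omega
  · rintro τ ⟨hF, hiff, hcu, hc⟩ hneg
    have hcu0 : τ.reg cu = 0 := by simpa using hneg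
    rw [hcu0] at hiff hc
    refine hPost _ (by simp [hF]) (by rw [hiff]; simp) ?_
    have : P.s * T + 24 ≤ 200 * ((P.s + 1) * (P.s + 1)) := by rw [hT]; nlinarith
    simp at hc ⊢; omega

end


/-! ### The table of a node, and cutting lists into pieces -/

open Var Arr

section

variable {Q : ℕ} {P : Params} {J K : List ℕ} {σ : State} {Post : State → Prop}

/-- The table refers to positions in `J` and `K`, so it is computed once for a leaf and serves all
rows of the block. -/
theorem run_table (hfit : P.Fits Q) (hσ : AtNode Q P J K σ)
    (hPost : ∀ τ, Frame [z, cu, cv, x, y, p, q] [tab] σ τ →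
      (∀ p' < P.xx, ∀ q' < P.xx, (τ.arr tab (p' * P.xx + q') ≠ 0 ↔
        ∃ x ∈ P.pos p', ∃ y ∈ P.pos q', P.Hit J K x y)) →
      τ.clock ≤ σ.clock + 300 * (P.xx * P.xx * ((P.s + 1) * (P.s + 1))) → Post τ) :
    Run Q table σ Post := by
  have hxx := hfit.xx_lt'
  have hxx2 := hfit.xx_lt
  have hxp := P.xx_pos
  have hQ : 0 < Q := by omega
  set D := (P.s + 1) * (P.s + 1) with hD
  have hD1 : 1 ≤ D := Nat.mul_pos (Nat.succ_pos _) (Nat.succ_pos _)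
  set U := P.xx * (200 * D + 30) + 20 with hU
  refine run_seq (run_assign (by simp [hQ]) ?_)
  refine run_for (fun k τ => Frame [z, cu, cv, x, y, p, q] [tab] σ τ ∧ τ.reg p = k ∧
    (∀ p' < k, ∀ q' < P.xx, (τ.arr tab (p' * P.xx + q') ≠ 0 ↔
        ∃ x ∈ P.pos p', ∃ y ∈ P.pos q', P.Hit J K x y)) ∧
    τ.clock ≤ σ.clock + 10 + k * U) 0 P.xx (Nat.zero_le _) hxx ?_ ?_ ?_ ?_
  · simp [Frame.refl]
  · rintro k τ - - ⟨hF, hp, -⟩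
    exact ⟨hp, (hF.reg _ (by decide)).trans hσ.xx⟩
  · rintro k τ - hk ⟨hF, hp, htab, hc⟩
    refine run_seq (run_assign (by simp [hQ]) ?_)
    refine run_for (fun l τ' => Frame [z, cu, cv, x, y, p, q] [tab] σ τ' ∧ τ'.reg p = k ∧
      τ'.reg q = l ∧
      (∀ p' < k, ∀ q' < P.xx, (τ'.arr tab (p' * P.xx + q') ≠ 0 ↔
        ∃ x ∈ P.pos p', ∃ y ∈ P.pos q', P.Hit J K x y)) ∧
      (∀ q' < l, (τ'.arr tab (k * P.xx + q') ≠ 0 ↔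
        ∃ x ∈ P.pos k, ∃ y ∈ P.pos q', P.Hit J K x y)) ∧
      τ'.clock ≤ σ.clock + 10 + k * U + 6 + l * (200 * D + 30))
      0 P.xx (Nat.zero_le _) hxx ?_ ?_ ?_ ?_
    · refine ⟨by simp [hF], by simp [hp], by simp, by simpa using htab, by simp, ?_⟩
      simp; omega
    · rintro l τ' - - ⟨hF', -, hq, -⟩
      exact ⟨hq, (hF'.reg _ (by decide)).trans hσ.xx⟩
    · rintro l τ' - hl ⟨hF', hp', hq', htab1, htab2, hc'⟩
      have hτ' : AtNode Q P J K (τ'.tick 4) :=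
        hσ.frame (by simpa using hF') (by decide) (by decide)
      have hpair := pair_lt hk hl
      have hle : k * P.xx ≤ k * P.xx + l := Nat.le_add_right _ _
      refine run_seq (run_tableEntry hfit hτ' hp' hq' hk hl ?_)
      intro υ hG hz hcυ
      have hpυ : υ.reg p = k := (hG.reg p (by decide)).trans hp'
      have hqυ : υ.reg q = l := (hG.reg q (by decide)).trans hq'
      have hxυ : υ.reg xx = P.xx := (hG.reg xx (by decide)).trans hτ'.xx
      have htυ : υ.arr tab = τ'.arr tab := hG.arr tab (by decide)
      have hFυ : Frame [z, cu, cv, x, y, p, q] [tab] σ υ :=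
        hF'.trans (Frame.tick_left_iff.1 (hG.mono (by decide) (by decide)))
      refine run_store (by simp [hpυ, hqυ, hxυ]; omega) (by simp) ?_
      simp only [Expr.eval_add, Expr.eval_mul, Expr.eval_var, hpυ, hqυ, hxυ]
      refine ⟨by simp [hqυ], by simp [hFυ], by simp [hpυ], by simp, ?_, ?_, ?_⟩
      · intro p' hp'' q' hq''
        have hne : p' * P.xx + q' ≠ k * P.xx + l := by
          intro h
          have := (pair_inj hq'' hl h).1
          omega
        simpa [htυ, Function.update_of_ne hne] using htab1 p' hp'' q' hq''
      · intro q' hq''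
        by_cases h : q' = l
        · subst h
          simpa using hz
        · have hne : k * P.xx + q' ≠ k * P.xx + l := by omega
          simpa [htυ, Function.update_of_ne hne] using htab2 q' (by omega)
      · rw [Nat.succ_mul]; simp at hcυ ⊢; omega
    · rintro τ' ⟨hF', hp', hq', htab1, htab2, hc'⟩
      refine ⟨by simp [hp'], by simp [hF'], by simp, ?_, ?_⟩
      · intro p' hp'' q' hq''
        by_cases h : p' = k
        · subst h; simpa using htab2 q' hq''
        · simpa using htab1 p' (by omega) q' hq''
      · rw [Nat.succ_mul]; simp; omega
  · rintro τ ⟨hF, hp, htab, hc⟩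
    refine hPost _ (by simp [hF]) (by simpa using htab) ?_
    have h1 : P.xx * U = 200 * (P.xx * P.xx * D) + 30 * (P.xx * P.xx) + 20 * P.xx := by
      rw [hU]; ring
    have h2 : P.xx * P.xx ≤ P.xx * P.xx * D := Nat.le_mul_of_pos_right _ hD1
    have h3 : P.xx ≤ P.xx * P.xx := Nat.le_mul_self _
    simp; omega

/-- A code of a piece that consists of kept entries. -/
def Params.IsPiece (P : Params) (L : List ℕ) (keep : ℕ → Bool) (code : ℕ) : Prop :=
  code < P.xx ∧ ∀ x ∈ P.pos code, 0 < x ∧ ∃ j, L[x - 1]? = some j ∧ keep j = true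

/-- A piece is closed either because it has `s` entries or because its chunk ends. The first happens
at most once for `s` kept entries, the second once for each chunk; this is the bound for the number
of pieces. -/
theorem run_piecesCmd (hfit : P.Fits Q) {src dst : Arr} {len : Var} {keep : Cond} (L : List ℕ)
    (kp : ℕ → Bool) (hσ : Consts P σ) (hlenv : σ.reg len = L.length)
    (hL : seg (σ.arr src) (σ.reg bs) L.length = L)
    (hlen : len ∉ [cnt, ch, t, cur, d, te, x]) (hLm : L.length ≤ P.m) (hsd : src ≠ dst)
    (hdi : dst ≠ Arr.inp) (hbs : σ.reg bs + P.m < Q)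
    (hkeep : ∀ τ, Frame [cnt, ch, t, cur, d, te, x] [dst] σ τ → τ.reg x ∈ L →
      keep.Ok Q τ ∧ (keep.Holds τ ↔ kp (τ.reg x) = true))
    (hcost : keep.cost ≤ 20)
    (hPost : ∀ τ, Frame [cnt, ch, t, cur, d, te, x] [dst] σ τ →
      (∀ u < τ.reg cnt, P.IsPiece L kp (τ.arr dst u)) →
      (∀ t j, L[t]? = some j → kp j = true → ∃ u < τ.reg cnt, t + 1 ∈ P.pos (τ.arr dst u)) →
      τ.reg cnt ≤ L.length / P.g + 1 + (L.filter kp).length / P.s →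
      τ.clock ≤ σ.clock + 200 * P.m + 200 → Post τ) :
    Run Q (piecesCmd src len keep dst) σ Post := by
  have hn := hfit.n_lt
  have hmn := hfit.m_le
  have hnn : P.n ≤ P.n * P.n := Nat.le_mul_self _
  have hg := P.g_pos
  have hs := hfit.s_pos
  have hxx := hfit.xx_lt'
  have hQ : 0 < Q := by omega
  simp only [List.mem_cons, List.not_mem_nil, or_false, not_or] at hlen
  have hkept : ∀ k, ((L.take k).filter kp).length ≤ L.length := fun k =>
    (List.length_filter_le _ _).trans (List.length_take_le' _ _)
  have hgQ : P.m + P.g < Q := by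
    have h1 : P.m < (P.m / P.g + 1) * P.g := by
      rw [Nat.succ_mul, Nat.mul_comm]
      have := Nat.div_add_mod P.m P.g; have := Nat.mod_lt P.m hg
      omega
    have h2 : (P.m / P.g + 1) * (2 * P.g) ≤ P.xx := Nat.mul_le_mul_left _ hfit.base_le
    have h3 : (P.m / P.g + 1) * (2 * P.g) = (P.m / P.g + 1) * P.g + (P.m / P.g + 1) * P.g := by
      ring
    have h4 : P.g ≤ (P.m / P.g + 1) * P.g := Nat.le_mul_of_pos_left _ (Nat.succ_pos _)
    omega
  -- A cruder bound without the factor `s`, needed only to keep the counter below `Q`.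
  have hcntle : ∀ {N c k : ℕ}, N * P.s ≤ c * P.s + ((L.take k).filter kp).length →
      N ≤ c + ((L.take k).filter kp).length := by
    intro N c k h
    refine Nat.le_of_mul_le_mul_right (h.trans ?_) hs
    rw [Nat.add_mul]
    exact Nat.add_le_add_left (Nat.le_mul_of_pos_right _ hs) _
  have hempty : ∀ {c : ℕ}, c * P.g ≤ P.m → P.IsPiece L kp (c * P.dd + 0) := by
    intro c hc
    refine ⟨Params.code_lt hc P.dd_pos, ?_⟩
    rw [Params.pos_code P.dd_pos]; simp
  -- the state between two chunks
  let Inv : ℕ → ℕ → State → Prop := fun c k τ => Frame [cnt, ch, t, cur, d, te, x] [dst] σ τ ∧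
    τ.reg t = k ∧ τ.reg ch = c ∧ k ≤ L.length ∧ c ≤ L.length / P.g + 1 ∧
    (k = c * P.g ∨ k = L.length) ∧
    (∀ u < τ.reg cnt, P.IsPiece L kp (τ.arr dst u)) ∧
    (∀ t j, t < k → L[t]? = some j → kp j = true →
      ∃ u < τ.reg cnt, t + 1 ∈ P.pos (τ.arr dst u)) ∧
    τ.reg cnt * P.s ≤ c * P.s + ((L.take k).filter kp).length ∧
    τ.clock ≤ σ.clock + 10 + c * 50 + k * 70
  refine run_seq (run_assign (by simp [hQ]) ?_)
  refine run_seq (run_assign (by simp [hQ]) ?_)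
  refine run_seq (run_assign (by simp [hQ]) ?_)
  refine run_loop (fun τ => ∃ c k, Inv c k τ) (fun τ => L.length - τ.reg t) ⟨0, 0, ?_⟩ ?_ ?_ ?_
  · simp [Inv, Frame.refl]
  · intro τ _; simp
  · rintro τ ⟨c, k, hF, ht, hch, hkL, hcL, hkc, hval, hcov, hcnt, hck⟩ hlt
    have hlenτ : τ.reg len = L.length := (hF.reg len (by simp [hlen])).trans hlenv
    have hτ := hσ.frame hF (by decide) (by simpa using hdi.symm)
    simp only [Cond.holds_lt, Expr.eval_var, ht, hlenτ] at hlt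
    obtain rfl : k = c * P.g := by omega
    have hcm : c * P.g ≤ P.m := by omega
    set k := c * P.g with hk
    have hcg : c ≤ L.length / P.g := (Nat.le_div_iff_mul_le hg).2 hkL
    have hcle : c ≤ c * P.g := Nat.le_mul_of_pos_right _ hg
    have hnl : n ≠ len → True := fun _ => trivial
    refine run_seq (run_assign (by simp [hQ]) ?_)
    refine run_seq (run_assign (by simp [hQ]) ?_)
    refine run_seq (run_assign (by simp [hτ.g, ht]; omega) ?_)
    set E := min (k + P.g) L.length with hE
    -- the inner loop
    have inner : ∀ τ₁ : State, Frame [cnt, ch, t, cur, d, te, x] [dst] σ τ₁ → τ₁.reg t = k →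
        τ₁.reg ch = c → τ₁.reg te = E → τ₁.reg cnt = τ.reg cnt → τ₁.arr dst = τ.arr dst →
        τ₁.reg cur = 0 → τ₁.reg d = 0 → τ₁.clock ≤ τ.clock + 20 →
        Run Q (forLoop t te (
          x ::= .get src (bs + t) ;;
          .ite keep (
            .ite (.eq d s)
              (.store dst cnt (ch * dd + cur) ;; cnt ::= cnt + 1 ;; cur ::= 0 ;; d ::= 0)
              .skip ;;
            cur ::= .shl cur hd + (t + 1 - ch * g) ;; d ::= d + 1) .skip) ;;
          .store dst cnt (ch * dd + cur) ;; cnt ::= cnt + 1 ;; ch ::= ch + 1) τ₁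
          (fun υ => (∃ c k, Inv c k υ) ∧ L.length - υ.reg t < L.length - k) := by
      intro τ₁ hF₁ ht₁ hch₁ hte₁ hcnt₁ hdst₁ hcur₁ hd₁ hc₁
      refine run_seq (run_for (fun l υ => Frame [cnt, ch, t, cur, d, te, x] [dst] σ υ ∧
        υ.reg t = l ∧ υ.reg ch = c ∧ υ.reg te = E ∧
        (∀ u < υ.reg cnt, P.IsPiece L kp (υ.arr dst u)) ∧
        P.IsPiece L kp (c * P.dd + υ.reg cur) ∧
        (Nat.digits (2 ^ (P.h + 1)) (υ.reg cur)).length = υ.reg d ∧ υ.reg d ≤ P.s ∧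
        (∀ t j, t < l → L[t]? = some j → kp j = true →
          (∃ u < υ.reg cnt, t + 1 ∈ P.pos (υ.arr dst u)) ∨
            t + 1 ∈ P.pos (c * P.dd + υ.reg cur)) ∧
        υ.reg cnt * P.s + υ.reg d ≤ c * P.s + ((L.take l).filter kp).length ∧
        υ.clock ≤ σ.clock + 10 + c * 50 + 20 + l * 70)
        k E (by omega) (by omega) ?_ ?_ ?_ ?_)
      · refine ⟨hF₁, ht₁, hch₁, hte₁, ?_, ?_, ?_, ?_, ?_, ?_, ?_⟩
        · rw [hcnt₁, hdst₁]; exact hval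
        · rw [hcur₁]; exact hempty hcm
        · simp [hcur₁, hd₁]
        · omega
        · rw [hcnt₁, hdst₁]
          exact fun t j h1 h2 h3 => Or.inl (hcov t j h1 h2 h3)
        · rw [hcnt₁, hd₁]; exact hcnt
        · omega
      · rintro l υ - - ⟨-, h1, -, h2, -⟩
        exact ⟨h1, h2⟩
      · rintro l υ hkl hlE ⟨hG, hlt, hchυ, hte, hvalυ, hpc, hdig, hds, hcovυ, hcntυ, hcυ⟩
        have hυ := hσ.frame hG (by decide) (by simpa using hdi.symm)
        have hbsυ : υ.reg bs = σ.reg bs := hG.reg bs (by decide)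
        have hlL : l < L.length := by omega
        have hLl : L[l]? = some (σ.arr src (σ.reg bs + l)) := by
          conv_lhs => rw [← hL]
          simp [seg, List.getElem?_range hlL]
        set y₀ := σ.arr src (σ.reg bs + l) with hy₀
        have hmem : y₀ ∈ L := List.mem_of_getElem? hLl
        have htake : (L.take (l + 1)).filter kp = (L.take l).filter kp ++ [y₀].filter kp := by
          rw [List.take_add_one, hLl, List.filter_append]; rfl
        have hread : υ.arr src = σ.arr src := hG.arr src (by simp [hsd])
        have hcurlt : υ.reg cur < P.dd := by
          rw [Params.dd_eq, ← Nat.digits_length_le_iff P.one_lt_base]; omega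
        have hcode := hpc.1
        have hkl' := hkept l
        have hcntle' := hcntle (N := υ.reg cnt) (c := c) (k := l) (by omega)
        refine run_seq (run_assign (by simp [hbsυ, hlt]; omega) ?_)
        have eR : Expr.eval (υ.tick 4) (.get src (bs + t)) = y₀ := by
          simp [hbsυ, hlt, hread, hy₀]
        rw [eR]
        obtain ⟨hok, hiff⟩ := hkeep (((υ.tick 4).tick ((Expr.get src (bs + t)).cost + 1)).set x y₀)
          (by simp [hG]) (by simpa using hmem)
        simp only [State.set_reg, if_true] at hiff
        refine run_ite hok ?_ ?_
        · intro hholds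
          have hkp : kp y₀ = true := hiff.1 hholds
          have hlen1 : ((L.take (l + 1)).filter kp).length = ((L.take l).filter kp).length + 1 := by
            rw [htake]; simp [hkp]
          -- adding the new digit
          have add : ∀ ξ : State, Frame [cnt, ch, t, cur, d, te, x] [dst] σ ξ → ξ.reg t = l →
              ξ.reg ch = c → ξ.reg te = E →
              (∀ u < ξ.reg cnt, P.IsPiece L kp (ξ.arr dst u)) →
              P.IsPiece L kp (c * P.dd + ξ.reg cur) →
              (Nat.digits (2 ^ (P.h + 1)) (ξ.reg cur)).length = ξ.reg d → ξ.reg d < P.s →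
              (∀ t j, t < l → L[t]? = some j → kp j = true →
                (∃ u < ξ.reg cnt, t + 1 ∈ P.pos (ξ.arr dst u)) ∨
                  t + 1 ∈ P.pos (c * P.dd + ξ.reg cur)) →
              ξ.reg cnt * P.s + ξ.reg d ≤ c * P.s + ((L.take l).filter kp).length →
              ξ.clock ≤ υ.clock + 50 →
              Run Q (cur ::= .shl cur hd + (t + 1 - ch * g) ;; d ::= d + 1) ξ (fun υ =>
                υ.reg t = l ∧ (fun l υ => Frame [cnt, ch, t, cur, d, te, x] [dst] σ υ ∧
                  υ.reg t = l ∧ υ.reg ch = c ∧ υ.reg te = E ∧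
                  (∀ u < υ.reg cnt, P.IsPiece L kp (υ.arr dst u)) ∧
                  P.IsPiece L kp (c * P.dd + υ.reg cur) ∧
                  (Nat.digits (2 ^ (P.h + 1)) (υ.reg cur)).length = υ.reg d ∧ υ.reg d ≤ P.s ∧
                  (∀ t j, t < l → L[t]? = some j → kp j = true →
                    (∃ u < υ.reg cnt, t + 1 ∈ P.pos (υ.arr dst u)) ∨
                      t + 1 ∈ P.pos (c * P.dd + υ.reg cur)) ∧
                  υ.reg cnt * P.s + υ.reg d ≤ c * P.s + ((L.take l).filter kp).length ∧
                  υ.clock ≤ σ.clock + 10 + c * 50 + 20 + l * 70)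
                  (l + 1) ((υ.tick 4).set t (l + 1))) := by
            intro ξ h1 h2 h3 h4 h5 h6 h7 h8 h9 h10 h11
            have hξ := hσ.frame h1 (by decide) (by simpa using hdi.symm)
            -- Positions in a chunk are counted from `1` to `g`. So they are nonzero digits in base
            -- `2 g`, and appending one at the low end makes the list of digits longer by one.
            have hdl : l + 1 - k < 2 ^ (P.h + 1) := by rw [Params.pow_succ_h]; omega
            have hnew : Nat.digits (2 ^ (P.h + 1)) (ξ.reg cur * 2 ^ (P.h + 1) + (l + 1 - k)) =
                (l + 1 - k) :: Nat.digits (2 ^ (P.h + 1)) (ξ.reg cur) := by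
              rw [Nat.add_comm (_ * _), Nat.mul_comm (ξ.reg cur)]
              exact Nat.digits_add _ P.one_lt_base _ _ hdl (Or.inl (by omega))
            have hold : ξ.reg cur < P.dd := by
              rw [Params.dd_eq, ← Nat.digits_length_le_iff P.one_lt_base]; omega
            set w := ξ.reg cur * 2 ^ (P.h + 1) + (l + 1 - k) with hw
            have hwlt : w < P.dd := by
              rw [Params.dd_eq, ← Nat.digits_length_le_iff P.one_lt_base, hnew,
                List.length_cons]; omega
            have hdx := P.dd_le_xx
            have hpos : P.pos (c * P.dd + w) = (l + 1) :: P.pos (c * P.dd + ξ.reg cur) := by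
              rw [Params.pos_code hwlt, Params.pos_code hold, hnew, List.map_cons, ← hk]
              congr 1; omega
            refine run_seq (run_assign ?_ ?_)
            · simp only [Expr.ok_add, Expr.ok_sub, Expr.ok_shl, Expr.ok_mul, Expr.ok_var,
                Expr.ok_lit, Expr.eval_sub, Expr.eval_mul, Expr.eval_shl, Expr.eval_add,
                Expr.eval_var, Expr.eval_lit, hξ.hd, hξ.g, h2, h3, ← hk, ← hw, true_and]
              omega
            have eW : Expr.eval ξ (.shl cur hd + (t + 1 - ch * g)) = w := by
              simp [hξ.hd, hξ.g, h2, h3, ← hk, ← hw]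
            rw [eW]
            have hsx : P.s ≤ P.dd := by
              have h1 : P.s ≤ (P.h + 1) * P.s := Nat.le_mul_of_pos_left _ (Nat.succ_pos _)
              exact h1.trans Nat.lt_two_pow_self.le
            refine run_assign (by simp; omega) ?_
            refine ⟨by simp [h2], by simp [h1], by simp, by simp [h3], by simp [h4],
              by simpa using h5, ?_, ?_, ?_, ?_, ?_, ?_⟩
            · simp only [State.set_reg, State.tick_reg, if_true, reduceCtorEq, if_false]
              refine ⟨Params.code_lt hcm hwlt, ?_⟩
              rw [hpos]
              rintro x hx
              rcases List.mem_cons.1 hx with rfl | hx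
              · exact ⟨Nat.succ_pos _, y₀, hLl, hkp⟩
              · exact h6.2 x hx
            · simp [hnew, h7]
            · simp; omega
            · simp only [State.set_reg, State.tick_reg, if_true, reduceCtorEq, if_false,
                State.set_arr, State.tick_arr, hpos, List.mem_cons]
              intro t' j ht' hj hkj
              by_cases heq : t' = l
              · subst heq; exact Or.inr (Or.inl rfl)
              · rcases h9 t' j (by omega) hj hkj with h | h
                · exact Or.inl h
                · exact Or.inr (Or.inr h)
            · rw [hlen1]; simp; omega
            · simp; omega
          refine run_seq (run_ite (by simp) ?_ ?_)
          · intro hds'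
            simp [hυ.s] at hds'
            refine run_seq (run_store (by simp) (by simp [hchυ, hυ.dd]; omega) ?_)
            refine run_seq (run_assign (by simp; omega) ?_)
            refine run_seq (run_assign (by simp [hQ]) ?_)
            refine run_assign (by simp [hQ]) ?_
            refine add _ (by simp [hG]) (by simp [hlt]) (by simp [hchυ]) (by simp [hte])
              ?_ ?_ ?_ ?_ ?_ ?_ ?_
            · simp only [State.set_reg, State.tick_reg, if_true, reduceCtorEq, if_false,
                State.set_arr, State.tick_arr, State.put_arr, State.put_reg, Expr.eval_add,
                Expr.eval_var, Expr.eval_mul, Expr.eval_lit, hchυ, hυ.dd]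
              intro u hu
              by_cases heq : u = υ.reg cnt
              · subst heq; simpa using hpc
              · rw [Function.update_of_ne heq]; exact hvalυ u (by omega)
            · simpa using hempty hcm
            · simp
            · simpa using hs
            · simp only [State.set_reg, State.tick_reg, if_true, reduceCtorEq, if_false,
                State.set_arr, State.tick_arr, State.put_arr, State.put_reg, Expr.eval_add,
                Expr.eval_var, Expr.eval_mul, Expr.eval_lit, hchυ, hυ.dd]
              intro t' j ht' hj hkj
              rcases hcovυ t' j ht' hj hkj with ⟨u, hu, hu'⟩ | h
              · exact Or.inl ⟨u, by omega, by rwa [Function.update_of_ne (by omega)]⟩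
              · exact Or.inl ⟨υ.reg cnt, by omega, by simpa using h⟩
            · simp only [State.set_reg, State.tick_reg, if_true, reduceCtorEq, if_false,
                State.put_reg, Expr.eval_add, Expr.eval_var, Expr.eval_lit]
              rw [Nat.succ_mul]; omega
            · simp; omega
          · intro hds'
            simp [hυ.s] at hds'
            refine run_skip (add _ (by simp [hG]) (by simp [hlt]) (by simp [hchυ])
              (by simp [hte]) (by simpa using hvalυ) (by simpa using hpc) (by simpa using hdig)
              ?_ (by simpa using hcovυ) (by simpa using hcntυ) ?_)
            · simp; omega
            · simp; omega
        · intro hholds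
          have hkp : ¬ kp y₀ = true := fun h => hholds (hiff.2 h)
          refine run_skip ⟨by simp [hlt], by simp [hG], by simp, by simp [hchυ], by simp [hte],
            by simpa using hvalυ, by simpa using hpc, by simpa using hdig, by simpa using hds,
            ?_, ?_, ?_⟩
          · simp only [State.set_reg, State.tick_reg, reduceCtorEq, if_false,
              State.set_arr, State.tick_arr]
            intro t' j ht' hj hkj
            by_cases heq : t' = l
            · subst heq
              rw [hLl] at hj
              exact absurd ((Option.some.inj hj) ▸ hkj) hkp
            · exact hcovυ t' j (by omega) hj hkj
          · rw [htake]; simpa [hkp] using hcntυ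
          · simp; omega
      · rintro υ ⟨hG, hlt, hchυ, hte, hvalυ, hpc, hdig, hds, hcovυ, hcntυ, hcυ⟩
        have hυ := hσ.frame hG (by decide) (by simpa using hdi.symm)
        have hcode := hpc.1
        have hkl' := hkept E
        have hcntle' := hcntle (N := υ.reg cnt) (c := c) (k := E) (by omega)
        have hcdd : c * P.dd ≤ c * P.dd + υ.reg cur := Nat.le_add_right _ _
        refine run_seq (run_store (by simp) (by simp [hchυ, hυ.dd]; omega) ?_)
        refine run_seq (run_assign (by simp; omega) ?_)
        refine run_assign (by simp [hchυ]; omega) ?_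
        refine ⟨⟨c + 1, E, by simp [hG], by simp [hlt], by simp [hchυ], by omega, by omega,
          ?_, ?_, ?_, ?_, ?_⟩, ?_⟩
        · rw [Nat.succ_mul]; omega
        · simp only [State.set_reg, State.tick_reg, if_true, reduceCtorEq, if_false,
            State.set_arr, State.tick_arr, State.put_arr, State.put_reg, Expr.eval_add,
            Expr.eval_var, Expr.eval_mul, Expr.eval_lit, hchυ, hυ.dd]
          intro u hu
          by_cases heq : u = υ.reg cnt
          · subst heq; simpa using hpc
          · rw [Function.update_of_ne heq]; exact hvalυ u (by omega)
        · simp only [State.set_reg, State.tick_reg, if_true, reduceCtorEq, if_false,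
            State.set_arr, State.tick_arr, State.put_arr, State.put_reg, Expr.eval_add,
            Expr.eval_var, Expr.eval_mul, Expr.eval_lit, hchυ, hυ.dd]
          intro t' j ht' hj hkj
          rcases hcovυ t' j ht' hj hkj with ⟨u, hu, hu'⟩ | h
          · exact ⟨u, by omega, by rwa [Function.update_of_ne (by omega)]⟩
          · exact ⟨υ.reg cnt, by omega, by simpa using h⟩
        · simp only [State.set_reg, State.tick_reg, if_true, reduceCtorEq, if_false,
            State.put_reg, Expr.eval_add, Expr.eval_var, Expr.eval_lit]
          rw [Nat.succ_mul, Nat.succ_mul]; omega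
        · simp; omega
        · simp [hlt]; omega
    have hknow : L.length - (τ.reg t) = L.length - k := by rw [ht]
    simp only [hknow]
    refine run_seq (run_ite (by simp) ?_ ?_)
    · intro hlt'
      simp [hlen, hlenτ, hτ.g, ht] at hlt'
      refine run_assign (by simp) (inner _ ?_ ?_ ?_ ?_ ?_ ?_ ?_ ?_ ?_)
      · simp [hF]
      · simp [ht]
      · simp [hch]
      · simp [hlen, hlenτ]; omega
      · simp
      · simp
      · simp
      · simp
      · simp
    · intro hlt'
      simp [hlen, hlenτ, hτ.g, ht] at hlt'
      refine run_skip (inner _ ?_ ?_ ?_ ?_ ?_ ?_ ?_ ?_ ?_)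
      · simp [hF]
      · simp [ht]
      · simp [hch]
      · simp [hτ.g, ht]; omega
      · simp
      · simp
      · simp
      · simp
      · simp
  · rintro τ ⟨c, k, hF, ht, hch, hkL, hcL, hkc, hval, hcov, hcnt, hck⟩ hge
    have hlenτ : τ.reg len = L.length := (hF.reg len (by simp [hlen])).trans hlenv
    simp only [Cond.holds_lt, Expr.eval_var, ht, hlenτ] at hge
    obtain rfl : k = L.length := by omega
    have hcov' : ∀ t j, L[t]? = some j → kp j = true →
        ∃ u < τ.reg cnt, t + 1 ∈ P.pos (τ.arr dst u) := fun t j hj hkj =>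
      hcov t j (List.getElem?_eq_some_iff.1 hj).1 hj hkj
    have hdivle : L.length / P.g ≤ L.length := Nat.div_le_self _ _
    refine hPost _ (by simp [hF]) (by simpa using hval) (by simpa using hcov') ?_ ?_
    · rw [List.take_length] at hcnt
      simp only [State.tick_reg]
      -- Apart from one piece for each chunk, all pieces are full.
      have h1 : τ.reg cnt - c ≤ (L.filter kp).length / P.s := by
        rw [Nat.le_div_iff_mul_le hs, Nat.sub_mul]; omega
      omega
    · simp; omega

end


/-! ### Lookups, leaves, and the division of a node -/

open Var Arr

theorem State.tick_tick (σ : State) (s t : ℕ) : (σ.tick s).tick t = σ.tick (s + t) := by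
  simp [State.tick, Nat.add_assoc]

section

variable {Q : ℕ} {P : Params} {J K : List ℕ} {σ : State} {Post : State → Prop} {r₀ r₁ : ℕ}

/-- After a hit both counters are set to their ends, and the outer increment still follows; hence
the value `N + 1` in the invariant and the extra one in `hnp`. Leaving both loops early is harmless,
since one hit already decides that the row is scanned. -/
theorem run_lookup (hfit : P.Fits Q) (hσ : Consts P σ) (hnp : σ.reg np + 1 < Q)
    (hnq : σ.reg nq + 1 < Q) (hpj : ∀ u < σ.reg np, σ.arr pj u < P.xx)
    (hpk : ∀ v < σ.reg nq, σ.arr pk v < P.xx)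
    (hPost : ∀ τ, Frame [z, u, v, p, q] [] σ τ →
      (τ.reg z ≠ 0 ↔ ∃ u < σ.reg np, ∃ v < σ.reg nq,
        σ.arr tab (σ.arr pj u * P.xx + σ.arr pk v) ≠ 0) →
      τ.clock ≤ σ.clock + 60 * (σ.reg np * σ.reg nq) + 60 * σ.reg np + 20 → Post τ) :
    Run Q lookup σ Post := by
  have hQ : 0 < Q := by omega
  have hQ1 : 1 < Q := by omega
  have hxx2 := hfit.xx_lt
  set N := σ.reg np with hN
  set M := σ.reg nq with hM
  refine run_seq (run_assign (by simp [hQ]) ?_)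
  refine run_seq (run_assign (by simp [hQ]) ?_)
  refine run_loop (fun τ => Frame [z, u, v, p, q] [] σ τ ∧
    (τ.reg z = 0 → τ.reg u ≤ N ∧
      (∀ u' < τ.reg u, ∀ v' < M, σ.arr tab (σ.arr pj u' * P.xx + σ.arr pk v') = 0) ∧
      τ.clock ≤ σ.clock + 10 + τ.reg u * (50 * M + 30)) ∧
    (τ.reg z ≠ 0 → τ.reg u = N + 1 ∧ (∃ u < N, ∃ v < M,
      σ.arr tab (σ.arr pj u * P.xx + σ.arr pk v) ≠ 0) ∧
      τ.clock ≤ σ.clock + 10 + N * (50 * M + 30)))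
    (fun τ => N + 1 - τ.reg u) ?_ ?_ ?_ ?_
  · simp [Frame.refl]
  · intro τ _; simp
  · rintro τ ⟨hF, h0, h1⟩ hlt
    have hNτ : τ.reg np = N := hF.reg np (by decide)
    have hMτ : τ.reg nq = M := hF.reg nq (by decide)
    simp only [Cond.holds_lt, Expr.eval_var, hNτ] at hlt
    have hz : τ.reg z = 0 := by
      by_contra h; have := (h1 h).1; omega
    obtain ⟨-, hnone, hc⟩ := h0 hz
    have hu1 : τ.reg u * (50 * M + 30) + (50 * M + 30) ≤ N * (50 * M + 30) := by
      rw [← Nat.succ_mul]; exact Nat.mul_le_mul_right _ hlt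
    have hpjτ : τ.arr pj = σ.arr pj := hF.arr pj (by decide)
    refine run_seq (run_assign (by simp) ?_)
    refine run_seq (run_assign (by simp [hQ]) ?_)
    refine run_seq (run_loop (fun υ => Frame [z, u, v, p, q] [] σ υ ∧ υ.reg v ≤ M ∧
      (υ.reg z = 0 → υ.reg u = τ.reg u ∧ υ.reg p = σ.arr pj (τ.reg u) ∧
        (∀ v' < υ.reg v, σ.arr tab (σ.arr pj (τ.reg u) * P.xx + σ.arr pk v') = 0) ∧
        υ.clock ≤ τ.clock + 10 + υ.reg v * 50) ∧
      (υ.reg z ≠ 0 → υ.reg u = N ∧ υ.reg v = M ∧ (∃ u < N, ∃ v < M,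
        σ.arr tab (σ.arr pj u * P.xx + σ.arr pk v) ≠ 0) ∧
        υ.clock ≤ τ.clock + 10 + M * 50))
      (fun υ => M - υ.reg v) ?_ ?_ ?_ ?_)
    · refine ⟨by simp [hF], by simp, ?_, ?_⟩
      · simp [hpjτ]
      · simp [hz]
    · intro υ _; simp
    · rintro υ ⟨hG, hvM, h0', h1'⟩ hlt'
      have hMυ : υ.reg nq = M := hG.reg nq (by decide)
      have hNυ : υ.reg np = N := hG.reg np (by decide)
      have hxυ : υ.reg xx = P.xx := (hG.reg xx (by decide)).trans hσ.xx
      have hpkυ : υ.arr pk = σ.arr pk := hG.arr pk (by decide)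
      have htabυ : υ.arr tab = σ.arr tab := hG.arr tab (by decide)
      simp only [Cond.holds_lt, Expr.eval_var, hMυ] at hlt'
      have hz' : υ.reg z = 0 := by
        by_contra h; have := (h1' h).2.1; omega
      obtain ⟨hu, hp, hnone', hc'⟩ := h0' hz'
      have hpair := pair_lt (hpj _ hlt) (hpk _ hlt')
      have hle : σ.arr pj (τ.reg u) * P.xx ≤ σ.arr pj (τ.reg u) * P.xx + σ.arr pk (υ.reg v) :=
        Nat.le_add_right _ _
      have hvle : υ.reg v * 50 + 50 ≤ M * 50 := by omega
      refine run_seq (run_assign (by simp) ?_)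
      refine run_seq (run_assign (by simp; omega) ?_)
      refine run_ite (by simp [hp, hxυ, hpkυ]; omega) ?_ ?_
      · intro hpos
        simp [hp, hxυ, hpkυ, htabυ] at hpos
        refine run_seq (run_assign (by simp [hQ1]) ?_)
        refine run_seq (run_assign (by simp) ?_)
        refine run_assign (by simp) ?_
        refine ⟨⟨by simp [hG], by simp [hMυ], by simp, fun _ => ⟨by simp [hNυ], by simp [hMυ],
          ⟨τ.reg u, hlt, υ.reg v, hlt', by omega⟩, ?_⟩⟩, ?_⟩
        · simp; omega
        · simp [hMυ]; omega
      · intro hpos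
        simp [hp, hxυ, hpkυ, htabυ] at hpos
        refine run_skip ⟨⟨by simp [hG], by simp; omega, fun _ => ⟨by simp [hu], by simp [hp],
          ?_, ?_⟩, by simp [hz']⟩, ?_⟩
        · simp only [State.tick_reg, State.set_reg, if_true, reduceCtorEq, if_false,
            Expr.eval_add, Expr.eval_var, Expr.eval_lit]
          intro v' hv'
          by_cases heq : v' = υ.reg v
          · subst heq; exact hpos
          · exact hnone' v' (by omega)
        · simp; omega
        · simp; omega
    · rintro υ ⟨hG, hvM, h0', h1'⟩ hge
      have hMυ : υ.reg nq = M := hG.reg nq (by decide)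
      simp only [Cond.holds_lt, Expr.eval_var, hMυ] at hge
      obtain hvM : υ.reg v = M := by omega
      by_cases hz' : υ.reg z = 0
      · obtain ⟨hu, hp, hnone', hc'⟩ := h0' hz'
        refine run_assign (by simp; omega) ⟨⟨by simp [hG], fun _ => ⟨by simp [hu]; omega, ?_, ?_⟩,
          by simp [hz']⟩, ?_⟩
        · simp only [State.tick_reg, State.set_reg, if_true,
            Expr.eval_add, Expr.eval_var, Expr.eval_lit, hu]
          intro u' hu' v' hv'
          by_cases heq : u' = τ.reg u
          · subst heq; exact hnone' v' (by omega)
          · exact hnone u' (by omega) v' hv'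
        · have e1 : (τ.reg u + 1) * (50 * M + 30) = τ.reg u * (50 * M + 30) + (50 * M + 30) :=
            Nat.succ_mul _ _
          simp [hu]; omega
        · simp [hu]; omega
      · obtain ⟨hu, hv, hex, hc'⟩ := h1' hz'
        refine run_assign (by simp; omega) ⟨⟨by simp [hG], by simp [hz'], fun _ =>
          ⟨by simp [hu], hex, ?_⟩⟩, ?_⟩
        · simp; omega
        · simp [hu]; omega
  · rintro τ ⟨hF, h0, h1⟩ hge
    have hNτ : τ.reg np = N := hF.reg np (by decide)
    simp only [Cond.holds_lt, Expr.eval_var, hNτ] at hge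
    have h2 : N * (50 * M + 30) = 50 * (N * M) + 30 * N := by ring
    refine hPost _ (by simp [hF]) ?_ ?_
    · simp only [State.tick_reg]
      constructor
      · exact fun h => (h1 h).2.1
      · rintro ⟨u', hu', v', hv', h⟩ hz
        exact h ((h0 hz).2.1 u' (by omega) v' hv')
    · by_cases hz : τ.reg z = 0
      · obtain ⟨hu, -, hc⟩ := h0 hz
        rw [show τ.reg u = N by omega] at hc
        simp; omega
      · have := (h1 hz).2.2
        simp; omega

/-- The table for the node is there. -/
def TableFor (P : Params) (J K : List ℕ) (σ : State) : Prop :=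
  ∀ p' < P.xx, ∀ q' < P.xx, (σ.arr tab (p' * P.xx + q') ≠ 0 ↔
    ∃ x ∈ P.pos p', ∃ y ∈ P.pos q', P.Hit J K x y)

/-- If all lookups fail, the rectangle is empty, since the pieces contain all loaded entries. If one
succeeds, the pieces contain only loaded entries, so the scan finds a new witness, and the decrease
of `unknowns` pays `200 m ^ 2` for it. -/
theorem run_lookupRow (hfit : P.Fits Q) {r : ℕ} (hσ : AtRow Q P J K r σ)
    (htab : TableFor P J K σ)
    (hPost : ∀ τ, Frame [cnt, ch, t, cur, d, te, x, z, u, v, p, q, np, nq, hit, y] [pj, pk, wit]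
        σ τ →
      P.Better (σ.arr wit) (τ.arr wit) → P.Covers (τ.arr wit) r J K →
      τ.clock + P.unknowns (τ.arr wit) * (200 * (P.m * P.m)) ≤ σ.clock +
        P.unknowns (σ.arr wit) * (200 * (P.m * P.m)) +
        60 * ((J.length / P.g + 1 + σ.reg nj / P.s) * (K.length / P.g + 1 + σ.reg nk / P.s)) +
        2000 * P.m → Post τ) :
    Run Q lookupRow σ Post := by
  have hn := hfit.n_lt
  have hmn := hfit.m_le
  have hm := hfit.m_pos
  have hnn : P.n ≤ P.n * P.n := Nat.le_mul_self _
  have hbs := hσ.bs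
  have hJ := hσ.J_le
  have hK := hσ.K_le
  have hsd : ∀ t, t / P.s ≤ t := fun t => Nat.div_le_self _ _
  have hgd : ∀ t, t / P.g ≤ t := fun t => Nat.div_le_self _ _
  have hnjJ : σ.reg nj ≤ J.length := by rw [hσ.nj]; exact List.length_filter_le _ _
  have hnkK : σ.reg nk ≤ K.length := by rw [hσ.nk]; exact List.length_filter_le _ _
  have hb1 := hsd (σ.reg nj)
  have hb2 := hsd (σ.reg nk)
  have hb3 := hgd J.length
  have hb4 := hgd K.length
  refine run_seq (run_piecesCmd hfit J (P.adj r) hσ.toConsts hσ.a hσ.segJ (by decide) hJ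
    (by decide) (by decide) (by omega) ?_ (by simp) ?_)
  · intro τ hF hx
    have hτ := hσ.toConsts.frame hF (by decide) (by decide)
    obtain ⟨h1, h2⟩ := entA_ok hfit hτ ((hF.reg i (by decide)).trans hσ.i) hσ.r_lt rfl
      (hσ.J_lt _ hx)
    refine ⟨⟨by simp; omega, h1⟩, ?_⟩
    rw [Cond.holds_lt, h2]
    simp [Params.adj]
  rintro τ hF hvalJ hcovJ hcntJ hc
  rw [← hσ.nj] at hcntJ
  refine run_seq (run_assign (by simp) ?_)
  have hF' : Frame [cnt, ch, t, cur, d, te, x, np] [pj] σ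
      ((τ.tick ((Expr.var cnt).cost + 1)).set np (Expr.eval τ (Expr.var cnt))) := by
    simpa using hF.mono (by simp) (by simp)
  have hτ := hσ.frame hF' (by decide) (by decide)
  set τ' := ((τ.tick ((Expr.var cnt).cost + 1)).set np (Expr.eval τ (Expr.var cnt))) with hτ'
  have hnp' : τ'.reg np = τ.reg cnt := by simp [hτ']
  have hpj' : τ'.arr pj = τ.arr pj := by simp [hτ']
  have hc' : τ'.clock ≤ σ.clock + 200 * P.m + 202 := by simp [hτ']; omega
  have hw' : τ'.arr wit = σ.arr wit := hF'.arr wit (by decide)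
  have hbs' := hτ.bs
  refine run_seq (run_piecesCmd hfit K (P.free (τ'.arr wit) r) hτ.toConsts hτ.c hτ.segK
    (by decide) hK (by decide) (by decide) (by omega) ?_ (by simp) ?_)
  · intro υ hG hx
    have hυ := hτ.toConsts.frame hG (by decide) (by decide)
    obtain ⟨h1, h2⟩ := entW_ok hfit hυ ((hG.reg i (by decide)).trans hτ.i) hτ.r_lt rfl
      (hτ.K_lt _ hx)
    refine ⟨⟨h1, by simp; omega⟩, ?_⟩
    rw [Cond.holds_eq, h2, hG.arr wit (by decide)]
    simp [Params.free]
  rintro υ hG hvalK hcovK hcntK hd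
  rw [hw', ← hσ.nk] at hcntK
  rw [hw'] at hvalK hcovK
  refine run_seq (run_assign (by simp) ?_)
  have hG' : Frame [cnt, ch, t, cur, d, te, x, nq] [pk] τ'
      ((υ.tick ((Expr.var cnt).cost + 1)).set nq (Expr.eval υ (Expr.var cnt))) := by
    simpa using hG.mono (by simp) (by simp)
  have hυ := hτ.frame hG' (by decide) (by decide)
  set υ' := ((υ.tick ((Expr.var cnt).cost + 1)).set nq (Expr.eval υ (Expr.var cnt))) with hυ'
  have hFυ : Frame [cnt, ch, t, cur, d, te, x, z, u, v, p, q, np, nq, hit, y] [pj, pk, wit]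
      σ υ' := (hF'.mono (by decide) (by decide)).trans (hG'.mono (by decide) (by decide))
  have hnp'' : υ'.reg np = τ.reg cnt := (hG'.reg np (by decide)).trans hnp'
  have hnq'' : υ'.reg nq = υ.reg cnt := by simp [hυ']
  have hpj'' : υ'.arr pj = τ.arr pj := (hG'.arr pj (by decide)).trans hpj'
  have hpk'' : υ'.arr pk = υ.arr pk := by simp [hυ']
  have hw'' : υ'.arr wit = σ.arr wit := (hG'.arr wit (by decide)).trans hw'
  have htab'' : υ'.arr tab = σ.arr tab := hFυ.arr tab (by decide)
  have hc'' : υ'.clock ≤ σ.clock + 400 * P.m + 404 := by simp [hυ']; omega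
  refine run_seq (run_lookup hfit hυ.toConsts (by omega) (by omega)
    (by rw [hnp'', hpj'']; exact fun u hu => (hvalJ u hu).1)
    (by rw [hnq'', hpk'']; exact fun u hu => (hvalK u hu).1) ?_)
  rw [hnp'', hnq'', hpj'', hpk'', htab'']
  intro ξ hH hz hcξ
  have hξ := hυ.frame hH (by decide) (by decide)
  have hFξ : Frame [cnt, ch, t, cur, d, te, x, z, u, v, p, q, np, nq, hit, y] [pj, pk, wit]
      σ ξ := hFυ.trans (hH.mono (by decide) (by decide))
  have hwξ : ξ.arr wit = σ.arr wit := (hH.arr wit (by decide)).trans hw''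
  -- a hit means that an entry of the product becomes known
  have hhit : ξ.reg z ≠ 0 → ∃ j ∈ J, ∃ k ∈ K, 0 < P.A r j ∧ 0 < P.B j k ∧
      σ.arr wit (r * P.n + k) = 0 := by
    rw [hz]
    rintro ⟨u', hu', v', hv', h⟩
    rw [htab _ (hvalJ u' hu').1 _ (hvalK v' hv').1] at h
    obtain ⟨x', hx', y', hy', -, -, j, k, hj, hk, hB⟩ := h
    obtain ⟨-, j', hj', hA⟩ := (hvalJ u' hu').2 x' hx'
    obtain ⟨-, k', hk', hfr⟩ := (hvalK v' hv').2 y' hy'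
    rw [hj] at hj'; rw [hk] at hk'
    obtain rfl := Option.some.inj hj'
    obtain rfl := Option.some.inj hk'
    exact ⟨j, List.mem_of_getElem? hj, k, List.mem_of_getElem? hk, by simpa [Params.adj] using hA,
      hB, by simpa [Params.free] using hfr⟩
  have hprod : τ.reg cnt * υ.reg cnt ≤
      (J.length / P.g + 1 + σ.reg nj / P.s) * (K.length / P.g + 1 + σ.reg nk / P.s) :=
    Nat.mul_le_mul hcntJ hcntK
  refine run_ite (by simp; omega) ?_ ?_
  · intro hpos
    simp at hpos
    obtain ⟨j, hj, k, hk, hA, hB, hW⟩ := hhit (by omega)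
    have hξ' : AtRow Q P J K r (ξ.tick (Cond.lt 0 (Expr.var z)).cost) :=
      hξ.frame (S := []) (R := []) (by simp [Frame.refl]) (by decide) (by decide)
    refine run_scan hfit hξ' ?_
    rintro ζ hI hBet hCov - - hcζ
    have hBet : P.Better (σ.arr wit) (ζ.arr wit) := by simpa [hwξ] using hBet
    have hunk := hBet.unknowns_lt (pair_lt hσ.r_lt (hσ.K_lt k hk)) hW (hCov j hj k hk hA hB)
    refine hPost _ (hFξ.trans ?_) hBet hCov ?_
    · simpa using hI.mono (S' := [cnt, ch, t, cur, d, te, x, z, u, v, p, q, np, nq, hit, y])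
        (R' := [pj, pk, wit]) (by decide) (by decide)
    · have h1 : ξ.reg nj = σ.reg nj := hFξ.reg nj (by decide)
      have h2 : ξ.reg nk = σ.reg nk := hFξ.reg nk (by decide)
      have h3 : σ.reg nj * σ.reg nk ≤ P.m * P.m := Nat.mul_le_mul (by omega) (by omega)
      have h4 : P.unknowns (ζ.arr wit) * (200 * (P.m * P.m)) + 200 * (P.m * P.m) ≤
          P.unknowns (σ.arr wit) * (200 * (P.m * P.m)) := by
        rw [← Nat.succ_mul]; exact Nat.mul_le_mul_right _ hunk
      simp [h1, h2] at hcζ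
      omega
  · intro hpos
    simp at hpos
    refine run_skip (hPost _ (by simp [hFξ]) (by simpa [hwξ] using Params.Better.refl _) ?_ ?_)
    · intro j hj k hk hA hB
      simp only [State.tick_arr, hwξ]
      intro hW
      obtain ⟨t₁, ht₁⟩ := List.mem_iff_getElem?.1 hj
      obtain ⟨t₂, ht₂⟩ := List.mem_iff_getElem?.1 hk
      obtain ⟨u', hu', hpu⟩ := hcovJ t₁ j ht₁ (by simpa [Params.adj] using hA)
      obtain ⟨v', hv', hpv⟩ := hcovK t₂ k ht₂ (by simpa [Params.free] using hW)
      refine absurd hpos (hz.2 ⟨u', hu', v', hv', ?_⟩)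
      rw [htab _ (hvalJ u' hu').1 _ (hvalK v' hv').1]
      exact ⟨_, hpu, _, hpv, Nat.succ_pos _, Nat.succ_pos _, j, k, by simpa using ht₁,
        by simpa using ht₂, hB⟩
    · simp [hwξ]; omega

namespace Params

/-- New witnesses only shorten the lists. So what `findRow` has established about the rows of a leaf
remains true while earlier rows of the leaf are being solved. -/
theorem Better.cntK_le {W W' : ℕ → ℕ} (h : P.Better W W') (K : List ℕ) (r : ℕ) :
    P.cntK K W' r ≤ P.cntK K W r := by
  refine List.Sublist.length_le (List.monotone_filter_right _ fun k hk => ?_)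
  simp only [free, decide_eq_true_eq] at hk ⊢
  by_contra h'
  exact h.mono _ h' hk

theorem Better.medium {W W' : ℕ → ℕ} (h : P.Better W W') {K : List ℕ} {r : ℕ}
    (hM : P.Medium J K W' r) : P.Medium J K W r :=
  ⟨hM.1, hM.2.trans (Nat.mul_le_mul_right _ (h.cntK_le K r))⟩

/-- The cost of a row of a leaf, up to a constant factor and smaller terms. -/
def rowCost (P : Params) (a c : ℕ) : ℕ :=
  a * c / P.gg + (a / P.g + a / (P.b * P.s)) * (c / P.g + c / (P.b * P.s))

end Params

/-- A row with a very short side is cheap to inspect. Any other row is medium, hence sparse on both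
sides by `hrow`, and is looked up. The two terms of `rowCost` correspond to these cases. -/
theorem run_leaf (hfit : P.Fits Q) (hσ : AtNode Q P J K σ) (hR : Rows P r₀ r₁ σ)
    (hrow : ∀ r, r₀ ≤ r → r < r₁ → P.Medium J K (σ.arr wit) r →
        P.cntJ J r * P.b < J.length ∧ P.cntK K (σ.arr wit) r * P.b < K.length)
    (hPost : ∀ τ, Frame nodeVars nodeArrs σ τ → τ.reg sp = σ.reg f →
      P.Better (σ.arr wit) (τ.arr wit) →
      (∀ r, r₀ ≤ r → r < r₁ → P.Covers (τ.arr wit) r J K) →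
      τ.clock + P.unknowns (τ.arr wit) * (200 * (P.m * P.m)) ≤ σ.clock +
        P.unknowns (σ.arr wit) * (200 * (P.m * P.m)) +
        300 * (P.xx * P.xx * ((P.s + 1) * (P.s + 1))) +
        60 * (P.m * P.rowCost J.length K.length) + 4000 * (P.m * P.m) → Post τ) :
    Run Q leaf σ Post := by
  have hn := hfit.n_lt
  have hmn := hfit.m_le
  have hmp := hfit.m_pos
  have hnn : P.n ≤ P.n * P.n := Nat.le_mul_self _
  have hJ := hσ.J_le
  have hK := hσ.K_le
  have hrn := hR.le_n
  have hrm := hR.le_m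
  have hr₀ := hR.i0
  have hggp : 0 < P.gg := Nat.mul_pos P.g_pos P.g_pos
  refine run_seq (run_table hfit hσ ?_)
  intro σ₁ hF₁ htab₁ hc₁
  have hσ₁ := hσ.frame hF₁ (by decide) (by decide)
  have hw₁ : σ₁.arr wit = σ.arr wit := hF₁.arr wit (by decide)
  refine run_seq (run_assign (by simp) ?_)
  set V := P.rowCost J.length K.length with hV
  set T := 60 * V + 3400 * P.m with hT
  set G := 200 * (P.m * P.m) with hG
  set TB := 300 * (P.xx * P.xx * ((P.s + 1) * (P.s + 1))) with hTB
  refine run_seq (run_for (fun k τ => Frame nodeVars nodeArrs σ τ ∧ τ.reg i = k ∧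
    P.Better (σ.arr wit) (τ.arr wit) ∧ TableFor P J K τ ∧
    (∀ r, r₀ ≤ r → r < k → P.Covers (τ.arr wit) r J K) ∧
    τ.clock + P.unknowns (τ.arr wit) * G ≤ σ.clock + P.unknowns (σ.arr wit) * G + TB + 10 +
      (k - r₀) * T) r₀ r₁ hR.le (by omega) ?_ ?_ ?_ ?_)
  · refine ⟨by simpa using hF₁.mono (by decide) (by decide), by simp [hF₁.reg i0, hR.i0],
      by simpa [hw₁] using Params.Better.refl _, by simpa [TableFor] using htab₁,
      fun r h1 h2 => by omega, ?_⟩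
    simp [hw₁]; omega
  · rintro k τ - - ⟨hF, hi, -⟩
    exact ⟨hi, (hF.reg _ (by decide)).trans hR.i1⟩
  · rintro k τ hk hk1 ⟨hF, hi, hB, htab, hcov, hc⟩
    have hτ : AtNode Q P J K (τ.tick 4) := hσ.frame (by simpa using hF) (by decide) (by decide)
    refine run_seq (run_loadRow hfit hτ hi (by omega) ?_)
    intro υ hG' hυ hcυ
    have hw : υ.arr wit = τ.arr wit := hG'.arr wit (by decide)
    have htabυ : υ.arr tab = τ.arr tab := hG'.arr tab (by decide)
    have hFυ : Frame nodeVars nodeArrs σ υ :=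
      hF.trans (by simpa using hG'.mono (S' := nodeVars) (R' := nodeArrs) (by decide) (by decide))
    have hnjJ : υ.reg nj ≤ J.length := by rw [hυ.nj]; exact List.length_filter_le _ _
    have hnkK : υ.reg nk ≤ K.length := by rw [hυ.nk]; exact List.length_filter_le _ _
    have hnjc : υ.reg nj = P.cntJ J k := hυ.nj
    have hnkc : υ.reg nk = P.cntK K (τ.arr wit) k := by rw [← hw]; exact hυ.nk
    have hcυ' : υ.clock ≤ τ.clock + 120 * P.m + 64 := by simp at hcυ; omega
    have h4 : (k + 1 - r₀) * T = (k - r₀) * T + T := by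
      rw [show k + 1 - r₀ = k - r₀ + 1 by omega, Nat.succ_mul]
    -- what has to be shown after the row
    have key : ∀ ξ : State, Frame nodeVars nodeArrs σ ξ → ξ.reg i = k →
        P.Better (τ.arr wit) (ξ.arr wit) → ξ.arr tab = τ.arr tab →
        P.Covers (ξ.arr wit) k J K →
        ξ.clock + P.unknowns (ξ.arr wit) * G ≤ υ.clock + P.unknowns (τ.arr wit) * G +
          60 * V + 3200 * P.m → ξ.reg i = k ∧
        (fun k τ => Frame nodeVars nodeArrs σ τ ∧ τ.reg i = k ∧
        P.Better (σ.arr wit) (τ.arr wit) ∧ TableFor P J K τ ∧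
        (∀ r, r₀ ≤ r → r < k → P.Covers (τ.arr wit) r J K) ∧
        τ.clock + P.unknowns (τ.arr wit) * G ≤ σ.clock + P.unknowns (σ.arr wit) * G + TB + 10 +
        (k - r₀) * T) (k + 1) ((ξ.tick 4).set i (k + 1)) := by
      intro ξ h1 h2 h3 h3' h5 h6
      refine ⟨h2, by simp [h1], by simp, by simpa using hB.trans h3, ?_, ?_, ?_⟩
      · simpa [TableFor, h3'] using htab
      · intro r hr1 hr2
        rcases Nat.lt_or_ge r k with h | h
        · simpa using h3.covers (hcov r hr1 h)
        · obtain rfl : r = k := by omega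
          simpa using h5
      · simp; omega
    -- the case of a short row
    have short : υ.reg nj * P.gg < J.length ∨ υ.reg nk * P.gg < K.length → ∀ t, t ≤ 20 →
        Run Q scan (υ.tick t) (fun ξ => ξ.reg i = k ∧
        (fun k τ => Frame nodeVars nodeArrs σ τ ∧ τ.reg i = k ∧
        P.Better (σ.arr wit) (τ.arr wit) ∧ TableFor P J K τ ∧
        (∀ r, r₀ ≤ r → r < k → P.Covers (τ.arr wit) r J K) ∧
        τ.clock + P.unknowns (τ.arr wit) * G ≤ σ.clock + P.unknowns (σ.arr wit) * G + TB + 10 +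
        (k - r₀) * T) (k + 1) ((ξ.tick 4).set i (k + 1))) := by
      intro hshort t ht
      have hυ' : AtRow Q P J K k (υ.tick t) :=
        hυ.frame (S := []) (R := []) (by simp [Frame.refl]) (by decide) (by decide)
      refine run_scan hfit hυ' ?_
      rintro ξ hH hBet hCov - - hcξ
      have hBet : P.Better (τ.arr wit) (ξ.arr wit) := by simpa [hw] using hBet
      have hHn : Frame nodeVars nodeArrs υ ξ := by
        simpa using hH.mono (S' := nodeVars) (R' := nodeArrs) (by decide) (by decide)
      refine key ξ (hFυ.trans hHn) ((hH.reg i (by decide)).trans hυ.i) hBet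
        ((hH.arr tab (by decide)).trans htabυ) hCov ?_
      -- One side is less than its `1 / gg` part and the other at most the whole side.
      have h5 : υ.reg nj * υ.reg nk ≤ V := by
        refine le_trans ?_ (Nat.le_add_right _ _)
        rw [Nat.le_div_iff_mul_le hggp]
        rcases hshort with h | h
        · calc υ.reg nj * υ.reg nk * P.gg = υ.reg nj * P.gg * υ.reg nk := by ring
            _ ≤ _ := Nat.mul_le_mul h.le hnkK
        · calc υ.reg nj * υ.reg nk * P.gg = υ.reg nj * (υ.reg nk * P.gg) := by ring
            _ ≤ _ := Nat.mul_le_mul hnjJ h.le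
      have h6 : P.unknowns (ξ.arr wit) * G ≤ P.unknowns (τ.arr wit) * G :=
        Nat.mul_le_mul_right _ hBet.unknowns_le
      simp at hcξ
      omega
    refine run_ite ?_ ?_ ?_
    · have := Nat.mul_le_mul_right P.gg (hnjJ.trans hJ)
      have := hfit.gg_lt
      simp [hυ.gg]; omega
    · intro hA
      simp [hυ.gg, hυ.a] at hA
      refine run_ite ?_ ?_ ?_
      · have := Nat.mul_le_mul_right P.gg (hnkK.trans hK)
        have := hfit.gg_lt
        simp [hυ.gg]; omega
      · intro hC
        simp [hυ.gg, hυ.c] at hC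
        have hmed : P.Medium J K (τ.arr wit) k := ⟨by rw [← hnjc]; omega, by rw [← hnkc]; omega⟩
        obtain ⟨hb1, hb2⟩ := hrow k hk hk1 (hB.medium hmed)
        have hb2 : P.cntK K (τ.arr wit) k * P.b < K.length :=
          lt_of_le_of_lt (Nat.mul_le_mul_right _ (hB.cntK_le K k)) hb2
        rw [← hnjc] at hb1
        rw [← hnkc] at hb2
        refine run_lookupRow (J := J) (K := K) (r := k) hfit ?_ ?_ ?_
        · exact hυ.frame (S := []) (R := []) (by simp [Frame.refl]) (by decide) (by decide)
        · simpa [TableFor, htabυ] using htab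
        intro ξ hH hBet hCov hcξ
        have hBet : P.Better (τ.arr wit) (ξ.arr wit) := by simpa [hw] using hBet
        have hHn : Frame nodeVars nodeArrs υ ξ := by
          simpa using hH.mono (S' := nodeVars) (R' := nodeArrs) (by decide) (by decide)
        refine key ξ (hFυ.trans hHn) ((hH.reg i (by decide)).trans hυ.i) hBet
          ((hH.arr tab (by decide)).trans htabυ) hCov ?_
        -- Sparsity turns the number of full pieces into the second summand of `rowCost`.
        have hd : ∀ {t L : ℕ}, t * P.b < L → t / P.s ≤ L / (P.b * P.s) := by
          intro t L h
          rw [← Nat.div_div_eq_div_mul]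
          exact Nat.div_le_div_right ((Nat.le_div_iff_mul_le hfit.b_pos).2 h.le)
        have e1 := hd hb1
        have e2 := hd hb2
        set X := J.length / P.g with hX
        set Y := K.length / P.g with hY
        set X' := J.length / (P.b * P.s) with hX'
        set Y' := K.length / (P.b * P.s) with hY'
        have hXm : X ≤ P.m := (Nat.div_le_self _ _).trans hJ
        have hYm : Y ≤ P.m := (Nat.div_le_self _ _).trans hK
        have hXm' : X' ≤ P.m := (Nat.div_le_self _ _).trans hJ
        have hYm' : Y' ≤ P.m := (Nat.div_le_self _ _).trans hK
        have h7 : (X + 1 + υ.reg nj / P.s) * (Y + 1 + υ.reg nk / P.s) ≤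
            (X + 1 + X') * (Y + 1 + Y') := Nat.mul_le_mul (by omega) (by omega)
        -- The incomplete last chunks contribute only terms that are linear in `m`.
        have h8 : (X + 1 + X') * (Y + 1 + Y') = (X + X') * (Y + Y') + (X + X' + (Y + Y') + 1) := by
          ring
        have h9 : (X + X') * (Y + Y') ≤ V := Nat.le_add_left _ _
        simp only [State.tick_reg, State.tick_arr, State.tick_clock, hw, Cond.cost_lt,
          Expr.cost_var, Expr.cost_add, Expr.cost_mul, Expr.cost_lit] at hcξ
        rw [← hG] at hcξ
        omega
      · intro hC
        simp [hυ.gg, hυ.c] at hC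
        rw [State.tick_tick]
        exact short (Or.inr (by omega)) _ (by simp)
    · intro hA
      simp [hυ.gg, hυ.a] at hA
      exact short (Or.inl (by omega)) _ (by simp)
  · rintro τ ⟨hF, hi, hB, htab, hcov, hc⟩
    refine run_assign (by simp) (hPost _ (by simp [hF]) ?_ ?_ ?_ ?_)
    · simp [hF.reg f]
    · simpa using hB
    · simpa using hcov
    · have h1 : (r₁ - r₀) * T ≤ P.m * T := Nat.mul_le_mul_right _ (by omega)
      have h2 : P.m * T = 60 * (P.m * V) + 3400 * (P.m * P.m) := by rw [hT]; ring
      have h3 : 1 ≤ P.m * P.m := Nat.one_le_iff_ne_zero.2 (by positivity)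
      simp; omega

/-- The old node keeps all of `L₂` and the `out₁` part of `L₁`; the new node on top gets the `in₁`
part of `L₁` and the `out₂` part of `L₂`. The order of the filters matters: `L₁` is overwritten in
place only after its other part has been copied to the new level. -/
theorem run_split {s₁ l₁ s₂ l₂ : Arr} {len₁ len₂ : Var} {in₁ out₁ out₂ : Cond} {L₁ L₂ : List ℕ}
    {pin pout₁ pout₂ : ℕ → Bool} {M : ℕ} (hs : s₁ ≠ s₂) (hl : l₁ ≠ l₂)
    (hsl : l₁ ≠ s₁ ∧ l₁ ≠ s₂ ∧ l₂ ≠ s₁ ∧ l₂ ≠ s₂)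
    (hlen₁ : len₁ ∉ [cnt, t, x, sp]) (hlen₂ : len₂ ∉ [cnt, t, x, sp])
    (h₁ : σ.reg len₁ = L₁.length) (h₂ : σ.reg len₂ = L₂.length)
    (hL₁ : seg (σ.arr s₁) (σ.reg bs) L₁.length = L₁)
    (hL₂ : seg (σ.arr s₂) (σ.reg bs) L₂.length = L₂) (hnb : σ.reg nb = σ.reg bs + M)
    (hM₁ : L₁.length ≤ M) (hM₂ : L₂.length ≤ M) (hQ : σ.reg bs + M + M < Q)
    (hsp : σ.reg sp + 1 < Q)
    (hin : ∀ τ, Frame [cnt, t, x, sp] [s₁, l₁, s₂, l₂] σ τ → τ.reg x ∈ L₁ →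
      in₁.Ok Q τ ∧ (in₁.Holds τ ↔ pin (τ.reg x) = true))
    (hout₁ : ∀ τ, Frame [cnt, t, x, sp] [s₁, l₁, s₂, l₂] σ τ → τ.reg x ∈ L₁ →
      out₁.Ok Q τ ∧ (out₁.Holds τ ↔ pout₁ (τ.reg x) = true))
    (hout₂ : ∀ τ, Frame [cnt, t, x, sp] [s₁, l₁, s₂, l₂] σ τ → τ.reg x ∈ L₂ →
      out₂.Ok Q τ ∧ (out₂.Holds τ ↔ pout₂ (τ.reg x) = true))
    (hc₁ : in₁.cost ≤ 20) (hc₂ : out₁.cost ≤ 20) (hc₃ : out₂.cost ≤ 20)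
    (hPost : ∀ τ, Frame [cnt, t, x, sp] [s₁, l₁, s₂, l₂] σ τ → τ.reg sp = σ.reg sp + 1 →
      τ.arr l₂ = Function.update (σ.arr l₂) (σ.reg sp) (L₂.filter pout₂).length →
      τ.arr l₁ = Function.update (Function.update (σ.arr l₁) (σ.reg sp) (L₁.filter pin).length)
        (σ.reg f) (L₁.filter pout₁).length →
      seg (τ.arr s₁) (σ.reg nb) (L₁.filter pin).length = L₁.filter pin →
      seg (τ.arr s₂) (σ.reg nb) (L₂.filter pout₂).length = L₂.filter pout₂ →
      seg (τ.arr s₁) (σ.reg bs) (L₁.filter pout₁).length = L₁.filter pout₁ →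
      (∀ y < σ.reg bs, τ.arr s₁ y = σ.arr s₁ y) → (∀ y < σ.reg nb, τ.arr s₂ y = σ.arr s₂ y) →
      τ.clock ≤ σ.clock + 200 * M + 100 → Post τ) :
    Run Q (split s₁ l₁ len₁ in₁ out₁ s₂ l₂ len₂ out₂) σ Post := by
  simp only [List.mem_cons, List.not_mem_nil, or_false, not_or] at hlen₁ hlen₂
  obtain ⟨d1, d2, d3, d4⟩ := hsl
  refine run_seq (run_filterCmd L₂ pout₂ (by rw [h₂, hL₂]) (by decide) (by simp [hlen₂])
    (by decide) (fun τ hF hx => hout₂ τ (hF.mono (by simp) (by simp)) hx) hc₃ (by omega)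
    (by omega) (Or.inr (Or.inr (by omega))) ?_)
  intro τ hF hy hc hcnt hseg
  have hspτ : τ.reg sp = σ.reg sp := hF.reg sp (by decide)
  refine run_seq (run_store (by simp) (by simp) ?_)
  simp only [Expr.eval_var, hspτ, hcnt, Expr.cost_var]
  set τ₁ := (τ.tick (1 + 1 + 2)).put l₂ (σ.reg sp) (L₂.filter pout₂).length with hτ₁
  have hF₁ : Frame [cnt, t, x, sp] [s₁, l₁, s₂, l₂] σ τ₁ := by
    simpa [hτ₁] using hF.mono (by simp) (by simp)
  have hs₁τ : τ₁.arr s₁ = σ.arr s₁ := by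
    simp [hτ₁, Ne.symm d3]; exact hF.arr s₁ (by simp [hs])
  have hl₂τ : τ₁.arr l₂ = Function.update (σ.arr l₂) (σ.reg sp) (L₂.filter pout₂).length := by
    simp [hτ₁, hF.arr l₂ (by simp [d4])]
  have hl₁τ : τ₁.arr l₁ = σ.arr l₁ := by
    simp [hτ₁, hl]; exact hF.arr l₁ (by simp [d2])
  have hs₂τ : τ₁.arr s₂ = τ.arr s₂ := by simp [hτ₁, Ne.symm d4]
  have hcτ : τ₁.clock ≤ σ.clock + 60 * M + 24 := by simp [hτ₁]; omega
  have hreg : ∀ r, r ∉ [cnt, t, x, sp] → τ₁.reg r = σ.reg r := hF₁.reg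
  have hbs₁ := hreg bs (by decide)
  have hnb₁ := hreg nb (by decide)
  have hlen₁' : τ₁.reg len₁ = L₁.length := (hreg len₁ (by simp [hlen₁])).trans h₁
  have hspτ₁ : τ₁.reg sp = σ.reg sp := by simp [hτ₁, hspτ]
  refine run_seq (run_filterCmd L₁ pin (by rw [hlen₁', hs₁τ, hbs₁, hL₁]) (by decide)
    (by simp [hlen₁]) (by decide)
    (fun υ hG hx => hin υ (hF₁.trans (hG.mono (by simp) (by simp))) hx) hc₁ (by omega)
    (by omega) (Or.inr (Or.inr (by omega))) ?_)
  rw [hs₁τ, hnb₁, hlen₁']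
  intro υ hG hy₁ hc₁' hcnt₁ hseg₁
  have hspυ : υ.reg sp = σ.reg sp := (hG.reg sp (by decide)).trans hspτ₁
  refine run_seq (run_store (by simp) (by simp) ?_)
  simp only [Expr.eval_var, hspυ, hcnt₁, Expr.cost_var]
  set υ₁ := (υ.tick (1 + 1 + 2)).put l₁ (σ.reg sp) (L₁.filter pin).length with hυ₁
  have hG₁ : Frame [cnt, t, x, sp] [s₁, l₁, s₂, l₂] σ υ₁ :=
    hF₁.trans (by
      simpa [hυ₁] using (hG.mono (by simp) (by simp) : Frame [cnt, t, x, sp] [s₁, l₁, s₂, l₂] τ₁ υ))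
  have hs₁υ : υ₁.arr s₁ = υ.arr s₁ := by simp [hυ₁, Ne.symm d1]
  have hl₁υ : υ₁.arr l₁ = Function.update (σ.arr l₁) (σ.reg sp) (L₁.filter pin).length := by
    simp [hυ₁, hG.arr l₁ (by simp [d1]), hl₁τ]
  have hl₂υ : υ₁.arr l₂ = τ₁.arr l₂ := by
    simp [hυ₁, hl.symm]; exact hG.arr l₂ (by simp [d3])
  have hs₂υ : υ₁.arr s₂ = τ.arr s₂ := by
    simp only [hυ₁, State.put_arr, State.tick_arr, if_neg (Ne.symm d2)]
    exact (hG.arr s₂ (by simp [hs.symm])).trans hs₂τ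
  have hcυ : υ₁.clock ≤ σ.clock + 120 * M + 60 := by simp [hυ₁]; omega
  have hreg₁ : ∀ r, r ∉ [cnt, t, x, sp] → υ₁.reg r = σ.reg r := hG₁.reg
  have hbs₂ := hreg₁ bs (by decide)
  have hf₂ := hreg₁ f (by decide)
  have hlen₂' : υ₁.reg len₁ = L₁.length := (hreg₁ len₁ (by simp [hlen₁])).trans h₁
  have hspυ₁ : υ₁.reg sp = σ.reg sp := by simp [hυ₁, hspυ]
  have hL₁' : seg (υ₁.arr s₁) (σ.reg bs) L₁.length = L₁ := by
    rw [hs₁υ]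
    conv_rhs => rw [← hL₁]
    exact seg_congr fun y _ h => hy₁ y (Or.inl (by omega))
  refine run_seq (run_filterCmd L₁ pout₁ (by rw [hlen₂', hbs₂, hL₁']) (by decide)
    (by simp [hlen₁]) (by decide)
    (fun ξ hH hx => hout₁ ξ (hG₁.trans (hH.mono (by simp) (by simp))) hx) hc₂ (by omega)
    (by omega) (Or.inr (Or.inl rfl)) ?_)
  rw [hbs₂, hlen₂', hs₁υ]
  intro ξ hH hy₂ hc₂' hcnt₂ hseg₂
  have hspξ : ξ.reg sp = σ.reg sp := (hH.reg sp (by decide)).trans hspυ₁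
  have hfξ : ξ.reg f = σ.reg f := (hH.reg f (by decide)).trans hf₂
  refine run_seq (run_store (by simp) (by simp) ?_)
  refine run_assign (by simp [hspξ]; omega) ?_
  simp only [Expr.eval_var, hfξ, hcnt₂, Expr.cost_var]
  have hs₂ξ : ξ.arr s₂ = τ.arr s₂ := (hH.arr s₂ (by simp [hs.symm])).trans hs₂υ
  have hl₂ξ : ξ.arr l₂ = υ₁.arr l₂ := hH.arr l₂ (by simp [d3])
  have hl₁ξ : ξ.arr l₁ = υ₁.arr l₁ := hH.arr l₁ (by simp [d1])
  have hlenin : (L₁.filter pin).length ≤ L₁.length := List.length_filter_le _ _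
  refine hPost _ ?_ ?_ ?_ ?_ ?_ ?_ ?_ ?_ ?_ ?_
  · simpa using hG₁.trans (hH.mono (by simp) (by simp))
  · simp [hspξ]
  · simp [hl.symm, hl₂ξ, hl₂υ, hl₂τ]
  · simp [hl₁ξ, hl₁υ]
  · simp only [State.set_arr, State.tick_arr, State.put_arr, if_neg (Ne.symm d1)]
    conv_rhs => rw [← hseg₁]
    exact seg_congr fun y h _ => hy₂ y (Or.inr (by omega))
  · simpa [Ne.symm d2, hs₂ξ] using hseg
  · simpa [Ne.symm d1] using hseg₂
  · intro y h
    simp only [State.set_arr, State.tick_arr, State.put_arr, if_neg (Ne.symm d1)]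
    rw [hy₂ y (Or.inl h), hy₁ y (Or.inl (by omega))]
  · intro y h
    simp only [State.set_arr, State.tick_arr, State.put_arr, if_neg (Ne.symm d2), hs₂ξ]
    exact hy y (Or.inl h)
  · simp; omega

end


open Var Arr

/-! ### The stack of nodes -/

/-- The sides of node number `t` of the stack. -/
def nodeJ (P : Params) (σ : State) (t : ℕ) : List ℕ := seg (σ.arr sj) (t * P.m) (σ.arr lj t)
def nodeK (P : Params) (σ : State) (t : ℕ) : List ℕ := seg (σ.arr sk) (t * P.m) (σ.arr lk t)
def nodeArea (P : Params) (σ : State) (t : ℕ) : ℕ := (nodeJ P σ t).length * (nodeK P σ t).length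

structure Stack (P : Params) (σ : State) : Prop extends Consts P σ where
  J_lt : ∀ t < σ.reg sp, ∀ y ∈ nodeJ P σ t, y < P.n
  K_lt : ∀ t < σ.reg sp, ∀ y ∈ nodeK P σ t, y < P.n
  J_le : ∀ t < σ.reg sp, (nodeJ P σ t).length ≤ P.m
  K_le : ∀ t < σ.reg sp, (nodeK P σ t).length ≤ P.m
  -- A division adds one node and loses at least one unit of area, so this sum never grows. It
  -- bounds the memory that the stack occupies.
  height : σ.reg sp + ∑ t ∈ Finset.range (σ.reg sp), nodeArea P σ t ≤ P.m * P.m + 1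

/-- A function `φ` of the area of a node that bounds the time for the node, apart from the time that
is paid for by new witnesses. -/
structure Potential (P : Params) (φ : ℕ → ℝ) : Prop where
  mono : Monotone φ
  tiny : ∀ x, x * P.e ≤ P.m * P.m → ((50 * (P.m * x) + 1000 * (P.m * P.m) : ℕ) : ℝ) ≤ φ x
  leaf : ∀ a c, a ≤ P.m → c ≤ P.m → P.m * P.m < a * c * P.e →
    ((300 * (P.xx * P.xx * ((P.s + 1) * (P.s + 1))) + 60 * (P.m * P.rowCost a c) +
      6000 * (P.m * P.m) : ℕ) : ℝ) ≤ φ (a * c)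
  split : ∀ a c u v, a ≤ P.m → c ≤ P.m → u ≤ a → v ≤ c → a ≤ u * P.gg → c ≤ v * P.b →
    P.m * P.m < a * c * P.e →
    φ (u * (c - v)) + φ ((a - u) * c) + ((1000 * (P.m * P.m) : ℕ) : ℝ) ≤ φ (a * c)

/-- The time, together with the time that the stack still has to pay for. -/
noncomputable def pot (P : Params) (φ : ℕ → ℝ) (σ : State) : ℝ :=
  ((σ.clock + P.unknowns (σ.arr wit) * (1000 * (P.m * P.m)) : ℕ) : ℝ) +
    ∑ t ∈ Finset.range (σ.reg sp), φ (nodeArea P σ t)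

/-- A measure for termination. -/
def stackMeasure (P : Params) (σ : State) : ℕ :=
  -- The factor two makes the loss of area outweigh the additional node of a division.
  P.unknowns (σ.arr wit) + (2 * ∑ t ∈ Finset.range (σ.reg sp), nodeArea P σ t) + σ.reg sp

abbrev blockVars : List Var := f :: a :: c :: bs :: nb :: nodeVars
abbrev blockArrs : List Arr := lj :: lk :: sj :: sk :: nodeArrs

/-- One step of the algorithm leads from `σ` to `τ`. -/
structure NodeStep (P : Params) (φ : ℕ → ℝ) (r₀ r₁ : ℕ) (σ τ : State) : Prop where
  stack : Stack P τ
  frame : Frame blockVars blockArrs σ τ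
  better : P.Better (σ.arr wit) (τ.arr wit)
  cover : ∀ r, r₀ ≤ r → r < r₁ → ∀ t < σ.reg sp, ∀ j ∈ nodeJ P σ t, ∀ k ∈ nodeK P σ t,
    0 < P.A r j → 0 < P.B j k → τ.arr wit (r * P.n + k) ≠ 0 ∨
      ∃ t < τ.reg sp, j ∈ nodeJ P τ t ∧ k ∈ nodeK P τ t
  -- The slack of ten pays for the test of the loop around `node`.
  pot_le : pot P φ τ + 10 ≤ pot P φ σ
  measure_lt : stackMeasure P τ < stackMeasure P σ

section

variable {Q : ℕ} {P : Params} {J K : List ℕ} {σ τ : State} {Post : State → Prop} {r₀ r₁ : ℕ}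
  {φ : ℕ → ℝ} {f' : ℕ}

/-- The top node has been solved; its potential, together with the new witnesses, pays for the time.
-/
theorem NodeStep.pop (hσ : Stack P σ) (hsp : σ.reg sp = f' + 1) (hsp' : τ.reg sp = f')
    (hτ : Consts P τ) (hF : Frame blockVars blockArrs σ τ)
    (hJ : ∀ t < f', nodeJ P τ t = nodeJ P σ t) (hK : ∀ t < f', nodeK P τ t = nodeK P σ t)
    (hB : P.Better (σ.arr wit) (τ.arr wit))
    (hcov : ∀ r, r₀ ≤ r → r < r₁ → P.Covers (τ.arr wit) r (nodeJ P σ f') (nodeK P σ f'))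
    (hc : ((τ.clock + P.unknowns (τ.arr wit) * (1000 * (P.m * P.m)) + 10 : ℕ) : ℝ) ≤
      ((σ.clock + P.unknowns (σ.arr wit) * (1000 * (P.m * P.m)) : ℕ) : ℝ) +
        φ (nodeArea P σ f')) : NodeStep P φ r₀ r₁ σ τ := by
  have hA : ∀ t < f', nodeArea P τ t = nodeArea P σ t := fun t ht => by
    rw [nodeArea, hJ t ht, hK t ht, nodeArea]
  have hsum : ∑ t ∈ Finset.range f', nodeArea P τ t = ∑ t ∈ Finset.range f', nodeArea P σ t :=
    Finset.sum_congr rfl fun t ht => hA t (Finset.mem_range.1 ht)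
  have hsum' : ∑ t ∈ Finset.range f', φ (nodeArea P τ t) =
      ∑ t ∈ Finset.range f', φ (nodeArea P σ t) :=
    Finset.sum_congr rfl fun t ht => by rw [hA t (Finset.mem_range.1 ht)]
  have hun := hB.unknowns_le
  refine ⟨⟨hτ, ?_, ?_, ?_, ?_, ?_⟩, hF, hB, ?_, ?_, ?_⟩
  · rw [hsp']; exact fun t ht => hJ t ht ▸ hσ.J_lt t (by omega)
  · rw [hsp']; exact fun t ht => hK t ht ▸ hσ.K_lt t (by omega)
  · rw [hsp']; exact fun t ht => hJ t ht ▸ hσ.J_le t (by omega)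
  · rw [hsp']; exact fun t ht => hK t ht ▸ hσ.K_le t (by omega)
  · have := hσ.height
    rw [hsp, Finset.sum_range_succ] at this
    rw [hsp', hsum]; omega
  · intro r hr0 hr1 t ht j hj k hk hAj hBk
    rcases Nat.lt_or_ge t f' with h | h
    · exact Or.inr ⟨t, by omega, by rwa [hJ t h], by rwa [hK t h]⟩
    · obtain rfl : t = f' := by omega
      exact Or.inl (hcov r hr0 hr1 j hj k hk hAj hBk)
  · rw [pot, pot, hsp, hsp', Finset.sum_range_succ, hsum']
    push_cast at hc ⊢
    linarith
  · rw [stackMeasure, stackMeasure, hsp, hsp', Finset.sum_range_succ, hsum]; omega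

/-- Every one of `B` in the old node lies in one of the two new nodes, so no possible witness is
lost, and the drop of the potential pays for the time. -/
theorem NodeStep.push {Ja Ka Jb Kb : List ℕ} (hσ : Stack P σ) (hsp : σ.reg sp = f' + 1)
    (hsp' : τ.reg sp = f' + 2)
    (hτ : Consts P τ) (hF : Frame blockVars blockArrs σ τ)
    (hJ : ∀ t < f', nodeJ P τ t = nodeJ P σ t) (hK : ∀ t < f', nodeK P τ t = nodeK P σ t)
    (hJa : nodeJ P τ f' = Ja) (hKa : nodeK P τ f' = Ka) (hJb : nodeJ P τ (f' + 1) = Jb)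
    (hKb : nodeK P τ (f' + 1) = Kb) (hJas : Ja.Sublist (nodeJ P σ f')) (hKas : Ka.Sublist (nodeK P σ f'))
    (hJbs : Jb.Sublist (nodeJ P σ f')) (hKbs : Kb.Sublist (nodeK P σ f'))
    (harea : Ja.length * Ka.length + Jb.length * Kb.length < nodeArea P σ f')
    (hB : τ.arr wit = σ.arr wit)
    (hcov : ∀ j ∈ nodeJ P σ f', ∀ k ∈ nodeK P σ f', 0 < P.B j k →
      (j ∈ Ja ∧ k ∈ Ka) ∨ (j ∈ Jb ∧ k ∈ Kb))
    (hc : ((τ.clock + 10 : ℕ) : ℝ) + φ (Ja.length * Ka.length) + φ (Jb.length * Kb.length) ≤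
      (σ.clock : ℝ) + φ (nodeArea P σ f')) : NodeStep P φ r₀ r₁ σ τ := by
  have hA : ∀ t < f', nodeArea P τ t = nodeArea P σ t := fun t ht => by
    rw [nodeArea, hJ t ht, hK t ht, nodeArea]
  have hAa : nodeArea P τ f' = Ja.length * Ka.length := by rw [nodeArea, hJa, hKa]
  have hAb : nodeArea P τ (f' + 1) = Jb.length * Kb.length := by rw [nodeArea, hJb, hKb]
  have hsum : ∑ t ∈ Finset.range f', nodeArea P τ t = ∑ t ∈ Finset.range f', nodeArea P σ t :=
    Finset.sum_congr rfl fun t ht => hA t (Finset.mem_range.1 ht)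
  have hsum' : ∑ t ∈ Finset.range f', φ (nodeArea P τ t) =
      ∑ t ∈ Finset.range f', φ (nodeArea P σ t) :=
    Finset.sum_congr rfl fun t ht => by rw [hA t (Finset.mem_range.1 ht)]
  have hcase : ∀ t < f' + 2, t < f' ∨ t = f' ∨ t = f' + 1 := fun t ht => by omega
  have hff : f' < σ.reg sp := by omega
  refine ⟨⟨hτ, ?_, ?_, ?_, ?_, ?_⟩, hF, by rw [hB]; exact Params.Better.refl _, ?_, ?_, ?_⟩
  · rw [hsp']
    intro t ht
    rcases hcase t ht with h | rfl | rfl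
    · rw [hJ t h]; exact hσ.J_lt t (by omega)
    · rw [hJa]; exact fun y hy => hσ.J_lt _ hff y (hJas.subset hy)
    · rw [hJb]; exact fun y hy => hσ.J_lt _ hff y (hJbs.subset hy)
  · rw [hsp']
    intro t ht
    rcases hcase t ht with h | rfl | rfl
    · rw [hK t h]; exact hσ.K_lt t (by omega)
    · rw [hKa]; exact fun y hy => hσ.K_lt _ hff y (hKas.subset hy)
    · rw [hKb]; exact fun y hy => hσ.K_lt _ hff y (hKbs.subset hy)
  · rw [hsp']
    intro t ht
    rcases hcase t ht with h | rfl | rfl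
    · rw [hJ t h]; exact hσ.J_le t (by omega)
    · rw [hJa]; exact hJas.length_le.trans (hσ.J_le _ hff)
    · rw [hJb]; exact hJbs.length_le.trans (hσ.J_le _ hff)
  · rw [hsp']
    intro t ht
    rcases hcase t ht with h | rfl | rfl
    · rw [hK t h]; exact hσ.K_le t (by omega)
    · rw [hKa]; exact hKas.length_le.trans (hσ.K_le _ hff)
    · rw [hKb]; exact hKbs.length_le.trans (hσ.K_le _ hff)
  · have := hσ.height
    rw [hsp, Finset.sum_range_succ] at this
    rw [hsp', Finset.sum_range_succ, Finset.sum_range_succ, hsum, hAa, hAb]; omega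
  · intro r hr0 hr1 t ht j hj k hk hAj hBk
    rcases Nat.lt_or_ge t f' with h | h
    · exact Or.inr ⟨t, by omega, by rwa [hJ t h], by rwa [hK t h]⟩
    · obtain rfl : t = f' := by omega
      rcases hcov j hj k hk hBk with ⟨h1, h2⟩ | ⟨h1, h2⟩
      · exact Or.inr ⟨t, by omega, by rwa [hJa], by rwa [hKa]⟩
      · exact Or.inr ⟨t + 1, by omega, by rwa [hJb], by rwa [hKb]⟩
  · rw [pot, pot, hsp, hsp', Finset.sum_range_succ, Finset.sum_range_succ, Finset.sum_range_succ,
      hsum', hAa, hAb, hB]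
    push_cast at hc ⊢
    linarith
  · rw [stackMeasure, stackMeasure, hsp, hsp', Finset.sum_range_succ, Finset.sum_range_succ,
      Finset.sum_range_succ, hsum, hAa, hAb, hB]; omega

/-- The scan has found a witness. The node stays as it is and is treated again; the drop in the
number of unknown entries pays for the attempt and makes the measure decrease. -/
theorem NodeStep.redo (hσ : Stack P σ) (hsp : τ.reg sp = σ.reg sp)
    (hτ : Consts P τ) (hF : Frame blockVars blockArrs σ τ)
    (hJ : ∀ t, nodeJ P τ t = nodeJ P σ t) (hK : ∀ t, nodeK P τ t = nodeK P σ t)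
    (hB : P.Better (σ.arr wit) (τ.arr wit))
    (hun : P.unknowns (τ.arr wit) < P.unknowns (σ.arr wit))
    (hc : τ.clock + P.unknowns (τ.arr wit) * (1000 * (P.m * P.m)) + 10 ≤
      σ.clock + P.unknowns (σ.arr wit) * (1000 * (P.m * P.m))) :
    NodeStep P φ r₀ r₁ σ τ := by
  have hA : nodeArea P τ = nodeArea P σ := funext fun t => by
    rw [nodeArea, hJ t, hK t, nodeArea]
  refine ⟨⟨hτ, ?_, ?_, ?_, ?_, ?_⟩, hF, hB, ?_, ?_, ?_⟩
  · rw [hsp]; exact fun t ht => hJ t ▸ hσ.J_lt t ht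
  · rw [hsp]; exact fun t ht => hK t ▸ hσ.K_lt t ht
  · rw [hsp]; exact fun t ht => hJ t ▸ hσ.J_le t ht
  · rw [hsp]; exact fun t ht => hK t ▸ hσ.K_le t ht
  · rw [hsp, hA]; exact hσ.height
  · exact fun r _ _ t ht j hj k hk _ _ =>
      Or.inr ⟨t, by omega, by rwa [hJ t], by rwa [hK t]⟩
  · rw [pot, pot, hsp, hA]
    have : ((τ.clock + P.unknowns (τ.arr wit) * (1000 * (P.m * P.m)) + 10 : ℕ) : ℝ) ≤
      ((σ.clock + P.unknowns (σ.arr wit) * (1000 * (P.m * P.m)) : ℕ) : ℝ) := by exact_mod_cast hc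
    push_cast at this ⊢
    linarith
  · rw [stackMeasure, stackMeasure, hsp, hA]; omega

theorem length_filter_not (L : List ℕ) (p : ℕ → Bool) :
    (L.filter fun y => !p y).length = L.length - (L.filter p).length := by
  have := List.length_eq_length_filter_add (l := L) p
  omega

-- The three outcomes for the top node are to be solved (tiny or leaf), to be divided, or to be kept
-- after new witnesses have been found. They match the clauses of `Potential` and the charge of
-- `1000 m ^ 2` for each unknown entry.
set_option maxHeartbeats 1000000 in
theorem run_node (hfit : P.Fits Q) (hφ : Potential P φ) (hσ : Stack P σ) (hR : Rows P r₀ r₁ σ)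
    (hsp0 : 0 < σ.reg sp) : Run Q node σ (NodeStep P φ r₀ r₁ σ) := by
  have hn := hfit.n_lt
  have hmn := hfit.m_le
  have hmp := hfit.m_pos
  have hnn : P.n ≤ P.n * P.n := Nat.le_mul_self _
  have hm1 : P.m ≤ P.m * P.m := Nat.le_mul_self _
  have hmm : P.m * P.m ≤ P.n * P.n := Nat.mul_le_mul hmn hmn
  have hm_lt := hfit.m_lt
  obtain ⟨f', hsp⟩ : ∃ f', σ.reg sp = f' + 1 := ⟨σ.reg sp - 1, by omega⟩
  have hff : f' < σ.reg sp := by omega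
  have hheight := hσ.height
  have hf'm : f' ≤ P.m * P.m := by omega
  have hf'mm : f' * P.m + P.m + P.m + P.m < Q := by
    have h1 : f' * P.m ≤ P.m * P.m * P.m := Nat.mul_le_mul_right _ hf'm
    have h2 : (P.m * P.m + 3) * P.m = P.m * P.m * P.m + 3 * P.m := by ring
    omega
  set J := nodeJ P σ f' with hJdef
  set K := nodeK P σ f' with hKdef
  have hJl : σ.arr lj f' = J.length := by simp [hJdef, nodeJ]
  have hKl : σ.arr lk f' = K.length := by simp [hKdef, nodeK]
  have hJm : J.length ≤ P.m := hσ.J_le f' hff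
  have hKm : K.length ≤ P.m := hσ.K_le f' hff
  have hAr : nodeArea P σ f' = J.length * K.length := rfl
  have hJK : J.length * K.length ≤ P.m * P.m := Nat.mul_le_mul hJm hKm
  have hJKe : J.length * K.length * P.e ≤ P.m * P.m * P.e := Nat.mul_le_mul_right _ hJK
  have he := hfit.e_lt
  refine run_seq (run_assign (by simp; omega) ?_)
  refine run_seq (run_assign (by simp) ?_)
  refine run_seq (run_assign (by simp) ?_)
  refine run_seq (run_assign (by simp [hsp, hσ.m]; omega) ?_)
  refine run_seq (run_assign (by simp [hsp, hσ.m]; omega) ?_)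
  simp only [Expr.eval_sub, Expr.eval_var, Expr.eval_lit, Expr.eval_get, Expr.eval_mul,
    Expr.eval_add, State.set_reg, State.tick_reg, State.set_arr, State.tick_arr, if_true,
    reduceCtorEq, if_false, hsp, Nat.add_sub_cancel, hσ.m, hJl, hKl]
  generalize hσ₁ : State.set _ nb (f' * P.m + P.m) = σ₁
  have hF₁ : Frame [f, a, c, bs, nb] [] σ σ₁ := by
    rw [← hσ₁]; simp [Frame.refl]
  have hc₁ : σ₁.clock = σ.clock + 20 := by rw [← hσ₁]; simp
  have ha₁ : σ₁.reg a = J.length := by rw [← hσ₁]; simp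
  have hk₁ : σ₁.reg c = K.length := by rw [← hσ₁]; simp
  have hf₁ : σ₁.reg f = f' := by rw [← hσ₁]; simp
  have hbs₁ : σ₁.reg bs = f' * P.m := by rw [← hσ₁]; simp
  have hnb₁ : σ₁.reg nb = f' * P.m + P.m := by rw [← hσ₁]; simp
  have hw₁ : σ₁.arr wit = σ.arr wit := hF₁.arr wit (by decide)
  have hC₁ : Consts P σ₁ := hσ.toConsts.frame hF₁ (by decide) (by decide)
  have hN₁ : AtNode Q P J K σ₁ := by
    refine ⟨hC₁, ha₁, hk₁, ?_, ?_, hσ.J_lt f' hff, hσ.K_lt f' hff, hJm, hKm, by omega⟩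
    · rw [hF₁.arr sj (by decide), hbs₁, ← hJl]; rfl
    · rw [hF₁.arr sk (by decide), hbs₁, ← hKl]; rfl
  have hR₁ : Rows P r₀ r₁ σ₁ := hR.frame hF₁ (by decide)
  have hFb : Frame blockVars blockArrs σ σ₁ := hF₁.mono (by decide) (by decide)
  -- the case that the node has been solved
  have solved : ∀ τ, Frame nodeVars nodeArrs σ₁ τ → τ.reg sp = σ₁.reg f →
      P.Better (σ₁.arr wit) (τ.arr wit) →
      (∀ r, r₀ ≤ r → r < r₁ → P.Covers (τ.arr wit) r J K) →
      ((τ.clock + P.unknowns (τ.arr wit) * (1000 * (P.m * P.m)) + 10 : ℕ) : ℝ) ≤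
      ((σ.clock + P.unknowns (σ.arr wit) * (1000 * (P.m * P.m)) : ℕ) : ℝ) +
        φ (J.length * K.length) → NodeStep P φ r₀ r₁ σ τ := by
    intro τ hF hspτ hB hcov hc
    have hFσ : Frame blockVars blockArrs σ τ := hFb.trans (hF.mono (by decide) (by decide))
    refine NodeStep.pop hσ hsp (hspτ.trans hf₁) (hσ.toConsts.frame hFσ (by decide) (by decide))
      hFσ ?_ ?_ (hw₁ ▸ hB) hcov hc
    · intro t _
      rw [nodeJ, nodeJ, hF.arr sj (by decide), hF₁.arr sj (by decide), hF.arr lj (by decide),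
        hF₁.arr lj (by decide)]
    · intro t _
      rw [nodeK, nodeK, hF.arr sk (by decide), hF₁.arr sk (by decide), hF.arr lk (by decide),
        hF₁.arr lk (by decide)]
  refine run_ite ?_ ?_ ?_
  · simp [ha₁, hk₁, hC₁.e, hC₁.m]; omega
  · intro hlt
    simp [ha₁, hk₁, hC₁.e, hC₁.m] at hlt
    refine run_tiny hfit (J := J) (K := K) (r₀ := r₀) (r₁ := r₁)
      (hN₁.frame (S := []) (R := []) (by simp [Frame.refl]) (by decide) (by decide))
      (hR₁.frame (S := []) (R := []) (by simp [Frame.refl]) (by decide)) ?_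
    intro τ hF hspτ hB hcov hc
    refine solved τ (by simpa using hF) (by simpa using hspτ) (by simpa using hB) hcov ?_
    have h1 := hφ.tiny (J.length * K.length) (by omega)
    have h2 : P.unknowns (τ.arr wit) * (1000 * (P.m * P.m)) ≤
        P.unknowns (σ.arr wit) * (1000 * (P.m * P.m)) :=
      Nat.mul_le_mul_right _ (by simpa [hw₁] using hB.unknowns_le)
    have h3 : τ.clock + P.unknowns (τ.arr wit) * (1000 * (P.m * P.m)) + 10 ≤
        σ.clock + P.unknowns (σ.arr wit) * (1000 * (P.m * P.m)) +
        (50 * (P.m * (J.length * K.length)) + 1000 * (P.m * P.m)) := by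
      simp [hc₁] at hc; omega
    have h4 := (Nat.cast_le (α := ℝ)).2 h3
    rw [Nat.cast_add _ (50 * _ + _)] at h4
    exact h4.trans (by linarith)
  · intro hlt
    simp [ha₁, hk₁, hC₁.e, hC₁.m] at hlt
    have hbig : P.m * P.m < J.length * K.length * P.e := by omega
    refine run_seq (run_findRow hfit (J := J) (K := K) (r₀ := r₀) (r₁ := r₁)
      (hN₁.frame (S := []) (R := []) (by simp [Frame.refl]) (by decide) (by decide))
      (hR₁.frame (S := []) (R := []) (by simp [Frame.refl]) (by decide)) ?_)
    intro τ hF hm0 hmne hc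
    rw [Frame.tick_left_iff] at hF
    simp only [State.tick_arr, hw₁] at hm0 hmne
    have hτ : AtNode Q P J K τ := hN₁.frame hF (by decide) (by decide)
    have hRτ : Rows P r₀ r₁ τ := hR₁.frame hF (by decide)
    have hwτ : τ.arr wit = σ.arr wit := (hF.arr wit (by decide)).trans hw₁
    have hspτ : τ.reg sp = f' + 1 :=
      ((hF.reg sp (by decide)).trans (hF₁.reg sp (by decide))).trans hsp
    have hfτ : τ.reg f = f' := (hF.reg f (by decide)).trans hf₁
    have hbsτ : τ.reg bs = f' * P.m := (hF.reg bs (by decide)).trans hbs₁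
    have hnbτ : τ.reg nb = f' * P.m + P.m := (hF.reg nb (by decide)).trans hnb₁
    have hFτ : Frame blockVars blockArrs σ τ := hFb.trans (hF.mono (by decide) (by decide))
    have hsame : ∀ r : Arr, r ∉ [bj, bk] → τ.arr r = σ.arr r := fun r hr =>
      (hF.arr r hr).trans (hF₁.arr r (by simp))
    have hcτ : τ.clock ≤ σ.clock + 400 * (P.m * P.m) + 40 := by simp [hc₁] at hc; omega
    refine run_ite (by simp; omega) ?_ ?_
    · intro hmode
      simp at hmode
      refine run_leaf hfit (J := J) (K := K) (r₀ := r₀) (r₁ := r₁)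
        (hτ.frame (S := []) (R := []) (by simp [Frame.refl]) (by decide) (by decide))
        (hRτ.frame (S := []) (R := []) (by simp [Frame.refl]) (by decide))
        (by simpa [hwτ] using hm0 hmode) ?_
      intro υ hG hspυ hB hcov hcυ
      rw [Frame.tick_left_iff] at hG
      refine solved υ ((hF.mono (by decide) (by decide)).trans hG) ?_
        (by simpa [hw₁, hwτ] using hB) hcov ?_
      · simpa [hfτ, hf₁] using hspυ
      have hun := hB.unknowns_le
      simp only [State.tick_arr, State.tick_clock, hwτ] at hun hcυ
      have h1 := hφ.leaf J.length K.length hJm hKm hbig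
      have h2 : P.unknowns (υ.arr wit) * (800 * (P.m * P.m)) ≤
          P.unknowns (σ.arr wit) * (800 * (P.m * P.m)) := Nat.mul_le_mul_right _ hun
      -- A leaf uses only `200` of the `1000` units that are set aside for each witness.
      have h3 : ∀ N, N * (1000 * (P.m * P.m)) = N * (200 * (P.m * P.m)) + N * (800 * (P.m * P.m)) :=
        fun N => by ring
      have h5 : υ.clock + P.unknowns (υ.arr wit) * (1000 * (P.m * P.m)) + 10 ≤
          σ.clock + P.unknowns (σ.arr wit) * (1000 * (P.m * P.m)) +
          (300 * (P.xx * P.xx * ((P.s + 1) * (P.s + 1))) +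
            60 * (P.m * P.rowCost J.length K.length) + 6000 * (P.m * P.m)) := by
        rw [h3, h3]
        simp only [Cond.cost_eq, Expr.cost_var, Expr.cost_lit] at hcυ
        omega
      have h4 := (Nat.cast_le (α := ℝ)).2 h5
      rw [Nat.cast_add _ (300 * _ + _ + _)] at h4
      exact h4.trans (by linarith)
    · intro hmode
      simp at hmode
      obtain ⟨r, hr0, hr1, hrow, hmed, hk1, hk2⟩ := hmne hmode
      have hrow' : AtRow Q P J K r (τ.tick ((Cond.eq (Expr.var mode) 0).cost + 1)) :=
        hrow.frame (S := []) (R := []) (by simp [Frame.refl]) (by decide) (by decide)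
      refine run_seq (run_scan hfit hrow' ?_)
      intro υ hG hB hcov h0 h1 hcυ
      rw [Frame.tick_left_iff] at hG
      simp only [State.tick_arr, hwτ] at hB h0 h1
      set u := P.cntJ J r with hu
      set v := P.cntK K (σ.arr wit) r with hv
      have hnj : τ.reg nj = u := hrow.nj
      have hnk : τ.reg nk = v := by rw [hrow.nk, hwτ]; rfl
      have huJ : u ≤ J.length := List.length_filter_le _ _
      have hvK : v ≤ K.length := List.length_filter_le _ _
      have huv : u * v ≤ P.m * P.m := Nat.mul_le_mul (by omega) (by omega)
      have hcυ' : υ.clock ≤ σ.clock + 500 * (P.m * P.m) + 70 := by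
        simp [hnj, hnk] at hcυ; omega
      have hFυ : Frame blockVars blockArrs σ υ := hFτ.trans (hG.mono (by decide) (by decide))
      have hυC : Consts P υ := hσ.toConsts.frame hFυ (by decide) (by decide)
      have hspυ : υ.reg sp = f' + 1 := (hG.reg sp (by decide)).trans hspτ
      have hfυ : υ.reg f = f' := (hG.reg f (by decide)).trans hfτ
      have hbsυ : υ.reg bs = f' * P.m := (hG.reg bs (by decide)).trans hbsτ
      have hnbυ : υ.reg nb = f' * P.m + P.m := (hG.reg nb (by decide)).trans hnbτ
      have hmodeυ : υ.reg mode = τ.reg mode := hG.reg mode (by decide)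
      have hsameυ : ∀ r : Arr, r ∉ [bj, bk, wit] → υ.arr r = σ.arr r := fun r hr =>
        (hG.arr r (by simp at hr ⊢; tauto)).trans (hsame r (by simp at hr ⊢; tauto))
      have haυ : υ.reg a = J.length := (hG.reg a (by decide)).trans hτ.a
      have hkυ : υ.reg c = K.length := (hG.reg c (by decide)).trans hτ.c
      have hiυ : υ.reg i = r := (hG.reg i (by decide)).trans hrow.i
      have hrn := hrow.r_lt
      have h1m : 1 ≤ P.m * P.m := Nat.one_le_iff_ne_zero.2 (by positivity)
      have hgb : J.length ≤ u * P.gg := hmed.1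
      have hgk : K.length ≤ v * P.gg := hmed.2
      have hJpos : 0 < J.length := by
        rcases Nat.eq_zero_or_pos J.length with h | h
        · rw [h] at hbig; simp at hbig
        · exact h
      have hKpos : 0 < K.length := by
        rcases Nat.eq_zero_or_pos K.length with h | h
        · rw [h] at hbig; simp at hbig
        · exact h
      -- The row is medium and the node not empty, so the removed rectangle is not empty and the
      -- area drops.
      have hupos : 0 < u := Nat.pos_of_ne_zero fun h => by rw [h] at hgb; omega
      have hvpos : 0 < v := Nat.pos_of_ne_zero fun h => by rw [h] at hgk; omega
      refine run_ite (by simp; omega) ?_ ?_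
      · intro hhit
        simp at hhit
        have hwυ : υ.arr wit = σ.arr wit := h0 hhit
        rw [hwυ] at hcov
        have hzero : ∀ j ∈ J, P.adj r j = true → ∀ k ∈ K, P.free (σ.arr wit) r k = true →
            ¬ 0 < P.B j k := by
          intro j hj hA k hk hfr hBjk
          exact hcov j hj k hk (by simpa [Params.adj] using hA) hBjk
            (by simpa [Params.free] using hfr)
        -- the conditions of the filters
        have condA : ∀ (S : List Var) (R : List Arr) (ξ : State), Frame S R υ ξ →
            (∀ r ∈ Var.i :: paramVars, r ∉ S) → (∀ r ∈ [Arr.inp, Arr.wit], r ∉ R) →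
            ξ.reg x ∈ J → (adjacent.Ok Q ξ ∧ (adjacent.Holds ξ ↔ P.adj r (ξ.reg x) = true)) ∧
            (nonadjacent.Ok Q ξ ∧ (nonadjacent.Holds ξ ↔ (!P.adj r (ξ.reg x)) = true)) := by
          intro S R ξ hH hS hR hx
          have hξ := hυC.frame hH (fun r hr => hS r (by simp [hr])) (hR _ (by decide))
          obtain ⟨e1, e2⟩ := entA_ok hfit hξ ((hH.reg i (hS _ (by decide))).trans hiυ) hrn rfl
            (hσ.J_lt f' hff _ hx)
          refine ⟨⟨⟨by simp; omega, e1⟩, ?_⟩, ⟨⟨e1, by simp; omega⟩, ?_⟩⟩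
          · rw [Cond.holds_lt, e2]; simp [Params.adj]
          · rw [Cond.holds_eq, e2]; simp [Params.adj]
        have condW : ∀ (S : List Var) (R : List Arr) (ξ : State), Frame S R υ ξ →
            (∀ r ∈ Var.i :: paramVars, r ∉ S) → (∀ r ∈ [Arr.inp, Arr.wit], r ∉ R) →
            ξ.reg x ∈ K →
            (unknown.Ok Q ξ ∧ (unknown.Holds ξ ↔ P.free (σ.arr wit) r (ξ.reg x) = true)) ∧
            (known.Ok Q ξ ∧ (known.Holds ξ ↔ (!P.free (σ.arr wit) r (ξ.reg x)) = true)) := by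
          intro S R ξ hH hS hR hx
          have hξ := hυC.frame hH (fun r hr => hS r (by simp [hr])) (hR _ (by decide))
          obtain ⟨e1, e2⟩ := entW_ok hfit hξ ((hH.reg i (hS _ (by decide))).trans hiυ) hrn rfl
            (hσ.K_lt f' hff _ hx)
          rw [hH.arr wit (hR _ (by decide)), hwυ] at e2
          refine ⟨⟨⟨e1, by simp; omega⟩, ?_⟩, ⟨⟨by simp; omega, e1⟩, ?_⟩⟩
          · rw [Cond.holds_eq, e2]; simp [Params.free]
          · rw [Cond.holds_lt, e2]; simp [Params.free, Nat.pos_iff_ne_zero]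
        have hlow : ∀ t < f', t * P.m + P.m ≤ f' * P.m := fun t ht => by
          rw [← Nat.succ_mul]; exact Nat.mul_le_mul_right _ ht
        have hJlow : ∀ t < f', σ.arr lj t ≤ P.m := fun t ht => by
          have := hσ.J_le t (by omega); simpa [nodeJ] using this
        have hKlow : ∀ t < f', σ.arr lk t ≤ P.m := fun t ht => by
          have := hσ.K_le t (by omega); simpa [nodeK] using this
        have hsucc : (f' + 1) * P.m = f' * P.m + P.m := Nat.succ_mul _ _
        have hsegJ : seg (υ.arr sj) (υ.reg bs) J.length = J := by
          rw [hsameυ sj (by decide), hbsυ, ← hJl]; rfl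
        have hsegK : seg (υ.arr sk) (υ.reg bs) K.length = K := by
          rw [hsameυ sk (by decide), hbsυ, ← hKl]; rfl
        have hnotJ := length_filter_not J (P.adj r)
        have hnotK := length_filter_not K (P.free (σ.arr wit) r)
        -- The two new nodes and the removed rectangle partition the old one; `hexpand'` is the same
        -- for the other cut.
        have hexpand : u * (K.length - v) + (J.length - u) * K.length + u * v =
            J.length * K.length := by
          rw [Nat.mul_sub, Nat.sub_mul]
          have e1 : u * v ≤ u * K.length := Nat.mul_le_mul_left _ hvK
          have e2 : u * K.length ≤ J.length * K.length := Nat.mul_le_mul_right _ huJ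
          omega
        have hexpand' : (J.length - u) * v + J.length * (K.length - v) + u * v =
            J.length * K.length := by
          rw [Nat.mul_sub, Nat.sub_mul]
          have e1 : u * v ≤ J.length * v := Nat.mul_le_mul_right _ huJ
          have e2 : J.length * v ≤ J.length * K.length := Nat.mul_le_mul_left _ hvK
          omega
        have huvpos : 0 < u * v := Nat.mul_pos hupos hvpos
        refine run_ite (by simp; omega) ?_ ?_
        · intro hm1'
          have hm1' : τ.reg mode = 1 := by simpa [hmodeυ] using hm1'
          refine run_split (L₁ := J) (L₂ := K) (pin := P.adj r) (pout₁ := fun y => !P.adj r y)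
            (pout₂ := fun y => !P.free (σ.arr wit) r y) (M := P.m) (by decide) (by decide)
            (by decide) (by decide) (by decide) (by simpa using haυ) (by simpa using hkυ)
            (by simpa using hsegJ) (by simpa using hsegK) (by simp [hnbυ, hbsυ])
            hJm hKm (by simp [hbsυ]; omega) (by simp [hspυ]; omega)
            (fun ξ hH hx => (condA _ _ ξ (by simpa using hH) (by decide) (by decide) hx).1)
            (fun ξ hH hx => (condA _ _ ξ (by simpa using hH) (by decide) (by decide) hx).2)
            (fun ξ hH hx => (condW _ _ ξ (by simpa using hH) (by decide) (by decide) hx).2)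
            (by simp) (by simp) (by simp) ?_
          simp only [State.tick_reg, State.tick_arr, Frame.tick_left_iff, State.tick_clock, hspυ,
            hfυ, hbsυ, hnbυ, hsameυ sj (by decide), hsameυ sk (by decide),
            hsameυ lj (by decide), hsameυ lk (by decide)]
          intro ξ hH hspξ hlk hlj hs1 hs2 hs3 hs4 hs5 hcξ
          have hFξ : Frame blockVars blockArrs σ ξ :=
            hFυ.trans (hH.mono (by decide) (by decide))
          refine NodeStep.push (Ja := J.filter fun y => !P.adj r y) (Ka := K)
            (Jb := J.filter (P.adj r)) (Kb := K.filter fun y => !P.free (σ.arr wit) r y)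
            hσ hsp hspξ (hσ.toConsts.frame hFξ (by decide) (by decide)) hFξ ?_ ?_ ?_ ?_ ?_ ?_
            List.filter_sublist (List.Sublist.refl _) List.filter_sublist List.filter_sublist
            ?_ ?_ ?_ ?_
          · intro t ht
            rw [nodeJ, nodeJ, hlj, Function.update_of_ne (by omega),
              Function.update_of_ne (by omega)]
            exact seg_congr fun y _ hy => hs4 y (by have := hlow t ht; have := hJlow t ht; omega)
          · intro t ht
            rw [nodeK, nodeK, hlk, Function.update_of_ne (by omega)]
            exact seg_congr fun y _ hy => hs5 y (by have := hlow t ht; have := hKlow t ht; omega)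
          · rw [nodeJ, hlj, Function.update_self]; exact hs3
          · rw [nodeK, hlk, Function.update_of_ne (by omega), hKl, hKdef, nodeK,
              length_seg]
            exact seg_congr fun y _ hy => hs5 y (by omega)
          · rw [nodeJ, hlj, Function.update_of_ne (by omega), Function.update_self, hsucc]
            exact hs1
          · rw [nodeK, hlk, Function.update_self, hsucc]; exact hs2
          · rw [hAr, hnotJ, hnotK]
            change (J.length - u) * K.length + u * (K.length - v) < _
            omega
          · rw [hH.arr wit (by decide), hwυ]
          · intro j hj k hk hBjk
            by_cases hA : P.adj r j = true
            · refine Or.inr ⟨List.mem_filter.2 ⟨hj, hA⟩, List.mem_filter.2 ⟨hk, ?_⟩⟩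
              by_contra hfr
              exact hzero j hj hA k hk (by simpa using hfr) hBjk
            · exact Or.inl ⟨List.mem_filter.2 ⟨hj, by simpa using hA⟩, hk⟩
          · have e1 := hφ.split J.length K.length u v hJm hKm huJ hvK hgb (hk1 hm1') hbig
            have e2 : ξ.clock + 10 ≤ σ.clock + 1000 * (P.m * P.m) := by
              simp at hcξ; omega
            have e3 := (Nat.cast_le (α := ℝ)).2 e2
            rw [Nat.cast_add σ.clock] at e3
            rw [hAr, hnotJ, hnotK]
            change _ + φ ((J.length - u) * K.length) + φ (u * (K.length - v)) ≤ _
            linarith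
        · intro hm1'
          have hm1' : τ.reg mode ≠ 1 := by simpa [hmodeυ] using hm1'
          refine run_split (L₁ := K) (L₂ := J) (pin := P.free (σ.arr wit) r)
            (pout₁ := fun y => !P.free (σ.arr wit) r y)
            (pout₂ := fun y => !P.adj r y) (M := P.m) (by decide) (by decide)
            (by decide) (by decide) (by decide) (by simpa using hkυ) (by simpa using haυ)
            (by simpa using hsegK) (by simpa using hsegJ) (by simp [hnbυ, hbsυ])
            hKm hJm (by simp [hbsυ]; omega) (by simp [hspυ]; omega)
            (fun ξ hH hx => (condW _ _ ξ (by simpa using hH) (by decide) (by decide) hx).1)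
            (fun ξ hH hx => (condW _ _ ξ (by simpa using hH) (by decide) (by decide) hx).2)
            (fun ξ hH hx => (condA _ _ ξ (by simpa using hH) (by decide) (by decide) hx).2)
            (by simp) (by simp) (by simp) ?_
          simp only [State.tick_reg, State.tick_arr, Frame.tick_left_iff, State.tick_clock, hspυ,
            hfυ, hbsυ, hnbυ, hsameυ sj (by decide), hsameυ sk (by decide),
            hsameυ lj (by decide), hsameυ lk (by decide)]
          intro ξ hH hspξ hlj hlk hs1 hs2 hs3 hs4 hs5 hcξ
          have hFξ : Frame blockVars blockArrs σ ξ :=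
            hFυ.trans (hH.mono (by decide) (by decide))
          refine NodeStep.push (Ja := J) (Ka := K.filter fun y => !P.free (σ.arr wit) r y)
            (Jb := J.filter fun y => !P.adj r y) (Kb := K.filter (P.free (σ.arr wit) r))
            hσ hsp hspξ (hσ.toConsts.frame hFξ (by decide) (by decide)) hFξ ?_ ?_ ?_ ?_ ?_ ?_
            (List.Sublist.refl _) List.filter_sublist List.filter_sublist List.filter_sublist
            ?_ ?_ ?_ ?_
          · intro t ht
            rw [nodeJ, nodeJ, hlj, Function.update_of_ne (by omega)]
            exact seg_congr fun y _ hy => hs5 y (by have := hlow t ht; have := hJlow t ht; omega)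
          · intro t ht
            rw [nodeK, nodeK, hlk, Function.update_of_ne (by omega),
              Function.update_of_ne (by omega)]
            exact seg_congr fun y _ hy => hs4 y (by have := hlow t ht; have := hKlow t ht; omega)
          · rw [nodeJ, hlj, Function.update_of_ne (by omega), hJl, hJdef, nodeJ,
              length_seg]
            exact seg_congr fun y _ hy => hs5 y (by omega)
          · rw [nodeK, hlk, Function.update_self]; exact hs3
          · rw [nodeJ, hlj, Function.update_self, hsucc]; exact hs2
          · rw [nodeK, hlk, Function.update_of_ne (by omega), Function.update_self, hsucc]
            exact hs1
          · rw [hAr, hnotJ, hnotK]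
            change J.length * (K.length - v) + (J.length - u) * v < _
            omega
          · rw [hH.arr wit (by decide), hwυ]
          · intro j hj k hk hBjk
            by_cases hfr : P.free (σ.arr wit) r k = true
            · refine Or.inr ⟨List.mem_filter.2 ⟨hj, ?_⟩, List.mem_filter.2 ⟨hk, hfr⟩⟩
              by_contra hA
              exact hzero j hj (by simpa using hA) k hk hfr hBjk
            · exact Or.inl ⟨hj, List.mem_filter.2 ⟨hk, by simpa using hfr⟩⟩
          -- In this mode `J` is the dense side, so the estimate is applied with the two sides
          -- exchanged.
          · have e1 := hφ.split K.length J.length v u hKm hJm hvK huJ hgk (hk2 hm1')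
              (by rwa [Nat.mul_comm K.length])
            rw [Nat.mul_comm K.length, Nat.mul_comm v, Nat.mul_comm (K.length - v)] at e1
            have e2 : ξ.clock + 10 ≤ σ.clock + 1000 * (P.m * P.m) := by
              simp at hcξ; omega
            have e3 := (Nat.cast_le (α := ℝ)).2 e2
            rw [Nat.cast_add σ.clock] at e3
            rw [hAr, hnotJ, hnotK]
            change _ + φ (J.length * (K.length - v)) + φ ((J.length - u) * v) ≤ _
            linarith
      · intro hhit
        simp at hhit
        have hun := h1 hhit
        refine run_skip (NodeStep.redo hσ (by simp [hspυ, hsp]) ?_ (by simpa using hFυ) ?_ ?_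
          (by simpa using hB) (by simpa using hun) ?_)
        · exact hυC.frame (S := []) (R := []) (by simp [Frame.refl]) (by decide) (by decide)
        · intro t
          simp only [nodeJ, State.tick_arr, hsameυ sj (by decide), hsameυ lj (by decide)]
        · intro t
          simp only [nodeK, State.tick_arr, hsameυ sk (by decide), hsameυ lk (by decide)]
        · have h4 : P.unknowns (υ.arr wit) * (1000 * (P.m * P.m)) + 1000 * (P.m * P.m) ≤
              P.unknowns (σ.arr wit) * (1000 * (P.m * P.m)) := by
            rw [← Nat.succ_mul]; exact Nat.mul_le_mul_right _ hun
          simp; omega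

end


/-! ### Blocks, and the search through all blocks -/

open Var Arr

section

variable {Q : ℕ} {P : Params} {σ τ : State} {Post : State → Prop} {r₀ r₁ : ℕ} {φ : ℕ → ℝ}

theorem run_fillRange {src l : Arr} {len lo hi : Var} (hlen : len ∉ [t, lo, hi])
    (hlo : lo ≠ t) (hl : l ≠ src) (hle : σ.reg lo ≤ σ.reg hi) (hQ : σ.reg hi < Q)
    (hPost : ∀ τ, Frame [len, t] [src, l] σ τ → τ.arr l 0 = σ.reg hi - σ.reg lo →
      (∀ y < σ.reg hi - σ.reg lo, τ.arr src y = σ.reg lo + y) →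
      τ.clock ≤ σ.clock + 20 * (σ.reg hi - σ.reg lo) + 20 → Post τ) :
    Run Q (fillRange src l len lo hi) σ Post := by
  simp only [List.mem_cons, List.not_mem_nil, or_false, not_or] at hlen
  obtain ⟨h1, h2, h3⟩ := hlen
  refine run_seq (run_assign (by simp [hle]) ?_)
  refine run_seq (run_assign (by simp; omega) ?_)
  refine run_seq (run_for (fun k τ => Frame [len, t] [src, l] σ τ ∧ τ.reg t = k ∧
    τ.reg len = σ.reg hi - σ.reg lo ∧ (∀ y < k, τ.arr src y = σ.reg lo + y) ∧
    τ.clock ≤ σ.clock + 10 + 20 * k) 0 (σ.reg hi - σ.reg lo) (Nat.zero_le _) (by omega)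
    ?_ ?_ ?_ ?_)
  · simp [Frame.refl, h1]
  · rintro k τ - - ⟨-, h4, h5, -⟩
    exact ⟨h4, h5⟩
  · rintro k τ - hk ⟨hF, ht, hlen, hs, hc⟩
    have hloτ : τ.reg lo = σ.reg lo := hF.reg lo (by simp [Ne.symm h2, hlo])
    refine run_store (by simp) (by simp [hloτ, ht]; omega) ?_
    refine ⟨by simp [ht], by simp [hF], by simp, by simp [h1, hlen], ?_, ?_⟩
    · simp only [State.set_arr, State.tick_arr, State.put_arr, if_true, Expr.eval_var,
        State.tick_reg, ht, Expr.eval_add, hloτ]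
      intro y hy
      by_cases h : y = k
      · subst h; simp
      · rw [Function.update_of_ne h]; exact hs y (by omega)
    · simp; omega
  · rintro τ ⟨hF, ht, hlen, hs, hc⟩
    refine run_store (by simp; omega) (by simp) (hPost _ (by simp [hF]) (by simp [hlen]) ?_ ?_)
    · simpa [Ne.symm hl] using hs
    · simp; omega

/-- The time, together with the time that the unknown entries still have to pay for. -/
noncomputable def pay (P : Params) (σ : State) : ℝ :=
  ((σ.clock + P.unknowns (σ.arr wit) * (1000 * (P.m * P.m)) : ℕ) : ℝ)

theorem pay_le_of_frame {S : List Var} {R : List Arr} (h : Frame S R σ τ) (hR : wit ∉ R) {N : ℕ}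
    (hc : τ.clock ≤ σ.clock + N) : pay P τ ≤ pay P σ + N := by
  rw [pay, pay, h.arr wit hR]
  exact_mod_cast (by omega)

/-- The first node has area at most `m ^ 2`. Time plus potential never increases, so at the end,
with an empty stack, the time is bounded by the potential at the beginning. An entry that has not
been found would still lie in a node of the stack. -/
theorem run_block (hfit : P.Fits Q) (hφ : Potential P φ) (hσ : Consts P σ) (hR : Rows P r₀ r₁ σ)
    {a₀ a₁ c₀ c₁ : ℕ} (hj0 : σ.reg j0 = a₀) (hj1 : σ.reg j1 = a₁) (hk0 : σ.reg k0 = c₀)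
    (hk1 : σ.reg k1 = c₁) (ha : a₀ ≤ a₁) (hc : c₀ ≤ c₁) (han : a₁ ≤ P.n) (hcn : c₁ ≤ P.n)
    (ham : a₁ ≤ a₀ + P.m) (hcm : c₁ ≤ c₀ + P.m)
    (hPost : ∀ τ, Frame blockVars blockArrs σ τ → P.Better (σ.arr wit) (τ.arr wit) →
      (∀ r, r₀ ≤ r → r < r₁ → ∀ j, a₀ ≤ j → j < a₁ → ∀ k, c₀ ≤ k → k < c₁ →
        0 < P.A r j → 0 < P.B j k → τ.arr wit (r * P.n + k) ≠ 0) →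
      pay P τ ≤ pay P σ + φ (P.m * P.m) + 40 * P.m + 100 → Post τ) :
    Run Q block σ Post := by
  have hn := hfit.n_lt
  have hnn : P.n ≤ P.n * P.n := Nat.le_mul_self _
  refine run_seq (run_fillRange (by decide) (by decide) (by decide)
    (by omega) (by omega) ?_)
  rw [hj0, hj1]
  intro τ hF hl hs hcτ
  have hk0τ : τ.reg k0 = c₀ := (hF.reg _ (by decide)).trans hk0
  have hk1τ : τ.reg k1 = c₁ := (hF.reg _ (by decide)).trans hk1
  refine run_seq (run_fillRange (by decide) (by decide) (by decide)
    (by omega) (by omega) ?_)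
  rw [hk0τ, hk1τ]
  intro υ hG hl' hs' hcυ
  have hFυ : Frame blockVars blockArrs σ υ :=
    (hF.mono (by decide) (by decide)).trans (hG.mono (by decide) (by decide))
  refine run_seq (run_assign (by simp; omega) ?_)
  generalize hσ₁ : State.set (υ.tick ((1 : Expr).cost + 1)) sp (Expr.eval υ 1) = σ₁
  have hF₁ : Frame blockVars blockArrs σ σ₁ := by rw [← hσ₁]; simp [hFυ]
  have hsp₁ : σ₁.reg sp = 1 := by rw [← hσ₁]; simp
  have harr : σ₁.arr = υ.arr := by rw [← hσ₁]; simp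
  have hw₁ : σ₁.arr wit = σ.arr wit := by
    rw [harr, hG.arr wit (by decide), hF.arr wit (by decide)]
  have hc₁ : σ₁.clock ≤ σ.clock + (40 * P.m + 50) := by rw [← hσ₁]; simp; omega
  have hC₁ : Consts P σ₁ := hσ.frame hF₁ (by decide) (by decide)
  have hJ : nodeJ P σ₁ 0 = (List.range (a₁ - a₀)).map fun y => a₀ + y := by
    rw [nodeJ, harr, hG.arr sj (by decide), hG.arr lj (by decide), hl, seg]
    refine List.map_congr_left fun y hy => ?_
    rw [Nat.zero_mul, Nat.zero_add]; exact hs y (List.mem_range.1 hy)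
  have hK : nodeK P σ₁ 0 = (List.range (c₁ - c₀)).map fun y => c₀ + y := by
    rw [nodeK, harr, hl', seg]
    refine List.map_congr_left fun y hy => ?_
    rw [Nat.zero_mul, Nat.zero_add]; exact hs' y (List.mem_range.1 hy)
  have hJlen : (nodeJ P σ₁ 0).length = a₁ - a₀ := by rw [hJ]; simp
  have hKlen : (nodeK P σ₁ 0).length = c₁ - c₀ := by rw [hK]; simp
  have harea : nodeArea P σ₁ 0 ≤ P.m * P.m := by
    rw [nodeArea, hJlen, hKlen]; exact Nat.mul_le_mul (by omega) (by omega)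
  have hR₁ : Rows P r₀ r₁ σ₁ := hR.frame hF₁ (by decide)
  refine run_loop (fun ξ => Stack P ξ ∧ Frame blockVars blockArrs σ ξ ∧
    P.Better (σ.arr wit) (ξ.arr wit) ∧
    (∀ r, r₀ ≤ r → r < r₁ → ∀ j ∈ nodeJ P σ₁ 0, ∀ k ∈ nodeK P σ₁ 0, 0 < P.A r j → 0 < P.B j k →
      ξ.arr wit (r * P.n + k) ≠ 0 ∨ ∃ t < ξ.reg sp, j ∈ nodeJ P ξ t ∧ k ∈ nodeK P ξ t) ∧
    pot P φ ξ ≤ pot P φ σ₁) (stackMeasure P) ⟨?_, hF₁, ?_, ?_, le_rfl⟩ ?_ ?_ ?_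
  · refine ⟨hC₁, ?_, ?_, ?_, ?_, ?_⟩
    · intro t ht y hy
      obtain rfl : t = 0 := by omega
      rw [hJ] at hy
      obtain ⟨y', hy', rfl⟩ := List.mem_map.1 hy
      have := List.mem_range.1 hy'
      omega
    · intro t ht y hy
      obtain rfl : t = 0 := by omega
      rw [hK] at hy
      obtain ⟨y', hy', rfl⟩ := List.mem_map.1 hy
      have := List.mem_range.1 hy'
      omega
    · intro t ht
      obtain rfl : t = 0 := by omega
      omega
    · intro t ht
      obtain rfl : t = 0 := by omega
      omega
    · rw [hsp₁, Finset.sum_range_one]; omega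
  · rw [hw₁]; exact Params.Better.refl _
  · exact fun r _ _ j hj k hk _ _ => Or.inr ⟨0, by omega, hj, hk⟩
  · intro ξ _; simp; omega
  · rintro ξ ⟨hS, hFξ, hB, hcov, hpot⟩ hpos
    simp only [Cond.holds_lt, Expr.eval_var, Expr.eval_lit] at hpos
    have hR' : Rows P r₀ r₁ ξ := hR.frame hFξ (by decide)
    refine (run_node hfit hφ (σ := ξ.tick ((Cond.lt 0 (Expr.var sp)).cost + 1)) (r₀ := r₀)
      (r₁ := r₁) ?_ ?_ hpos).mono ?_
    · exact ⟨hS.toConsts.frame (S := []) (R := []) (by simp [Frame.refl]) (by decide) (by decide),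
        hS.J_lt, hS.K_lt, hS.J_le, hS.K_le, hS.height⟩
    · exact hR'.frame (S := []) (R := []) (by simp [Frame.refl]) (by decide)
    · intro ζ hζ
      have hstep := hζ.pot_le
      have htick : pot P φ (ξ.tick ((Cond.lt 0 (Expr.var sp)).cost + 1)) = pot P φ ξ + 4 := by
        simp only [pot, State.tick_clock, State.tick_arr, State.tick_reg, Cond.cost_lt,
          Expr.cost_var, Expr.cost_lit]
        change _ + ∑ t ∈ Finset.range (ξ.reg sp), φ (nodeArea P ξ t) = _
        push_cast
        ring
      refine ⟨⟨hζ.stack, hFξ.trans (by simpa using hζ.frame), hB.trans hζ.better, ?_, ?_⟩,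
        hζ.measure_lt⟩
      · intro r hr0 hr1 j hj k hk hA hBjk
        rcases hcov r hr0 hr1 j hj k hk hA hBjk with h | ⟨t, ht, h1, h2⟩
        · exact Or.inl (hζ.better.mono _ h)
        · exact hζ.cover r hr0 hr1 t ht j h1 k h2 hA hBjk
      · linarith
  · rintro ξ ⟨hS, hFξ, hB, hcov, hpot⟩ hneg
    have hsp0 : ξ.reg sp = 0 := by simpa using hneg
    refine hPost _ (by simp [hFξ]) (by simpa using hB) ?_ ?_
    · intro r hr0 hr1 j hj0' hj1' k hk0' hk1' hA hBjk
      have hj : j ∈ nodeJ P σ₁ 0 := by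
        rw [hJ]; exact List.mem_map.2 ⟨j - a₀, List.mem_range.2 (by omega), by omega⟩
      have hk : k ∈ nodeK P σ₁ 0 := by
        rw [hK]; exact List.mem_map.2 ⟨k - c₀, List.mem_range.2 (by omega), by omega⟩
      rcases hcov r hr0 hr1 j hj k hk hA hBjk with h | ⟨t, ht, -⟩
      · exact h
      · omega
    -- No node is left, so only the clock and the charge for unknown entries remain.
    · have e1 : pot P φ ξ = pay P ξ := by rw [pot, hsp0, pay]; simp
      have e2 : pot P φ σ₁ ≤ pay P σ₁ + φ (P.m * P.m) := by
        rw [pot, hsp₁, Finset.sum_range_one, pay]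
        exact add_le_add le_rfl (hφ.mono harea)
      have e3 : pay P σ₁ ≤ pay P σ + (40 * P.m + 50 : ℕ) := by
        rw [pay, pay, hw₁]
        exact_mod_cast (by omega)
      have e4 : pay P (ξ.tick ((Cond.lt 0 (Expr.var sp)).cost + 1)) = pay P ξ + 4 := by
        simp only [pay, State.tick_clock, State.tick_arr, Cond.cost_lt,
          Expr.cost_var, Expr.cost_lit]
        push_cast
        ring
      rw [e4]
      push_cast at e3
      linarith

/-- The first argument of the invariant counts the intervals, the second is the start of the next
one. All intervals but the last have length `M`, which bounds their number by `N / M + 1`. -/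
theorem run_intervals {x y : Var} {body : Cmd} (I : ℕ → ℕ → State → Prop) {N M : ℕ} (hM : 0 < M)
    (hNM : N + M < Q) (hy : y ∉ [x, n, m])
    (h0 : I 0 0 ((σ.tick 2).set x 0))
    (hv : ∀ c t τ, I c t τ → τ.reg x = t ∧ τ.reg n = N ∧ τ.reg m = M)
    (hbody : ∀ c t t' τ τ', I c t τ → t < t' → t' ≤ N → t' ≤ t + M → Frame [y] [] τ τ' →
      τ'.reg y = t' → τ'.clock ≤ τ.clock + 20 →
      Run Q body τ' fun υ => υ.reg y = t' ∧ I (c + 1) t' ((υ.tick 2).set x t'))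
    (hexit : ∀ c τ, I c N τ → c ≤ N / M + 1 → Post (τ.tick 4)) :
    Run Q (intervals x y body) σ Post := by
  simp only [List.mem_cons, List.not_mem_nil, or_false, not_or] at hy
  obtain ⟨hyx, hyn, hym⟩ := hy
  refine run_seq (run_assign (by simp; omega) ?_)
  refine run_loop (fun τ => ∃ c t, I c t τ ∧ t ≤ N ∧ c ≤ N / M + 1 ∧ (t = c * M ∨ t = N))
    (fun τ => N - τ.reg x) ⟨0, 0, by simpa using h0, Nat.zero_le _, Nat.zero_le _, Or.inl (Nat.zero_mul _).symm⟩ ?_ ?_ ?_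
  · intro τ _; simp
  · rintro τ ⟨c, t, hI, htN, hc, htc⟩ hlt
    obtain ⟨hx, hn, hm⟩ := hv c t τ hI
    simp only [Cond.holds_lt, Expr.eval_var, hx, hn] at hlt
    obtain rfl : t = c * M := by omega
    have hcM : c ≤ N / M := (Nat.le_div_iff_mul_le hM).2 htN
    -- the end of the interval
    have main : ∀ τ', Frame [y] [] τ τ' → τ'.reg y = min (c * M + M) N →
        τ'.clock ≤ τ.clock + 20 → Run Q (body ;; x ::= y) τ' fun υ =>
          (∃ c t, I c t υ ∧ t ≤ N ∧ c ≤ N / M + 1 ∧ (t = c * M ∨ t = N)) ∧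
          N - υ.reg x < N - τ.reg x := by
      intro τ' hF hy' hc'
      refine run_seq ((hbody c (c * M) (min (c * M + M) N) τ τ' hI (by omega) (by omega) (by omega)
        hF hy' hc').mono ?_)
      rintro υ ⟨hyυ, hI'⟩
      refine run_assign (by simp) ⟨⟨c + 1, min (c * M + M) N, ?_, by omega, by omega, ?_⟩, ?_⟩
      · simpa [hyυ] using hI'
      · rw [Nat.succ_mul]; omega
      · simp [hyυ, hx]; omega
    refine run_seq (run_assign (by simp [hx, hm]; omega) ?_)
    refine run_seq (run_ite (by simp) ?_ ?_)
    · intro h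
      simp [hx, hn, hm, Ne.symm hyn] at h
      refine run_assign (by simp) (main _ (by simp [Frame.refl]) ?_ ?_)
      · simp [hn, Ne.symm hyn]; omega
      · simp
    · intro h
      simp [hx, hn, hm, Ne.symm hyn] at h
      refine run_skip (main _ (by simp [Frame.refl]) ?_ ?_)
      · simp [hx, hm]; omega
      · simp
  · rintro τ ⟨c, t, hI, htN, hc, htc⟩ hge
    obtain ⟨hx, hn, hm⟩ := hv c t τ hI
    simp only [Cond.holds_lt, Expr.eval_var, hx, hn] at hge
    obtain rfl : t = N := by omega
    exact hexit c τ hI hc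

abbrev searchVars : List Var := i0 :: i1 :: j0 :: j1 :: k0 :: k1 :: blockVars

/-- The estimate is made for `pay` and not for the clock, because an entry of the product is charged
once for all blocks and not once for each block. -/
theorem run_search (hfit : P.Fits Q) (hφ : Potential P φ) (hφ0 : 0 ≤ φ (P.m * P.m))
    (hσ : Consts P σ) (hPost : ∀ τ, Frame searchVars blockArrs σ τ →
      P.Better (σ.arr wit) (τ.arr wit) →
      (∀ i < P.n, ∀ j < P.n, ∀ k < P.n, 0 < P.A i j → 0 < P.B j k →
        τ.arr wit (i * P.n + k) ≠ 0) →
      pay P τ ≤ pay P σ + 10 + (P.n / P.m + 1 : ℕ) * (30 + (P.n / P.m + 1 : ℕ) * (30 +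
        (P.n / P.m + 1 : ℕ) * (φ (P.m * P.m) + 40 * P.m + 130))) → Post τ) :
    Run Q search σ Post := by
  have hn := hfit.n_lt
  have hmn := hfit.m_le
  have hmp := hfit.m_pos
  have hnn : P.n ≤ P.n * P.n := Nat.le_mul_self _
  have hNM : P.n + P.m < Q := by omega
  set C := φ (P.m * P.m) + 40 * P.m + 130 with hC
  set D : ℝ := ((P.n / P.m + 1 : ℕ) : ℝ) with hD
  have hC0 : 0 ≤ C := by positivity
  have hD0 : 0 ≤ D := by positivity
  have htick : ∀ (ξ : State) (d : Var) (t z : ℕ), pay P ((ξ.tick t).set d z) = pay P ξ + t := by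
    intro ξ d t z
    simp only [pay, State.set_arr, State.tick_arr, State.set_clock, State.tick_clock]
    push_cast; ring
  have htick' : ∀ (ξ : State) (t : ℕ), pay P (ξ.tick t) = pay P ξ + t := by
    intro ξ t
    simp only [pay, State.tick_arr, State.tick_clock]
    push_cast; ring
  have hcD : ∀ {c : ℕ}, c ≤ P.n / P.m + 1 → (c : ℝ) ≤ D := fun h => Nat.cast_le.2 h
  refine run_intervals (fun c t τ => Frame searchVars blockArrs σ τ ∧ τ.reg i0 = t ∧
    P.Better (σ.arr wit) (τ.arr wit) ∧
    (∀ i < t, ∀ j < P.n, ∀ k < P.n, 0 < P.A i j → 0 < P.B j k →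
      τ.arr wit (i * P.n + k) ≠ 0) ∧
    pay P τ ≤ pay P σ + 2 + c * (30 + D * (30 + D * C))) hmp hNM (by decide) ?_ ?_ ?_ ?_
  · refine ⟨by simp [Frame.refl], by simp, by simpa using Params.Better.refl _, by simp, ?_⟩
    rw [htick]; simp
  · rintro c t τ ⟨hF, h, -⟩
    exact ⟨h, (hF.reg _ (by decide)).trans hσ.n, (hF.reg _ (by decide)).trans hσ.m⟩
  · rintro ci s₀ s₁ τ₀ τ ⟨hF₀, hi0, hB₀, hcov₀, hp₀⟩ hs hsn hsm hFy hi1 hcy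
    have hFτ : Frame searchVars blockArrs σ τ := hF₀.trans (hFy.mono (by decide) (by decide))
    have hi0 : τ.reg i0 = s₀ := (hFy.reg _ (by decide)).trans hi0
    have hp := pay_le_of_frame (P := P) hFy (by decide) hcy
    have hwy : τ.arr wit = τ₀.arr wit := hFy.arr wit (by decide)
    rw [← hwy] at hB₀ hcov₀
    clear hFy hcy hF₀
    refine run_intervals (fun c t υ => Frame searchVars blockArrs σ υ ∧ υ.reg j0 = t ∧
      υ.reg i0 = s₀ ∧ υ.reg i1 = s₁ ∧ P.Better (τ.arr wit) (υ.arr wit) ∧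
      (∀ i, s₀ ≤ i → i < s₁ → ∀ j < t, ∀ k < P.n, 0 < P.A i j → 0 < P.B j k →
        υ.arr wit (i * P.n + k) ≠ 0) ∧
      pay P υ ≤ pay P τ + 2 + c * (30 + D * C)) hmp hNM (by decide) ?_ ?_ ?_ ?_
    · refine ⟨by simp [hFτ], by simp, by simp [hi0], by simp [hi1],
        by simpa using Params.Better.refl _, by simp, ?_⟩
      rw [htick]; simp
    · rintro c t υ ⟨hF, h, -⟩
      exact ⟨h, (hF.reg _ (by decide)).trans hσ.n, (hF.reg _ (by decide)).trans hσ.m⟩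
    · rintro cj a₀ a₁ υ₀ υ ⟨hG₀, hj0, hi0', hi1', hB₁, hcov₁, hp₁⟩ ha han ham hFy hj1 hcy
      have hFυ : Frame searchVars blockArrs σ υ := hG₀.trans (hFy.mono (by decide) (by decide))
      have hj0 : υ.reg j0 = a₀ := (hFy.reg _ (by decide)).trans hj0
      have hi0' : υ.reg i0 = s₀ := (hFy.reg _ (by decide)).trans hi0'
      have hi1' : υ.reg i1 = s₁ := (hFy.reg _ (by decide)).trans hi1'
      have hp' := pay_le_of_frame (P := P) hFy (by decide) hcy
      have hwy' : υ.arr wit = υ₀.arr wit := hFy.arr wit (by decide)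
      rw [← hwy'] at hB₁ hcov₁
      clear hFy hcy hG₀
      refine run_intervals (fun c t ξ => Frame searchVars blockArrs σ ξ ∧ ξ.reg k0 = t ∧
        ξ.reg i0 = s₀ ∧ ξ.reg i1 = s₁ ∧ ξ.reg j0 = a₀ ∧ ξ.reg j1 = a₁ ∧
        P.Better (υ.arr wit) (ξ.arr wit) ∧
        (∀ i, s₀ ≤ i → i < s₁ → ∀ j, a₀ ≤ j → j < a₁ → ∀ k < t, 0 < P.A i j → 0 < P.B j k →
          ξ.arr wit (i * P.n + k) ≠ 0) ∧
        pay P ξ ≤ pay P υ + 2 + c * C) hmp hNM (by decide) ?_ ?_ ?_ ?_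
      · refine ⟨by simp [hFυ], by simp, by simp [hi0'], by simp [hi1'], by simp [hj0],
          by simp [hj1], by simpa using Params.Better.refl _, by simp, ?_⟩
        rw [htick]; simp
      · rintro c t ξ ⟨hF, h, -⟩
        exact ⟨h, (hF.reg _ (by decide)).trans hσ.n, (hF.reg _ (by decide)).trans hσ.m⟩
      · rintro ck c₀ c₁ ξ₀ ξ ⟨hH₀, hk0, hi0'', hi1'', hj0', hj1', hB₂, hcov₂, hp₂⟩ hc hcn hcm hFy
          hk1 hcy
        have hFξ : Frame searchVars blockArrs σ ξ := hH₀.trans (hFy.mono (by decide) (by decide))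
        have hp'' := pay_le_of_frame (P := P) hFy (by decide) hcy
        have hwy'' : ξ.arr wit = ξ₀.arr wit := hFy.arr wit (by decide)
        have hk0 : ξ.reg k0 = c₀ := (hFy.reg _ (by decide)).trans hk0
        have hj0' : ξ.reg j0 = a₀ := (hFy.reg _ (by decide)).trans hj0'
        have hj1' : ξ.reg j1 = a₁ := (hFy.reg _ (by decide)).trans hj1'
        have hi0'' : ξ.reg i0 = s₀ := (hFy.reg _ (by decide)).trans hi0''
        have hi1'' : ξ.reg i1 = s₁ := (hFy.reg _ (by decide)).trans hi1''
        rw [← hwy''] at hB₂ hcov₂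
        refine run_block hfit hφ (hσ.frame hFξ (by decide) (by decide))
          ⟨hi0'', hi1'', hs.le, hsn, hsm⟩ hj0' hj1' hk0 hk1 ha.le hc.le han hcn ham hcm ?_
        intro ζ hI hB₃ hcov₃ hp₃
        refine ⟨(hI.reg _ (by decide)).trans hk1, ?_, by simp,
          by simpa using (hI.reg _ (by decide)).trans hi0'',
          by simpa using (hI.reg _ (by decide)).trans hi1'',
          by simpa using (hI.reg _ (by decide)).trans hj0',
          by simpa using (hI.reg _ (by decide)).trans hj1', by simpa using hB₂.trans hB₃, ?_, ?_⟩
        · simpa using hFξ.trans (hI.mono (by decide) (by decide))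
        · intro i hi hi' j hj hj' k hk hA hBjk
          simp only [State.set_arr, State.tick_arr]
          rcases Nat.lt_or_ge k c₀ with h | h
          · exact hB₃.mono _ (hcov₂ i hi hi' j hj hj' k h hA hBjk)
          · exact hcov₃ i hi hi' j hj hj' k h hk hA hBjk
        · rw [htick]; push_cast at hp'' ⊢; linarith
      · rintro ck ξ ⟨hFξ, hk0, hi0'', hi1'', hj0', hj1', hB₂, hcov₂, hp₂⟩ hck
        refine ⟨by simpa using hj1', by simp [hFξ], by simp, by simpa using hi0'',
          by simpa using hi1'', by simpa using hB₁.trans hB₂, ?_, ?_⟩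
        · intro i hi hi' j hj k hk hA hBjk
          simp only [State.set_arr, State.tick_arr]
          rcases Nat.lt_or_ge j a₀ with h | h
          · exact hB₂.mono _ (hcov₁ i hi hi' j h k hk hA hBjk)
          · exact hcov₂ i hi hi' j h hj k hk hA hBjk
        · rw [htick, htick']
          have := mul_le_mul_of_nonneg_right (hcD hck) hC0
          push_cast at hp' ⊢; linarith
    · rintro cj υ ⟨hFυ, hj0, hi0', hi1', hB₁, hcov₁, hp₁⟩ hcj
      refine ⟨by simpa using hi1', by simp [hFυ], by simp, by simpa using hB₀.trans hB₁, ?_, ?_⟩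
      · intro i hi j hj k hk hA hBjk
        simp only [State.set_arr, State.tick_arr]
        rcases Nat.lt_or_ge i s₀ with h | h
        · exact hB₁.mono _ (hcov₀ i h j hj k hk hA hBjk)
        · exact hcov₁ i h hi j hj k hk hA hBjk
      · rw [htick, htick']
        have := mul_le_mul_of_nonneg_right (hcD hcj) (show 0 ≤ 30 + D * C by positivity)
        push_cast at hp ⊢; linarith
  · rintro ci τ ⟨hF, hi0, hB, hcov, hp⟩ hci
    refine hPost _ (by simp [hF]) (by simpa using hB) (by simpa using hcov) ?_
    rw [htick']
    have := mul_le_mul_of_nonneg_right (hcD hci) (show 0 ≤ 30 + D * (30 + D * C) by positivity)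
    push_cast; linarith

end


open Var Arr BMM

/-! ### The certificate -/

/-- The words of a line of a certificate. -/
def lineWords {N : ℕ} : Line N → List ℕ
  | .zeroLeft i' j' => [0, i', j', 0]
  | .zeroRight j' k' => [1, j', k', 0]
  | .witness i' j' k' => [2, i', j', k']
  | .merge axis p' q' => [3, axis, p', q']

theorem map_lineWords (w : ℕ) {N : ℕ} (L : List (Line N)) :
    (L.flatMap lineWords).map (BitVec.ofNat w) = L.flatMap (Line.words w) := by
  rw [List.map_flatMap]
  congr 1
  funext l
  cases l <;> rfl

theorem length_of_derivation {N : ℕ} {A B : Matrix (Fin N) (Fin N) Bool} {L : List (Line N)}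
    {X : List (Box N)} (h : Derivation A B L X) : X.length = L.length := by
  induction h <;> simp [*]

/-- Line number `t` yields a box that contains `S`. -/
def HasBox {N : ℕ} (X : List (Box N)) (t : ℕ) (S : Box N) : Prop :=
  ∃ Y, X[t]? = some Y ∧ ∀ a, S a ⊆ Y a

/-- The last line of a chain, with number `top - 1`, yields a box that contains `S`; or the chain and
the side of `S` on the axis are empty. -/
def ChainBox {N : ℕ} (X : List (Box N)) (top : ℕ) (axis : Fin 3) (S : Box N) : Prop :=
  (top = 0 → S axis = ∅) ∧ (top ≠ 0 → HasBox X (top - 1) S)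

section

variable {N : ℕ} {X X' : List (Box N)} {t top : ℕ} {S S' : Box N} {axis : Fin 3}

theorem HasBox.mono (h : HasBox X t S) (hX : X.IsPrefix X') : HasBox X' t S := by
  obtain ⟨Y, hY, hS⟩ := h
  obtain ⟨Z, rfl⟩ := hX
  refine ⟨Y, ?_, hS⟩
  rw [List.getElem?_append_left (List.getElem?_eq_some_iff.1 hY).1, hY]

theorem HasBox.subset (h : HasBox X t S) (hS : ∀ a, S' a ⊆ S a) : HasBox X t S' := by
  obtain ⟨Y, hY, hS'⟩ := h
  exact ⟨Y, hY, fun a => (hS a).trans (hS' a)⟩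

theorem ChainBox.mono (h : ChainBox X top axis S) (hX : X.IsPrefix X') :
    ChainBox X' top axis S :=
  ⟨h.1, fun ht => (h.2 ht).mono hX⟩

theorem HasBox.last (X : List (Box N)) (Y : Box N) : HasBox (X ++ [Y]) X.length Y :=
  ⟨Y, by simp, fun _ => subset_rfl⟩

end

/-- The output tape holds the derivation `L` of the boxes `X`. -/
structure Writing (P : Params) (A B : Matrix (Fin P.n) (Fin P.n) Bool) (W : ℕ → ℕ)
    (L : List (Line P.n)) (X : List (Box P.n)) (σ : State) : Prop where
  inp : σ.arr inp = P.inp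
  wit : σ.arr wit = W
  n : σ.reg n = P.n
  der : Derivation A B L X
  out : σ.out = L.flatMap lineWords
  ln : σ.reg ln = L.length

section

variable {Q : ℕ} {P : Params} {A B : Matrix (Fin P.n) (Fin P.n) Bool} {W : ℕ → ℕ}
  {L : List (Line P.n)} {X : List (Box P.n)} {σ τ : State} {Post : State → Prop}

theorem Writing.congr (h : Writing P A B W L X σ) (h1 : τ.arr Arr.inp = σ.arr Arr.inp)
    (h2 : τ.arr Arr.wit = σ.arr Arr.wit) (h3 : τ.reg Var.n = σ.reg Var.n) (h4 : τ.out = σ.out)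
    (h5 : τ.reg Var.ln = σ.reg Var.ln) : Writing P A B W L X τ :=
  ⟨h1.trans h.inp, h2.trans h.wit, h3.trans h.n, h.der, h4.trans h.out, h5.trans h.ln⟩

theorem run_emit_value {e : Expr} {v : ℕ} (he : e.Ok Q σ ∧ e.eval σ = v)
    (h : Post ((σ.tick (e.cost + 1)).print v)) : Run Q (.emit e) σ Post :=
  run_emit he.1 (he.2 ▸ h)

theorem run_emitLine (hσ : Writing P A B W L X σ) (l : Line P.n) (Y : Box P.n)
    (hl : Derivation A B (L ++ [l]) (X ++ [Y])) {e₀ e₁ e₂ e₃ : Expr} {v₀ v₁ v₂ v₃ : ℕ}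
    (hv : lineWords l = [v₀, v₁, v₂, v₃])
    (h₀ : ∀ τ : State, τ.reg = σ.reg → τ.arr = σ.arr → e₀.Ok Q τ ∧ e₀.eval τ = v₀)
    (h₁ : ∀ τ : State, τ.reg = σ.reg → τ.arr = σ.arr → e₁.Ok Q τ ∧ e₁.eval τ = v₁)
    (h₂ : ∀ τ : State, τ.reg = σ.reg → τ.arr = σ.arr → e₂.Ok Q τ ∧ e₂.eval τ = v₂)
    (h₃ : ∀ τ : State, τ.reg = σ.reg → τ.arr = σ.arr → e₃.Ok Q τ ∧ e₃.eval τ = v₃)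
    (hc : e₀.cost + e₁.cost + e₂.cost + e₃.cost ≤ 20) (hQ : L.length + 1 < Q)
    (hPost : ∀ τ, Writing P A B W (L ++ [l]) (X ++ [Y]) τ → HasBox (X ++ [Y]) (τ.reg p) Y →
      (∀ r, r ≠ p → r ≠ ln → τ.reg r = σ.reg r) → τ.arr = σ.arr →
      τ.clock ≤ σ.clock + 40 → Post τ) :
    Run Q (emitLine e₀ e₁ e₂ e₃) σ Post := by
  refine run_seq (run_emit_value (h₀ _ (by rfl) (by rfl)) ?_)
  refine run_seq (run_emit_value (h₁ _ (by rfl) (by rfl)) ?_)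
  refine run_seq (run_emit_value (h₂ _ (by rfl) (by rfl)) ?_)
  refine run_seq (run_emit_value (h₃ _ (by rfl) (by rfl)) ?_)
  refine run_seq (run_assign (by simp) ?_)
  refine run_assign (by simp [hσ.ln]; omega) ?_
  refine hPost _ ⟨by simp [hσ.inp], by simp [hσ.wit], by simp [hσ.n], hl, ?_, by simp [hσ.ln]⟩
    ?_ ?_ (by simp) ?_
  · simp [hσ.out, hv]
  · have : HasBox (X ++ [Y]) L.length Y := length_of_derivation hσ.der ▸ HasBox.last X Y
    simpa [hσ.ln] using this
  · intro r h1 h2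
    simp [h1, h2]
  · simp; omega

/-- On the axis the sides are united; on the other axes `S` and `S'` agree, so the intersection
loses nothing. For an empty chain no line is printed: the given line becomes the chain, which is
correct because `S` is then empty on the axis. -/
theorem run_chain (hσ : Writing P A B W L X σ) {ax : Expr} {axis : Fin 3}
    (hax : ∀ τ, ax.Ok Q τ ∧ ax.eval τ = axis) (haxc : ax.cost = 1) {top line : Var}
    (htl : top ∉ [line, n, ln]) {S S' : Box P.n}
    (hS : ChainBox X (σ.reg top) axis S) (hS' : HasBox X (σ.reg line) S')
    (hSS : ∀ a, a ≠ axis → S a = S' a) (hQ : L.length + 2 < Q) (hline : σ.reg line + 1 < Q)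
    (hPost : ∀ τ L' X', Writing P A B W L' X' τ → X.IsPrefix X' → L'.length ≤ L.length + 1 →
      τ.reg top ≠ 0 → HasBox X' (τ.reg top - 1) (Function.update S axis (S axis ∪ S' axis)) →
      (∀ r, r ≠ top → r ≠ ln → τ.reg r = σ.reg r) → τ.arr = σ.arr →
      τ.clock ≤ σ.clock + 30 → Post τ) :
    Run Q (chain ax top line) σ Post := by
  simp only [List.mem_cons, List.not_mem_nil, or_false, not_or] at htl
  obtain ⟨h1, h2, h3⟩ := htl
  have hQ3 : 3 < Q ∨ Q ≤ 3 := Nat.lt_or_ge _ _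
  refine run_ite (by simp; omega) ?_ ?_
  · intro h
    simp at h
    refine run_assign (by simp; omega) (hPost _ L X ?_ (List.prefix_refl _) (Nat.le_succ _)
      (by simp) ?_ ?_ (by simp) ?_)
    · exact hσ.congr (by simp) (by simp) (by simp [Ne.symm h2]) (by simp) (by simp [Ne.symm h3])
    · simp only [State.set_reg, if_true, Expr.eval_add, Expr.eval_var, Expr.eval_lit,
        State.tick_reg, Nat.add_sub_cancel]
      refine hS'.subset fun a => ?_
      by_cases ha : a = axis
      · subst ha; simp [hS.1 h]
      · rw [Function.update_of_ne ha, hSS a ha]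
    · intro r hr _; simp [hr]
    · simp
  · intro h
    simp at h
    obtain ⟨Y, hY, hSY⟩ := hS.2 h
    obtain ⟨Z, hZ, hSZ⟩ := hS'
    have hL1 : 1 ≤ L.length := by
      have := (List.getElem?_eq_some_iff.1 hY).1
      rw [length_of_derivation hσ.der] at this
      omega
    refine run_seq (run_emit (by simp; omega) ?_)
    refine run_seq (run_emit (hax _).1 ?_)
    rw [(hax _).2, haxc]
    refine run_seq (run_emit (by simp; omega) ?_)
    refine run_seq (run_emit (by simp) ?_)
    refine run_seq (run_assign (by simp [hσ.ln]; omega) ?_)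
    refine run_assign (by simp) ?_
    refine hPost _ (L ++ [Line.merge axis (σ.reg top - 1) (σ.reg line)]) (X ++ [Y.merge Z axis])
      ⟨by simp [hσ.inp], by simp [hσ.wit], by simp [hσ.n, Ne.symm h2],
        .merge hσ.der hY hZ, ?_, by simp [hσ.ln, Ne.symm h3]⟩ (List.prefix_append _ _) (by simp)
      (by simp [hσ.ln]) ?_ ?_ (by simp) ?_
    · simp [hσ.out, lineWords]
    · have hbox := HasBox.last X (Y.merge Z axis)
      rw [length_of_derivation hσ.der] at hbox
      have e : ∀ a, Function.update S axis (S axis ∪ S' axis) a ⊆ Y.merge Z axis a := by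
        intro a
        by_cases ha : a = axis
        · subst ha
          simpa [Box.merge] using
            ⟨(hSY a).trans Set.subset_union_left, (hSZ a).trans Set.subset_union_right⟩
        · rw [Function.update_of_ne ha, Box.merge, if_neg ha]
          exact Set.subset_inter (hSY a) (hSS a ha ▸ hSZ a)
      simpa [hσ.ln] using hbox.subset e
    · intro r hr hr'; simp [hr, hr']
    · simp

theorem HasBox.lt (hσ : Writing P A B W L X σ) {t : ℕ} {S : Box P.n} (h : HasBox X t S) :
    t < L.length := by
  obtain ⟨Y, hY, -⟩ := h
  rw [← length_of_derivation hσ.der]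
  exact (List.getElem?_eq_some_iff.1 hY).1

/-- The zeros of row `j` of `B`. -/
abbrev zeroBox (B : Matrix (Fin P.n) (Fin P.n) Bool) (r : Fin P.n) (T : Set (Fin P.n)) : Box P.n :=
  ![Set.univ, {r}, {y' | y' ∈ T ∧ B r y' = false}]

/-- Each zero of `B` costs at most two lines, itself and one merge. The chains are built once and
shared by all rows of the product, which keeps the whole certificate quadratic. -/
theorem run_zeroRows (hB : ∀ y y' : Fin P.n, 0 < P.B y y' ↔ B y y' = true)
    (hn : 16 * (P.n * P.n) + 16 < Q) (hσ : Writing P A B W [] [] σ)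
    (hPost : ∀ τ L X, Writing P A B W L X τ → L.length ≤ 2 * (P.n * P.n) →
      (∀ y : Fin P.n, ChainBox X (τ.arr zr y) 2 (zeroBox B y Set.univ)) →
      τ.clock ≤ σ.clock + 200 * (P.n * P.n) + 10 → Post τ) :
    Run Q zeroRows σ Post := by
  have hnn : P.n ≤ P.n * P.n := Nat.le_mul_self _
  refine run_seq (run_assign (by simp; omega) ?_)
  refine run_for (fun s τ => ∃ L X, Writing P A B W L X τ ∧ τ.reg j = s ∧
    L.length ≤ s * (2 * P.n) ∧
    (∀ y : Fin P.n, (y : ℕ) < s → ChainBox X (τ.arr zr y) 2 (zeroBox B y Set.univ)) ∧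
    τ.clock ≤ σ.clock + 4 + s * (110 * P.n + 30)) 0 P.n (Nat.zero_le _) (by omega) ?_ ?_ ?_ ?_
  · exact ⟨[], [], hσ.congr (by simp) (by simp) (by simp) (by simp) (by simp), by simp, by simp,
      by simp, by simp⟩
  · rintro s τ - - ⟨L, X, hτ, hj, -⟩
    exact ⟨hj, hτ.n⟩
  · rintro s τ - hs ⟨L, X, hτ, hj, hL, hzr, hc⟩
    have hsn : s * (2 * P.n) + 2 * P.n ≤ 2 * (P.n * P.n) := by
      calc s * (2 * P.n) + 2 * P.n = (s + 1) * (2 * P.n) := (Nat.succ_mul _ _).symm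
        _ ≤ P.n * (2 * P.n) := Nat.mul_le_mul_right _ hs
        _ = _ := by ring
    have hsucc : (s + 1) * (2 * P.n) = s * (2 * P.n) + 2 * P.n := Nat.succ_mul _ _
    have hsucc' : (s + 1) * (110 * P.n + 30) = s * (110 * P.n + 30) + (110 * P.n + 30) :=
      Nat.succ_mul _ _
    refine run_seq (run_assign (by simp; omega) ?_)
    refine run_seq (run_assign (by simp; omega) ?_)
    refine run_seq (run_for (fun t υ => ∃ L X, Writing P A B W L X υ ∧ υ.reg j = s ∧ υ.reg k = t ∧
      L.length ≤ s * (2 * P.n) + 2 * t ∧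
      (∀ y : Fin P.n, (y : ℕ) < s → ChainBox X (υ.arr zr y) 2 (zeroBox B y Set.univ)) ∧
      ChainBox X (υ.reg cur) 2 (zeroBox B ⟨s, hs⟩ {y' | (y' : ℕ) < t}) ∧
      υ.clock ≤ σ.clock + 4 + s * (110 * P.n + 30) + 10 + 110 * t) 0 P.n (Nat.zero_le _)
      (by omega) ?_ ?_ ?_ ?_)
    · refine ⟨L, X, hτ.congr (by simp) (by simp) (by simp) (by simp) (by simp), by simp [hj],
        by simp, by simpa using hL, by simpa using hzr, ?_, ?_⟩
      · simp [ChainBox]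
      · simp; omega
    · rintro t υ - - ⟨L, X, hυ, -, hk, -⟩
      exact ⟨hk, hυ.n⟩
    · rintro t υ - ht ⟨L, X, hυ, hj, hk, hL, hzr, hch, hc⟩
      have hBv : (entB Var.j Var.k).eval (υ.tick 4) = P.B s t := by
        simp [hυ.inp, hυ.n, hj, hk, Params.B]
      have hst := pair_lt hs ht
      have hset : {y' : Fin P.n | (y' : ℕ) < t + 1} = {y' : Fin P.n | (y' : ℕ) < t} ∪ {⟨t, ht⟩} := by
        ext y'; simp [Fin.ext_iff]; omega
      refine run_ite ?_ ?_ ?_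
      · simp [hυ.n, hj, hk]; omega
      · intro h0
        rw [Cond.holds_eq, hBv] at h0
        have h0 : P.B s t = 0 := h0
        have hBf : B ⟨s, hs⟩ ⟨t, ht⟩ = false := by
          have := hB ⟨s, hs⟩ ⟨t, ht⟩
          rw [Bool.eq_false_iff, ne_eq, ← this]
          simp [h0]
        refine run_seq (run_emitLine (A := A) (B := B) (W := W) (L := L) (X := X) ?_
          (.zeroRight ⟨s, hs⟩ ⟨t, ht⟩) _ (.zeroRight hυ.der hBf)
          (v₀ := 1) (v₁ := s) (v₂ := t) (v₃ := 0) rfl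
          (fun ξ h1 h2 => ⟨by simp; omega, rfl⟩)
          (fun ξ h1 h2 => ⟨by simp, by simp [h1, hj]⟩)
          (fun ξ h1 h2 => ⟨by simp, by simp [h1, hk]⟩)
          (fun ξ h1 h2 => ⟨by simp; omega, rfl⟩) (by simp) (by omega) ?_)
        · exact hυ.congr (by simp) (by simp) (by simp) (by simp) (by simp)
        intro ξ hξ hbox hreg harr hcξ
        have hcur : ξ.reg cur = υ.reg cur := by simpa using hreg cur (by decide) (by decide)
        have hplt := hbox.lt hξ
        simp only [List.length_append, List.length_singleton] at hplt
        refine run_chain hξ (axis := 2) (S := zeroBox B ⟨s, hs⟩ {y' | (y' : ℕ) < t})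
          (fun τ => ⟨by simp; omega, rfl⟩) rfl (by decide)
          (by rw [hcur]; exact hch.mono (List.prefix_append _ _)) hbox ?_ ?_ ?_ ?_
        · intro a ha
          fin_cases a
          · rfl
          · rfl
          · exact absurd rfl ha
        · simp; omega
        · omega
        intro ζ L' X' hζ hpre hL' hcur0 hbox' hreg' harr' hcζ
        simp only [List.length_append, List.length_singleton] at hL'
        have hzrζ : ζ.arr = υ.arr := harr'.trans (by simpa using harr)
        have hkζ : ζ.reg k = t :=
          (hreg' k (by decide) (by decide)).trans ((hreg k (by decide) (by decide)).trans
            (by simpa using hk))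
        have hjζ : ζ.reg j = s :=
          (hreg' j (by decide) (by decide)).trans ((hreg j (by decide) (by decide)).trans
            (by simpa using hj))
        have hXX' : X.IsPrefix X' := (List.prefix_append _ _).trans hpre
        refine ⟨hkζ, L', X', hζ.congr (by simp) (by simp) (by simp) (by simp) (by simp),
          by simp [hjζ], by simp, by omega, ?_, ?_, ?_⟩
        · intro j hj
          simpa [hzrζ] using (hzr j hj).mono hXX'
        · refine ⟨fun h => absurd h (by simpa using hcur0), fun _ => ?_⟩
          have h2 : (((ζ.tick 4).set k (t + 1)).reg cur) = ζ.reg cur := by simp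
          rw [h2]
          refine hbox'.subset fun a => ?_
          fin_cases a
          · exact subset_rfl
          · exact subset_rfl
          · intro k hk
            obtain ⟨hk1, hk2⟩ := hk
            rw [hset] at hk1
            rcases hk1 with h | h
            · exact Or.inl ⟨h, hk2⟩
            · exact Or.inr h
        · simp at hcξ hcζ ⊢; omega
      · intro h0
        rw [Cond.holds_eq, hBv] at h0
        have h0 : ¬ P.B s t = 0 := h0
        have hBt : B ⟨s, hs⟩ ⟨t, ht⟩ = true := by
          rw [← hB ⟨s, hs⟩ ⟨t, ht⟩]; exact Nat.pos_of_ne_zero h0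
        refine run_skip ⟨by simp [hk], L, X,
          hυ.congr (by simp) (by simp) (by simp) (by simp) (by simp), by simp [hj], by simp,
          by omega, by simpa using hzr, ?_, ?_⟩
        · have e : zeroBox B ⟨s, hs⟩ {y' | (y' : ℕ) < t + 1} =
              zeroBox B ⟨s, hs⟩ {y' | (y' : ℕ) < t} := by
            unfold zeroBox
            congr 3
            ext k
            simp only [Set.mem_ofPred_eq]
            constructor
            · rintro ⟨h1, h2⟩
              refine ⟨?_, h2⟩
              by_contra h3
              have : k = ⟨t, ht⟩ := Fin.ext (by simp; omega)
              rw [this, hBt] at h2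
              exact absurd h2 (by decide)
            · rintro ⟨h1, h2⟩
              exact ⟨by omega, h2⟩
          rw [e]; simpa using hch
        · simp; omega
    · rintro υ ⟨L, X, hυ, hj, hk, hL, hzr, hch, hc⟩
      refine run_store (by simp) (by simp) ⟨by simp [hj], L, X,
        hυ.congr (by simp) (by simp) (by simp) (by simp) (by simp), by simp, by omega, ?_, ?_⟩
      · simp only [State.set_arr, State.tick_arr, State.put_arr, if_true, Expr.eval_var,
          State.tick_reg, hj]
        intro j hjs
        by_cases h : (j : ℕ) = s
        · rw [h, Function.update_self]
          obtain rfl : j = ⟨s, hs⟩ := Fin.ext h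
          refine ⟨fun h0 => ?_, fun h0 => (hch.2 h0).subset fun a => ?_⟩
          · have := hch.1 h0
            refine Set.eq_empty_of_subset_empty fun k hk => ?_
            rw [← this]
            exact ⟨k.2, hk.2⟩
          · fin_cases a
            · exact subset_rfl
            · exact subset_rfl
            · exact fun k hk => ⟨k.2, hk.2⟩
        · rw [Function.update_of_ne h]; exact hzr j (by omega)
      · simp; omega
  · rintro τ ⟨L, X, hτ, hj, hL, hzr, hc⟩
    have h1 : P.n * (2 * P.n) = 2 * (P.n * P.n) := by ring
    have h2 : P.n * (110 * P.n + 30) = 110 * (P.n * P.n) + 30 * P.n := by ring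
    refine hPost _ L X (hτ.congr (by simp) (by simp) (by simp) (by simp) (by simp)) (by omega)
      (fun j => by simpa using hzr j j.2) ?_
    simp; omega

end


/-! ### Covering the unknown entries of a row -/

open Var Arr BMM

/-- From `σ` to `τ`, only the variables in `S` change, and the output. -/
structure Keeps (S : List Var) (σ τ : State) : Prop where
  reg : ∀ r, r ∉ S → τ.reg r = σ.reg r
  arr : τ.arr = σ.arr

namespace Keeps

variable {S S' : List Var} {σ τ υ : State}

theorem refl (S : List Var) (σ : State) : Keeps S σ σ := ⟨fun _ _ => rfl, rfl⟩

theorem trans (h : Keeps S σ τ) (h' : Keeps S τ υ) : Keeps S σ υ :=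
  ⟨fun r hr => (h'.reg r hr).trans (h.reg r hr), h'.arr.trans h.arr⟩

theorem mono (h : Keeps S σ τ) (hS : S ⊆ S') : Keeps S' σ τ :=
  ⟨fun r hr => h.reg r fun h' => hr (hS h'), h.arr⟩

@[simp] theorem tick_iff {t : ℕ} : Keeps S σ (τ.tick t) ↔ Keeps S σ τ :=
  ⟨fun h => ⟨h.reg, h.arr⟩, fun h => ⟨h.reg, h.arr⟩⟩

@[simp] theorem print_iff {t : ℕ} : Keeps S σ (τ.print t) ↔ Keeps S σ τ :=
  ⟨fun h => ⟨h.reg, h.arr⟩, fun h => ⟨h.reg, h.arr⟩⟩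

@[simp] theorem set_iff {d : Var} {x : ℕ} (hd : d ∈ S) :
    Keeps S σ (τ.set d x) ↔ Keeps S σ τ := by
  have key : ∀ r, r ∉ S → (τ.set d x).reg r = τ.reg r := by
    intro r hr
    have : r ≠ d := fun h => hr (h ▸ hd)
    simp [this]
  exact ⟨fun h => ⟨fun r hr => (key r hr).symm.trans (h.reg r hr), h.arr⟩,
    fun h => ⟨fun r hr => (key r hr).trans (h.reg r hr), h.arr⟩⟩

end Keeps

section

variable {Q : ℕ} {P : Params} {A B : Matrix (Fin P.n) (Fin P.n) Bool} {W : ℕ → ℕ}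
  {L : List (Line P.n)} {X : List (Box P.n)} {σ τ : State} {Post : State → Prop}

theorem ChainBox.box {axis : Fin 3} {S : Box P.n} {top : ℕ} (h : ChainBox X top axis S)
    (hS : (S axis).Nonempty) : top ≠ 0 ∧ HasBox X (top - 1) S := by
  have h0 : top ≠ 0 := fun h0 => hS.ne_empty (h.1 h0)
  exact ⟨h0, h.2 h0⟩

/-- Adds the line in `p` to the chain that ends in `cur`. -/
theorem run_chain_cur (hσ : Writing P A B W L X σ) {ax : Expr} {axis : Fin 3}
    (hax : ∀ τ, ax.Ok Q τ ∧ ax.eval τ = axis) (haxc : ax.cost = 1)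
    {S S' S'' : Box P.n}
    (hS : ChainBox X (σ.reg cur) axis S) (hS' : HasBox X (σ.reg p) S')
    (hSS : ∀ a, a ≠ axis → S a = S' a) (hSS' : ∀ a, a ≠ axis → S'' a = S a)
    (hSS'' : S'' axis ⊆ S axis ∪ S' axis)
    (hQ : L.length + 2 < Q)
    (hPost : ∀ τ L' X', Writing P A B W L' X' τ → X.IsPrefix X' → L'.length ≤ L.length + 1 →
      ChainBox X' (τ.reg cur) axis S'' → Keeps [cur, ln] σ τ →
      τ.clock ≤ σ.clock + 30 → Post τ) :
    Run Q (chain ax cur p) σ Post := by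
  have hlt := hS'.lt hσ
  refine run_chain hσ hax haxc (by decide) hS hS' hSS hQ (by omega) ?_
  intro τ L' X' hτ hpre hL h0 hbox hreg harr hc
  refine hPost τ L' X' hτ hpre hL ⟨fun h => absurd h h0, fun _ => hbox.subset fun a => ?_⟩
    ⟨fun r hr => ?_, harr⟩ hc
  · by_cases ha : a = axis
    · subst ha; simpa using hSS''
    · rw [Function.update_of_ne ha, hSS' a ha]
  · simp only [List.mem_cons, List.not_mem_nil, or_false, not_or] at hr
    exact hreg r hr.1 hr.2

def rowVars : List Var := [z, k, cur, j, p, ln]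

/-- The box of the triples of row `r`, with sides `J` and `K`. -/
abbrev rowBox (r : Fin P.n) (J K : Set (Fin P.n)) : Box P.n := ![{r}, J, K]

theorem rowBox_ne_one {r : Fin P.n} {J J' K : Set (Fin P.n)} (a' : Fin 3) (ha : a' ≠ 1) :
    rowBox r J K a' = rowBox r J' K a' := by
  fin_cases a'
  · rfl
  · exact absurd rfl ha
  · rfl

theorem rowBox_ne_two {r : Fin P.n} {J K K' : Set (Fin P.n)} (a' : Fin 3) (ha : a' ≠ 2) :
    rowBox r J K a' = rowBox r J K' a' := by
  fin_cases a'
  · rfl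
  · rfl
  · exact absurd rfl ha

/-- A row in which all entries are known needs no chain over `j`; the chains of zeros might then be
empty and could not be used. -/
theorem run_findUnknown (r : Fin P.n) (hσ : Writing P A B W L X σ) (hi : σ.reg i = r)
    (hn : 16 * (P.n * P.n) + 16 < Q)
    (hPost : ∀ τ, Writing P A B W L X τ → Keeps rowVars σ τ →
      (τ.reg z = 0 ↔ ∀ y : Fin P.n, W (r * P.n + y) ≠ 0) →
      τ.clock ≤ σ.clock + 50 * P.n + 10 → Post τ) :
    Run Q (z ::= 0 ;; k ::= 0 ;; forLoop k n (.ite (.eq (entW k) 0) (z ::= 1) .skip)) σ Post := by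
  have hnn : P.n ≤ P.n * P.n := Nat.le_mul_self _
  refine run_seq (run_assign (by simp; omega) ?_)
  refine run_seq (run_assign (by simp; omega) ?_)
  refine run_for (fun t τ => Writing P A B W L X τ ∧ Keeps rowVars σ τ ∧ τ.reg k = t ∧
    (τ.reg z = 0 ↔ ∀ y : Fin P.n, (y : ℕ) < t → W (r * P.n + y) ≠ 0) ∧
    τ.clock ≤ σ.clock + 4 + 50 * t) 0 P.n (Nat.zero_le _) (by omega) ?_ ?_ ?_ ?_
  · refine ⟨hσ.congr (by simp) (by simp) (by simp) (by simp) (by simp), ?_, by simp, by simp,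
      by simp⟩
    simp [Keeps.set_iff (show k ∈ rowVars by decide), Keeps.set_iff (show z ∈ rowVars by decide),
      Keeps.refl]
  · rintro t τ - - ⟨hτ, -, hk, -⟩
    exact ⟨hk, hτ.n⟩
  · rintro t τ - ht ⟨hτ, hK, hk, hz, hc⟩
    have hi' : τ.reg i = r := (hK.reg i (by decide)).trans hi
    have hrt := pair_lt r.2 ht
    have hw : (entW k).eval (τ.tick 4) = W (r * P.n + t) := by
      simp [hτ.wit, hτ.n, hi', hk]
    have hsplit : (∀ y : Fin P.n, (y : ℕ) < t + 1 → W (r * P.n + y) ≠ 0) ↔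
        (∀ y : Fin P.n, (y : ℕ) < t → W (r * P.n + y) ≠ 0) ∧ W (r * P.n + t) ≠ 0 := by
      constructor
      · exact fun h => ⟨fun y hy => h y (by omega), h ⟨t, ht⟩ (by simp)⟩
      · rintro ⟨h1, h2⟩ y hy
        by_cases h : (y : ℕ) = t
        · rwa [h]
        · exact h1 y (by omega)
    refine run_ite (by simp [hτ.n, hi', hk]; omega) ?_ ?_
    · intro h0
      rw [Cond.holds_eq, hw] at h0
      have h0 : W (r * P.n + t) = 0 := h0
      refine run_assign (by simp; omega) ⟨by simp [hk],
        hτ.congr (by simp) (by simp) (by simp) (by simp) (by simp), ?_, by simp, ?_, ?_⟩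
      · simp [Keeps.set_iff (show k ∈ rowVars by decide),
          Keeps.set_iff (show z ∈ rowVars by decide), hK]
      · rw [hsplit]; simp [h0]
      · simp; omega
    · intro h0
      rw [Cond.holds_eq, hw] at h0
      have h0 : ¬ W (r * P.n + t) = 0 := h0
      refine run_skip ⟨by simp [hk],
        hτ.congr (by simp) (by simp) (by simp) (by simp) (by simp), ?_, by simp, ?_, ?_⟩
      · simp [Keeps.set_iff (show k ∈ rowVars by decide), hK]
      · rw [hsplit, ← hz]; simp [h0]
      · simp; omega
  · rintro τ ⟨hτ, hK, hk, hz, hc⟩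
    refine hPost _ (hτ.congr (by simp) (by simp) (by simp) (by simp) (by simp)) (by simpa using hK)
      ?_ (by simp; omega)
    simp only [State.tick_reg]
    rw [hz]
    exact ⟨fun h y => h y y.2, fun h y _ => h y⟩

/-- For each `j`, either `A r j = 0` gives a box with all columns, or row `j` of `B` vanishes on `U`
by `hAB`, so that the chain of zeros of this row contains what is needed. The union over `j` is
taken along the middle axis. -/
theorem run_rowUnknowns (r : Fin P.n) (hσ : Writing P A B W L X σ) (hi : σ.reg i = r)
    (hA : ∀ y y' : Fin P.n, 0 < P.A y y' ↔ A y y' = true)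
    (hn : 16 * (P.n * P.n) + 16 < Q) (hLQ : L.length + 2 * P.n + 2 < Q)
    (hzr : ∀ y : Fin P.n, ChainBox X (σ.arr zr y) 2 (zeroBox B y Set.univ))
    {U : Set (Fin P.n)} (hU : U.Nonempty) (hAB : ∀ j' k', A r j' = true → k' ∈ U → B j' k' = false)
    (hcur : σ.reg cur = 0)
    (hPost : ∀ τ L' X', Writing P A B W L' X' τ → X.IsPrefix X' →
      L'.length ≤ L.length + 2 * P.n → ChainBox X' (τ.reg cur) 1 (rowBox r Set.univ U) →
      Keeps rowVars σ τ → τ.clock ≤ σ.clock + 120 * P.n + 10 → Post τ) :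
    Run Q (j ::= 0 ;;
      forLoop j n (
        .ite (.eq (entA j) 0) (emitLine 0 i j 0) (p ::= .get zr j - 1) ;; chain 1 cur p))
      σ Post := by
  have hnn : P.n ≤ P.n * P.n := Nat.le_mul_self _
  refine run_seq (run_assign (by simp; omega) ?_)
  refine run_for (fun t τ => ∃ L' X', Writing P A B W L' X' τ ∧ X.IsPrefix X' ∧
    L'.length ≤ L.length + 2 * t ∧ ChainBox X' (τ.reg cur) 1 (rowBox r {y' | (y' : ℕ) < t} U) ∧
    Keeps rowVars σ τ ∧ τ.reg j = t ∧ τ.clock ≤ σ.clock + 4 + 120 * t)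
    0 P.n (Nat.zero_le _) (by omega) ?_ ?_ ?_ ?_
  · refine ⟨L, X, hσ.congr (by simp) (by simp) (by simp) (by simp) (by simp),
      List.prefix_refl _, by simp, ?_, ?_, by simp, by simp⟩
    · simp [ChainBox, hcur]
    · simp [Keeps.set_iff (show j ∈ rowVars by decide), Keeps.refl]
  · rintro t τ - - ⟨_, _, hτ, -, -, -, -, hj, -⟩
    exact ⟨hj, hτ.n⟩
  · rintro t τ - ht ⟨L', X', hτ, hpre, hL, hch, hK, hj, hc⟩
    have hi' : τ.reg i = r := (hK.reg i (by decide)).trans hi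
    have hrt := pair_lt r.2 ht
    have hset : {y' : Fin P.n | (y' : ℕ) < t + 1} ⊆
        {y' : Fin P.n | (y' : ℕ) < t} ∪ {⟨t, ht⟩} := by
      intro y'; simp [Fin.ext_iff]; omega
    have hAv : (entA j).eval (τ.tick 4) = P.A r t := by
      simp [hτ.inp, hτ.n, hi', hj, Params.A]
    have hfin : ∀ (L'' : List (Line P.n)) (X'' : List (Box P.n)) (υ : State),
        Writing P A B W L'' X'' υ → X'.IsPrefix X'' → L''.length ≤ L'.length + 1 →
        HasBox X'' (υ.reg p) (rowBox r {⟨t, ht⟩} U) → Keeps rowVars τ υ →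
        υ.reg j = t → υ.reg cur = τ.reg cur → υ.clock ≤ τ.clock + 75 →
        Run Q (chain 1 cur p) υ fun υ => υ.reg j = t ∧ ∃ L' X',
          Writing P A B W L' X' ((υ.tick 4).set j (t + 1)) ∧ X.IsPrefix X' ∧
          L'.length ≤ L.length + 2 * (t + 1) ∧
          ChainBox X' (((υ.tick 4).set j (t + 1)).reg cur) 1
            (rowBox r {y' | (y' : ℕ) < t + 1} U) ∧
          Keeps rowVars σ ((υ.tick 4).set j (t + 1)) ∧ ((υ.tick 4).set j (t + 1)).reg j = t + 1 ∧
          ((υ.tick 4).set j (t + 1)).clock ≤ σ.clock + 4 + 120 * (t + 1) := by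
      intro L'' X'' υ hυ hpre' hL' hbox hKυ hjυ hcurυ hcυ
      refine run_chain_cur hυ (axis := 1) (S := rowBox r {y' | (y' : ℕ) < t} U)
        (S' := rowBox r {⟨t, ht⟩} U) (S'' := rowBox r {y' | (y' : ℕ) < t + 1} U)
        (fun τ => ⟨by simp; omega, rfl⟩) rfl
        (by rw [hcurυ]; exact hch.mono hpre') hbox rowBox_ne_one rowBox_ne_one
        (by simpa using hset) (by omega) ?_
      intro ξ L₃ X₃ hξ hpre₃ hL₃ hch₃ hK₃ hc₃
      have hjξ : ξ.reg j = t := (hK₃.reg j (by decide)).trans hjυ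
      refine ⟨hjξ, L₃, X₃, hξ.congr (by simp) (by simp) (by simp) (by simp) (by simp),
        hpre.trans (hpre'.trans hpre₃), by omega, by simpa using hch₃, ?_, by simp, ?_⟩
      · simp only [Keeps.set_iff (show j ∈ rowVars by decide), Keeps.tick_iff]
        exact (hK.trans hKυ).trans (hK₃.mono (by decide))
      · simp; omega
    refine run_seq (run_ite (by simp [hτ.n, hi', hj]; omega) ?_ ?_)
    · intro h0
      rw [Cond.holds_eq, hAv] at h0
      have h0 : P.A r t = 0 := h0
      have hAf : A r ⟨t, ht⟩ = false := by
        have := hA r ⟨t, ht⟩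
        rw [Bool.eq_false_iff, ne_eq, ← this]
        simp [h0]
      refine run_emitLine (A := A) (B := B) (W := W) (L := L') (X := X') ?_
        (.zeroLeft r ⟨t, ht⟩) _ (.zeroLeft hτ.der hAf)
        (v₀ := 0) (v₁ := r) (v₂ := t) (v₃ := 0) rfl
        (fun ξ h1 h2 => ⟨by simp; omega, rfl⟩)
        (fun ξ h1 h2 => ⟨by simp, by simp [h1, hi']⟩)
        (fun ξ h1 h2 => ⟨by simp, by simp [h1, hj]⟩)
        (fun ξ h1 h2 => ⟨by simp; omega, rfl⟩) (by simp) (by omega) ?_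
      · exact hτ.congr (by simp) (by simp) (by simp) (by simp) (by simp)
      intro ξ hξ hbox hreg harr hcξ
      refine hfin _ _ ξ hξ (List.prefix_append _ _) (by simp) (hbox.subset fun a' => ?_)
        ⟨fun v hv => hreg v (fun h => hv (h ▸ by decide)) fun h => hv (h ▸ by decide), harr⟩
        ((hreg j (by decide) (by decide)).trans (by simpa using hj))
        (hreg cur (by decide) (by decide)) (by simp at hcξ; omega)
      fin_cases a'
      · exact subset_rfl
      · exact subset_rfl
      · exact Set.subset_univ _
    · intro h0
      rw [Cond.holds_eq, hAv] at h0
      have h0 : ¬ P.A r t = 0 := h0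
      have hAt : A r ⟨t, ht⟩ = true := by
        rw [← hA r ⟨t, ht⟩]; exact Nat.pos_of_ne_zero h0
      have hzrt : τ.arr zr = σ.arr zr := congrFun hK.arr _
      obtain ⟨k', hk'⟩ := hU
      -- An element of `U` is a zero of this row of `B`, so its chain is not empty and the
      -- subtraction of one is safe.
      obtain ⟨hne, hbox⟩ := (hzr ⟨t, ht⟩).box ⟨k', Set.mem_univ _, hAB _ _ hAt hk'⟩
      simp only at hne hbox
      refine run_assign (by simp [hj, hzrt]; omega) (hfin L' X' _
        (hτ.congr (by simp) (by simp) (by simp) (by simp) (by simp)) (List.prefix_refl _)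
        (Nat.le_succ _) ?_ ?_ (by simpa using hj) (by simp) (by simp))
      · simp only [State.set_reg, if_true, Expr.eval_sub, Expr.eval_get, Expr.eval_var,
          Expr.eval_lit, State.tick_reg, State.tick_arr, hj, hzrt]
        refine (hbox.mono hpre).subset fun a' => ?_
        fin_cases a'
        · exact Set.subset_univ _
        · exact subset_rfl
        · exact fun y' hy' => ⟨Set.mem_univ _, hAB _ _ hAt hy'⟩
      · simp [Keeps.set_iff (show p ∈ rowVars by decide), Keeps.refl]
  · rintro τ ⟨L', X', hτ, hpre, hL, hch, hK, hj, hc⟩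
    refine hPost _ L' X' (hτ.congr (by simp) (by simp) (by simp) (by simp) (by simp)) hpre hL ?_
      (by simpa using hK) (by simp; omega)
    have : {y' : Fin P.n | (y' : ℕ) < P.n} = Set.univ := by ext y'; simp
    rwa [this] at hch

end


/-! ### Witness lines, the complete certificate, and the printed product -/

open Var Arr BMM

/-- Sequences associate to the right; this allows a statement about the first three commands to be
used inside a longer sequence. -/
theorem run_assoc {Q : ℕ} {p₁ p₂ p₃ p₄ : Cmd} {σ : State} {Post : State → Prop}
    (h : Run Q (p₁ ;; p₂ ;; p₃) σ fun τ => Run Q p₄ τ Post) :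
    Run Q (p₁ ;; p₂ ;; p₃ ;; p₄) σ Post := by
  obtain ⟨τ, hE, υ, h4, hυ⟩ := h
  cases hE with
  | seq h1 h23 =>
    cases h23 with
    | seq h2 h3 => exact ⟨υ, .seq h1 (.seq h2 (.seq h3 h4)), hυ⟩

section

variable {Q : ℕ} {P : Params} {A B : Matrix (Fin P.n) (Fin P.n) Bool} {W : ℕ → ℕ}
  {L : List (Line P.n)} {X : List (Box P.n)} {σ τ : State} {Post : State → Prop}

/-- The chain starts with the columns without a witness, or empty if there are none. Each witness
line covers all `j` for one further column and is merged along the last axis. -/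
theorem run_rowWitnesses (r : Fin P.n) (hσ : Writing P A B W L X σ) (hi : σ.reg i = r)
    (hA : ∀ y y' : Fin P.n, 0 < P.A y y' ↔ A y y' = true)
    (hB : ∀ y y' : Fin P.n, 0 < P.B y y' ↔ B y y' = true)
    (hW : P.Sound W) (hn : 16 * (P.n * P.n) + 16 < Q) (hLQ : L.length + 2 * P.n + 2 < Q)
    (hch : ChainBox X (σ.reg cur) 2 (rowBox r Set.univ {k' | W (r * P.n + k') = 0}))
    (hPost : ∀ τ L' X', Writing P A B W L' X' τ → X.IsPrefix X' →
      L'.length ≤ L.length + 2 * P.n → ChainBox X' (τ.reg cur) 2 (rowBox r Set.univ Set.univ) →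
      Keeps rowVars σ τ → τ.clock ≤ σ.clock + 120 * P.n + 10 → Post τ) :
    Run Q (k ::= 0 ;;
      forLoop k n (
        .ite (.eq (entW k) 0) .skip (emitLine 2 i (entW k - 1) k ;; chain 2 cur p)))
      σ Post := by
  have hnn : P.n ≤ P.n * P.n := Nat.le_mul_self _
  refine run_seq (run_assign (by simp; omega) ?_)
  refine run_for (fun t τ => ∃ L' X', Writing P A B W L' X' τ ∧ X.IsPrefix X' ∧
    L'.length ≤ L.length + 2 * t ∧
    ChainBox X' (τ.reg cur) 2 (rowBox r Set.univ {k' | W (r * P.n + k') = 0 ∨ (k' : ℕ) < t}) ∧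
    Keeps rowVars σ τ ∧ τ.reg k = t ∧ τ.clock ≤ σ.clock + 4 + 120 * t)
    0 P.n (Nat.zero_le _) (by omega) ?_ ?_ ?_ ?_
  · refine ⟨L, X, hσ.congr (by simp) (by simp) (by simp) (by simp) (by simp),
      List.prefix_refl _, by simp, ?_, ?_, by simp, by simp⟩
    · simpa using hch
    · simp [Keeps.set_iff (show k ∈ rowVars by decide), Keeps.refl]
  · rintro t τ - - ⟨_, _, hτ, -, -, -, -, hk, -⟩
    exact ⟨hk, hτ.n⟩
  · rintro t τ - ht ⟨L', X', hτ, hpre, hL, hch, hK, hk, hc⟩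
    have hi' : τ.reg i = r := (hK.reg i (by decide)).trans hi
    have hrt := pair_lt r.2 ht
    have hwv : ∀ υ : State, υ.reg = τ.reg → υ.arr = τ.arr →
        (entW k).eval υ = W (r * P.n + t) := by
      intro υ h1 h2
      simp [h1, h2, hτ.wit, hτ.n, hi', hk]
    refine run_ite (by simp [hτ.n, hi', hk]; omega) ?_ ?_
    · intro h0
      rw [Cond.holds_eq, hwv _ (by rfl) (by rfl)] at h0
      have h0 : W (r * P.n + t) = 0 := h0
      have hset : {k' : Fin P.n | W (r * P.n + k') = 0 ∨ (k' : ℕ) < t + 1} =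
          {k' : Fin P.n | W (r * P.n + k') = 0 ∨ (k' : ℕ) < t} := by
        ext k'
        simp only [Set.mem_ofPred_eq]
        by_cases h : (k' : ℕ) = t
        · simp [h, h0]
        · have : (k' : ℕ) < t + 1 ↔ (k' : ℕ) < t := by omega
          rw [this]
      refine run_skip ⟨by simp [hk], L', X',
        hτ.congr (by simp) (by simp) (by simp) (by simp) (by simp), hpre, by omega, ?_, ?_,
        by simp, by simp; omega⟩
      · rw [hset]; simpa using hch
      · simp [Keeps.set_iff (show k ∈ rowVars by decide), hK]
    · intro h0
      rw [Cond.holds_eq, hwv _ (by rfl) (by rfl)] at h0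
      have h0 : W (r * P.n + t) ≠ 0 := h0
      obtain ⟨hwn, hwA, hwB⟩ := hW r r.2 t ht h0
      have hAt := (hA r ⟨_, hwn⟩).1 hwA
      have hBt := (hB ⟨_, hwn⟩ ⟨t, ht⟩).1 hwB
      refine run_seq (run_emitLine (A := A) (B := B) (W := W) (L := L') (X := X') ?_
        (.witness r ⟨_, hwn⟩ ⟨t, ht⟩) _ (.witness hτ.der hAt hBt)
        (v₀ := 2) (v₁ := r) (v₂ := W (r * P.n + t) - 1) (v₃ := t) rfl
        (fun ξ h1 h2 => ⟨by simp; omega, rfl⟩)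
        (fun ξ h1 h2 => ⟨by simp, by simp [h1, hi']⟩)
        (fun ξ h1 h2 => ⟨?_, ?_⟩)
        (fun ξ h1 h2 => ⟨by simp, by simp [h1, hk]⟩) (by simp) (by omega) ?_)
      · exact hτ.congr (by simp) (by simp) (by simp) (by simp) (by simp)
      · have := hwv ξ h1 h2
        simp only [Expr.ok_sub, Expr.ok_lit, Expr.eval_lit, this]
        refine ⟨?_, by omega, by omega⟩
        simp [h1, hτ.n, hi', hk]; omega
      · simpa only [Expr.eval_sub, Expr.eval_lit] using congrArg (· - 1) (hwv ξ h1 h2)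
      intro ξ hξ hbox hreg harr hcξ
      have hcurξ : ξ.reg cur = τ.reg cur := hreg cur (by decide) (by decide)
      refine run_chain_cur hξ (axis := 2)
        (S := rowBox r Set.univ {k' | W (r * P.n + k') = 0 ∨ (k' : ℕ) < t})
        (S' := rowBox r Set.univ {⟨t, ht⟩})
        (S'' := rowBox r Set.univ {k' | W (r * P.n + k') = 0 ∨ (k' : ℕ) < t + 1})
        (fun τ => ⟨by simp; omega, rfl⟩) rfl
        (by rw [hcurξ]; exact hch.mono (List.prefix_append _ _)) hbox rowBox_ne_two rowBox_ne_two
        ?_ (by simp; omega) ?_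
      · intro k'
        simp [Fin.ext_iff]
        omega
      intro ζ L₃ X₃ hζ hpre₃ hL₃ hch₃ hK₃ hc₃
      simp only [List.length_append, List.length_singleton] at hL₃
      have hkζ : ζ.reg k = t := (hK₃.reg k (by decide)).trans
        ((hreg k (by decide) (by decide)).trans (by simpa using hk))
      have hKξ : Keeps rowVars τ ξ :=
        ⟨fun v hv => hreg v (fun h => hv (h ▸ by decide)) fun h => hv (h ▸ by decide), harr⟩
      refine ⟨hkζ, L₃, X₃, hζ.congr (by simp) (by simp) (by simp) (by simp) (by simp),
        hpre.trans ((List.prefix_append _ _).trans hpre₃), by omega, by simpa using hch₃, ?_,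
        by simp, ?_⟩
      · simp only [Keeps.set_iff (show k ∈ rowVars by decide), Keeps.tick_iff]
        exact (hK.trans hKξ).trans (hK₃.mono (by decide))
      · simp at hcξ ⊢; omega
  · rintro τ ⟨L', X', hτ, hpre, hL, hch, hK, hk, hc⟩
    refine hPost _ L' X' (hτ.congr (by simp) (by simp) (by simp) (by simp) (by simp)) hpre hL ?_
      (by simpa using hK) (by simp; omega)
    have : {k' : Fin P.n | W (r * P.n + k') = 0 ∨ (k' : ℕ) < P.n} = Set.univ := by ext k'; simp
    rwa [this] at hch

/-- If `(r, k)` is unknown and `A r j = 1`, then `B j k = 0`, since otherwise the search would have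
found a witness (`hcov`). So the unknown columns can be covered by zeros, and the known ones by
witnesses. -/
theorem run_rowChain (r : Fin P.n) (hσ : Writing P A B W L X σ) (hi : σ.reg i = r)
    (hA : ∀ y y' : Fin P.n, 0 < P.A y y' ↔ A y y' = true)
    (hB : ∀ y y' : Fin P.n, 0 < P.B y y' ↔ B y y' = true)
    (hW : P.Sound W) (hcov : ∀ i' < P.n, ∀ j' < P.n, ∀ k' < P.n, 0 < P.A i' j' → 0 < P.B j' k' →
      W (i' * P.n + k') ≠ 0)
    (hn : 16 * (P.n * P.n) + 16 < Q) (hLQ : L.length + 4 * P.n + 4 < Q)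
    (hzr : ∀ y : Fin P.n, ChainBox X (σ.arr zr y) 2 (zeroBox B y Set.univ))
    (hPost : ∀ τ L' X', Writing P A B W L' X' τ → X.IsPrefix X' →
      L'.length ≤ L.length + 4 * P.n → τ.reg cur ≠ 0 →
      HasBox X' (τ.reg cur - 1) (rowBox r Set.univ Set.univ) →
      Keeps rowVars σ τ → τ.clock ≤ σ.clock + 290 * P.n + 60 → Post τ) :
    Run Q rowChain σ Post := by
  have hnn : P.n ≤ P.n * P.n := Nat.le_mul_self _
  have hn0 : 0 < P.n := (Nat.zero_le _).trans_lt r.2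
  refine run_assoc (run_findUnknown r hσ hi hn ?_)
  intro τ hτ hK hz hc
  refine run_seq (run_assign (by simp; omega) ?_)
  have hfin : ∀ L' X' υ, Writing P A B W L' X' υ → X.IsPrefix X' →
      L'.length ≤ L.length + 2 * P.n →
      ChainBox X' (υ.reg cur) 2 (rowBox r Set.univ {k' | W (r * P.n + k') = 0}) →
      Keeps rowVars σ υ → υ.clock ≤ σ.clock + 170 * P.n + 40 →
      Run Q (k ::= 0 ;;
        forLoop k n (
          .ite (.eq (entW k) 0) .skip (emitLine 2 i (entW k - 1) k ;; chain 2 cur p))) υ Post := by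
    intro L' X' υ hυ hpre hL hch hKυ hcυ
    refine run_rowWitnesses r hυ ((hKυ.reg i (by decide)).trans hi) hA hB hW hn (by omega) hch ?_
    intro ξ L'' X'' hξ hpre' hL' hch' hK' hcξ
    obtain ⟨h0, hbox⟩ := hch'.box ⟨r, Set.mem_univ _⟩
    exact hPost ξ L'' X'' hξ (hpre.trans hpre') (by omega) h0 hbox (hKυ.trans hK') (by omega)
  refine run_seq (run_ite (by simp; omega) ?_ ?_)
  · intro h0
    have h0 : τ.reg z = 0 := by simpa using h0
    refine run_skip (hfin L X _ (hτ.congr (by simp) (by simp) (by simp) (by simp) (by simp))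
      (List.prefix_refl _) (by omega) ?_ ?_ (by simp; omega))
    · have : {k' : Fin P.n | W (r * P.n + k') = 0} = ∅ := by
        ext k'; simpa using hz.1 h0 k'
      rw [this]
      simp [ChainBox]
    · simp [Keeps.set_iff (show cur ∈ rowVars by decide), hK]
  · intro h0
    have h0 : τ.reg z ≠ 0 := by simpa using h0
    have hU : {k' : Fin P.n | W (r * P.n + k') = 0}.Nonempty := by
      by_contra h
      refine h0 (hz.2 fun y hy => h ⟨y, hy⟩)
    refine run_rowUnknowns r (L := L) (X := X) (B := B) (W := W)
      (hτ.congr (by simp) (by simp) (by simp) (by simp) (by simp))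
      (by simpa using (hK.reg i (by decide)).trans hi) hA hn (by omega) ?_ hU ?_ (by simp) ?_
    · simpa [hK.arr] using hzr
    · intro j' k' hAj hk'
      by_contra h
      exact hcov r r.2 j' j'.2 k' k'.2 ((hA r j').2 hAj) ((hB j' k').2 (by simpa using h)) hk'
    · intro υ L' X' hυ hpre hL hch hKυ hcυ
      obtain ⟨h1, hbox⟩ := hch.box ⟨⟨0, hn0⟩, Set.mem_univ _⟩
      refine hfin L' X' υ hυ hpre hL ⟨fun h => absurd h h1, fun _ => hbox⟩ (hK.trans ?_)
        (by simp at hcυ; omega)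
      exact ⟨fun v hv => (hKυ.reg v hv).trans (by
        have : v ≠ cur := fun h => hv (h ▸ by decide)
        simp [this]), hKυ.arr.trans (by simp)⟩

/-- The rows of the product are merged along the first axis. There are at most `2 n ^ 2` lines for
the zeros of `B` and `4 n + 1` for each row, so line numbers stay below `Q`. -/
theorem run_certificate (h1 : σ.arr inp = P.inp) (h2 : σ.arr wit = W) (h3 : σ.reg n = P.n)
    (h4 : σ.out = []) (hn0 : 0 < P.n)
    (hA : ∀ y y' : Fin P.n, 0 < P.A y y' ↔ A y y' = true)
    (hB : ∀ y y' : Fin P.n, 0 < P.B y y' ↔ B y y' = true)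
    (hW : P.Sound W) (hcov : ∀ i' < P.n, ∀ j' < P.n, ∀ k' < P.n, 0 < P.A i' j' → 0 < P.B j' k' →
      W (i' * P.n + k') ≠ 0)
    (hn : 16 * (P.n * P.n) + 16 < Q)
    (hPost : ∀ τ L X, Writing P A B W L X τ → IsCertificate A B L →
      τ.clock ≤ σ.clock + 700 * (P.n * P.n) + 50 → Post τ) :
    Run Q certificate σ Post := by
  have hnn : P.n ≤ P.n * P.n := Nat.le_mul_self _
  refine run_seq (run_assign (by simp; omega) ?_)
  refine run_seq (run_zeroRows hB hn
    (A := A) (W := W) ⟨by simp [h1], by simp [h2], by simp [h3], .nil, by simp [h4], by simp⟩ ?_)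
  intro τ L₀ X₀ hτ hL₀ hzr hc
  refine run_seq (run_assign (by simp; omega) ?_)
  refine run_seq (run_assign (by simp; omega) ?_)
  refine run_for (fun t υ => ∃ L X, Writing P A B W L X υ ∧ X₀.IsPrefix X ∧
    L.length ≤ 2 * (P.n * P.n) + t * (4 * P.n + 1) ∧
    ChainBox X (υ.reg tot) 0 ![{y' | (y' : ℕ) < t}, Set.univ, Set.univ] ∧ υ.reg i = t ∧
    υ.arr = τ.arr ∧ υ.clock ≤ σ.clock + 200 * (P.n * P.n) + 40 + t * (290 * P.n + 110))
    0 P.n (Nat.zero_le _) (by omega) ?_ ?_ ?_ ?_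
  · refine ⟨L₀, X₀, hτ.congr (by simp) (by simp) (by simp) (by simp) (by simp),
      List.prefix_refl _, by simpa using hL₀, ?_, by simp, by simp, ?_⟩
    · simp [ChainBox]
    · simp at hc ⊢; omega
  · rintro t υ - - ⟨_, _, hυ, -, -, -, hi, -⟩
    exact ⟨hi, hυ.n⟩
  · rintro t υ - ht ⟨L, X, hυ, hpre, hL, hch, hi, harr, hc⟩
    have hsn : t * (4 * P.n + 1) + (4 * P.n + 1) ≤ 4 * (P.n * P.n) + P.n := by
      calc t * (4 * P.n + 1) + (4 * P.n + 1) = (t + 1) * (4 * P.n + 1) := (Nat.succ_mul _ _).symm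
        _ ≤ P.n * (4 * P.n + 1) := Nat.mul_le_mul_right _ ht
        _ = _ := by ring
    have hsucc : (t + 1) * (4 * P.n + 1) = t * (4 * P.n + 1) + (4 * P.n + 1) := Nat.succ_mul _ _
    have hsucc' : (t + 1) * (290 * P.n + 110) = t * (290 * P.n + 110) + (290 * P.n + 110) :=
      Nat.succ_mul _ _
    refine run_seq (run_rowChain ⟨t, ht⟩ (L := L) (X := X) (A := A) (B := B) (W := W)
      (hυ.congr (by simp) (by simp) (by simp) (by simp) (by simp)) (by simpa using hi) hA hB hW
      hcov hn (by omega) (fun y' => by simpa [harr] using (hzr y').mono hpre) ?_)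
    intro ξ L' X' hξ hpre' hL' h0 hbox hK hcξ
    have hlt := hbox.lt hξ
    refine run_seq (run_assign (by simp; omega) ?_)
    have htot : ξ.reg tot = υ.reg tot := hK.reg tot (by decide)
    refine run_chain (axis := 0) (L := L') (X := X') (A := A) (B := B) (W := W)
      (S := ![{y' | (y' : ℕ) < t}, Set.univ, Set.univ])
      (S' := rowBox ⟨t, ht⟩ Set.univ Set.univ)
      (hξ.congr (by simp) (by simp) (by simp) (by simp) (by simp))
      (fun τ => ⟨by simp; omega, rfl⟩) rfl (by decide)
      (by simpa [htot] using hch.mono hpre') (by simpa using hbox) ?_ (by omega)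
      (by simp; omega) ?_
    · intro a' ha
      fin_cases a'
      · exact absurd rfl ha
      · rfl
      · rfl
    intro ζ L₃ X₃ hζ hpre₃ hL₃ h0' hbox' hreg harr' hcζ
    have hiζ : ζ.reg i = t := (hreg i (by decide) (by decide)).trans
      (by simpa [hi] using hK.reg i (by decide))
    refine ⟨hiζ, L₃, X₃, hζ.congr (by simp) (by simp) (by simp) (by simp) (by simp),
      hpre.trans (hpre'.trans hpre₃), by omega, ?_, by simp, ?_, ?_⟩
    · refine ⟨fun h => absurd h (by simpa using h0'), fun _ => ?_⟩
      have : (((ζ.tick 4).set i (t + 1)).reg tot) = ζ.reg tot := by simp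
      rw [this]
      refine hbox'.subset fun a' => ?_
      fin_cases a'
      · intro y'; simp [Fin.ext_iff]; omega
      · exact subset_rfl
      · exact subset_rfl
    · simp only [State.set_arr, State.tick_arr]
      exact (harr'.trans (by simpa using hK.arr)).trans harr
    · simp at hcξ hcζ ⊢; omega
  · rintro υ ⟨L, X, hυ, hpre, hL, hch, hi, harr, hc⟩
    have h2 : P.n * (290 * P.n + 110) = 290 * (P.n * P.n) + 110 * P.n := by ring
    refine hPost _ L X (hυ.congr (by simp) (by simp) (by simp) (by simp) (by simp)) ?_
      (by simp; omega)
    obtain ⟨-, Y, hY, hsub⟩ := hch.box ⟨⟨0, hn0⟩, hn0⟩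
    refine ⟨X, hυ.der, ?_⟩
    have : Y = fun _ => Set.univ := by
      funext a'
      refine Set.eq_univ_of_univ_subset (le_trans ?_ (hsub a'))
      fin_cases a'
      · intro y' _; exact y'.2
      · exact subset_rfl
      · exact subset_rfl
    exact this ▸ List.mem_of_getElem? hY

/-- The first `t` entries of the product, as words. -/
def productWords (W : ℕ → ℕ) (t : ℕ) : List ℕ :=
  (List.range t).map fun y' => if W y' = 0 then 0 else 1

theorem productWords_succ (W : ℕ → ℕ) (t : ℕ) :
    productWords W (t + 1) = productWords W t ++ [if W t = 0 then 0 else 1] := by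
  simp [productWords, List.range_succ]

theorem run_printProduct (hn0 : σ.reg n = P.n) (hn : 16 * (P.n * P.n) + 16 < Q)
    (hPost : ∀ τ, τ.out = σ.out ++ productWords (σ.arr wit) (P.n * P.n) →
      τ.clock ≤ σ.clock + 100 * (P.n * P.n) + 10 → Post τ) :
    Run Q printProduct σ Post := by
  have hnn : P.n ≤ P.n * P.n := Nat.le_mul_self _
  refine run_seq (run_assign (by simp; omega) ?_)
  refine run_for (fun t τ => Keeps [i, k] σ τ ∧ τ.reg i = t ∧
    τ.out = σ.out ++ productWords (σ.arr wit) (t * P.n) ∧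
    τ.clock ≤ σ.clock + 2 + t * (50 * P.n + 30)) 0 P.n (Nat.zero_le _) (by omega) ?_ ?_ ?_ ?_
  · simp [Keeps.refl, productWords]
  · rintro t τ - - ⟨hK, hi, -⟩
    exact ⟨hi, (hK.reg n (by decide)).trans hn0⟩
  · rintro t τ - ht ⟨hK, hi, hout, hc⟩
    have hsucc' : (t + 1) * (50 * P.n + 30) = t * (50 * P.n + 30) + (50 * P.n + 30) :=
      Nat.succ_mul _ _
    refine run_seq (run_assign (by simp; omega) ?_)
    refine run_for (fun v τ => Keeps [i, k] σ τ ∧ τ.reg i = t ∧ τ.reg k = v ∧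
      τ.out = σ.out ++ productWords (σ.arr wit) (t * P.n + v) ∧
      τ.clock ≤ σ.clock + 2 + t * (50 * P.n + 30) + 6 + 50 * v) 0 P.n (Nat.zero_le _) (by omega)
      ?_ ?_ ?_ ?_
    · simp [hK, hi, hout]; omega
    · rintro v υ - - ⟨hK, hi, hk, -⟩
      exact ⟨hk, (hK.reg n (by decide)).trans hn0⟩
    · rintro v υ - hv ⟨hK, hi, hk, hout, hc⟩
      have hn' : υ.reg n = P.n := (hK.reg n (by decide)).trans hn0
      have htv := pair_lt ht hv
      have hw : (entW k).eval (υ.tick 4) = σ.arr wit (t * P.n + v) := by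
        simp [hK.arr, hi, hk, hn']
      refine run_ite (by simp [hi, hk, hn']; omega) ?_ ?_
      · intro h0
        rw [Cond.holds_eq, hw] at h0
        have h0 : σ.arr wit (t * P.n + v) = 0 := h0
        refine run_emit (by simp; omega) ⟨by simp [hk], by simp [hK], by simp [hi], by simp, ?_,
          by simp; omega⟩
        simp [hout, ← add_assoc, productWords_succ, h0]
      · intro h0
        rw [Cond.holds_eq, hw] at h0
        have h0 : ¬ σ.arr wit (t * P.n + v) = 0 := h0
        refine run_emit (by simp; omega) ⟨by simp [hk], by simp [hK], by simp [hi], by simp, ?_,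
          by simp; omega⟩
        simp [hout, ← add_assoc, productWords_succ, h0]
    · rintro υ ⟨hK, hi, hk, hout, hc⟩
      refine ⟨by simp [hi], by simp [hK], by simp, ?_, by simp; omega⟩
      simp [hout, Nat.succ_mul]
  · rintro τ ⟨hK, hi, hout, hc⟩
    have h2 : P.n * (50 * P.n + 30) = 50 * (P.n * P.n) + 30 * P.n := by ring
    exact hPost _ (by simpa using hout) (by simp; omega)

theorem map_productWords (w : ℕ) {N : ℕ} {M : Matrix (Fin N) (Fin N) Bool} {W : ℕ → ℕ}
    (hW : ∀ r y' : Fin N, W (r * N + y') ≠ 0 ↔ M r y' = true) :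
    (productWords W (N * N)).map (BitVec.ofNat w) = matrixWords w M := by
  refine List.ext_getElem (by simp [productWords, matrixWords]) fun t h1 h2 => ?_
  have ht : t < N * N := by simpa [productWords] using h1
  have key := hW (Fin.divNat ⟨t, ht⟩) (Fin.modNat ⟨t, ht⟩)
  have e : ((Fin.divNat (⟨t, ht⟩ : Fin (N * N)) : ℕ) * N +
      (Fin.modNat (⟨t, ht⟩ : Fin (N * N)) : ℕ)) = t := by
    simp [Fin.divNat, Fin.modNat, Nat.div_add_mod']
  rw [e] at key
  simp only [productWords, matrixWords, List.getElem_map, List.getElem_range, List.getElem_ofFn,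
    ← key]
  by_cases h : W t = 0 <;> simp [h]

end


open Var Arr BMM

/-! ### The parameters -/

/-- A quarter of the logarithm. -/
def logPart (N : ℕ) : ℕ := Nat.log 2 N / 4

/-- The parameters for matrices of size `N`. -/
def Params.ofSize (M : ℕ → ℕ) (N : ℕ) : Params where
  inp := M
  n := N
  m := 2 ^ logPart N
  h := Nat.clog 2 (logPart N * logPart N)
  s := (logPart N - 1) / (8 * (Nat.clog 2 (logPart N * logPart N) + 1)) + 1
  b := (logPart N / 2048 - 1) / ((Nat.clog 2 (logPart N * logPart N) + 1) *
    (Nat.clog 2 (logPart N * logPart N) + 1)) + 1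
  e := 2 ^ (logPart N / 4)

theorem pow_logPart_le {N : ℕ} (hN : 0 < N) : 2 ^ (4 * logPart N) ≤ N :=
  (Nat.pow_le_pow_right (by norm_num) (by unfold logPart; omega)).trans
    (Nat.pow_log_le_self 2 hN.ne')

/-- The right side is the test of the doubling loop of `params`, which compares the fourth power of
the doubled `m` with `n`. -/
theorem lt_logPart_iff {N : ℕ} (hN : 0 < N) (y' : ℕ) : y' < logPart N ↔ 2 ^ (4 * (y' + 1)) ≤ N := by
  rw [← Nat.le_log_iff_pow_le (by norm_num) hN.ne', logPart]
  omega

theorem mul_succ_lt_iff {D K t : ℕ} (hD : 0 < D) : D * (t + 1) < K ↔ t < (K - 1) / D := by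
  rw [Nat.lt_iff_add_one_le, Nat.lt_iff_add_one_le, Nat.le_div_iff_mul_le hD, mul_comm D]
  have : 0 < (t + 1) * D := by positivity
  omega

theorem mul_succ_le_of_le {D K t : ℕ} (hD : 0 < D) (h : t ≤ (K - 1) / D) :
    D * (t + 1) ≤ K + D := by
  rw [Nat.le_div_iff_mul_le hD] at h
  rw [Nat.mul_succ, mul_comm]
  omega

theorem pow_clog_le (y' : ℕ) : 2 ^ Nat.clog 2 y' ≤ 2 * y' + 1 := by
  rcases Nat.lt_or_ge 1 y' with h | h
  · have h1 := Nat.pow_pred_clog_lt_self (b := 2) (by norm_num) h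
    have h2 : 0 < Nat.clog 2 y' := Nat.clog_pos (by norm_num) h
    obtain ⟨t, ht⟩ : ∃ t, Nat.clog 2 y' = t + 1 := ⟨_, (Nat.succ_pred_eq_of_pos h2).symm⟩
    rw [ht] at h1 ⊢
    simp only [Nat.pred_succ] at h1
    rw [pow_succ]; omega
  · rw [Nat.clog_of_right_le_one h]; simp

section

variable {Q : ℕ} {N : ℕ} {σ : State} {Post : State → Prop}

theorem run_double {x y : Var} (hxy : x ≠ y) {c : Cond} (K t₀ : ℕ)
    (hx : σ.reg x = 1) (hy : σ.reg y = 0) (hK : K + 1 < Q) (hQ : 2 ^ K < Q)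
    (hc : ∀ t ≤ K, ∀ τ, Frame [x, y] [] σ τ → τ.reg x = 2 ^ t → τ.reg y = t →
      c.Ok Q τ ∧ (c.Holds τ ↔ t < K)) (hcost : c.cost + 9 ≤ t₀)
    (hPost : ∀ τ, Frame [x, y] [] σ τ → τ.reg x = 2 ^ K → τ.reg y = K →
      τ.clock ≤ σ.clock + t₀ * K + t₀ → Post τ) :
    Run Q (.loop c (x ::= x + x ;; y ::= y + 1)) σ Post := by
  refine run_loop (fun τ => Frame [x, y] [] σ τ ∧ ∃ t ≤ K, τ.reg x = 2 ^ t ∧ τ.reg y = t ∧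
    τ.clock ≤ σ.clock + t₀ * t) (fun τ => K - τ.reg y)
    ⟨Frame.refl _ _ _, 0, Nat.zero_le _, by simpa using hx, hy, by simp⟩ ?_ ?_ ?_
  · rintro τ ⟨hF, t, ht, h1, h2, -⟩
    exact (hc t ht τ hF h1 h2).1
  · rintro τ ⟨hF, t, ht, h1, h2, h3⟩ hh
    have ht' := (hc t ht τ hF h1 h2).2.1 hh
    have hp : 2 ^ t + 2 ^ t = 2 ^ (t + 1) := by rw [pow_succ]; omega
    have hp' : 2 ^ (t + 1) ≤ 2 ^ K := Nat.pow_le_pow_right (by norm_num) ht'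
    have hs : t₀ * (t + 1) = t₀ * t + t₀ := Nat.mul_succ _ _
    refine run_seq (run_assign (by simp [h1]; omega) ?_)
    refine run_assign (by simp [h2, hxy.symm]; omega) ⟨⟨?_, t + 1, ht', ?_, ?_, ?_⟩, ?_⟩
    · simp [hF]
    · simp [h1, hxy, hp]
    · simp [h2, hxy.symm]
    · simp; omega
    · simp [h2, hxy.symm]; omega
  · rintro τ ⟨hF, t, ht, h1, h2, h3⟩ hh
    have ht' : t = K := by
      have := mt (hc t ht τ hF h1 h2).2.2 hh
      omega
    subst ht'
    exact hPost _ (by simpa using hF) (by simpa using h1) (by simpa using h2) (by simp; omega)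

theorem run_count {x : Var} {c : Cond} (K t₀ : ℕ)
    (hx : σ.reg x = 1) (hK : K + 2 < Q)
    (hc : ∀ t ≤ K, ∀ τ, Frame [x] [] σ τ → τ.reg x = t + 1 → c.Ok Q τ ∧ (c.Holds τ ↔ t < K))
    (hcost : c.cost + 5 ≤ t₀)
    (hPost : ∀ τ, Frame [x] [] σ τ → τ.reg x = K + 1 →
      τ.clock ≤ σ.clock + t₀ * K + t₀ → Post τ) :
    Run Q (.loop c (x ::= x + 1)) σ Post := by
  refine run_loop (fun τ => Frame [x] [] σ τ ∧ ∃ t ≤ K, τ.reg x = t + 1 ∧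
    τ.clock ≤ σ.clock + t₀ * t) (fun τ => K + 1 - τ.reg x)
    ⟨Frame.refl _ _ _, 0, Nat.zero_le _, by simpa using hx, by simp⟩ ?_ ?_ ?_
  · rintro τ ⟨hF, t, ht, h1, -⟩
    exact (hc t ht τ hF h1).1
  · rintro τ ⟨hF, t, ht, h1, h3⟩ hh
    have ht' := (hc t ht τ hF h1).2.1 hh
    have hs : t₀ * (t + 1) = t₀ * t + t₀ := Nat.mul_succ _ _
    refine run_assign (by simp [h1]; omega) ⟨⟨?_, t + 1, ht', ?_, ?_⟩, ?_⟩
    · simp [hF]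
    · simp [h1]
    · simp; omega
    · simp [h1]; omega
  · rintro τ ⟨hF, t, ht, h1, h3⟩ hh
    have ht' : t = K := by
      have := mt (hc t ht τ hF h1).2.2 hh
      omega
    subst ht'
    exact hPost _ (by simpa using hF) (by simpa using h1) (by simp; omega)

end

/-- With `R = 2 ^ (Nat.log 2 N + 1)` the array length is `R ^ 10`, while `N < R`, `m ^ 4 < R`, `g ≤
2 m ^ 2` and `xx ≤ 8 R`. Hence every quantity is at most a constant times `R ^ 2`. -/
theorem Params.fits_ofSize (M : ℕ → ℕ) {N : ℕ} (hN : 0 < N) :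
    (Params.ofSize M N).Fits (arraySize N) := by
  have hR : N < 2 ^ (Nat.log 2 N + 1) := Nat.lt_pow_succ_log_self (by norm_num) N
  have hQ : arraySize N = (2 ^ (Nat.log 2 N + 1)) ^ 10 := by rw [arraySize, ← pow_mul, mul_comm]
  set R := 2 ^ (Nat.log 2 N + 1) with hRd
  have hR2 : 2 ≤ R := by
    calc 2 = 2 ^ 1 := rfl
      _ ≤ R := Nat.pow_le_pow_right (by norm_num) (by omega)
  have hQ' : 256 * (R * R) ≤ arraySize N := by
    rw [hQ, show R ^ 10 = R ^ 8 * (R * R) by ring]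
    exact Nat.mul_le_mul_right _ (Nat.pow_le_pow_left hR2 8)
  set l' := logPart N with hl
  have hm4 : (2 ^ l') ^ 4 ≤ N := by rw [← pow_mul, mul_comm]; exact pow_logPart_le hN
  have hlm : l' < 2 ^ l' := Nat.lt_two_pow_self
  set m' := 2 ^ l' with hm
  have hm1 : 1 ≤ m' := by omega
  have hmm : m' * m' * (m' * m') < R := by
    have : m' * m' * (m' * m') = m' ^ 4 := by ring
    omega
  have hm2 : m' ≤ m' * m' := Nat.le_mul_self _
  have hmm2 : m' * m' ≤ m' * m' * (m' * m') := Nat.le_mul_self _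
  have hRR : R ≤ R * R := Nat.le_mul_self _
  have hg : 2 ^ Nat.clog 2 (l' * l') ≤ 2 * (m' * m') := by
    have h1 := pow_clog_le (l' * l')
    have h2 : (l' + 1) * (l' + 1) ≤ m' * m' := Nat.mul_le_mul hlm hlm
    have h3 : (l' + 1) * (l' + 1) = l' * l' + 2 * l' + 1 := by ring
    omega
  set h' := Nat.clog 2 (l' * l') with hh
  have hm3 : m' * m' * m' ≤ R := (Nat.mul_le_mul_left _ hm2).trans hmm.le
  refine ⟨hN, hm1, Nat.succ_pos _, Nat.succ_pos _, ?_, ?_, ?_, ?_, ?_, ?_, ?_⟩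
  · show m' ≤ N
    have : m' * m' * (m' * m') = m' ^ 4 := by ring
    omega
  · show 16 * (N * N) + 16 < _
    have : N * N ≤ R * R := Nat.mul_le_mul hR.le hR.le
    omega
  · show (m' * m' + 3) * m' < _
    have : (m' * m' + 3) * m' = m' * m' * m' + 3 * m' := by ring
    omega
  · show m' * m' * 2 ^ (l' / 4) < _
    have : 2 ^ (l' / 4) ≤ m' := Nat.pow_le_pow_right (by norm_num) (Nat.div_le_self _ _)
    have := Nat.mul_le_mul_left (m' * m') this
    omega
  · show m' * (2 ^ h' * 2 ^ h') + 1 < _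
    have h1 := Nat.mul_le_mul_left m' (Nat.mul_le_mul hg hg)
    have h2 : m' * (2 * (m' * m') * (2 * (m' * m'))) = 4 * (m' * (m' * m' * (m' * m'))) := by ring
    have h3 : m' * (m' * m' * (m' * m')) ≤ R * R := Nat.mul_le_mul (by omega) hmm.le
    omega
  · show m' * ((l' / 2048 - 1) / ((h' + 1) * (h' + 1)) + 1) + 1 < _
    have h1 : (l' / 2048 - 1) / ((h' + 1) * (h' + 1)) + 1 ≤ m' := by
      have := Nat.div_le_self (l' / 2048 - 1) ((h' + 1) * (h' + 1))
      omega
    have := Nat.mul_le_mul_left m' h1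
    omega
  · have hd : (h' + 1) * ((l' - 1) / (8 * (h' + 1)) + 1) ≤ l' + h' + 1 := by
      have h1 : (l' - 1) / (8 * (h' + 1)) * (8 * (h' + 1)) ≤ l' - 1 := Nat.div_mul_le_self _ _
      have h2 : (h' + 1) * ((l' - 1) / (8 * (h' + 1)) + 1) ≤
          (l' - 1) / (8 * (h' + 1)) * (8 * (h' + 1)) + (h' + 1) := by
        rw [Nat.mul_succ, mul_comm]
        exact Nat.add_le_add_right (Nat.mul_le_mul_left _ (by omega)) _
      omega
    have hx : (Params.ofSize M N).xx ≤ 8 * R := by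
      show (m' / 2 ^ h' + 1) * 2 ^ ((h' + 1) * ((l' - 1) / (8 * (h' + 1)) + 1)) ≤ _
      calc (m' / 2 ^ h' + 1) * 2 ^ ((h' + 1) * ((l' - 1) / (8 * (h' + 1)) + 1))
          ≤ (m' + m') * 2 ^ (l' + h' + 1) :=
            Nat.mul_le_mul (Nat.add_le_add (Nat.div_le_self _ _) hm1)
              (Nat.pow_le_pow_right (by norm_num) hd)
        _ = 4 * (m' * m' * 2 ^ h') := by rw [hm, pow_succ, pow_add]; ring
        _ ≤ 4 * (m' * m' * (2 * (m' * m'))) := by gcongr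
        _ = 8 * (m' * m' * (m' * m')) := by ring
        _ ≤ 8 * R := by omega
    have := Nat.mul_le_mul hx hx
    have h2 : 8 * R * (8 * R) = 64 * (R * R) := by ring
    have h3 : 0 < R * R := by positivity
    omega


/-- The language has no division or logarithm, so the parameters are found by doubling and counting
loops. Their tests hold exactly below the values in `Params.ofSize`, by `lt_logPart_iff`,
`Nat.lt_clog_iff_pow_lt` and `mul_succ_lt_iff`. -/
theorem run_params {N : ℕ} (hN : 0 < N) {σ : State} {Post : State → Prop}
    (hσ : ∀ v, σ.reg v = 0) (hinp : σ.arr inp 0 = N)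
    (hPost : ∀ τ, Frame (l :: paramVars) [] σ τ → Consts (Params.ofSize (σ.arr inp) N) τ →
      τ.clock ≤ σ.clock + 200 * (N * N) + 500 → Post τ) :
    Run (arraySize N) params σ Post := by
  have hfit := Params.fits_ofSize (σ.arr inp) hN
  set Q := arraySize N with hQ
  set l' := logPart N with hl
  set h' := Nat.clog 2 (l' * l') with hh
  have hnQ : 16 * (N * N) + 16 < Q := hfit.n_lt
  have hnn : N ≤ N * N := Nat.le_mul_self _
  have hm4 := pow_logPart_le hN
  rw [← hl] at hm4
  have hml : 2 ^ l' ≤ N := (Nat.pow_le_pow_right (by norm_num) (by omega)).trans hm4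
  have hll : l' < 2 ^ l' := Nat.lt_two_pow_self
  have hlN : l' < N := by omega
  have hl2 : l' * l' ≤ N * N := Nat.mul_le_mul hlN.le hlN.le
  have hh2 : h' ≤ l' * l' := Nat.clog_le_of_le_pow Nat.lt_two_pow_self.le
  have hgg := hfit.gg_lt
  have hgQ : 2 ^ h' < Q := by
    have h1 : 1 ≤ 2 ^ l' := Nat.one_le_two_pow
    have h2 : 2 ^ h' ≤ 2 ^ h' * 2 ^ h' := Nat.le_mul_self _
    have h3 : 1 * (2 ^ h' * 2 ^ h') ≤ 2 ^ l' * (2 ^ h' * 2 ^ h') := Nat.mul_le_mul_right _ h1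
    change 2 ^ l' * (2 ^ h' * 2 ^ h') + 1 < Q at hgg
    omega
  have hdd : (h' + 1) * (h' + 1) ≤ 4 * N := by
    have h1 : h' + 1 ≤ 2 ^ h' := Nat.lt_two_pow_self
    have h2 : 2 ^ h' ≤ 2 * (2 ^ l' * 2 ^ l') := by
      have h1 := pow_clog_le (l' * l')
      rw [← hh] at h1
      have h2 : (l' + 1) * (l' + 1) ≤ 2 ^ l' * 2 ^ l' := Nat.mul_le_mul hll hll
      have h3 : (l' + 1) * (l' + 1) = l' * l' + 2 * l' + 1 := by ring
      omega
    calc (h' + 1) * (h' + 1) ≤ (2 * (2 ^ l' * 2 ^ l')) * (2 * (2 ^ l' * 2 ^ l')) :=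
          Nat.mul_le_mul (h1.trans h2) (h1.trans h2)
      _ = 4 * 2 ^ (4 * l') := by rw [show 4 * l' = l' + l' + (l' + l') by omega]; simp only [pow_add]; ring
      _ ≤ 4 * N := by omega
  refine run_seq (run_assign (by simp; omega) ?_)
  refine run_seq (run_assign (by simp; omega) ?_)
  refine run_seq (run_double (K := l') (t₀ := 28) (by decide) (by simp) (by simp [hσ]) (by omega)
    (by omega) ?_ (by simp) ?_)
  · intro t ht τ hF h1 h2
    have hn' : τ.reg n = N := by rw [hF.reg n (by decide)]; simp [hinp]
    have e1 : (2 ^ t + 2 ^ t) * (2 ^ t + 2 ^ t) * ((2 ^ t + 2 ^ t) * (2 ^ t + 2 ^ t)) =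
        2 ^ (4 * (t + 1)) := by
      rw [show 4 * (t + 1) = t + 1 + (t + 1) + (t + 1 + (t + 1)) by omega]
      simp only [pow_add]; ring
    have e2 : 2 ^ (4 * (t + 1)) ≤ 16 * N := by
      calc 2 ^ (4 * (t + 1)) ≤ 2 ^ (4 * l' + 4) := Nat.pow_le_pow_right (by norm_num) (by omega)
        _ = 16 * 2 ^ (4 * l') := by rw [pow_add]; ring
        _ ≤ 16 * N := by omega
    have e3 := Nat.le_mul_self (2 ^ t + 2 ^ t)
    have e4 := Nat.le_mul_self ((2 ^ t + 2 ^ t) * (2 ^ t + 2 ^ t))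
    rw [e1] at e4
    refine ⟨?_, ?_⟩
    · simp only [Cond.ok_lt, Expr.ok_mul, Expr.ok_add, Expr.ok_var, Expr.ok_lit, Expr.eval_add,
        Expr.eval_mul, Expr.eval_var, Expr.eval_lit, h1, hn', e1, true_and]
      omega
    · simp only [Cond.holds_lt, Expr.eval_add, Expr.eval_mul, Expr.eval_var, Expr.eval_lit, h1, hn',
        e1]
      rw [hl, lt_logPart_iff hN]
      omega
  intro τ₁ hF₁ hm₁ hl₁ hc₁
  refine run_seq (run_assign (by simp; omega) ?_)
  refine run_seq (run_double (K := h') (t₀ := 14) (by decide) (by simp)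
    (by simp [hF₁.reg, hσ]) (by omega) hgQ ?_ (by simp) ?_)
  · intro t ht τ hF h1 h2
    have hl' : τ.reg l = l' := by rw [hF.reg l (by decide)]; simpa using hl₁
    refine ⟨by simp [hl']; omega, ?_⟩
    simp only [Cond.holds_lt, Expr.eval_mul, Expr.eval_var, h1, hl', hh]
    exact (Nat.lt_clog_iff_pow_lt (by norm_num)).symm
  intro τ₂ hF₂ hg₂ hh₂ hc₂
  refine run_seq (run_assign (by simp [hh₂]; omega) ?_)
  refine run_seq (run_assign (by simp; omega) ?_)
  refine run_seq (run_count (K := (l' - 1) / (8 * (h' + 1))) (t₀ := 12) (by simp) ?_ ?_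
    (by simp) ?_)
  · have := Nat.div_le_self (l' - 1) (8 * (h' + 1)); omega
  · intro t ht τ hF h1
    have hl' : τ.reg l = l' := by
      rw [hF.reg l (by decide)]; simpa [hF₂.reg l (by decide)] using hl₁
    have hd' : τ.reg hd = h' + 1 := by rw [hF.reg hd (by decide)]; simpa using hh₂
    have e1 := mul_succ_le_of_le (by omega) ht
    refine ⟨?_, ?_⟩
    · simp only [Cond.ok_lt, Expr.ok_mul, Expr.ok_var, Expr.ok_lit, Expr.eval_mul, Expr.eval_var,
        Expr.eval_lit, hd', h1, true_and, and_true]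
      omega
    · simp only [Cond.holds_lt, Expr.eval_mul, Expr.eval_var, Expr.eval_lit, hd', h1, hl']
      exact mul_succ_lt_iff (by omega)
  intro τ₃ hF₃ hs₃ hc₃
  refine run_seq (run_assign (by simp; omega) ?_)
  refine run_seq (run_count (K := (l' / 2048 - 1) / ((h' + 1) * (h' + 1))) (t₀ := 14) (by simp)
    ?_ ?_ (by simp) ?_)
  · have := Nat.div_le_self (l' / 2048 - 1) ((h' + 1) * (h' + 1)); omega
  · intro t ht τ hF h1
    have hl' : τ.reg l = l' := by
      rw [hF.reg l (by decide)]
      simpa [hF₃.reg l (by decide), hF₂.reg l (by decide)] using hl₁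
    have hd' : τ.reg hd = h' + 1 := by
      rw [hF.reg hd (by decide)]; simpa [hF₃.reg hd (by decide)] using hh₂
    have hpos : 0 < (h' + 1) * (h' + 1) := by positivity
    have e1 := mul_succ_le_of_le hpos ht
    refine ⟨?_, ?_⟩
    · simp only [Cond.ok_lt, Expr.ok_mul, Expr.ok_var, Expr.ok_lit, Expr.ok_shr, Expr.eval_mul,
        Expr.eval_var, hd', h1, true_and]
      omega
    · simp only [Cond.holds_lt, Expr.eval_mul, Expr.eval_var, Expr.eval_lit, Expr.eval_shr, hd', h1,
        hl']
      exact mul_succ_lt_iff hpos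
  intro τ₄ hF₄ hb₄ hc₄
  have hm₄ : τ₄.reg m = 2 ^ l' := by
    simpa [hF₄.reg m (by decide), hF₃.reg m (by decide), hF₂.reg m (by decide)] using hm₁
  have hl₄ : τ₄.reg l = l' := by
    simpa [hF₄.reg l (by decide), hF₃.reg l (by decide), hF₂.reg l (by decide)] using hl₁
  have hg₄ : τ₄.reg g = 2 ^ h' := by
    simpa [hF₄.reg g (by decide), hF₃.reg g (by decide)] using hg₂
  have hh₄ : τ₄.reg h = h' := by
    simpa [hF₄.reg h (by decide), hF₃.reg h (by decide)] using hh₂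
  have hd₄ : τ₄.reg hd = h' + 1 := by
    simpa [hF₄.reg hd (by decide), hF₃.reg hd (by decide)] using hh₂
  have hs₄ : τ₄.reg s = (l' - 1) / (8 * (h' + 1)) + 1 := by
    simpa [hF₄.reg s (by decide)] using hs₃
  have hn₄ : τ₄.reg n = N := by
    simp [hF₄.reg n (by decide), hF₃.reg n (by decide), hF₂.reg n (by decide),
      hF₁.reg n (by decide), hinp]
  have ho₄ : τ₄.reg o = 0 := by
    simp [hF₄.reg o (by decide), hF₃.reg o (by decide), hF₂.reg o (by decide),
      hF₁.reg o (by decide), hσ]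
  have hFall : Frame (l :: paramVars) [] σ τ₄ := by
    have w₁ : Frame (l :: paramVars) [] _ τ₁ := hF₁.mono (by decide) (by decide)
    have w₂ : Frame (l :: paramVars) [] _ τ₂ := hF₂.mono (by decide) (by decide)
    have w₃ : Frame (l :: paramVars) [] _ τ₃ := hF₃.mono (by decide) (by decide)
    have w₄ : Frame (l :: paramVars) [] _ τ₄ := hF₄.mono (by decide) (by decide)
    refine Frame.trans (τ := τ₃) (Frame.trans (τ := τ₂) (Frame.trans (τ := τ₁)
      (Frame.trans ?_ w₁) (Frame.trans ?_ w₂)) (Frame.trans ?_ w₃)) (Frame.trans ?_ w₄) <;>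
    simp [paramVars, Frame.refl]
  have hinp₄ : τ₄.arr inp = σ.arr inp := hFall.arr inp (by decide)
  have hK1 := Nat.div_le_self (l' - 1) (8 * (h' + 1))
  have hK2 := Nat.div_le_self (l' / 2048 - 1) ((h' + 1) * (h' + 1))
  have hmpos : 1 ≤ 2 ^ l' := Nat.one_le_two_pow
  have hxxQ : (2 ^ l' / 2 ^ h' + 1) * 2 ^ ((h' + 1) * ((l' - 1) / (8 * (h' + 1)) + 1)) < Q :=
    (Nat.le_mul_self _).trans_lt hfit.xx_lt
  have hddQ : 2 ^ ((h' + 1) * ((l' - 1) / (8 * (h' + 1)) + 1)) < Q := by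
    rw [Nat.succ_mul] at hxxQ; omega
  have hsQ : (h' + 1) * ((l' - 1) / (8 * (h' + 1)) + 1) < Q := Nat.lt_two_pow_self.trans hddQ
  have hggQ : 2 ^ h' * 2 ^ h' < Q := by
    have h3 : 1 * (2 ^ h' * 2 ^ h') ≤ 2 ^ l' * (2 ^ h' * 2 ^ h') := Nat.mul_le_mul_right _ hmpos
    change 2 ^ l' * (2 ^ h' * 2 ^ h') + 1 < Q at hgg
    omega
  have hxQ : 2 ^ l' / 2 ^ h' + 1 < Q := by
    have := Nat.div_le_self (2 ^ l') (2 ^ h'); omega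
  have heQ : 2 ^ (l' / 4) < Q := by
    have : 2 ^ (l' / 4) ≤ 2 ^ l' := Nat.pow_le_pow_right (by norm_num) (Nat.div_le_self _ _)
    omega
  refine run_seq (run_assign (by simpa [hg₄] using hggQ) ?_)
  refine run_seq (run_assign (by simp [hl₄]; omega) ?_)
  refine run_seq (run_assign (by simp [hd₄, hs₄]; omega) ?_)
  refine run_assign ?_ (hPost _ ?_ ?_ ?_)
  · simp [hd₄, hs₄, hm₄, hh₄]; omega
  · simpa [paramVars] using hFall
  · refine ⟨by simp [hinp₄, Params.ofSize], by simp [hn₄, Params.ofSize],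
      by simp [hm₄, Params.ofSize, hl], by simp [hg₄, Params.ofSize, Params.g, hh, hl],
      by simp [hh₄, Params.ofSize, hh, hl], by simp [hd₄, Params.ofSize, hh, hl],
      by simp [hs₄, Params.ofSize, hh, hl], by simp [hb₄, Params.ofSize, hh, hl],
      by simp [hg₄, Params.ofSize, Params.gg, Params.g, hh, hl],
      by simp [hl₄, Params.ofSize, hl],
      by simp [hd₄, hs₄, Params.ofSize, Params.dd, hh, hl],
      by simp [hd₄, hs₄, hm₄, hh₄, Params.ofSize, Params.dd, Params.g, Params.xx, hh, hl],
      by simp [ho₄]⟩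
  · simp at hc₁ hc₂ hc₃ hc₄ ⊢
    omega


/-! ### The whole algorithm: correctness, and its time in terms of a potential -/

open Var Arr BMM

/-- The time of the algorithm with given parameters and potential. -/
noncomputable def timeBound (P : Params) (φ : ℕ → ℝ) : ℝ :=
  1000 * (P.n * P.n) + 600 + P.n * P.n * (1000 * (P.m * P.m)) +
    (P.n / P.m + 1 : ℕ) * (30 + (P.n / P.m + 1 : ℕ) * (30 +
      (P.n / P.m + 1 : ℕ) * (φ (P.m * P.m) + 40 * P.m + 130)))

/-- The table starts empty and hence sound. Soundness and completeness of the final table together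
say that its nonzero entries are the ones of the product. All `n ^ 2` unknown entries are charged in
advance. -/
theorem run_solve {Q : ℕ} {P : Params} {φ : ℕ → ℝ} {σ : State} {Post : State → Prop}
    {A B : Matrix (Fin P.n) (Fin P.n) Bool}
    (hfit : P.Fits Q) (hφ : Potential P φ) (hφ0 : 0 ≤ φ (P.m * P.m)) (hσ : Consts P σ)
    (hA : ∀ y y' : Fin P.n, 0 < P.A y y' ↔ A y y' = true)
    (hB : ∀ y y' : Fin P.n, 0 < P.B y y' ↔ B y y' = true)
    (hwit : ∀ t, σ.arr wit t = 0) (hout : σ.out = [])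
    (hc : σ.clock ≤ 200 * (P.n * P.n) + 500)
    (hPost : ∀ τ L W, IsCertificate A B L →
      (∀ r y' : Fin P.n, W (r * P.n + y') ≠ 0 ↔ boolMul A B r y' = true) →
      τ.out = L.flatMap lineWords ++ productWords W (P.n * P.n) →
      (τ.clock : ℝ) ≤ timeBound P φ → Post τ) :
    Run Q (search ;; certificate ;; printProduct) σ Post := by
  refine run_seq (run_search hfit hφ hφ0 hσ ?_)
  intro τ hF hbetter hcov hpay
  have hsound : P.Sound (τ.arr wit) :=
    hbetter.sound fun i' _ k' _ h => absurd (hwit _) h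
  have hτ := hσ.frame hF (by decide) (by decide)
  refine run_seq (run_certificate (A := A) (B := B) (W := τ.arr wit)
    hτ.inp rfl hτ.n (hF.out.trans hout) hfit.n_pos hA hB hsound hcov hfit.n_lt ?_)
  intro υ L X hυ hcert hcυ
  refine run_printProduct hυ.n hfit.n_lt ?_
  intro ξ hξ hcξ
  refine hPost ξ L (υ.arr wit) hcert ?_ (by rw [hξ, hυ.out]) ?_
  · intro r y'
    rw [hυ.wit]
    constructor
    · intro h
      obtain ⟨h1, h2, h3⟩ := hsound r r.2 y' y'.2 h
      exact decide_eq_true ⟨⟨_, h1⟩, (hA r ⟨_, h1⟩).1 h2, (hB ⟨_, h1⟩ y').1 h3⟩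
    · intro h
      obtain ⟨j', h1, h2⟩ := of_decide_eq_true h
      exact hcov r r.2 j' j'.2 y' y'.2 ((hA r j').2 h1) ((hB j' y').2 h2)
  · have hpay' : (τ.clock : ℝ) ≤ pay P τ := by
      unfold pay; exact_mod_cast Nat.le_add_right _ _
    have hunk : P.unknowns (σ.arr wit) ≤ P.n * P.n :=
      (Finset.card_filter_le _ _).trans (by simp)
    have hpay₀ : pay P σ ≤ 200 * (P.n * P.n) + 500 + P.n * P.n * (1000 * (P.m * P.m)) := by
      unfold pay
      exact_mod_cast Nat.add_le_add hc (Nat.mul_le_mul_right _ hunk)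
    have hend : (ξ.clock : ℝ) ≤ τ.clock + 800 * (P.n * P.n) + 60 := by
      exact_mod_cast (by omega : ξ.clock ≤ τ.clock + 800 * (P.n * P.n) + 60)
    unfold timeBound
    linarith

theorem inputWords_eq (w : ℕ) {N : ℕ} (A B : Matrix (Fin N) (Fin N) Bool) :
    inputWords w A B = (N :: ((List.ofFn fun t : Fin (N * N) =>
      if A t.divNat t.modNat then 1 else 0) ++ List.ofFn fun t : Fin (N * N) =>
        if B t.divNat t.modNat then 1 else 0)).map (BitVec.ofNat w) := by
  have h : ∀ M : Matrix (Fin N) (Fin N) Bool, matrixWords w M = (List.ofFn fun t : Fin (N * N) =>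
      if M t.divNat t.modNat then 1 else 0).map (BitVec.ofNat w) := by
    intro M
    rw [matrixWords, List.map_ofFn]
    congr 1
    funext t
    by_cases ht : M t.divNat t.modNat = true <;> simp [ht]
  rw [inputWords, h, h, List.map_cons, List.map_append]

theorem getD_ofFn {N : ℕ} (M : Matrix (Fin N) (Fin N) Bool) (r y' : Fin N) :
    (List.ofFn fun t : Fin (N * N) => if M t.divNat t.modNat then 1 else 0)[(r * N + y' : ℕ)]? =
      some (if M r y' then 1 else 0) := by
  have h := pair_lt r.2 y'.2
  have hN : 0 < N := (Nat.zero_le _).trans_lt r.2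
  have h1 : Fin.divNat (⟨r * N + y', h⟩ : Fin (N * N)) = r := by
    ext
    simp [Fin.divNat, mul_comm _ N, Nat.mul_add_div hN, Nat.div_eq_of_lt y'.2]
  have h2 : Fin.modNat (⟨r * N + y', h⟩ : Fin (N * N)) = y' := by
    ext
    simp [Fin.modNat, Nat.mod_eq_of_lt y'.2]
  rw [List.getElem?_eq_getElem (by simpa using h), List.getElem_ofFn, h1, h2]

/-- The potential depends only on `N` and not on the input array, so one time bound, written for the
zero array, holds for all matrices of this size. -/
theorem isCombinatorialAlgorithm_multiply (φ : ℕ → ℕ → ℝ)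
    (hφ : ∀ (M : ℕ → ℕ) (N : ℕ), 0 < N → Potential (Params.ofSize M N) (φ N))
    (hφ0 : ∀ N t, 0 ≤ φ N t) :
    IsCombinatorialAlgorithm (program multiply) 14 fun N =>
      ⌊timeBound (Params.ofSize 0 N) (φ N)⌋₊ + 4 * Nat.log 2 N + 30 := by
  intro N w hN hw A B
  obtain ⟨input, hinput⟩ : ∃ input, input = N :: ((List.ofFn fun t : Fin (N * N) =>
      if A t.divNat t.modNat then 1 else 0) ++ List.ofFn fun t : Fin (N * N) =>
        if B t.divNat t.modNat then 1 else 0) := ⟨_, rfl⟩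
  set σ := initState input with hσ
  have hinp : σ.arr inp = fun t => input.getD t 0 := by funext t; simp [hσ, initState]
  have h0 : input.getD 0 0 = N := by rw [hinput]; rfl
  have hfit := Params.fits_ofSize (σ.arr inp) hN
  have hnQ : 16 * (N * N) + 16 < arraySize N := hfit.n_lt
  have hnn : N ≤ N * N := Nat.le_mul_self _
  have hA : ∀ r y' : Fin N, 0 < (Params.ofSize (σ.arr inp) N).A r y' ↔ A r y' = true := by
    intro r y'
    have h := pair_lt r.2 y'.2
    have : (Params.ofSize (σ.arr inp) N).A r y' = if A r y' then 1 else 0 := by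
      show σ.arr inp (1 + r * N + y') = _
      rw [hinp, hinput]
      simp only [List.getD_eq_getElem?_getD]
      rw [show 1 + (r : ℕ) * N + y' = (r * N + y') + 1 by ring, List.getElem?_cons_succ,
        List.getElem?_append_left (by simpa using h), getD_ofFn]
      rfl
    rw [this]
    by_cases hAr : A r y' = true <;> simp [hAr]
  have hB : ∀ r y' : Fin N, 0 < (Params.ofSize (σ.arr inp) N).B r y' ↔ B r y' = true := by
    intro r y'
    have : (Params.ofSize (σ.arr inp) N).B r y' = if B r y' then 1 else 0 := by
      show σ.arr inp (1 + N * N + r * N + y') = _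
      rw [hinp, hinput]
      simp only [List.getD_eq_getElem?_getD]
      rw [show 1 + N * N + (r : ℕ) * N + y' = (N * N + (r * N + y')) + 1 by ring,
        List.getElem?_cons_succ, List.getElem?_append_right (by simp)]
      simp only [List.length_ofFn, Nat.add_sub_cancel_left]
      rw [getD_ofFn]
      rfl
    rw [this]
    by_cases hBr : B r y' = true <;> simp [hBr]
  obtain ⟨τ, hE, L, W, hcert, hW, hout, hclock⟩ :
      Run (arraySize N) multiply σ fun τ => ∃ (L : List (Line N)) (W : ℕ → ℕ),
        IsCertificate A B L ∧ (∀ r y' : Fin N, W (r * N + y') ≠ 0 ↔ boolMul A B r y' = true) ∧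
        τ.out = L.flatMap lineWords ++ productWords W (N * N) ∧
        (τ.clock : ℝ) ≤ timeBound (Params.ofSize 0 N) (φ N) := by
    refine run_seq (run_params hN (fun v => rfl) (by rw [hinp]; exact h0) ?_)
    intro τ hF hC hcτ
    have hinpτ : τ.arr inp = σ.arr inp := hF.arr _ (by decide)
    refine run_solve (P := Params.ofSize (σ.arr inp) N) (A := A) (B := B) hfit (hφ _ _ hN) (hφ0 _ _) hC hA hB
      (fun t => by rw [hF.arr wit (by decide)]; rfl) (hF.out.trans rfl) ?_ ?_
    · have : σ.clock = 0 := rfl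
      show τ.clock ≤ 200 * (N * N) + 500
      omega
    · intro υ L W h1 h2 h3 h4
      exact ⟨L, W, h1, h2, h3, h4⟩
  refine ⟨L, hcert, ?_⟩
  have hmain := outputsWithin_of_run (w := w) (T := ⌊timeBound (Params.ofSize 0 N) (φ N)⌋₊)
    (p := multiply) (input := input) (out := L.flatMap lineWords ++ productWords W (N * N)) hN hw h0
    (by rw [hinput]; simp; omega) ?_ ⟨τ, hE, Nat.le_floor hclock, hout⟩
  · rw [inputWords_eq, ← hinput]
    rwa [List.map_append, map_lineWords, map_productWords w hW] at hmain
  · intro y' hy'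
    rw [hinput] at hy'
    simp only [List.mem_cons, List.mem_append, List.mem_ofFn] at hy'
    rcases hy' with h | ⟨t, h⟩ | ⟨t, h⟩
    · omega
    · rw [← h]; split <;> omega
    · rw [← h]; split <;> omega


open Var Arr BMM

/-! ### The potential -/

/-- The inequality behind the recursion: a node with area one is divided into two nodes with areas
`x * (1 - y)` and `1 - x`. -/
theorem rpow_add_rpow_le {x y K η : ℝ} (hx0 : 0 < x) (hx1 : x ≤ 1) (hy0 : 0 < y) (hy1 : y ≤ 1)
    (hη0 : 0 ≤ η) (hη1 : η ≤ y / 16) (hxK : 1 ≤ x * K) (hKη : K ^ η ≤ 1 + y / 8) :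
    (x * (1 - y)) ^ (1 - η) + (1 - x) ^ (1 - η) ≤ 1 - x * y / 4 := by
  have hc0 : 0 ≤ 1 - η := by linarith
  have hc1 : 1 - η ≤ 1 := by linarith
  -- Bernoulli's inequality for an exponent between zero and one, here and in `h2`.
  have h1 : (1 - x) ^ (1 - η) ≤ 1 - (1 - η) * x := by
    have := rpow_one_add_le_one_add_mul_self (s := -x) (by linarith) hc0 hc1
    simpa [sub_eq_add_neg] using this
  have h2 : (1 - y) ^ (1 - η) ≤ 1 - (1 - η) * y := by
    have := rpow_one_add_le_one_add_mul_self (s := -y) (by linarith) hc0 hc1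
    simpa [sub_eq_add_neg] using this
  -- Since `1 / x ≤ K`, the factor `x ^ (-η)` is at most `K ^ η`.
  have h3 : x ^ (1 - η) ≤ x * (1 + y / 8) := by
    rw [Real.rpow_sub hx0, Real.rpow_one, div_eq_mul_inv]
    refine mul_le_mul_of_nonneg_left ?_ hx0.le
    rw [← Real.inv_rpow hx0.le]
    refine le_trans (Real.rpow_le_rpow (by positivity) ?_ hη0) hKη
    rwa [inv_le_iff_one_le_mul₀ hx0, mul_comm]
  have h4 : 0 ≤ 1 - (1 - η) * y := by nlinarith
  have h5 : (x * (1 - y)) ^ (1 - η) ≤ x * (1 + y / 8) * (1 - (1 - η) * y) := by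
    rw [Real.mul_rpow hx0.le (by linarith)]
    exact mul_le_mul h3 h2 (Real.rpow_nonneg (by linarith) _) (by positivity)
  -- Multiplied by `x`, the `-η` on the right cancels the `η x` that `h1` loses; what remains is the
  -- gain `x y / 4`.
  have h6 : (1 + y / 8) * (1 - (1 - η) * y) ≤ 1 - η - y / 4 := by
    nlinarith [mul_nonneg hη0 (sub_nonneg.2 hy1), mul_nonneg hc0 (sq_nonneg y)]
  nlinarith [mul_le_mul_of_nonneg_left h6 hx0.le]

theorem area_left {a' c' u' v' t M : ℝ} (ha : a' ≠ 0) (hc : c' ≠ 0) :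
    u' * (c' - v') * t / M = a' * c' * t / M * (u' / a' * (1 - v' / c')) := by
  have : u' / a' * (1 - v' / c') = u' * (c' - v') / (a' * c') := by field_simp
  rw [this, div_mul_div_comm, mul_comm M, mul_assoc (a' * c'), mul_div_mul_left _ _ (by positivity)]
  ring

theorem area_right {a' c' u' t M : ℝ} (ha : a' ≠ 0) :
    (a' - u') * c' * t / M = a' * c' * t / M * (1 - u' / a') := by
  have : a' * (1 - u' / a') = a' - u' := by field_simp
  rw [← this]
  ring

namespace Params

variable (P : Params)

/-- The cost of looking up a row of a node, per unit of the area of the node. -/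
noncomputable def rate : ℝ := 1 / P.gg + (1 / P.g + 1 / (P.b * P.s)) ^ 2

/-- The cost of a node, apart from the rows of a leaf. -/
noncomputable def nodeCost : ℝ :=
  7000 * (P.m * P.m) + 300 * (P.xx * P.xx * ((P.s + 1) * (P.s + 1))) + 50 * P.m ^ 3 / P.e

/-- The number of nodes grows with this power of the area, up to one. -/
noncomputable def excess : ℝ := 1 / (16 * P.b * (P.h + 1))

/-- The first term pays for the rows of leaves; it is linear in the area, so a division only lowers
it. The second is the cost of a node times a bound for the number of nodes below one of area `t`,
where `t e / m ^ 2` is the area in units of the largest tiny node. -/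
noncomputable def potential (t : ℕ) : ℝ :=
  60 * P.m * t * P.rate +
    P.nodeCost * (1 + 8 * P.gg * P.b * (t * P.e / (P.m * P.m)) ^ (1 - P.excess))

variable {P}

theorem rate_nonneg : 0 ≤ P.rate := by unfold rate; positivity

theorem nodeCost_nonneg : 0 ≤ P.nodeCost := by unfold nodeCost; positivity

theorem potential_nonneg (t : ℕ) : 0 ≤ P.potential t := by
  have := P.rate_nonneg
  have := P.nodeCost_nonneg
  unfold potential; positivity

theorem excess_nonneg : 0 ≤ P.excess := by unfold excess; positivity

theorem excess_le (hb : 0 < P.b) : P.excess ≤ 1 / P.b / 16 := by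
  have hb' : (1 : ℝ) ≤ P.b := by exact_mod_cast hb
  have hh : (0 : ℝ) ≤ P.h := Nat.cast_nonneg _
  unfold excess
  rw [div_div]
  exact one_div_le_one_div_of_le (by positivity) (by nlinarith)

theorem excess_le_one (hb : 0 < P.b) : P.excess ≤ 1 := by
  have hb' : (1 : ℝ) ≤ P.b := by exact_mod_cast hb
  have := P.excess_le hb
  have : 1 / (P.b : ℝ) ≤ 1 := by rw [div_le_one (by positivity)]; exact hb'
  linarith

/-- Since `gg = 2 ^ (2 h)`, the exponent of two is at most `1 / (8 b)`, and Bernoulli's inequality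
applies. This is why `excess` contains the factor `1 / (h + 1)`. -/
theorem gg_rpow_excess (hb : 0 < P.b) : (P.gg : ℝ) ^ P.excess ≤ 1 + 1 / P.b / 8 := by
  have hb' : (1 : ℝ) ≤ P.b := by exact_mod_cast hb
  have h1 : (P.gg : ℝ) = (1 + 1) ^ ((2 * P.h : ℕ) : ℝ) := by
    rw [Real.rpow_natCast]
    simp only [gg, g]
    push_cast
    norm_num
    ring
  have h2 : ((2 * P.h : ℕ) : ℝ) * P.excess ≤ 1 / P.b / 8 := by
    unfold excess
    push_cast
    rw [mul_one_div, div_div, div_le_div_iff₀ (by positivity) (by positivity)]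
    nlinarith [(Nat.cast_nonneg P.h : (0 : ℝ) ≤ P.h)]
  rw [h1, ← Real.rpow_mul (by norm_num)]
  calc ((1 : ℝ) + 1) ^ (((2 * P.h : ℕ) : ℝ) * P.excess) ≤ (1 + 1) ^ (1 / (P.b : ℝ) / 8) :=
        Real.rpow_le_rpow_of_exponent_le (by norm_num) h2
    _ ≤ 1 + 1 / P.b / 8 * 1 := by
        refine rpow_one_add_le_one_add_mul_self (by norm_num) (by positivity) ?_
        have : 1 / (P.b : ℝ) ≤ 1 := by rw [div_le_one (by positivity)]; exact hb'
        linarith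
    _ = _ := by ring

theorem rowCost_le (a' c' : ℕ) : (P.rowCost a' c' : ℝ) ≤ a' * c' * P.rate := by
  have h1 : ((a' * c' / P.gg : ℕ) : ℝ) ≤ a' * c' / P.gg := by
    have := Nat.cast_div_le (α := ℝ) (m := a' * c') (n := P.gg)
    push_cast at this; exact this
  have h2 : ∀ t : ℕ, ((t / P.g + t / (P.b * P.s) : ℕ) : ℝ) ≤ t * (1 / P.g + 1 / (P.b * P.s)) := by
    intro t
    have h3 := Nat.cast_div_le (α := ℝ) (m := t) (n := P.g)
    have h4 := Nat.cast_div_le (α := ℝ) (m := t) (n := P.b * P.s)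
    push_cast at h3 h4 ⊢
    rw [mul_add, mul_one_div, mul_one_div]
    exact add_le_add h3 h4
  unfold rowCost rate
  rw [Nat.cast_add, Nat.cast_mul, mul_add, mul_one_div]
  refine add_le_add h1 ((mul_le_mul (h2 a') (h2 c') (by positivity) (by positivity)).trans ?_)
  exact le_of_eq (by ring)

-- `rpow_add_rpow_le` is used with the shares `x = u' / a'` and `y = v' / c'` and with `K = gg`. The
-- conditions for a division give `x ≥ 1 / gg` and `y ≥ 1 / b`, so the gain is at least `1 / (4 gg
-- b)`.
set_option maxHeartbeats 1000000 in
theorem potential_split (hm : 0 < P.m) (hb : 0 < P.b) (he : 0 < P.e) {a' c' u' v' : ℕ}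
    (hu : u' ≤ a') (hv : v' ≤ c') (hau : a' ≤ u' * P.gg) (hcv : c' ≤ v' * P.b)
    (hac : P.m * P.m < a' * c' * P.e) :
    P.potential (u' * (c' - v')) + P.potential ((a' - u') * c') + ((1000 * (P.m * P.m) : ℕ) : ℝ) ≤
      P.potential (a' * c') := by
  have hm' : (0 : ℝ) < P.m := by exact_mod_cast hm
  have hb' : (1 : ℝ) ≤ P.b := by exact_mod_cast hb
  have he' : (0 : ℝ) < P.e := by exact_mod_cast he
  have hg : 0 < P.g := Nat.two_pow_pos _
  have hgg1 : 1 ≤ P.gg := Nat.mul_pos hg hg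
  have hr := P.rate_nonneg
  have hY := P.nodeCost_nonneg
  have hη := P.excess_nonneg
  have hη1 := P.excess_le_one hb
  have hac' : 0 < a' * c' := by
    rcases Nat.eq_zero_or_pos (a' * c') with h | h
    · simp [h] at hac
    · exact h
  have ha : 0 < a' := Nat.pos_of_mul_pos_right hac'
  have hc : 0 < c' := Nat.pos_of_mul_pos_left hac'
  have hu0 : 0 < u' := by
    rcases Nat.eq_zero_or_pos u' with h | h
    · simp [h] at hau; omega
    · exact h
  have hv0 : 0 < v' := by
    rcases Nat.eq_zero_or_pos v' with h | h
    · simp [h] at hcv; omega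
    · exact h
  have hA : (0 : ℝ) < a' := by exact_mod_cast ha
  have hC : (0 : ℝ) < c' := by exact_mod_cast hc
  have hU : (0 : ℝ) < u' := by exact_mod_cast hu0
  have hV : (0 : ℝ) < v' := by exact_mod_cast hv0
  have hUA : (u' : ℝ) ≤ a' := by exact_mod_cast hu
  have hVC : (v' : ℝ) ≤ c' := by exact_mod_cast hv
  have hAU : (a' : ℝ) ≤ u' * P.gg := by exact_mod_cast hau
  have hCV : (c' : ℝ) ≤ v' * P.b := by exact_mod_cast hcv
  have hbig : 1 ≤ (a' : ℝ) * c' * P.e / (P.m * P.m) := by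
    rw [one_le_div (by positivity)]; exact_mod_cast hac.le
  have hq : 1 / (P.b : ℝ) ≤ v' / c' := by
    rw [div_le_div_iff₀ (by positivity) hC]; linarith
  have key := rpow_add_rpow_le (x := u' / a') (y := v' / c') (K := P.gg) (η := P.excess)
    (by positivity) (by rw [div_le_one hA]; exact hUA) (by positivity)
    (by rw [div_le_one hC]; exact hVC) hη
    ((P.excess_le hb).trans (div_le_div_of_nonneg_right hq (by norm_num)))
    (by rw [div_mul_eq_mul_div, one_le_div hA]; exact hAU)
    ((P.gg_rpow_excess hb).trans (by
      have := div_le_div_of_nonneg_right hq (show (0 : ℝ) ≤ 8 by norm_num)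
      linarith))
  set Z := (a' : ℝ) * c' * P.e / (P.m * P.m) with hZ
  have hZ0 : 0 ≤ Z := by positivity
  have e1 : (u' : ℝ) * (c' - v') * P.e / (P.m * P.m) = Z * (u' / a' * (1 - v' / c')) := area_left hA.ne' hC.ne'
  have e2 : ((a' : ℝ) - u') * c' * P.e / (P.m * P.m) = Z * (1 - u' / a') := area_right hA.ne'
  have n1 : 0 ≤ 1 - (u' : ℝ) / a' := by rw [sub_nonneg, div_le_one hA]; exact hUA
  have n2 : 0 ≤ 1 - (v' : ℝ) / c' := by rw [sub_nonneg, div_le_one hC]; exact hVC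
  have hZc : 1 ≤ Z ^ (1 - P.excess) := Real.one_le_rpow hbig (by linarith)
  -- The constant `8` provides two node costs: one for the additional node, one for the time of the
  -- division. That the node is not tiny makes `Z ≥ 1`, which preserves this gain.
  have hR : 2 ≤ 8 * P.gg * P.b * ((u' / a' : ℝ) * (v' / c') / 4) := by
    have h1 : 1 ≤ (u' : ℝ) / a' * P.gg := by
      rw [div_mul_eq_mul_div, one_le_div hA]; exact hAU
    have h2 : 1 ≤ (v' : ℝ) / c' * P.b := by
      rw [div_mul_eq_mul_div, one_le_div hC]; exact hCV
    have := one_le_mul_of_one_le_of_one_le h1 h2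
    linarith
  have hYm : ((1000 * (P.m * P.m) : ℕ) : ℝ) ≤ P.nodeCost := by
    unfold nodeCost
    push_cast
    have : (0 : ℝ) ≤ 50 * P.m ^ 3 / P.e := by positivity
    have h2 : (0 : ℝ) ≤ 300 * (P.xx * P.xx * ((P.s + 1) * (P.s + 1))) := by positivity
    nlinarith [mul_pos hm' hm']
  unfold potential
  push_cast [Nat.cast_sub hu, Nat.cast_sub hv] at hYm ⊢
  rw [e1, e2, Real.mul_rpow hZ0 (by positivity), Real.mul_rpow hZ0 n1]
  set S := (u' / a' * (1 - v' / c') : ℝ) ^ (1 - P.excess)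
  set S' := (1 - u' / a' : ℝ) ^ (1 - P.excess)
  set Zc := Z ^ (1 - P.excess)
  have hlin : 60 * P.m * (u' * ((c' : ℝ) - v')) * P.rate + 60 * P.m * (((a' : ℝ) - u') * c') * P.rate ≤
      60 * P.m * (a' * c') * P.rate := by
    have : 0 ≤ 60 * P.m * (u' * v') * P.rate := by positivity
    linarith
  have hR' : 2 ≤ 8 * P.gg * P.b * (Zc * (1 - S - S')) := by
    have h8 : 0 ≤ 8 * (P.gg : ℝ) * P.b := by positivity
    refine hR.trans (mul_le_mul_of_nonneg_left ?_ h8)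
    have h1 : (u' / a' : ℝ) * (v' / c') / 4 ≤ 1 - S - S' := by linarith
    have h0 : 0 ≤ (u' / a' : ℝ) * (v' / c') / 4 := by positivity
    exact h1.trans (le_mul_of_one_le_left (h0.trans h1) hZc)
  have := mul_le_mul_of_nonneg_left hR' hY
  linarith

/-- In a tiny node the inspection costs `50 m t ≤ 50 m ^ 3 / e`, which is contained in `nodeCost`.
In a leaf, `rowCost_le` moves the rows to the linear term, and the table is part of `nodeCost`. -/
theorem potential_spec (hm : 0 < P.m) (hb : 0 < P.b) (he : 0 < P.e) :
    Potential P P.potential := by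
  have hm' : (0 : ℝ) < P.m := by exact_mod_cast hm
  have hb' : (1 : ℝ) ≤ P.b := by exact_mod_cast hb
  have he' : (0 : ℝ) < P.e := by exact_mod_cast he
  have hg : 0 < P.g := Nat.two_pow_pos _
  have hgg1 : 1 ≤ P.gg := Nat.mul_pos hg hg
  have hgg : (1 : ℝ) ≤ P.gg := by exact_mod_cast hgg1
  have hr := P.rate_nonneg
  have hY := P.nodeCost_nonneg
  have hη := P.excess_nonneg
  have hη1 := P.excess_le_one hb
  have hYle : ∀ t : ℝ, 0 ≤ t → P.nodeCost ≤ P.nodeCost * (1 + 8 * P.gg * P.b * t) := by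
    intro t ht
    refine le_mul_of_one_le_right hY ?_
    have : 0 ≤ 8 * P.gg * P.b * t := by positivity
    linarith
  refine ⟨?_, ?_, ?_, ?_⟩
  · intro t t' htt
    have : (t : ℝ) ≤ t' := by exact_mod_cast htt
    unfold potential
    refine add_le_add (by gcongr) (mul_le_mul_of_nonneg_left ?_ hY)
    have := Real.rpow_le_rpow (z := 1 - P.excess) (by positivity)
      (show (t : ℝ) * P.e / (P.m * P.m) ≤ t' * P.e / (P.m * P.m) by gcongr) (by linarith)
    have h8 : 0 ≤ 8 * (P.gg : ℝ) * P.b := by positivity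
    nlinarith [mul_le_mul_of_nonneg_left this h8]
  · intro t ht
    have ht' : (t : ℝ) * P.e ≤ P.m * P.m := by exact_mod_cast ht
    refine le_trans ?_ (le_add_of_nonneg_left (by positivity))
    refine le_trans ?_ (hYle _ (by positivity))
    unfold nodeCost
    push_cast
    have h1 : 50 * ((P.m : ℝ) * t) ≤ 50 * P.m ^ 3 / P.e := by
      rw [le_div_iff₀ he']
      nlinarith [mul_le_mul_of_nonneg_left ht' hm'.le]
    have h2 : (0 : ℝ) ≤ 300 * (P.xx * P.xx * ((P.s + 1) * (P.s + 1))) := by positivity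
    nlinarith [mul_pos hm' hm']
  · intro a' c' _ _ _
    have h1 := mul_le_mul_of_nonneg_left (P.rowCost_le a' c') (show 0 ≤ 60 * (P.m : ℝ) by positivity)
    have h2 : (300 * (P.xx * P.xx * ((P.s + 1) * (P.s + 1))) + 6000 * (P.m * P.m) : ℝ) ≤
        P.nodeCost := by
      unfold nodeCost
      have : (0 : ℝ) ≤ 50 * P.m ^ 3 / P.e := by positivity
      nlinarith [mul_pos hm' hm']
    have h3 := hYle (((a' * c' : ℕ) * P.e / (P.m * P.m)) ^ (1 - P.excess)) (by positivity)
    unfold potential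
    push_cast at h3 ⊢
    linarith
  · intro a' c' u' v' _ _ hu hv hau hcv hac
    exact P.potential_split hm hb he hu hv hau hcv hac

end Params


open Var Arr BMM Filter

/-! ### The running time -/

namespace Params

variable {P : Params} {ℓ : ℝ}

/-- This is where the fourth power comes from: `gg ≥ ℓ ^ 4`, and `b s ≥ ℓ ^ 2 / (2 ^ 15 H ^ 3)` with
`H = h + 1`, a multiple of `log ℓ`. The square of `1 / (b s)` gives the factor `H ^ 6`. -/
theorem rate_le (hℓ : 0 < ℓ) (hg : ℓ ^ 2 ≤ P.g) (hs : ℓ ≤ 8 * (P.h + 1) * P.s)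
    (hb : ℓ ≤ 4096 * (P.h + 1) ^ 2 * P.b) : P.rate ≤ 2 ^ 31 * (P.h + 1) ^ 6 / ℓ ^ 4 := by
  obtain ⟨H, hH⟩ : ∃ H : ℝ, H = P.h + 1 := ⟨_, rfl⟩
  rw [← hH] at hs hb ⊢
  have hH1 : 1 ≤ H := by rw [hH]; linarith [(Nat.cast_nonneg P.h : (0 : ℝ) ≤ P.h)]
  have hg0 : (0 : ℝ) < P.g := lt_of_lt_of_le (by positivity) hg
  have hbs0 : (0 : ℝ) ≤ P.b * P.s := by positivity
  have hbs : ℓ ^ 2 ≤ 2 ^ 15 * H ^ 3 * (P.b * P.s) := by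
    calc ℓ ^ 2 = ℓ * ℓ := sq ℓ
      _ ≤ (8 * H * P.s) * (4096 * H ^ 2 * P.b) := mul_le_mul hs hb hℓ.le (by positivity)
      _ = _ := by ring
  have hbs1 : (0 : ℝ) < P.b * P.s := by
    by_contra h
    have : (P.b : ℝ) * P.s = 0 := le_antisymm (not_lt.1 h) hbs0
    rw [this, mul_zero] at hbs
    exact absurd hbs (not_le.2 (by positivity))
  have h1 : 1 / (P.gg : ℝ) ≤ H ^ 6 / ℓ ^ 4 := by
    have : ℓ ^ 4 ≤ P.gg := by
      have : (P.gg : ℝ) = P.g * P.g := by simp [gg]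
      rw [this]
      calc ℓ ^ 4 = ℓ ^ 2 * ℓ ^ 2 := by ring
        _ ≤ _ := mul_le_mul hg hg (by positivity) hg0.le
    exact (one_div_le_one_div_of_le (by positivity) this).trans
      (div_le_div_of_nonneg_right (one_le_pow₀ hH1) (by positivity))
  have h2 : 1 / (P.g : ℝ) ≤ H ^ 3 / ℓ ^ 2 :=
    (one_div_le_one_div_of_le (by positivity) hg).trans
      (div_le_div_of_nonneg_right (one_le_pow₀ hH1) (by positivity))
  have h3 : 1 / ((P.b : ℝ) * P.s) ≤ 2 ^ 15 * (H ^ 3 / ℓ ^ 2) := by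
    rw [← mul_div_assoc, div_le_div_iff₀ hbs1 (by positivity)]
    linarith
  have h4 : (1 / (P.g : ℝ) + 1 / (P.b * P.s)) ^ 2 ≤ ((2 ^ 15 + 1) * (H ^ 3 / ℓ ^ 2)) ^ 2 :=
    pow_le_pow_left₀ (by positivity) (by linarith) 2
  have h5 : ((2 ^ 15 + 1) * (H ^ 3 / ℓ ^ 2)) ^ 2 = (2 ^ 15 + 1) ^ 2 * (H ^ 6 / ℓ ^ 4) := by
    rw [mul_pow, div_pow]; ring
  have h6 : 0 ≤ H ^ 6 / ℓ ^ 4 := by positivity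
  unfold rate
  rw [mul_div_assoc]
  linarith

/-- Table and division cost about `m ^ 2 e` up to powers of `ℓ`; as `e ^ 4 ≤ m`, this is at most `m
^ 3 / e ^ 3` up to such powers, less than the `m ^ 3 / e` of tiny nodes. -/
theorem nodeCost_le (hℓ : 1 ≤ ℓ) (hm : 0 < P.m) (he : 0 < P.e) (hg : (P.g : ℝ) ≤ 3 * ℓ ^ 2)
    (hs : (P.s : ℝ) ≤ ℓ) (hem : P.e ^ 4 ≤ P.m) (hxx : P.xx * P.xx ≤ 16 * P.m ^ 2 * P.e * P.g ^ 2) :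
    P.nodeCost ≤ P.m ^ 3 * (180000 * ℓ ^ 6 / P.e ^ 3 + 50 / P.e) := by
  have hm' : (0 : ℝ) < P.m := by exact_mod_cast hm
  have he' : (1 : ℝ) ≤ P.e := by exact_mod_cast he
  have hem' : (P.e : ℝ) ^ 4 ≤ P.m := by exact_mod_cast hem
  have hxx' : (P.xx : ℝ) * P.xx ≤ 16 * P.m ^ 2 * P.e * P.g ^ 2 := by exact_mod_cast hxx
  have hg2 : (P.g : ℝ) ^ 2 ≤ 9 * ℓ ^ 4 := by
    calc (P.g : ℝ) ^ 2 ≤ (3 * ℓ ^ 2) ^ 2 := pow_le_pow_left₀ (by positivity) hg 2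
      _ = _ := by ring
  have hs2 : ((P.s : ℝ) + 1) * (P.s + 1) ≤ 4 * ℓ ^ 2 := by
    calc ((P.s : ℝ) + 1) * (P.s + 1) ≤ (2 * ℓ) * (2 * ℓ) :=
          mul_le_mul (by linarith) (by linarith) (by positivity) (by positivity)
      _ = _ := by ring
  have h1 : (P.xx : ℝ) * P.xx * ((P.s + 1) * (P.s + 1)) ≤
      16 * P.m ^ 2 * P.e * (9 * ℓ ^ 4) * (4 * ℓ ^ 2) :=
    mul_le_mul (hxx'.trans (by gcongr)) hs2 (by positivity) (by positivity)
  have h2 : 7000 * ((P.m : ℝ) * P.m) ≤ 7000 * (P.m ^ 2 * P.e * ℓ ^ 6) := by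
    have : 1 ≤ (P.e : ℝ) * ℓ ^ 6 := one_le_mul_of_one_le_of_one_le he' (one_le_pow₀ hℓ)
    nlinarith [mul_le_mul_of_nonneg_left this (sq_nonneg (P.m : ℝ))]
  have h3 : (P.m : ℝ) ^ 2 * P.e * ℓ ^ 6 ≤ P.m ^ 3 * (ℓ ^ 6 / P.e ^ 3) := by
    rw [← mul_div_assoc, le_div_iff₀ (by positivity)]
    calc (P.m : ℝ) ^ 2 * P.e * ℓ ^ 6 * P.e ^ 3 = P.m ^ 2 * ℓ ^ 6 * P.e ^ 4 := by ring
      _ ≤ P.m ^ 2 * ℓ ^ 6 * P.m := by gcongr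
      _ = _ := by ring
  have h4 : 50 * (P.m : ℝ) ^ 3 / P.e = P.m ^ 3 * (50 / P.e) := by ring
  unfold nodeCost
  have h6 : (P.m : ℝ) ^ 3 * (180000 * ℓ ^ 6 / P.e ^ 3 + 50 / P.e) =
      180000 * (P.m ^ 3 * (ℓ ^ 6 / P.e ^ 3)) + P.m ^ 3 * (50 / P.e) := by ring
  rw [h4, h6]
  have h5 : 0 ≤ (P.m : ℝ) ^ 2 * P.e * ℓ ^ 6 := by positivity
  linarith

/-- The first node has area `m ^ 2`, that is `e` in units of the largest tiny node. So there are
about `gg b e ^ (1 - η)` nodes, and the hypothesis on `e ^ η` saves the factor `ℓ ^ 16`. -/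
theorem rpow_excess_le (hℓ : 1 ≤ ℓ) (hm : 0 < P.m) (he : 0 < P.e) (hbp : 0 < P.b)
    (hg : (P.g : ℝ) ≤ 3 * ℓ ^ 2) (hb : (P.b : ℝ) ≤ ℓ) (heη : ℓ ^ 16 ≤ (P.e : ℝ) ^ P.excess) :
    1 + 8 * P.gg * P.b * (((P.m * P.m : ℕ) : ℝ) * P.e / (P.m * P.m)) ^ (1 - P.excess) ≤
      81 * ℓ ^ 5 * (P.e / ℓ ^ 16) := by
  have hm' : (0 : ℝ) < P.m := by exact_mod_cast hm
  have he' : (1 : ℝ) ≤ P.e := by exact_mod_cast he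
  have hb' : (1 : ℝ) ≤ P.b := by exact_mod_cast hbp
  have hgp : (1 : ℝ) ≤ P.g := by exact_mod_cast (Nat.two_pow_pos _ : 0 < P.g)
  have hgg : (P.gg : ℝ) = P.g ^ 2 := by simp [gg, sq]
  have e1 : ((P.m * P.m : ℕ) : ℝ) * P.e / (P.m * P.m) = P.e := by
    push_cast; field_simp
  have hexp : (1 : ℝ) ≤ (P.e : ℝ) ^ (1 - P.excess) :=
    Real.one_le_rpow he' (by linarith [P.excess_le_one hbp])
  have hexp' : (P.e : ℝ) ^ (1 - P.excess) ≤ P.e / ℓ ^ 16 := by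
    rw [Real.rpow_sub (by linarith), Real.rpow_one]
    exact div_le_div_of_nonneg_left (by linarith) (by positivity) heη
  have hggb : (P.gg : ℝ) * P.b ≤ 9 * ℓ ^ 5 := by
    rw [hgg]
    calc (P.g : ℝ) ^ 2 * P.b ≤ (3 * ℓ ^ 2) ^ 2 * ℓ :=
          mul_le_mul (pow_le_pow_left₀ (by positivity) hg 2) hb (by positivity) (by positivity)
      _ = _ := by ring
  have hggb1 : 1 ≤ (P.gg : ℝ) * P.b := by
    rw [hgg]; exact one_le_mul_of_one_le_of_one_le (one_le_pow₀ hgp) hb'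
  rw [e1]
  calc 1 + 8 * P.gg * P.b * (P.e : ℝ) ^ (1 - P.excess)
      ≤ 9 * ((P.gg * P.b) * (P.e : ℝ) ^ (1 - P.excess)) := by
        have := one_le_mul_of_one_le_of_one_le hggb1 hexp
        linarith
    _ ≤ 9 * ((9 * ℓ ^ 5) * (P.e / ℓ ^ 16)) := by gcongr
    _ = _ := by ring

/-- In the product of the two previous bounds `e` cancels against the cost `m ^ 3 / e` of tiny nodes
and `m ^ 3 / ℓ ^ 11` is left. Hence the rows of the leaves dominate. -/
theorem potential_le (hℓ : 1 ≤ ℓ) (hm : 0 < P.m) (hbp : 0 < P.b)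
    (hg : ℓ ^ 2 ≤ P.g) (hg' : (P.g : ℝ) ≤ 3 * ℓ ^ 2)
    (hs : ℓ ≤ 8 * (P.h + 1) * P.s) (hs' : (P.s : ℝ) ≤ ℓ)
    (hb : ℓ ≤ 4096 * (P.h + 1) ^ 2 * P.b) (hb' : (P.b : ℝ) ≤ ℓ)
    (hem : P.e ^ 4 ≤ P.m) (hxx : P.xx * P.xx ≤ 16 * P.m ^ 2 * P.e * P.g ^ 2)
    (heη : ℓ ^ 16 ≤ (P.e : ℝ) ^ P.excess) (hle : ℓ ^ 16 ≤ P.e) :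
    P.potential (P.m * P.m) ≤ P.m ^ 3 * (2 ^ 38 * (P.h + 1) ^ 6 / ℓ ^ 4) := by
  have hℓ0 : 0 < ℓ := by linarith
  have hm' : (0 : ℝ) < P.m := by exact_mod_cast hm
  have he0 : (0 : ℝ) < P.e := lt_of_lt_of_le (by positivity) hle
  have he : 0 < P.e := by exact_mod_cast he0
  have hH1 : (1 : ℝ) ≤ P.h + 1 := by linarith [(Nat.cast_nonneg P.h : (0 : ℝ) ≤ P.h)]
  have h1 := P.rate_le hℓ0 hg hs hb
  have h2 := P.nodeCost_le hℓ hm he hg' hs' hem hxx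
  have h3 := P.rpow_excess_le hℓ hm he hbp hg' hb' heη
  have h4 := mul_le_mul h2 h3 (by positivity) (by positivity)
  have h5 : (P.m : ℝ) ^ 3 * (180000 * ℓ ^ 6 / P.e ^ 3 + 50 / P.e) * (81 * ℓ ^ 5 * (P.e / ℓ ^ 16)) =
      P.m ^ 3 * (14580000 / (P.e ^ 2 * ℓ ^ 5) + 4050 / ℓ ^ 11) := by
    field_simp; ring
  have h6 : 14580000 / ((P.e : ℝ) ^ 2 * ℓ ^ 5) ≤ 14580000 * ((P.h + 1) ^ 6 / ℓ ^ 4) := by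
    rw [← mul_div_assoc]
    refine div_le_div₀ (by positivity) (le_mul_of_one_le_right (by norm_num) (one_le_pow₀ hH1))
      (by positivity) ?_
    calc ℓ ^ 4 ≤ 1 * ℓ ^ 5 := by rw [one_mul]; exact pow_le_pow_right₀ hℓ (by norm_num)
      _ ≤ P.e ^ 2 * ℓ ^ 5 := by
        refine mul_le_mul_of_nonneg_right (one_le_pow₀ ?_) (by positivity)
        exact (one_le_pow₀ hℓ).trans hle
  have h7 : 4050 / ℓ ^ 11 ≤ 4050 * ((P.h + 1) ^ 6 / ℓ ^ 4) := by
    rw [← mul_div_assoc]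
    exact div_le_div₀ (by positivity) (le_mul_of_one_le_right (by norm_num) (one_le_pow₀ hH1))
      (by positivity) (pow_le_pow_right₀ hℓ (by norm_num))
  rw [h5] at h4
  have h8 : 0 ≤ (P.m : ℝ) ^ 3 := by positivity
  have h9 : 60 * (P.m : ℝ) * ((P.m * P.m : ℕ) : ℝ) * P.rate ≤
      P.m ^ 3 * (60 * (2 ^ 31 * ((P.h + 1) ^ 6 / ℓ ^ 4))) := by
    push_cast
    rw [mul_div_assoc] at h1
    have := mul_le_mul_of_nonneg_left h1 h8
    linarith
  have h10 : 0 ≤ (P.h + 1 : ℝ) ^ 6 / ℓ ^ 4 := by positivity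
  unfold potential
  rw [show 2 ^ 38 * (P.h + 1 : ℝ) ^ 6 / ℓ ^ 4 = 2 ^ 38 * ((P.h + 1) ^ 6 / ℓ ^ 4) from
    mul_div_assoc _ _ _]
  calc _ ≤ (P.m : ℝ) ^ 3 * (60 * (2 ^ 31 * ((P.h + 1) ^ 6 / ℓ ^ 4))) +
        P.m ^ 3 * (14580000 / (P.e ^ 2 * ℓ ^ 5) + 4050 / ℓ ^ 11) := add_le_add h9 h4
    _ = P.m ^ 3 * (60 * (2 ^ 31 * ((P.h + 1) ^ 6 / ℓ ^ 4)) +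
        (14580000 / (P.e ^ 2 * ℓ ^ 5) + 4050 / ℓ ^ 11)) := by ring
    _ ≤ _ := by
        refine mul_le_mul_of_nonneg_left ?_ h8
        linarith

end Params

/-- There are at most `(2 n / m) ^ 3` blocks. The charge for witnesses, `n ^ 2 m ^ 2`, is at most `n
^ 3 / m ^ 2` because `m ^ 4 ≤ n`. The summand `40 n ^ 2` is a reserve for the prologue. -/
theorem timeBound_le {P : Params} {φ : ℕ → ℝ} {ρ : ℝ} (hm : 0 < P.m) (hmn : P.m ^ 4 ≤ P.n)
    (hφ0 : 0 ≤ φ (P.m * P.m)) (hφ : φ (P.m * P.m) ≤ P.m ^ 3 * ρ) :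
    timeBound P φ + 40 * (P.n * P.n) ≤ P.n ^ 3 * (8 * ρ + 4600 / P.m ^ 2) := by
  have hm' : (1 : ℝ) ≤ P.m := by exact_mod_cast hm
  have hm0 : (0 : ℝ) < P.m := by linarith
  have hmn' : (P.m : ℝ) ^ 4 ≤ P.n := by exact_mod_cast hmn
  have hn : (1 : ℝ) ≤ P.n := (one_le_pow₀ hm').trans hmn'
  have hmn1 : (P.m : ℝ) ≤ P.n := (le_self_pow₀ hm' (by norm_num)).trans hmn'
  set D : ℝ := ((P.n / P.m + 1 : ℕ) : ℝ) with hD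
  have hD1 : 1 ≤ D := by rw [hD]; push_cast; linarith [(Nat.cast_nonneg (P.n / P.m) : (0 : ℝ) ≤ _)]
  have hDn : D ≤ 2 * (P.n / P.m) := by
    have h1 : ((P.n / P.m : ℕ) : ℝ) ≤ P.n / P.m := Nat.cast_div_le
    have h2 : 1 ≤ (P.n : ℝ) / P.m := by rw [one_le_div hm0]; exact hmn1
    rw [hD]; push_cast; linarith
  have hD3 : D ^ 3 ≤ 8 * (P.n ^ 3 / P.m ^ 3) := by
    calc D ^ 3 ≤ (2 * (P.n / P.m)) ^ 3 := pow_le_pow_left₀ (by positivity) hDn 3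
      _ = _ := by rw [mul_pow, div_pow]; norm_num
  have hD13 : D ≤ D ^ 3 := le_self_pow₀ hD1 (by norm_num)
  have hD23 : D ^ 2 ≤ D ^ 3 := pow_le_pow_right₀ hD1 (by norm_num)
  have h1 : D * (30 + D * (30 + D * (φ (P.m * P.m) + 40 * P.m + 130))) ≤
      8 * (P.n ^ 3 / P.m ^ 3) * (P.m ^ 3 * ρ + 230 * P.m) := by
    calc D * (30 + D * (30 + D * (φ (P.m * P.m) + 40 * P.m + 130)))
        = D ^ 3 * (φ (P.m * P.m) + 40 * P.m + 130) + 30 * D ^ 2 + 30 * D := by ring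
      _ ≤ D ^ 3 * (φ (P.m * P.m) + 40 * P.m + 130) + 30 * D ^ 3 + 30 * D ^ 3 := by gcongr
      _ = D ^ 3 * (φ (P.m * P.m) + 40 * P.m + 190) := by ring
      _ ≤ 8 * (P.n ^ 3 / P.m ^ 3) * (P.m ^ 3 * ρ + 230 * P.m) :=
          mul_le_mul hD3 (by linarith) (by positivity) (by positivity)
  have h2 : 8 * ((P.n : ℝ) ^ 3 / P.m ^ 3) * (P.m ^ 3 * ρ + 230 * P.m) =
      P.n ^ 3 * (8 * ρ + 1840 / P.m ^ 2) := by field_simp; ring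
  have h3 : (P.n : ℝ) * P.n * (P.m * P.m) ≤ P.n ^ 3 * (1 / P.m ^ 2) := by
    rw [mul_one_div, le_div_iff₀ (by positivity)]
    calc (P.n : ℝ) * P.n * (P.m * P.m) * (P.m : ℝ) ^ 2 = P.n * P.n * (P.m : ℝ) ^ 4 := by ring
      _ ≤ (P.n : ℝ) * P.n * P.n := by gcongr
      _ = _ := by ring
  have h4 : (P.n : ℝ) * P.n ≤ P.n * P.n * (P.m * P.m) :=
    le_mul_of_one_le_right (by positivity) (one_le_mul_of_one_le_of_one_le hm' hm')
  have h5 : (1 : ℝ) ≤ P.n * P.n := one_le_mul_of_one_le_of_one_le hn hn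
  unfold timeBound
  have h6 : (P.n : ℝ) ^ 3 * (8 * ρ + 4600 / P.m ^ 2) =
      P.n ^ 3 * (8 * ρ + 1840 / P.m ^ 2) + 2760 * (P.n ^ 3 * (1 / P.m ^ 2)) := by ring
  rw [h6, ← h2]
  linarith


/-! ### The estimates for the actual parameters, and the asymptotic bound -/

open Var Arr BMM Filter

/-- A piece has about `ℓ / 8` bits, up to one more digit of `h + 1` bits. So pairs of digit codes
number about `2 ^ (ℓ / 4) = e`; this fixes the constant `8` in the definition of `s`. -/
theorem dd_sq_le (M : ℕ → ℕ) (N : ℕ) : (Params.ofSize M N).dd ^ 2 ≤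
    4 * (Params.ofSize M N).e * (Params.ofSize M N).g ^ 2 := by
  set l' := logPart N with hl
  set h' := Nat.clog 2 (l' * l') with hh
  show (2 ^ ((h' + 1) * ((l' - 1) / (8 * (h' + 1)) + 1))) ^ 2 ≤ 4 * 2 ^ (l' / 4) * (2 ^ h') ^ 2
  have e1 : 4 * 2 ^ (l' / 4) * (2 ^ h') ^ 2 = 2 ^ (2 + l' / 4 + h' * 2) := by
    rw [pow_add, pow_add, ← pow_mul]; norm_num
  rw [← pow_mul, e1]
  refine Nat.pow_le_pow_right (by norm_num) ?_
  have h1 : (l' - 1) / (8 * (h' + 1)) * (h' + 1) ≤ (l' - 1) / 8 := by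
    rw [Nat.le_div_iff_mul_le (by norm_num), mul_assoc, mul_comm (h' + 1)]
    exact Nat.div_mul_le_self _ _
  have e2 : (h' + 1) * ((l' - 1) / (8 * (h' + 1)) + 1) =
      (l' - 1) / (8 * (h' + 1)) * (h' + 1) + (h' + 1) := by ring
  rw [e2]
  omega

theorem xx_mul_xx_le (M : ℕ → ℕ) (N : ℕ) : (Params.ofSize M N).xx * (Params.ofSize M N).xx ≤
    16 * (Params.ofSize M N).m ^ 2 * (Params.ofSize M N).e * (Params.ofSize M N).g ^ 2 := by
  have h1 := dd_sq_le M N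
  set P := Params.ofSize M N
  have hm : 1 ≤ P.m := Nat.one_le_two_pow
  have h2 : P.xx ≤ 2 * P.m * P.dd := by
    refine Nat.mul_le_mul_right _ ?_
    have := Nat.div_le_self P.m P.g
    omega
  calc P.xx * P.xx ≤ (2 * P.m * P.dd) * (2 * P.m * P.dd) := Nat.mul_le_mul h2 h2
    _ = 4 * P.m ^ 2 * P.dd ^ 2 := by ring
    _ ≤ 4 * P.m ^ 2 * (4 * P.e * P.g ^ 2) := Nat.mul_le_mul_left _ h1
    _ = _ := by ring

/-- The conditions on `logPart N` under which the time is estimated. -/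
structure LargePart (t : ℕ) : Prop where
  large : 4096 ≤ t
  clog : 2048 * (Nat.clog 2 (t * t) + 1) ^ 2 ≤ t
  pow : t ^ 16 ≤ 2 ^ (t / 4)

/-- With `q' = ℓ / 4` rounded down and `e = 2 ^ q'` this reads `e ^ η ≥ 2 ^ (8 H)`, and `2 ^ H`
exceeds `ℓ ^ 2`. So the bound on `b` is what yields the saving `ℓ ^ 16`. -/
theorem excess_large {b' H t : ℝ} {q' : ℕ} (hb : 1 ≤ b') (hH : 1 ≤ H) (hq : t ≤ 8 * q')
    (hbH : 1024 * b' * H ^ 2 ≤ t) : 8 * H ≤ q' * (1 / (16 * b' * H)) := by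
  rw [mul_one_div, le_div_iff₀ (by positivity)]
  nlinarith

/-- Here the roundings are dealt with: up to powers of `h + 1`, the parameters `s` and `b` are of
order `ℓ` and `g` lies between `ℓ ^ 2` and `3 ℓ ^ 2`. -/
theorem potential_ofSize_le {N : ℕ} (hN : LargePart (logPart N)) :
    (Params.ofSize 0 N).potential ((Params.ofSize 0 N).m * (Params.ofSize 0 N).m) ≤
      (Params.ofSize 0 N).m ^ 3 * (2 ^ 38 * (Nat.clog 2 (logPart N * logPart N) + 1 : ℝ) ^ 6 /
        (logPart N : ℝ) ^ 4) := by
  obtain ⟨hl, hcl, hpow⟩ := hN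
  have hxx := xx_mul_xx_le 0 N
  set P := Params.ofSize 0 N with hP
  set l' := logPart N with hl'
  set h' := Nat.clog 2 (l' * l') with hh
  have hg : P.g = 2 ^ h' := rfl
  have hs : P.s = (l' - 1) / (8 * (h' + 1)) + 1 := rfl
  have hb : P.b = (l' / 2048 - 1) / ((h' + 1) * (h' + 1)) + 1 := rfl
  have he : P.e = 2 ^ (l' / 4) := rfl
  have hPh : P.h = h' := rfl
  have hpos : 0 < (h' + 1) * (h' + 1) := by positivity
  have hg1 : l' ^ 2 ≤ P.g := by rw [sq]; exact Nat.le_pow_clog (by norm_num) _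
  have hg2 : P.g ≤ 3 * l' ^ 2 := by
    have := pow_clog_le (l' * l')
    rw [← hh] at this
    have : 1 * 1 ≤ l' * l' := Nat.mul_le_mul (by omega) (by omega)
    rw [hg, sq]; omega
  have hs1 : l' ≤ 8 * (h' + 1) * P.s := by
    have := Nat.lt_mul_div_succ (l' - 1) (show 0 < 8 * (h' + 1) by omega)
    rw [hs]; omega
  have hs2 : P.s ≤ l' := by
    have := Nat.div_le_self (l' - 1) (8 * (h' + 1))
    rw [hs]; omega
  have hb1 : l' ≤ 4096 * (h' + 1) ^ 2 * P.b := by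
    have := Nat.lt_mul_div_succ (l' / 2048 - 1) hpos
    rw [← hb] at this
    rw [show 4096 * (h' + 1) ^ 2 * P.b = 4096 * ((h' + 1) * (h' + 1) * P.b) by ring]
    omega
  have hb2 : P.b ≤ l' := by
    have := Nat.div_le_self (l' / 2048 - 1) ((h' + 1) * (h' + 1))
    rw [hb]; omega
  -- The quotient in `b` contributes at most half of `l'`, by the constant `2048`; the added one
  -- contributes the other half, by `LargePart.clog`.
  have hb3 : 1024 * P.b * (h' + 1) ^ 2 ≤ l' := by
    have := Nat.div_mul_le_self (l' / 2048 - 1) ((h' + 1) * (h' + 1))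
    have e1 : 1024 * P.b * (h' + 1) ^ 2 = 1024 * ((l' / 2048 - 1) / ((h' + 1) * (h' + 1)) *
      ((h' + 1) * (h' + 1))) + 1024 * (h' + 1) ^ 2 := by rw [hb]; ring
    omega
  have hem : P.e ^ 4 ≤ P.m := by
    rw [he, ← pow_mul]
    exact Nat.pow_le_pow_right (by norm_num) (Nat.div_mul_le_self _ _)
  have hm0 : 0 < P.m := Nat.two_pow_pos _
  have hb0 : 0 < P.b := Nat.succ_pos _
  -- `l' ^ 16 ≤ g ^ 8 = 2 ^ (8 h')`, and `excess_large` bounds this exponent.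
  have heη : (l' : ℝ) ^ 16 ≤ (P.e : ℝ) ^ P.excess := by
    have hb0' : (1 : ℝ) ≤ P.b := by exact_mod_cast hb0
    have hH : (1 : ℝ) ≤ (h' : ℝ) + 1 := by linarith [(Nat.cast_nonneg h' : (0 : ℝ) ≤ h')]
    have h1 : 8 * ((h' : ℝ) + 1) ≤ ((l' / 4 : ℕ) : ℝ) * P.excess := by
      refine excess_large hb0' hH (t := l') ?_ (by exact_mod_cast hb3)
      exact_mod_cast (by omega : l' ≤ 8 * (l' / 4))
    have h2 : (P.e : ℝ) = 2 ^ ((l' / 4 : ℕ) : ℝ) := by rw [he, Real.rpow_natCast]; push_cast; rfl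
    rw [h2, ← Real.rpow_mul (by norm_num)]
    calc (l' : ℝ) ^ 16 = ((l' : ℝ) ^ 2) ^ 8 := by ring
      _ ≤ ((P.g : ℝ)) ^ 8 := pow_le_pow_left₀ (by positivity) (by exact_mod_cast hg1) 8
      _ = (2 : ℝ) ^ ((8 * h' : ℕ) : ℝ) := by
          rw [hg, Real.rpow_natCast]; push_cast; rw [← pow_mul, mul_comm]
      _ ≤ _ := by
          refine Real.rpow_le_rpow_of_exponent_le (by norm_num) (le_trans ?_ h1)
          push_cast; linarith
  have hmain := P.potential_le (ℓ := l') (by exact_mod_cast (by omega : 1 ≤ l')) hm0 hb0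
    (by exact_mod_cast hg1) (by exact_mod_cast hg2) (by exact_mod_cast hs1) (by exact_mod_cast hs2)
    (by exact_mod_cast hb1) (by exact_mod_cast hb2) hem hxx heη (by exact_mod_cast hpow)
  exact hmain

theorem time_le {N : ℕ} (hN : LargePart (logPart N)) :
    timeBound (Params.ofSize 0 N) (Params.ofSize 0 N).potential + 40 * (N * N) ≤
      N ^ 3 * (2 ^ 42 * (Nat.clog 2 (logPart N * logPart N) + 1 : ℝ) ^ 6 / (logPart N : ℝ) ^ 4) := by
  have h1 := potential_ofSize_le hN
  have hl := hN.large
  have hN0 : 0 < N := by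
    rcases Nat.eq_zero_or_pos N with h | h
    · rw [h] at hl; simp [logPart] at hl
    · exact h
  have hm : (Params.ofSize 0 N).m = 2 ^ logPart N := rfl
  have h2 := timeBound_le (P := Params.ofSize 0 N) (Nat.two_pow_pos _)
    (by rw [hm, ← pow_mul, mul_comm]; exact pow_logPart_le hN0) (Params.potential_nonneg _) h1
  refine h2.trans ?_
  show (N : ℝ) ^ 3 * _ ≤ _
  refine mul_le_mul_of_nonneg_left ?_ (by positivity)
  set ℓ : ℝ := (logPart N : ℝ) with hℓ
  have hℓ1 : 1 ≤ ℓ := by rw [hℓ]; exact_mod_cast (by omega : 1 ≤ logPart N)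
  have hℓ0 : 0 < ℓ := by linarith
  have h3 : ℓ ^ 2 ≤ ((Params.ofSize 0 N).m : ℝ) := by
    have : logPart N ^ 2 ≤ 2 ^ logPart N :=
      (Nat.pow_le_pow_right (by omega) (by norm_num : 2 ≤ 16)).trans
        (hN.pow.trans (Nat.pow_le_pow_right (by norm_num) (Nat.div_le_self _ _)))
    rw [hℓ, hm]; exact_mod_cast this
  set H : ℝ := (Nat.clog 2 (logPart N * logPart N) + 1 : ℝ) with hH
  have hH1 : 1 ≤ H := by
    rw [hH]; linarith [(Nat.cast_nonneg (Nat.clog 2 (logPart N * logPart N)) : (0 : ℝ) ≤ _)]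
  have h4 : 4600 / ((Params.ofSize 0 N).m : ℝ) ^ 2 ≤ 4600 * (H ^ 6 / ℓ ^ 4) := by
    rw [← mul_div_assoc]
    refine div_le_div₀ (by positivity) (le_mul_of_one_le_right (by norm_num) (one_le_pow₀ hH1))
      (by positivity) ?_
    calc ℓ ^ 4 = (ℓ ^ 2) ^ 2 := by ring
      _ ≤ _ := pow_le_pow_left₀ (by positivity) h3 2
  have h5 : 0 ≤ H ^ 6 / ℓ ^ 4 := by positivity
  rw [mul_div_assoc, mul_div_assoc]
  linarith

theorem tendsto_logPart : Tendsto logPart atTop atTop := by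
  refine tendsto_atTop.2 fun t => ?_
  filter_upwards [eventually_ge_atTop (2 ^ (4 * t))] with N hN
  have := (Nat.le_log_iff_pow_le (b := 2) (by norm_num)
    (show N ≠ 0 from (lt_of_lt_of_le (by positivity) hN).ne')).2 hN
  unfold logPart
  omega

/-- From `2 ^ clog ≤ 2 t ^ 2 + 1 ≤ t ^ 3`. This turns the powers of `h + 1` in the time into powers
of an iterated logarithm. -/
theorem clog_sq_le {t : ℕ} (ht : 3 ≤ t) : (Nat.clog 2 (t * t) + 1 : ℝ) ≤ 8 * Real.log t := by
  have ht' : (3 : ℝ) ≤ t := by exact_mod_cast ht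
  have h1 : 1 ≤ Real.log t := by
    rw [Real.le_log_iff_exp_le (by linarith)]
    linarith [Real.exp_one_lt_d9]
  have h2 : ((2 : ℝ) ^ Nat.clog 2 (t * t)) ≤ t ^ 3 := by
    have := pow_clog_le (t * t)
    have h3 : 2 * (t * t) + 1 ≤ t ^ 3 := by nlinarith
    exact_mod_cast this.trans h3
  have h3 := Real.log_le_log (by positivity) h2
  rw [Real.log_pow, Real.log_pow] at h3
  push_cast at h3
  nlinarith [Real.log_two_gt_d9, (Nat.cast_nonneg (Nat.clog 2 (t * t)) : (0 : ℝ) ≤ _)]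

theorem eventually_largePart : ∀ᶠ t in atTop, LargePart t := by
  have h1 : ∀ᶠ t : ℕ in atTop, 2048 * (Nat.clog 2 (t * t) + 1) ^ 2 ≤ t := by
    have h := (Real.isLittleO_pow_log_id_atTop (n := 2)).bound
      (show (0 : ℝ) < 1 / 131072 by norm_num)
    filter_upwards [tendsto_natCast_atTop_atTop.eventually h, eventually_ge_atTop 3] with t ht ht3
    have h2 := clog_sq_le ht3
    simp only [id, Real.norm_eq_abs, abs_pow, sq_abs, Nat.abs_cast] at ht
    have h3 : ((2048 * (Nat.clog 2 (t * t) + 1) ^ 2 : ℕ) : ℝ) ≤ t := by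
      push_cast
      have := pow_le_pow_left₀ (by positivity) h2 2
      nlinarith
    exact_mod_cast h3
  have h2 : ∀ᶠ t : ℕ in atTop, t ^ 16 ≤ 2 ^ (t / 4) := by
    have h := (isLittleO_pow_const_const_pow_of_one_lt (R := ℝ) 16 (r := 2) (by norm_num)).bound
      (show (0 : ℝ) < 1 / 7 ^ 16 by norm_num)
    filter_upwards [(Nat.tendsto_div_const_atTop (n := 4) (by norm_num)).eventually h,
      eventually_ge_atTop 4] with t ht ht4
    simp only [Real.norm_eq_abs, abs_pow, Nat.abs_cast, abs_of_pos (show (0 : ℝ) < 2 by norm_num)]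
      at ht
    have h3 : (t : ℝ) ≤ 7 * ((t / 4 : ℕ) : ℝ) := by exact_mod_cast (by omega : t ≤ 7 * (t / 4))
    have h4 : ((t ^ 16 : ℕ) : ℝ) ≤ ((2 ^ (t / 4) : ℕ) : ℝ) := by
      push_cast
      calc (t : ℝ) ^ 16 ≤ (7 * ((t / 4 : ℕ) : ℝ)) ^ 16 := pow_le_pow_left₀ (by positivity) h3 16
        _ = 7 ^ 16 * ((t / 4 : ℕ) : ℝ) ^ 16 := by rw [mul_pow]
        _ ≤ 7 ^ 16 * (1 / 7 ^ 16 * 2 ^ (t / 4)) := by gcongr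
        _ = _ := by ring
    exact_mod_cast h4
  filter_upwards [h1, h2, eventually_ge_atTop 4096] with t a1 a2 a3
  exact ⟨a3, a1, a2⟩

theorem logPart_le_log {N : ℕ} (hN : 0 < N) : (logPart N : ℝ) ≤ Real.log N := by
  have h1 : ((2 : ℝ) ^ (4 * logPart N)) ≤ N := by exact_mod_cast pow_logPart_le hN
  have h2 := Real.log_le_log (by positivity) h1
  rw [Real.log_pow] at h2
  push_cast at h2
  nlinarith [Real.log_two_gt_d9, (Nat.cast_nonneg (logPart N) : (0 : ℝ) ≤ _)]

theorem log_le_logPart {N : ℕ} (hN : 0 < N) (h : 1 ≤ logPart N) :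
    Real.log N ≤ 8 * logPart N := by
  have h1 : N < 2 ^ (4 * (logPart N + 1)) := by
    refine (Nat.lt_pow_succ_log_self (b := 2) (by norm_num) N).trans_le
      (Nat.pow_le_pow_right (by norm_num) ?_)
    unfold logPart; omega
  have h1' : (N : ℝ) ≤ 2 ^ (4 * (logPart N + 1)) := by exact_mod_cast h1.le
  have h2 := Real.log_le_log (by exact_mod_cast hN) h1'
  rw [Real.log_pow] at h2
  push_cast at h2
  have h3 : (1 : ℝ) ≤ logPart N := by exact_mod_cast h
  nlinarith [Real.log_two_lt_d9]

/-- The exponent of the iterated logarithm is the `6` of `rate_le`. The four factors `8` replace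
`logPart N` by `log N`, the six factors `8` come from `clog_sq_le`. -/
theorem isOHat_of_le {T : ℕ → ℕ} (hT : ∀ N, LargePart (logPart N) → (T N : ℝ) ≤
    N ^ 3 * (2 ^ 42 * (Nat.clog 2 (logPart N * logPart N) + 1 : ℝ) ^ 6 / (logPart N : ℝ) ^ 4)) :
    IsOHat (fun N => (T N : ℝ)) fun N => (N : ℝ) ^ 3 / Real.log N ^ 4 := by
  refine ⟨6, Asymptotics.IsBigO.of_bound (2 ^ 42 * 8 ^ 6 * 8 ^ 4) ?_⟩
  have hlog := (Real.isLittleO_pow_log_id_atTop (n := 4)).bound (show (0 : ℝ) < 1 by norm_num)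
  filter_upwards [tendsto_logPart.eventually eventually_largePart, eventually_ge_atTop 1,
    tendsto_natCast_atTop_atTop.eventually hlog] with N hN hN1 hlogN
  have hl := hN.large
  have hN' : (1 : ℝ) ≤ N := by exact_mod_cast hN1
  have hℓ : (4096 : ℝ) ≤ logPart N := by exact_mod_cast hl
  have h1 := logPart_le_log hN1
  have h2 := log_le_logPart hN1 (by omega)
  have hlog0 : 0 < Real.log N := by linarith
  simp only [id, Real.norm_eq_abs, one_mul, Nat.abs_cast] at hlogN
  rw [abs_of_nonneg (by positivity)] at hlogN
  -- The definition of `IsOHat` takes the iterated logarithm of `f`, not of `N`; since `f` is at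
  -- least `N`, it is large enough.
  have hf : (N : ℝ) ≤ N ^ 3 / Real.log N ^ 4 := by
    rw [le_div_iff₀ (by positivity)]
    calc (N : ℝ) * Real.log N ^ 4 ≤ N * N := by gcongr
      _ = N ^ 2 := by ring
      _ ≤ N ^ 3 := pow_le_pow_right₀ hN' (by norm_num)
  have hf0 : 0 ≤ (N : ℝ) ^ 3 / Real.log N ^ 4 := by linarith
  have hloglog : Real.log (logPart N) ≤ Real.log (Real.log (N ^ 3 / Real.log N ^ 4)) :=
    Real.log_le_log (by linarith) (h1.trans (Real.log_le_log (by linarith) hf))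
  have hH := (clog_sq_le (t := logPart N) (by omega)).trans
    (mul_le_mul_of_nonneg_left hloglog (by norm_num))
  set Λ := Real.log (Real.log (N ^ 3 / Real.log N ^ 4)) with hΛ
  set H : ℝ := (Nat.clog 2 (logPart N * logPart N) + 1 : ℝ) with hHd
  have hH0 : 0 ≤ H := by positivity
  have hΛ0 : 0 ≤ Λ := by linarith
  rw [Real.norm_of_nonneg (by positivity), Real.norm_of_nonneg (by positivity)]
  have h3 : 1 / (logPart N : ℝ) ^ 4 ≤ 8 ^ 4 / Real.log N ^ 4 := by
    rw [div_le_div_iff₀ (by positivity) (by positivity), one_mul, ← mul_pow]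
    exact pow_le_pow_left₀ hlog0.le h2 4
  calc (T N : ℝ) ≤ N ^ 3 * (2 ^ 42 * H ^ 6 / (logPart N : ℝ) ^ 4) := hT N hN
    _ = N ^ 3 * (2 ^ 42 * H ^ 6 * (1 / (logPart N : ℝ) ^ 4)) := by ring
    _ ≤ N ^ 3 * (2 ^ 42 * (8 * Λ) ^ 6 * (8 ^ 4 / Real.log N ^ 4)) := by gcongr
    _ = _ := by ring

theorem exists_isCombinatorialAlgorithm_isOHat :
    ∃ (P : WordRAM.Program) (C : ℕ) (T : ℕ → ℕ),
      BMM.IsCombinatorialAlgorithm P C T ∧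
      IsOHat (fun n => (T n : ℝ)) (fun n => (n : ℝ) ^ 3 / Real.log n ^ 4) := by
  refine ⟨_, _, _, isCombinatorialAlgorithm_multiply (fun N => (Params.ofSize 0 N).potential) ?_
    fun N => Params.potential_nonneg, isOHat_of_le fun N hN => ?_⟩
  · intro M N _
    exact (Params.ofSize M N).potential_spec (Nat.two_pow_pos _) (Nat.succ_pos _)
      (Nat.two_pow_pos _)
  · refine le_trans ?_ (time_le hN)
    have hN0 : 0 < N := by
      rcases Nat.eq_zero_or_pos N with h | h
      · have := hN.large
        rw [h] at this
        simp [logPart] at this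
      · exact h
    have h0 : 0 ≤ timeBound (Params.ofSize 0 N) (Params.ofSize 0 N).potential := by
      have := (Params.ofSize 0 N).potential_nonneg
        ((Params.ofSize 0 N).m * (Params.ofSize 0 N).m)
      unfold timeBound
      positivity
    have h1 : (⌊timeBound (Params.ofSize 0 N) (Params.ofSize 0 N).potential⌋₊ : ℝ) ≤ _ :=
      Nat.floor_le h0
    have h2 : Nat.log 2 N ≤ N := Nat.log_le_self 2 N
    have h3 : N ≤ N * N := Nat.le_mul_self N
    -- The steps of the prologue are covered by the reserve in `time_le`.
    have h4 : ((4 * Nat.log 2 N + 30 : ℕ) : ℝ) ≤ ((40 * (N * N) : ℕ) : ℝ) := by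
      exact_mod_cast (by omega : 4 * Nat.log 2 N + 30 ≤ 40 * (N * N))
    push_cast at h4 ⊢
    linarith

end RamLang

theorem theorem2 :
    ∃ (P : WordRAM.Program) (C : ℕ) (T : ℕ → ℕ),
      BMM.IsCombinatorialAlgorithm P C T ∧
      IsOHat (fun n => (T n : ℝ)) (fun n => (n : ℝ) ^ 3 / Real.log n ^ 4) := by
  exact RamLang.exists_isCombinatorialAlgorithm_isOHat
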